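/- **Setting.** Let $n,r\in\mathbb N$ with $r\ge 1$, and $m>0$, $s\in\mathbb R$. Put $\langle\xi\rangle=\sqrt{m^2+|\xi|^2}$ and $\|f\|_{H^\sigma}=\|\langle\xi\rangle^\sigma\hat f\|_{L^2}$ on $\mathbb R^n$; the norm of a vector-valued map is the sum of the norms of its coordinates. Let $E=E_1\oplus E_2$ with $E_1=\mathbb R^{d_1}$, $E_2=\mathbb R^{d_2}$, write $u=(u_1,u_2)$ accordingly, and let $$L=\begin{pmatrix}\gamma^0\partial_0+P_1(\vec\partial)&0\\0&\partial_0^2+P_2(\vec\partial)\end{pmatrix},$$ where $\gamma^0\in\mathrm{End}(E_1)$ is invertible, $P_1,P_2$ are polynomials with coefficients in $\mathrm{End}(E_1)$, $\mathrm{End}(E_2)$ of degrees at most $r$ and $2r$, and for all $\xi\in\mathbb R^n$ the matrix $i(\gamma^0)^{-1}P_1(i\xi)$ is Hermitian and $P_2(i\xi)$ is Hermitian with $P_2(i\xi)\ge\alpha(\mu_0+|\xi|^{2r})$, for some constants $\alpha>0$, $\mu_0\ge 0$. Let $I\subset\mathbb R$ be an interval with non-empty interior, and assume that $\mu_0>0$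 or that $I$ is bounded. Set $\mathcal F^s(I)=C^0(I,H^s(\mathbb R^n,E))\cap C^1(I,H^{s-r}(\mathbb R^n,E))$ with $$\|u\|_{\mathcal F^s(I)}=\sup_{\tau\in I}\big(\|u(\tau)\|_{H^s}+\|\partial_0u_2(\tau)\|_{H^{s-r}}\big),$$ and let $\mathcal E_0^s(I)$ be the space of the $\varphi\in\mathcal F^s(I)$ with $L\varphi=0$ weakly, with the same norm. "Weakly" means in the sense of distributions on $\mathrm{int}(I)\times\mathbb R^n$. For $u\in\mathcal F^s(I)$ and $t\in I$, $\Theta_tu$ denotes the unique $\varphi\in\mathcal E_0^s(\mathbb R)$ with $\varphi|_t=u|_t$ and $\partial_0\varphi_2|_t=\partial_0u_2|_t$. Let $G$ be the $\mathrm{End}(E)$-valued Green function: $LG=0$ and $L(YG)=\delta_0\otimes 1_E$ with $Y=1_{\{x^0\ge0\}}$. **Nonlinearity.** Let $N=(N_1,N_2)=\sum_{p\ge 1}N^{(p)}$ be a real analytic map, without constant term ($N(0)=0$), from $E_{(1)}=E\times E_2\times\mathcal L(\mathbb R^n,E)\ni(u,\partial_0u_2,\vec\partial u)$ to $E$, given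 by homogeneous terms $N^{(p)}$ of degree $p$; let $\|N^{(p)}\|_\otimes$ be the norm of the symmetric $p$-linear map that polarizes $N^{(p)}$ (for the $\ell^1$ norm of coordinates on $E_{(1)}$), and $\rho_\otimes(N)$ the radius of convergence of $\sum_p\|N^{(p)}\|_\otimes z^p$. Assume $\rho_\otimes(N)>0$, that $N_1$ depends only on $u$, and that one of the following holds: 1. $N_2$ does not depend on $\partial u=(\partial_0u_2,\vec\partial u)$, and $s>n/2$; 2. $N_2$ is affine in $\partial u$, that is, $N_2(u,\partial u)=J(u)+\sum_kK_k(u)(\partial u)_k$ with power series $J$, $K_k$, and $s>n/2>s-r\ge 0$; 3. $s>n/2+1$ and, in addition, $s-r>n/2$ or $N_2$ does not depend on $\partial_0u_2$ (the addition is automatic if $r=1$). Let $V_t$ be the Lagrange–Duhamel vector field $$V_t(\varphi)(x)=\int_{\mathbb R^n}G(x^0-t,\vec x-\vec y)\,N(\varphi,\partial\varphi)(t,\vec y)\,d\vec y .$$ **Theorem.** There is a constant $Q_s>0$, depending only on $n,r,m,s$, such that for all $L$, $I$, $N$ as above there is $\rho_\otimes(V)\in(0,\infty]$ with $Q_s\,\rho_\otimes(V)\ge\rho_\otimes(N)$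 for which: * $(V_t)_{t\in I}$ is a normal family of analytic maps of multiradius $\rho_\otimes(V)$ on $\mathcal E_0^s(I)$: the polarized homogeneous terms $V_t^{(p)}$ (obtained by replacing $N$ by $N^{(p)}$) map $\mathcal E_0^s(I)^p$ to $\mathcal E_0^s(I)$ with norms at most $X_p$ for all $t\in I$, for some series $\sum_pX_pz^p$ with non-negative coefficients and radius of convergence $\rho_\otimes(V)$; and for $\varphi\in\mathcal E_0^s(I)$ with $\|\varphi\|_{\mathcal F^s(I)}<\rho_\otimes(V)$, $V_t(\varphi)$ is a well-defined element of $\mathcal E_0^s(I)$ and is the sum of the series $\sum_pV_t^{(p)}(\varphi)$; * for every $u\in\mathcal F^s(I)$ with $\|u\|_{\mathcal F^s(I)}\le\rho_\otimes(V)$: $u$ is a weak solution of $Lu+N(u,\partial u)=0$ if and only if the map $I\ni t\mapsto\Theta_tu\in\mathcal E_0^s(I)$ is $C^1$ and satisfies $$\frac{d(\Theta_tu)}{dt}+V_t(\Theta_tu)=0\quad\text{on } I .$$ -/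

import Mathlib

open MeasureTheory Filter Topology Set
open scoped ComplexOrder SchwartzMap FourierTransform ENNReal NNReal LineDeriv Matrix Distributions

noncomputable section

namespace LagrangeDuhamel

/-! ### Space, fields, tempered distributions -/

/-- The space `ℝⁿ`. -/
abbrev Sp (n : ℕ) := EuclideanSpace ℝ (Fin n)

/-- Complex-valued tempered distributions on `ℝⁿ`. -/
abbrev Dist (n : ℕ) := 𝓢'(Sp n, ℂ)

/-- Labels of the coordinates of `E = E₁ ⊕ E₂` with `E₁ = ℝ^d₁`, `E₂ = ℝ^d₂`. -/
abbrev Idx (d₁ d₂ : ℕ) := Fin d₁ ⊕ Fin d₂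

/-- A time-dependent `E`-valued distribution on space, `t ↦ u(t) = (uⁱ(t))ᵢ`.
Only the values at times in the interval under consideration matter. -/
abbrev FieldPath (n d₁ d₂ : ℕ) := ℝ → Idx d₁ d₂ → Dist n

variable {n d₁ d₂ : ℕ}

/-- The `k`-th vector of the canonical basis of `ℝⁿ`. -/
def basisVec (k : Fin n) : Sp n := EuclideanSpace.single k 1

/-- A distribution is real if it takes real values on real-valued test functions. -/
def IsRealDist (f : Dist n) : Prop :=
  ∀ g : 𝓢(Sp n, ℂ), (∀ x, (g x).im = 0) → (f g).im = 0

open Classical in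
/-- The tempered distribution defined by a square integrable function (and `0` by convention if the
function is not square integrable). -/
def ofFun (g : Sp n → ℂ) : Dist n :=
  if h : MemLp g 2 (volume : Measure (Sp n)) then ((h.toLp g : Lp ℂ 2 volume) : Dist n) else 0

open Classical in
/-- The square integrable function (defined a.e.) that represents a tempered distribution
(and `0` by convention if there is none). -/
def rep (f : Dist n) : Sp n → ℂ :=
  if h : ∃ g : Lp ℂ 2 (volume : Measure (Sp n)), f = (g : Dist n) then (h.choose : Sp n → ℂ) else 0

/-- The Sobolev norm `‖f‖_{H^s} = ‖⟨ξ⟩^s f̂‖_{L²}` with `⟨ξ⟩ = √(m² + |ξ|²)` and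
`f̂(ξ) = ∫ f(x) e^{-i x·ξ} dx`; it is `∞` if `⟨ξ⟩^s f̂` is not an `L²` function.
Here `𝓕 f` is the transform with kernel `e^{-2 π i x·η}`, so that `ξ = 2 π η`, whence the
factor `(2 π)^{n/2}`. The infimum is over a set with at most one element. -/
def sobNorm (m s : ℝ) (f : Dist n) : ℝ≥0∞ :=
  ⨅ (g : Lp ℂ 2 (volume : Measure (Sp n)))
    (_ : TemperedDistribution.smulLeftCLM ℂ
      (fun η : Sp n => (((m ^ 2 + ‖(2 * Real.pi) • η‖ ^ 2) ^ (s / 2) : ℝ) : ℂ)) (𝓕 f) = (g : Dist n)),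
    ENNReal.ofReal ((2 * Real.pi) ^ ((n : ℝ) / 2)) * ‖g‖ₑ

/-- The real Sobolev space `H^s(ℝⁿ)`. -/
def MemSob (m s : ℝ) (f : Dist n) : Prop := IsRealDist f ∧ sobNorm m s f < ⊤

/-! ### Time derivative and the spaces `𝓕^s(I)` -/

open Classical in
/-- The time derivative `∂₀u` at time `t ∈ I` of a curve of distributions, in the sense of
distributions on space (`0` by convention if it does not exist). -/
def timeDeriv (I : Set ℝ) (u : FieldPath n d₁ d₂) : FieldPath n d₁ d₂ := fun t i =>
  if h : ∃ v : Dist n, ∀ g : 𝓢(Sp n, ℂ), HasDerivWithinAt (fun τ => u τ i g) (v g) I t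
  then h.choose else 0

/-- `u ∈ 𝓕^s(I) = C⁰(I, H^s(ℝⁿ, E)) ∩ C¹(I, H^{s-r}(ℝⁿ, E))`. -/
structure MemF (r : ℕ) (m s : ℝ) (I : Set ℝ) (u : FieldPath n d₁ d₂) : Prop where
  mem : ∀ t ∈ I, ∀ i, MemSob m s (u t i)
  cont : ∀ t ∈ I, ∀ i, Tendsto (fun τ => sobNorm m s (u τ i - u t i)) (𝓝[I] t) (𝓝 0)
  mem_deriv : ∀ t ∈ I, ∀ i, MemSob m (s - r) (timeDeriv I u t i)
  hasDeriv : ∀ t ∈ I, ∀ i, Tendsto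
    (fun τ => sobNorm m (s - r) (((τ - t : ℝ) : ℂ)⁻¹ • (u τ i - u t i) - timeDeriv I u t i))
    (𝓝[I \ {t}] t) (𝓝 0)
  cont_deriv : ∀ t ∈ I, ∀ i, Tendsto
    (fun τ => sobNorm m (s - r) (timeDeriv I u τ i - timeDeriv I u t i)) (𝓝[I] t) (𝓝 0)

/-- `‖u‖_{𝓕^s(I)} = sup_{τ ∈ I} (‖u(τ)‖_{H^s} + ‖∂₀u₂(τ)‖_{H^{s-r}})`, where the Sobolev norm of a
vector-valued map is the sum of the norms of its coordinates. -/
def fNorm (r : ℕ) (m s : ℝ) (I : Set ℝ) (u : FieldPath n d₁ d₂) : ℝ≥0∞ :=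
  ⨆ τ ∈ I, ((∑ i, sobNorm m s (u τ i)) +
    ∑ j : Fin d₂, sobNorm m (s - r) (timeDeriv I u τ (Sum.inr j)))

/-! ### The linear operator `L` -/

/-- The coefficients of `L = diag(γ⁰ ∂₀ + P₁(∂), ∂₀² + P₂(∂))`: polynomials with matrix coefficients
are given as matrices of polynomials. -/
structure EvolOp (n d₁ d₂ : ℕ) where
  γ : Matrix (Fin d₁) (Fin d₁) ℝ
  P₁ : Matrix (Fin d₁) (Fin d₁) (MvPolynomial (Fin n) ℝ)
  P₂ : Matrix (Fin d₂) (Fin d₂) (MvPolynomial (Fin n) ℝ)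

/-- The complex matrix `P(iξ)`. -/
def symb {d : ℕ} (P : Matrix (Fin d) (Fin d) (MvPolynomial (Fin n) ℝ)) (ξ : Sp n) :
    Matrix (Fin d) (Fin d) ℂ :=
  P.map (fun p => MvPolynomial.aeval (fun k => Complex.I * (ξ k : ℂ)) p)

/-- `γ⁰` as a complex matrix. -/
def EvolOp.γC (L : EvolOp n d₁ d₂) : Matrix (Fin d₁) (Fin d₁) ℂ := L.γ.map (fun x : ℝ => (x : ℂ))

/-- The hypotheses on `L`: `γ⁰` is invertible, `P₁` and `P₂` have degree (at most) `r` and `2r`,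
`i (γ⁰)⁻¹ P₁(iξ)` is Hermitian, and `P₂(iξ)` is Hermitian with `P₂(iξ) ≥ α (μ₀ + |ξ|^{2r})`. -/
structure EvolOp.Admissible (L : EvolOp n d₁ d₂) (r : ℕ) (α μ₀ : ℝ) : Prop where
  isUnit : IsUnit L.γ.det
  deg₁ : ∀ i j, (L.P₁ i j).totalDegree ≤ r
  deg₂ : ∀ i j, (L.P₂ i j).totalDegree ≤ 2 * r
  herm₁ : ∀ ξ : Sp n, (Complex.I • (L.γC⁻¹ * symb L.P₁ ξ)).IsHermitian
  herm₂ : ∀ ξ : Sp n, (symb L.P₂ ξ).IsHermitian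
  pos₂ : ∀ ξ : Sp n,
    (symb L.P₂ ξ - ((α * (μ₀ + ‖ξ‖ ^ (2 * r)) : ℝ) : ℂ) • (1 : Matrix (Fin d₂) (Fin d₂) ℂ)).PosSemidef

/-- `∂^a f = ∂₁^{a₁} ⋯ ∂ₙ^{aₙ} f` for a multi-index `a`. -/
def partialD (a : Fin n →₀ ℕ) (f : Dist n) : Dist n :=
  (List.finRange n).foldr (fun k g => (∂_{basisVec k})^[a k] g) f

/-- `p(∂₁, …, ∂ₙ) f` for a polynomial `p`. -/
def polyD (p : MvPolynomial (Fin n) ℝ) (f : Dist n) : Dist n :=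
  ∑ a ∈ p.support, ((p.coeff a : ℝ) : ℂ) • partialD a f

/-- The open subset `int(I) × ℝⁿ` of space-time. -/
def slab (n : ℕ) (I : Set ℝ) : TopologicalSpace.Opens (ℝ × Sp n) :=
  ⟨interior I ×ˢ univ, isOpen_interior.prod isOpen_univ⟩

theorem hasCompactSupport_slice {I : Set ℝ} (ψ : 𝓓(slab n I, ℂ)) (t : ℝ) :
    HasCompactSupport (fun x : Sp n => ψ (t, x)) := by
  refine HasCompactSupport.of_support_subset_isCompact
    (ψ.hasCompactSupport.isCompact.image continuous_snd) ?_
  intro x hx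
  exact ⟨(t, x), subset_tsupport _ hx, rfl⟩

theorem contDiff_slice {I : Set ℝ} (ψ : 𝓓(slab n I, ℂ)) (t : ℝ) :
    ContDiff ℝ ((⊤ : ℕ∞) : WithTop ℕ∞) (fun x : Sp n => ψ (t, x)) :=
  ψ.contDiff.comp (contDiff_const.prodMk contDiff_id)

/-- The restriction `ψ(t, ·)` of a space-time test function to time `t`. -/
def slice {I : Set ℝ} (ψ : 𝓓(slab n I, ℂ)) (t : ℝ) : 𝓢(Sp n, ℂ) :=
  (hasCompactSupport_slice ψ t).toSchwartzMap (contDiff_slice ψ t)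

/-- The unit vector in the time direction. -/
def e₀ (n : ℕ) : ℝ × Sp n := (1, 0)

/-- `Lu + f = 0` weakly, i.e. in the sense of distributions on `int(I) × ℝⁿ`. -/
structure IsWeakSol (L : EvolOp n d₁ d₂) (I : Set ℝ) (u f : FieldPath n d₁ d₂) : Prop where
  fst : ∀ (ψ : 𝓓(slab n I, ℂ)) (i : Fin d₁),
    ∫ t : ℝ, (- (∑ j, ((L.γ i j : ℝ) : ℂ) * u t (Sum.inl j) (slice (∂_{e₀ n} ψ) t))
      + (∑ j, polyD (L.P₁ i j) (u t (Sum.inl j)) (slice ψ t))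
      + f t (Sum.inl i) (slice ψ t)) = 0
  snd : ∀ (ψ : 𝓓(slab n I, ℂ)) (i : Fin d₂),
    ∫ t : ℝ, (u t (Sum.inr i) (slice (∂_{e₀ n} (∂_{e₀ n} ψ)) t)
      + (∑ j, polyD (L.P₂ i j) (u t (Sum.inr j)) (slice ψ t))
      + f t (Sum.inr i) (slice ψ t)) = 0

/-- `φ ∈ 𝓔₀^s(I)`: `φ ∈ 𝓕^s(I)` and `Lφ = 0` weakly. -/
def MemE₀ (L : EvolOp n d₁ d₂) (r : ℕ) (m s : ℝ) (I : Set ℝ) (φ : FieldPath n d₁ d₂) : Prop :=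
  MemF r m s I φ ∧ IsWeakSol L I φ 0

/-! ### The map `Θ` -/

/-- `φ ∈ 𝓔₀^s(ℝ)` and `φ` has the same Cauchy data as `u` at time `t`: `φ|ₜ = u|ₜ` and
`∂₀φ₂|ₜ = ∂₀u₂|ₜ`. -/
def IsTheta (L : EvolOp n d₁ d₂) (r : ℕ) (m s : ℝ) (I : Set ℝ) (u : FieldPath n d₁ d₂) (t : ℝ)
    (φ : FieldPath n d₁ d₂) : Prop :=
  MemE₀ L r m s univ φ ∧ φ t = u t ∧
    ∀ j : Fin d₂, timeDeriv univ φ t (Sum.inr j) = timeDeriv I u t (Sum.inr j)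

open Classical in
/-- `Θₜ u`: the solution `φ` of `Lφ = 0` with the same Cauchy data as `u` at time `t`. -/
def Theta (L : EvolOp n d₁ d₂) (r : ℕ) (m s : ℝ) (I : Set ℝ) (u : FieldPath n d₁ d₂) (t : ℝ) :
    FieldPath n d₁ d₂ :=
  if h : ∃ φ, IsTheta L r m s I u t φ then h.choose else 0

/-! ### The nonlinearity -/

/-- Labels of the coordinates of `E₍₁₎ = E × E₂ × L(ℝⁿ, E)`, the space of the
`(u, ∂₀u₂, ∂₁u, …, ∂ₙu)`. -/
abbrev JetIdx (n d₁ d₂ : ℕ) := Idx d₁ d₂ ⊕ (Fin d₂ ⊕ (Fin n × Idx d₁ d₂))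

/-- `E₍₁₎`, with the sum of the absolute values of the coordinates as norm. -/
abbrev Jet (n d₁ d₂ : ℕ) := PiLp 1 (fun _ : JetIdx n d₁ d₂ => ℝ)

/-- The space `E`, with coordinates. -/
abbrev Fld (d₁ d₂ : ℕ) := Idx d₁ d₂ → ℝ

/-- A formal series `N = ∑ₚ N^{(p)}` from `E₍₁₎` to `E`. -/
abbrev Series (n d₁ d₂ : ℕ) := FormalMultilinearSeries ℝ (Jet n d₁ d₂) (Fld d₁ d₂)

/-- The terms `N^{(p)}` are symmetric. The multilinear map `N p` is then the polarization of the
homogeneous polynomial `N^{(p)}`, and `N.radius` is the multiradius of convergence of `N`. -/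
def IsSymm (N : Series n d₁ d₂) : Prop :=
  ∀ (p : ℕ) (σ : Equiv.Perm (Fin p)) (v : Fin p → Jet n d₁ d₂), N p (v ∘ σ) = N p v

/-- The `i`-th component of `N` depends only on the coordinates in `S`. -/
def DependsOnlyOn (N : Series n d₁ d₂) (i : Idx d₁ d₂) (S : Set (JetIdx n d₁ d₂)) : Prop :=
  ∀ (p : ℕ) (z z' : Jet n d₁ d₂), (∀ k ∈ S, z k = z' k) → N p (fun _ => z) i = N p (fun _ => z') i

/-- The coordinates of `u`. -/
def fieldCoords (n d₁ d₂ : ℕ) : Set (JetIdx n d₁ d₂) := range Sum.inl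

/-- The coordinates of `(u, ∂₁u, …, ∂ₙu)`, i.e. all of them but those of `∂₀u₂`. -/
def noTimeDerivCoords (n d₁ d₂ : ℕ) : Set (JetIdx n d₁ d₂) :=
  {k | ∀ j : Fin d₂, k ≠ Sum.inr (Sum.inl j)}

/-- `N₂` is affine in `∂u`: `N₂(u, ∂u) = J(u) + ∑ₖ Kₖ(u) (∂u)ₖ` for power series `J` and `Kₖ` in
`u`, where `(∂u)ₖ` runs over the coordinates of `∂u = (∂₀u₂, ∂₁u, …, ∂ₙu)`; the identity is
written degree by degree. -/
def IsAffine (N : Series n d₁ d₂) : Prop :=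
  ∃ (J : FormalMultilinearSeries ℝ (Fld d₁ d₂) (Fin d₂ → ℝ))
    (K : (Fin d₂ ⊕ (Fin n × Idx d₁ d₂)) → FormalMultilinearSeries ℝ (Fld d₁ d₂) (Fin d₂ → ℝ)),
    ∀ (z : Jet n d₁ d₂) (j : Fin d₂),
      N 0 (fun _ => z) (Sum.inr j) = J 0 (fun _ i => z (Sum.inl i)) j ∧
      ∀ p : ℕ, N (p + 1) (fun _ => z) (Sum.inr j) =
        J (p + 1) (fun _ i => z (Sum.inl i)) j +
          ∑ k, K k p (fun _ i => z (Sum.inl i)) j * z (Sum.inr k)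

/-- The value `(φ, ∂₀φ₂, ∂₁φ, …, ∂ₙφ)(t, y) ∈ E₍₁₎`. Coordinates that are not represented by a
square integrable function get the value `0`. -/
def jet (I : Set ℝ) (φ : FieldPath n d₁ d₂) (t : ℝ) (y : Sp n) : Jet n d₁ d₂ :=
  WithLp.toLp 1 fun k => match k with
    | Sum.inl i => (rep (φ t i) y).re
    | Sum.inr (Sum.inl j) => (rep (timeDeriv I φ t (Sum.inr j)) y).re
    | Sum.inr (Sum.inr (l, i)) => (rep (∂_{basisVec l} (φ t i)) y).re

/-- `N(φ, ∂φ)`, with `N(z) = ∑ₚ N^{(p)}(z)`. -/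
def nonlin (N : Series n d₁ d₂) (I : Set ℝ) (φ : FieldPath n d₁ d₂) : FieldPath n d₁ d₂ :=
  fun t i => ofFun fun y => ((N.sum (jet I φ t y) i : ℝ) : ℂ)

/-- `N^{(p)}((φ₁, ∂φ₁) ⊗ ⋯ ⊗ (φₚ, ∂φₚ))`. -/
def nonlinTerm (N : Series n d₁ d₂) (I : Set ℝ) (p : ℕ) (φ : Fin p → FieldPath n d₁ d₂) :
    FieldPath n d₁ d₂ :=
  fun t i => ofFun fun y => ((N p (fun a => jet I (φ a) t y) i : ℝ) : ℂ)

/-! ### The Green function and the Lagrange--Duhamel vector field -/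

/-- The partial Fourier transform in space `Ĝ₁(τ, ξ)` of the Green function of
`γ⁰ ∂₀ + P₁(∂)`. -/
def green₁ (L : EvolOp n d₁ d₂) (τ : ℝ) (ξ : Sp n) : Matrix (Fin d₁) (Fin d₁) ℂ :=
  NormedSpace.exp (τ • (-(L.γC⁻¹ * symb L.P₁ ξ))) * L.γC⁻¹

/-- The fundamental matrix of the first order system equivalent to `y'' + P₂(iξ) y = 0`. -/
def prop₂ (L : EvolOp n d₁ d₂) (τ : ℝ) (ξ : Sp n) :
    Matrix (Fin d₂ ⊕ Fin d₂) (Fin d₂ ⊕ Fin d₂) ℂ :=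
  NormedSpace.exp (τ • Matrix.fromBlocks 0 1 (-symb L.P₂ ξ) 0)

/-- The partial Fourier transform in space `Ĝ₂(τ, ξ)` of the Green function of `∂₀² + P₂(∂)`. -/
def green₂ (L : EvolOp n d₁ d₂) (τ : ℝ) (ξ : Sp n) : Matrix (Fin d₂) (Fin d₂) ℂ :=
  (prop₂ L τ ξ).toBlocks₁₂

/-- The partial Fourier transform in space `Ĝ(τ, ξ)` of the Green function `G`, the solution of
`LG = 0` such that `L(YG) = δ₀`, `Y` the Heaviside function of time. -/
def green (L : EvolOp n d₁ d₂) (τ : ℝ) (ξ : Sp n) : Matrix (Idx d₁ d₂) (Idx d₁ d₂) ℂ :=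
  Matrix.fromBlocks (green₁ L τ ξ) 0 0 (green₂ L τ ξ)

/-- Initial value of `G₁`: `γ⁰ G₁ = δ₀` at time `0`. -/
theorem green₁_zero (L : EvolOp n d₁ d₂) (ξ : Sp n) : green₁ L 0 ξ = L.γC⁻¹ := by
  simp [green₁]

/-- `G₁` solves `γ⁰ ∂₀G₁ + P₁(∂)G₁ = 0`. -/
theorem hasDerivAt_green₁ (L : EvolOp n d₁ d₂) (τ : ℝ) (ξ : Sp n) :
    HasDerivAt (fun σ => green₁ L σ ξ) (-(L.γC⁻¹ * symb L.P₁ ξ) * green₁ L τ ξ) τ := by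
  let _ : NormedRing (Matrix (Fin d₁) (Fin d₁) ℂ) := Matrix.linftyOpNormedRing
  let _ : NormedAlgebra ℝ (Matrix (Fin d₁) (Fin d₁) ℂ) := Matrix.linftyOpNormedAlgebra
  have h := (hasDerivAt_exp_smul_const' (𝕂 := ℝ) (-(L.γC⁻¹ * symb L.P₁ ξ)) τ).mul_const L.γC⁻¹
  rw [mul_assoc] at h
  exact h

/-- Initial values of `G₂`: `G₂ = 0` at time `0`; moreover `∂₀G₂ = δ₀` at time `0`, see
`hasDerivAt_green₂` and `prop₂_zero`. -/
theorem green₂_zero (L : EvolOp n d₁ d₂) (ξ : Sp n) : green₂ L 0 ξ = 0 := by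
  ext i j
  simp [green₂, prop₂, Matrix.toBlocks₁₂]

theorem prop₂_zero (L : EvolOp n d₁ d₂) (ξ : Sp n) : (prop₂ L 0 ξ).toBlocks₂₂ = 1 := by
  ext i j
  simp [prop₂, Matrix.toBlocks₂₂, Matrix.one_apply]

theorem hasDerivAt_prop₂ (L : EvolOp n d₁ d₂) (τ : ℝ) (ξ : Sp n) :
    HasDerivAt (fun σ => prop₂ L σ ξ)
      (Matrix.fromBlocks 0 1 (-symb L.P₂ ξ) 0 * prop₂ L τ ξ) τ := by
  let _ : NormedRing (Matrix (Fin d₂ ⊕ Fin d₂) (Fin d₂ ⊕ Fin d₂) ℂ) := Matrix.linftyOpNormedRing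
  let _ : NormedAlgebra ℝ (Matrix (Fin d₂ ⊕ Fin d₂) (Fin d₂ ⊕ Fin d₂) ℂ) :=
    Matrix.linftyOpNormedAlgebra
  exact hasDerivAt_exp_smul_const' (𝕂 := ℝ) _ τ

/-- The convolution in space `∫ G(τ, x - y) f(y) dy` of the Green function with a (square
integrable) `E`-valued function `f`: its Fourier transform is `Ĝ(τ, ξ) f̂(ξ)`. -/
def greenConv (L : EvolOp n d₁ d₂) (τ : ℝ) (f : Idx d₁ d₂ → Dist n) : Idx d₁ d₂ → Dist n :=
  fun i => 𝓕⁻ (ofFun fun η : Sp n => ∑ j, green L τ ((2 * Real.pi) • η) i j * rep (𝓕 (f j)) η)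

/-- The Lagrange--Duhamel vector field
`Vₜ(φ)(x) = ∫ G(x⁰ - t, x - y) N(φ, ∂φ)(t, y) dy`. -/
def LDField (L : EvolOp n d₁ d₂) (N : Series n d₁ d₂) (I : Set ℝ) (t : ℝ) (φ : FieldPath n d₁ d₂) :
    FieldPath n d₁ d₂ :=
  fun τ => greenConv L (τ - t) (nonlin N I φ t)

/-- The polarized homogeneous term of degree `p` of `Vₜ`. -/
def LDTerm (L : EvolOp n d₁ d₂) (N : Series n d₁ d₂) (I : Set ℝ) (t : ℝ) (p : ℕ)
    (φ : Fin p → FieldPath n d₁ d₂) : FieldPath n d₁ d₂ :=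
  fun τ => greenConv L (τ - t) (nonlinTerm N I p φ t)

/-- `(Vₜ)_{t ∈ I}` is a normal family of analytic maps of multiradius `ρ` on `𝓔₀^s(I)`: the
polarized terms of `Vₜ` are bounded by the coefficients of a series `X` with radius of
convergence `ρ`, and `Vₜ` is well defined, with values in `𝓔₀^s(I)`, and the sum of its terms on the
open ball of radius `ρ`. -/
structure IsNormalFamily (L : EvolOp n d₁ d₂) (r : ℕ) (m s : ℝ) (I : Set ℝ) (N : Series n d₁ d₂)
    (ρ : ℝ≥0∞) : Prop where
  bound : ∃ X : ℕ → ℝ≥0,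
    (FormalMultilinearSeries.ofScalars ℝ (fun p => (X p : ℝ))).radius = ρ ∧
    ∀ t ∈ I, ∀ (p : ℕ) (φ : Fin p → FieldPath n d₁ d₂), (∀ a, MemE₀ L r m s I (φ a)) →
      MemE₀ L r m s I (LDTerm L N I t p φ) ∧
      fNorm r m s I (LDTerm L N I t p φ) ≤ X p * ∏ a, fNorm r m s I (φ a)
  sum : ∀ t ∈ I, ∀ φ : FieldPath n d₁ d₂, MemE₀ L r m s I φ → fNorm r m s I φ < ρ →
    MemE₀ L r m s I (LDField L N I t φ) ∧
    Tendsto (fun k : ℕ => fNorm r m s I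
      (LDField L N I t φ - ∑ p ∈ Finset.range k, LDTerm L N I t p (fun _ => φ))) atTop (𝓝 0)

/-- The map `I ∋ t ↦ Ψ t ∈ 𝓔₀^s(I)` is `C¹` with derivative `t ↦ w t ∈ 𝓔₀^s(I)`, for the norm of
`𝓕^s(I)`. -/
structure IsC1Curve (L : EvolOp n d₁ d₂) (r : ℕ) (m s : ℝ) (I : Set ℝ)
    (Ψ w : ℝ → FieldPath n d₁ d₂) : Prop where
  mem : ∀ t ∈ I, MemE₀ L r m s I (Ψ t)
  mem_deriv : ∀ t ∈ I, MemE₀ L r m s I (w t)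
  hasDeriv : ∀ t ∈ I, Tendsto
    (fun t' => fNorm r m s I (((t' - t : ℝ) : ℂ)⁻¹ • (Ψ t' - Ψ t) - w t)) (𝓝[I \ {t}] t) (𝓝 0)
  cont_deriv : ∀ t ∈ I, Tendsto (fun t' => fNorm r m s I (w t' - w t)) (𝓝[I] t) (𝓝 0)

end LagrangeDuhamel

end

open LagrangeDuhamel

open MeasureTheory Filter Topology Set
open scoped ComplexOrder SchwartzMap FourierTransform ENNReal NNReal LineDeriv Matrix Distributions

noncomputable section

namespace LagrangeDuhamel

variable {n d₁ d₂ : ℕ}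

/-! ### Weights -/

/-! On the Fourier side, multiplication by `⟨ξ⟩^σ` identifies `H^σ` with `L²` (`hatT`, an isometry
onto `H^σ`). A curve `u` in `𝓕^s(I)` becomes a continuous curve `x` of weighted Cauchy data `(u₁,
u₂, ∂₀u₂)` in a finite product of copies of `L²`, the third slot carrying the weight of order `s -
r`. The linear equation becomes an ordinary differential equation with matrix symbol `gen`, whose
exponentials `evo` are bounded multipliers: the first block is unitary, the second conserves the
energy defined by `P₂` (`prop₂_energy`, `norm_evo_le`). The bound is uniform in time if `μ₀ > 0`,
and grows at most linearly otherwise; this is why `I` must be bounded when `μ₀ = 0`. So the free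
evolution is a strongly continuous group `S` (`isEvolution_evoOp`).

The linear half of the argument is variation of constants. Integration by parts and the lemma of du
Bois-Reymond show that `u` is a weak solution iff `x` solves the evolution equation after a
smoothing of order `r` (`isWeakSol_iff`). This is equivalent to `Z(t) = S(-t) x(t)` being
differentiable, with no smoothing and no loss of derivatives (`IsEvolution.duhamel_iff`). Now `Z(t)`
is precisely the Cauchy data at time `0` of `Θₜu` (`theta_eq`), the vector field evaluated at `Θₜu`
has data `S(-t)` applied to the source `N(u, ∂u)(t)` (`LDField_eq`, `dataOf_theta`), and the norm of
`𝓔₀^s(I)` is equivalent to that of the data at time `0` (`exists_fNorm_sol_le`). Hence the weak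
equation for `u` and the differential equation for `t ↦ Θₜu` are the same statement about `Z`
(`isWeakSol_iff_isC1Curve`).

The nonlinear half is the product estimate `H^{σ₀} · H^σ ⊂ H^σ` for `σ₀ > n/2` and `0 ≤ σ ≤ σ₀`
(`exists_prod`). In each of the three cases every monomial of a component of `N` has at most one
factor of order below `σ₀`, and all are of order at least `σ` (`exists_order`). So `N` induces power
series `F` on Cauchy data with `‖F p‖ ≤ C ‖N p‖ A^p` (`exists_isSourceSeries`). The `ℓ¹` norm on
jets makes the sum over monomials a product of sums, so `A` does not depend on the dimensions of
`E₁` and `E₂`. A majorant with ratio `2 A` in place of `A` keeps the closed ball of its radius of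
convergence inside the open domain of convergence (`exists_radius`), whence `Q = 2 A`. -/

/-- The weight `⟨2πη⟩^σ`. -/
def wt (m σ : ℝ) (η : Sp n) : ℝ := (m ^ 2 + ‖(2 * Real.pi) • η‖ ^ 2) ^ (σ / 2)

/-- The normalization constant `(2π)^{n/2}`. -/
def nc (n : ℕ) : ℝ := (2 * Real.pi) ^ ((n : ℝ) / 2)

/-- The space `L²(ℝⁿ)`. -/
abbrev L2 (n : ℕ) := Lp ℂ 2 (volume : Measure (Sp n))

theorem nc_pos (n : ℕ) : 0 < nc n := Real.rpow_pos_of_pos (by positivity) _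

theorem nc_ne_zero (n : ℕ) : ((nc n : ℝ) : ℂ) ≠ 0 := by exact_mod_cast (nc_pos n).ne'

theorem wt_base_pos {m : ℝ} (hm : 0 < m) (η : Sp n) : 0 < m ^ 2 + ‖(2 * Real.pi) • η‖ ^ 2 := by
  positivity

theorem wt_pos {m : ℝ} (hm : 0 < m) (σ : ℝ) (η : Sp n) : 0 < wt m σ η :=
  Real.rpow_pos_of_pos (wt_base_pos hm η) _

theorem wt_add {m : ℝ} (hm : 0 < m) (σ τ : ℝ) (η : Sp n) :
    wt m (σ + τ) η = wt m σ η * wt m τ η := by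
  rw [wt, wt, wt, ← Real.rpow_add (wt_base_pos hm η), add_div]

@[simp] theorem wt_zero (m : ℝ) (η : Sp n) : wt m 0 η = 1 := by simp [wt]

theorem wt_neg_mul {m : ℝ} (hm : 0 < m) (σ : ℝ) (η : Sp n) : wt m (-σ) η * wt m σ η = 1 := by
  rw [← wt_add hm]; simp

theorem wt_mul_neg {m : ℝ} (hm : 0 < m) (σ : ℝ) (η : Sp n) : wt m σ η * wt m (-σ) η = 1 := by
  rw [← wt_add hm]; simp

theorem wt_even (m σ : ℝ) (η : Sp n) : wt m σ (-η) = wt m σ η := by simp [wt]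

theorem continuous_wt {m : ℝ} (hm : 0 < m) (σ : ℝ) : Continuous (wt m σ : Sp n → ℝ) := by
  unfold wt
  exact Continuous.rpow_const (by fun_prop) fun η => Or.inl (wt_base_pos hm η).ne'

theorem wt_one {m : ℝ} (η : Sp n) : wt m 1 η = √(m ^ 2 + ‖(2 * Real.pi) • η‖ ^ 2) := by
  rw [Real.sqrt_eq_rpow]; rfl

theorem le_wt_one (m : ℝ) (η : Sp n) : m ≤ wt m 1 η := by
  rw [wt_one]
  exact Real.le_sqrt_of_sq_le (by nlinarith [sq_nonneg ‖(2 * Real.pi) • η‖])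

theorem wt_eq_rpow {m : ℝ} (hm : 0 < m) (σ : ℝ) (η : Sp n) : wt m σ η = wt m 1 η ^ σ := by
  rw [wt, wt, ← Real.rpow_mul (wt_base_pos hm η).le]
  congr 1; ring

theorem norm_le_wt_one (m : ℝ) (η : Sp n) : ‖(2 * Real.pi) • η‖ ≤ wt m 1 η := by
  rw [wt_one]
  exact Real.le_sqrt_of_sq_le (by nlinarith [sq_nonneg m])

theorem wt_nat {m : ℝ} (hm : 0 < m) (k : ℕ) (η : Sp n) : wt m k η = wt m 1 η ^ k := by
  rw [wt_eq_rpow hm, Real.rpow_natCast]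

theorem wt_two {m : ℝ} (η : Sp n) : wt m 2 η = m ^ 2 + ‖(2 * Real.pi) • η‖ ^ 2 := by simp [wt]

theorem wt_neg_le {m : ℝ} (hm : 0 < m) {σ : ℝ} (hσ : 0 ≤ σ) (η : Sp n) :
    wt m (-σ) η ≤ m ^ (-σ) := by
  rw [wt_eq_rpow hm]
  exact Real.rpow_le_rpow_of_nonpos hm (le_wt_one m η) (by linarith)

theorem wt_le {m : ℝ} (hm : 0 < m) {σ τ : ℝ} (h : σ ≤ τ) (η : Sp n) :
    wt m σ η ≤ m ^ (σ - τ) * wt m τ η := by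
  have : wt m σ η = wt m (-(τ - σ)) η * wt m τ η := by rw [← wt_add hm]; congr 1; ring
  rw [this]
  have := wt_neg_le hm (sub_nonneg.2 h) η
  rw [neg_sub] at this ⊢
  exact mul_le_mul_of_nonneg_right this (wt_pos hm _ _).le

/-- Factoring out `m^σ` leaves the bracket `(1 + |·|²)^{σ/2}` composed with the dilation by `2π/m`.
-/
theorem hasTemperateGrowth_wt {m : ℝ} (hm : 0 < m) (σ : ℝ) :
    Function.HasTemperateGrowth (fun η : Sp n => ((wt m σ η : ℝ) : ℂ)) := by
  have h1 := Function.hasTemperateGrowth_one_add_norm_sq_rpow (H := Sp n) (σ / 2)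
  have h2 : Function.HasTemperateGrowth (fun η : Sp n => ((2 * Real.pi) / m) • η) :=
    ((2 * Real.pi / m) • ContinuousLinearMap.id ℝ (Sp n)).hasTemperateGrowth
  have h3 := (Function.HasTemperateGrowth.const ((m ^ 2) ^ (σ / 2))).mul (h1.comp h2)
  have h4 := Function.Complex.hasTemperateGrowth_ofReal.comp h3
  refine Eq.subst (motive := Function.HasTemperateGrowth) ?_ h4
  funext η
  simp only [Function.comp_apply, Pi.mul_apply, wt]
  rw [← Real.mul_rpow (by positivity) (by positivity)]
  congr 3
  rw [norm_smul, norm_smul]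
  simp only [Real.norm_eq_abs, abs_of_pos Real.pi_pos, abs_of_pos hm, abs_mul, abs_div]
  field_simp

/-! ### Functions of `η` as Fourier transforms -/

theorem toTD_apply (g : L2 n) (ψ : 𝓢(Sp n, ℂ)) : (g : Dist n) ψ = ∫ η, ψ η * g η := by
  simp

theorem toTD_injective : Function.Injective (fun g : L2 n => (g : Dist n)) := by
  have h := Lp.ker_toTemperedDistributionCLM_eq_bot (F := ℂ) (E := Sp n) (p := 2)
    (μ := volume)
  intro a b hab
  have : a - b ∈ (Lp.toTemperedDistributionCLM (E := Sp n) ℂ volume 2).ker := by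
    simp only [LinearMap.mem_ker, ContinuousLinearMap.coe_coe, map_sub, sub_eq_zero]
    exact hab
  rw [h] at this
  exact sub_eq_zero.1 (by simpa using this)

/-- The isometry `L² → H^σ`. -/
def hatT (m σ : ℝ) : L2 n →L[ℂ] Dist n :=
  ((nc n : ℝ) : ℂ)⁻¹ • ((FourierTransform.fourierInvCLM ℂ (Dist n)) ∘L
    (TemperedDistribution.smulLeftCLM ℂ (fun η : Sp n => ((wt m (-σ) η : ℝ) : ℂ))) ∘L
    (Lp.toTemperedDistributionCLM (E := Sp n) ℂ volume 2))

theorem smul_schwartz {m : ℝ} (hm : 0 < m) (σ : ℝ) (ψ : 𝓢(Sp n, ℂ)) (η : Sp n) :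
    SchwartzMap.smulLeftCLM ℂ (fun η : Sp n => ((wt m σ η : ℝ) : ℂ)) ψ η = wt m σ η * ψ η := by
  rw [SchwartzMap.smulLeftCLM_apply_apply (hasTemperateGrowth_wt hm σ)]
  rfl

theorem hatT_eq (m σ : ℝ) (g : L2 n) : hatT m σ g = ((nc n : ℝ) : ℂ)⁻¹ •
    𝓕⁻ (TemperedDistribution.smulLeftCLM ℂ (fun η : Sp n => ((wt m (-σ) η : ℝ) : ℂ)) (g : Dist n)) :=
  rfl

theorem fourier_hatT_apply {m : ℝ} (hm : 0 < m) (σ : ℝ) (g : L2 n) (ψ : 𝓢(Sp n, ℂ)) :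
    𝓕 (hatT m σ g) ψ = ∫ η, ψ η * (((nc n : ℝ) : ℂ)⁻¹ * (wt m (-σ) η * g η)) := by
  rw [hatT_eq, FourierTransform.fourier_smul, FourierTransform.fourier_fourierInv_eq]
  change ((nc n : ℝ) : ℂ)⁻¹ * ((g : Dist n) _) = _
  rw [toTD_apply, ← integral_const_mul]
  congr 1; ext η
  refine (congrArg (fun z => ((nc n : ℝ) : ℂ)⁻¹ * (z * g η)) (smul_schwartz hm (-σ) ψ η)).trans ?_
  ring

theorem hatT_apply {m : ℝ} (hm : 0 < m) (σ : ℝ) (g : L2 n) (ψ : 𝓢(Sp n, ℂ)) :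
    hatT m σ g ψ = ∫ η, (𝓕⁻ ψ) η * (((nc n : ℝ) : ℂ)⁻¹ * (wt m (-σ) η * g η)) := by
  rw [← fourier_hatT_apply hm, TemperedDistribution.fourier_apply]
  simp

theorem smulLeft_fourier_hatT {m : ℝ} (hm : 0 < m) (σ : ℝ) (g : L2 n) :
    TemperedDistribution.smulLeftCLM ℂ (fun η : Sp n => ((wt m σ η : ℝ) : ℂ)) (𝓕 (hatT m σ g)) =
      ((((nc n : ℝ) : ℂ)⁻¹ • g : L2 n) : Dist n) := by
  rw [hatT_eq, FourierTransform.fourier_smul, FourierTransform.fourier_fourierInv_eq, map_smul,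
    TemperedDistribution.smulLeftCLM_smulLeftCLM_apply (hasTemperateGrowth_wt hm _)
      (hasTemperateGrowth_wt hm _)]
  have h1 : ((fun η : Sp n => ((wt m (-σ) η : ℝ) : ℂ)) * fun η => ((wt m σ η : ℝ) : ℂ)) =
      fun _ => (1 : ℂ) := by
    funext η
    simp only [Pi.mul_apply]
    rw [← Complex.ofReal_mul, wt_neg_mul hm, Complex.ofReal_one]
  rw [h1, TemperedDistribution.smulLeftCLM_const, one_smul]
  exact ((Lp.toTemperedDistributionCLM (E := Sp n) ℂ volume 2).map_smul _ g).symm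

theorem hatT_injective {m : ℝ} (hm : 0 < m) (σ : ℝ) :
    Function.Injective (hatT m σ : L2 n → Dist n) := by
  intro a b hab
  have h := smulLeft_fourier_hatT hm σ a
  rw [hab, smulLeft_fourier_hatT hm σ b] at h
  have := toTD_injective h
  exact (smul_right_injective _ (inv_ne_zero (nc_ne_zero n)) this).symm

theorem sobNorm_eq_of {m σ : ℝ} {f : Dist n} {g : L2 n}
    (h : TemperedDistribution.smulLeftCLM ℂ (fun η : Sp n => ((wt m σ η : ℝ) : ℂ)) (𝓕 f) =
      (g : Dist n)) : sobNorm m σ f = ENNReal.ofReal (nc n) * ‖g‖ₑ := by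
  unfold sobNorm
  apply le_antisymm
  · exact iInf₂_le g h
  · refine le_iInf₂ fun g' hg' => ?_
    have : g = g' := toTD_injective (h.symm.trans hg')
    rw [this]; rfl

theorem sobNorm_hatT {m : ℝ} (hm : 0 < m) (σ : ℝ) (g : L2 n) : sobNorm m σ (hatT m σ g) = ‖g‖ₑ := by
  rw [sobNorm_eq_of (smulLeft_fourier_hatT hm σ g), enorm_smul, ← mul_assoc]
  have : ‖((nc n : ℝ) : ℂ)⁻¹‖ₑ = (ENNReal.ofReal (nc n))⁻¹ := by
    rw [enorm_inv (nc_ne_zero n), ← ofReal_norm, Complex.norm_real, Real.norm_eq_abs,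
      abs_of_pos (nc_pos n)]
  rw [this, ENNReal.mul_inv_cancel, one_mul]
  · simpa using nc_pos n
  · exact ENNReal.ofReal_ne_top

/-- The weight of order `-σ` is also of temperate growth, so it can be multiplied back and cancels
the weight in the definition of the norm. With `sobNorm_hatT` this makes `H^σ` the range of `hatT`.
-/
theorem exists_hatT_of_sobNorm {m : ℝ} (hm : 0 < m) {σ : ℝ} {f : Dist n} (h : sobNorm m σ f < ⊤) :
    ∃ g : L2 n, f = hatT m σ g := by
  unfold sobNorm at h
  simp only [iInf_lt_iff] at h
  obtain ⟨g, hg, -⟩ := h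
  refine ⟨((nc n : ℝ) : ℂ) • g, ?_⟩
  have h2 : TemperedDistribution.smulLeftCLM ℂ (fun η : Sp n => ((wt m (-σ) η : ℝ) : ℂ))
      (TemperedDistribution.smulLeftCLM ℂ (fun η : Sp n => ((wt m σ η : ℝ) : ℂ)) (𝓕 f)) = 𝓕 f := by
    rw [TemperedDistribution.smulLeftCLM_smulLeftCLM_apply (hasTemperateGrowth_wt hm _)
      (hasTemperateGrowth_wt hm _)]
    have h1 : ((fun η : Sp n => ((wt m σ η : ℝ) : ℂ)) * fun η => ((wt m (-σ) η : ℝ) : ℂ)) =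
        fun _ => (1 : ℂ) := by
      funext η
      simp only [Pi.mul_apply]
      rw [← Complex.ofReal_mul, wt_mul_neg hm, Complex.ofReal_one]
    rw [h1, TemperedDistribution.smulLeftCLM_const, one_smul]
  rw [map_smul, hatT_eq, smul_smul, mul_inv_cancel₀ (nc_ne_zero n), one_smul]
  have h3 : TemperedDistribution.smulLeftCLM ℂ (fun η : Sp n => ((wt m σ η : ℝ) : ℂ)) (𝓕 f) =
      (g : Dist n) := hg
  rw [← h3, h2, FourierTransform.fourierInv_fourier_eq]

theorem sobNorm_lt_top_iff {m : ℝ} (hm : 0 < m) {σ : ℝ} {f : Dist n} :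
    sobNorm m σ f < ⊤ ↔ ∃ g : L2 n, f = hatT m σ g := by
  refine ⟨exists_hatT_of_sobNorm hm, ?_⟩
  rintro ⟨g, rfl⟩
  rw [sobNorm_hatT hm]
  exact enorm_lt_top

open Classical in
/-- The inverse of `hatT` on `H^σ` (`0` by convention elsewhere). -/
def unhat (m σ : ℝ) (f : Dist n) : L2 n := if h : ∃ g : L2 n, f = hatT m σ g then h.choose else 0

theorem hatT_unhat {m : ℝ} (hm : 0 < m) {σ : ℝ} {f : Dist n} (h : sobNorm m σ f < ⊤) :
    hatT m σ (unhat m σ f) = f := by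
  have := exists_hatT_of_sobNorm hm h
  rw [unhat, dif_pos this]
  exact this.choose_spec.symm

theorem dist_ext_fourier {f g : Dist n} (h : ∀ ψ, 𝓕 f ψ = 𝓕 g ψ) : f = g := by
  have : 𝓕 f = 𝓕 g := by ext ψ; exact h ψ
  rw [← FourierTransform.fourierInv_fourier_eq (F := Dist n) f, this,
    FourierTransform.fourierInv_fourier_eq]

/-- The Fourier transform of `f` is given by the function `h` of polynomially weighted `L²` type. -/
structure FourierRep (m : ℝ) (f : Dist n) (h : Sp n → ℂ) : Prop where
  temp : ∃ σ, MemLp (fun η => (wt m σ η : ℂ) * h η) 2 volume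
  eq : ∀ ψ : 𝓢(Sp n, ℂ), 𝓕 f ψ = ∫ η, ψ η * h η

theorem memLp_wt_mul {m : ℝ} (hm : 0 < m) {σ τ : ℝ} (h : σ ≤ τ) {f : Sp n → ℂ}
    (hf : MemLp (fun η => (wt m τ η : ℂ) * f η) 2 volume) :
    MemLp (fun η => (wt m σ η : ℂ) * f η) 2 volume := by
  have hmeas : AEStronglyMeasurable (fun η => (wt m σ η : ℂ) * f η) volume := by
    have h1 : (fun η => (wt m σ η : ℂ) * f η) =
        fun η => (wt m (σ - τ) η : ℂ) * ((wt m τ η : ℂ) * f η) := by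
      funext η
      rw [← mul_assoc, ← Complex.ofReal_mul, ← wt_add hm]
      simp
    rw [h1]
    exact (Complex.continuous_ofReal.comp (continuous_wt hm _)).aestronglyMeasurable.mul hf.1
  refine (hf.const_mul ((m ^ (σ - τ) : ℝ) : ℂ)).mono hmeas (Eventually.of_forall fun η => ?_)
  rw [← mul_assoc, norm_mul, norm_mul (_ * _), ← Complex.ofReal_mul, Complex.norm_real,
    Complex.norm_real, Real.norm_of_nonneg (wt_pos hm _ _).le,
    Real.norm_of_nonneg (mul_nonneg (by positivity) (wt_pos hm _ _).le)]
  exact mul_le_mul_of_nonneg_right (wt_le hm h η) (norm_nonneg _)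

theorem coeFn_ofReal_wt_mul_wt {m : ℝ} (hm : 0 < m) (σ τ : ℝ) (η : Sp n) (z : ℂ) :
    (wt m σ η : ℂ) * ((wt m τ η : ℂ) * z) = (wt m (σ + τ) η : ℂ) * z := by
  rw [← mul_assoc, ← Complex.ofReal_mul, ← wt_add hm]

theorem fourierRep_hatT {m : ℝ} (hm : 0 < m) (σ : ℝ) (g : L2 n) :
    FourierRep m (hatT m σ g) (fun η => ((nc n : ℝ) : ℂ)⁻¹ * (wt m (-σ) η * g η)) := by
  refine ⟨⟨σ, ?_⟩, fourier_hatT_apply hm σ g⟩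
  have : (fun η => (wt m σ η : ℂ) * (((nc n : ℝ) : ℂ)⁻¹ * (wt m (-σ) η * g η))) =
      fun η => ((nc n : ℝ) : ℂ)⁻¹ * g η := by
    funext η
    rw [mul_left_comm, coeFn_ofReal_wt_mul_wt hm]; simp
  rw [this]
  exact (Lp.memLp g).const_mul _

theorem FourierRep.eq_hatT {m : ℝ} (hm : 0 < m) {f : Dist n} {h : Sp n → ℂ} (hf : FourierRep m f h)
    {σ : ℝ} (hσ : MemLp (fun η => ((nc n : ℝ) : ℂ) * ((wt m σ η : ℂ) * h η)) 2 volume) :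
    f = hatT m σ hσ.toLp := by
  apply dist_ext_fourier
  intro ψ
  rw [hf.eq, fourier_hatT_apply hm]
  apply integral_congr_ae
  filter_upwards [hσ.coeFn_toLp] with η hη
  rw [hη, mul_left_comm _ ((nc n : ℝ) : ℂ), inv_mul_cancel_left₀ (nc_ne_zero n),
    coeFn_ofReal_wt_mul_wt hm]
  simp

theorem FourierRep.exists_eq_hatT {m : ℝ} (hm : 0 < m) {f : Dist n} {h : Sp n → ℂ}
    (hf : FourierRep m f h) {σ : ℝ} (hσ : MemLp (fun η => (wt m σ η : ℂ) * h η) 2 volume) :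
    ∃ g : L2 n, f = hatT m σ g ∧ g =ᵐ[volume] fun η => ((nc n : ℝ) : ℂ) * ((wt m σ η : ℂ) * h η) :=
  ⟨_, hf.eq_hatT hm (hσ.const_mul _), (hσ.const_mul _).coeFn_toLp⟩

/-- Both representatives can be weighted to the smaller of their two orders, where injectivity of
`hatT` compares them. -/
theorem FourierRep.unique {m : ℝ} (hm : 0 < m) {f : Dist n} {h h' : Sp n → ℂ}
    (hf : FourierRep m f h) (hf' : FourierRep m f h') : h =ᵐ[volume] h' := by
  obtain ⟨σ, hσ⟩ := hf.temp
  obtain ⟨σ', hσ'⟩ := hf'.temp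
  obtain ⟨g, hg, hg'⟩ := hf.exists_eq_hatT hm (memLp_wt_mul hm (min_le_left σ σ') hσ)
  obtain ⟨k, hk, hk'⟩ := hf'.exists_eq_hatT hm (memLp_wt_mul hm (min_le_right σ σ') hσ')
  have : g = k := hatT_injective hm _ (hg.symm.trans hk)
  subst this
  filter_upwards [hg', hk'] with η h1 h2
  rw [h1] at h2
  have h3 := mul_left_cancel₀ (nc_ne_zero n) h2
  have h4 : (wt m (min σ σ') η : ℂ) ≠ 0 := by exact_mod_cast (wt_pos hm _ _).ne'
  exact mul_left_cancel₀ h4 h3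

theorem FourierRep.integrable {m : ℝ} (hm : 0 < m) {h : Sp n → ℂ}
    {σ : ℝ} (hσ : MemLp (fun η => (wt m σ η : ℂ) * h η) 2 volume) (ψ : 𝓢(Sp n, ℂ)) :
    Integrable (fun η => ψ η * h η) := by
  have h1 := (SchwartzMap.smulLeftCLM ℂ (fun η : Sp n => ((wt m (-σ) η : ℝ) : ℂ)) ψ).memLp 2 volume
  have h2 := h1.integrable_mul hσ
  refine h2.congr (Eventually.of_forall fun η => ?_)
  simp only [Pi.mul_apply]
  rw [smul_schwartz hm, mul_assoc, mul_left_comm, coeFn_ofReal_wt_mul_wt hm]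
  simp

theorem FourierRep.integrable' {m : ℝ} (hm : 0 < m) {f : Dist n} {h : Sp n → ℂ}
    (hf : FourierRep m f h) (ψ : 𝓢(Sp n, ℂ)) : Integrable (fun η => ψ η * h η) :=
  let ⟨_, hσ⟩ := hf.temp
  FourierRep.integrable hm hσ ψ

theorem FourierRep.add {m : ℝ} (hm : 0 < m) {f f' : Dist n} {h h' : Sp n → ℂ}
    (hf : FourierRep m f h) (hf' : FourierRep m f' h') :
    FourierRep m (f + f') (fun η => h η + h' η) := by
  obtain ⟨σ, hσ⟩ := hf.temp
  obtain ⟨σ', hσ'⟩ := hf'.temp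
  refine ⟨⟨min σ σ', ?_⟩, fun ψ => ?_⟩
  · simpa only [mul_add] using! (memLp_wt_mul hm (min_le_left σ σ') hσ).add
      (memLp_wt_mul hm (min_le_right σ σ') hσ')
  · rw [FourierTransform.fourier_add]
    simp only [mul_add]
    rw [integral_add (hf.integrable' hm ψ) (hf'.integrable' hm ψ), ← hf.eq, ← hf'.eq]
    rfl

theorem FourierRep.smul {m : ℝ} {f : Dist n} {h : Sp n → ℂ}
    (hf : FourierRep m f h) (z : ℂ) : FourierRep m (z • f) (fun η => z * h η) := by
  obtain ⟨σ, hσ⟩ := hf.temp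
  refine ⟨⟨σ, ?_⟩, fun ψ => ?_⟩
  · simpa only [mul_left_comm] using hσ.const_mul z
  · rw [FourierTransform.fourier_smul]
    simp only [mul_left_comm _ z]
    rw [integral_const_mul, ← hf.eq]
    rfl

theorem FourierRep.zero (m : ℝ) : FourierRep m (0 : Dist n) (fun _ => 0) := by
  refine ⟨⟨0, by simp⟩, fun ψ => ?_⟩
  have : (𝓕 (0 : Dist n)) = 0 := map_zero (FourierTransform.fourierCLM ℂ (Dist n))
  rw [this]; simp

theorem FourierRep.sum {m : ℝ} (hm : 0 < m) {ι : Type*} (s : Finset ι) {f : ι → Dist n}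
    {h : ι → Sp n → ℂ} (hf : ∀ i ∈ s, FourierRep m (f i) (h i)) :
    FourierRep m (∑ i ∈ s, f i) (fun η => ∑ i ∈ s, h i η) := by
  classical
  induction s using Finset.induction_on with
  | empty => simpa using FourierRep.zero m
  | insert a s ha ih =>
    simp only [Finset.sum_insert ha]
    exact (hf a (by simp)).add hm (ih fun i hi => hf i (by simp [hi]))

/-! ### Matrix exponentials -/

section MatrixExp

variable {ι κ : Type*} [Fintype ι] [DecidableEq ι] [Fintype κ] [DecidableEq κ]

theorem hasDerivAt_exp_smul_entry (A : Matrix ι ι ℂ) (t : ℝ) (i j : ι) :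
    HasDerivAt (fun s : ℝ => NormedSpace.exp (s • A) i j)
      ((A * NormedSpace.exp (t • A)) i j) t := by
  let _ : NormedRing (Matrix ι ι ℂ) := Matrix.linftyOpNormedRing
  let _ : NormedAlgebra ℝ (Matrix ι ι ℂ) := Matrix.linftyOpNormedAlgebra
  have h : HasDerivAt (fun s : ℝ => NormedSpace.exp (s • A)) (A * NormedSpace.exp (t • A)) t :=
    hasDerivAt_exp_smul_const' (𝕂 := ℝ) A t
  exact hasDerivAt_pi.1 (hasDerivAt_pi.1 h i) j

theorem continuous_matrix_exp : Continuous (NormedSpace.exp : Matrix ι ι ℂ → Matrix ι ι ℂ) := by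
  let _ : NormedRing (Matrix ι ι ℂ) := Matrix.linftyOpNormedRing
  let _ : NormedAlgebra ℝ (Matrix ι ι ℂ) := Matrix.linftyOpNormedAlgebra
  let _ : NormedAlgebra ℚ (Matrix ι ι ℂ) := NormedAlgebra.restrictScalars ℚ ℝ _
  exact NormedSpace.exp_continuous

/-- The derivative of `exp(sA)ᴴ D exp(sA)` is `exp(sA)ᴴ (AᴴD + DA) exp(sA) = 0`. The choice `D = 1`
will give unitarity, and `D = diag(P₂, 1)` conservation of energy. -/
theorem conjTranspose_exp_mul_exp {A D : Matrix ι ι ℂ} (h : Aᴴ * D + D * A = 0) (t : ℝ) :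
    (NormedSpace.exp (t • A))ᴴ * D * NormedSpace.exp (t • A) = D := by
  let _ : NormedRing (Matrix ι ι ℂ) := Matrix.linftyOpNormedRing
  let _ : NormedAlgebra ℝ (Matrix ι ι ℂ) := Matrix.linftyOpNormedAlgebra
  have hd : ∀ s : ℝ, HasDerivAt
      (fun s : ℝ => NormedSpace.exp (s • Aᴴ) * D * NormedSpace.exp (s • A)) 0 s := by
    intro s
    have h1 := ((hasDerivAt_exp_smul_const (𝕂 := ℝ) Aᴴ s).mul_const D).mul
      (hasDerivAt_exp_smul_const' (𝕂 := ℝ) A s)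
    have h2 : NormedSpace.exp (s • Aᴴ) * Aᴴ * D * NormedSpace.exp (s • A) +
        NormedSpace.exp (s • Aᴴ) * D * (A * NormedSpace.exp (s • A)) = 0 := by
      have : NormedSpace.exp (s • Aᴴ) * Aᴴ * D * NormedSpace.exp (s • A) +
        NormedSpace.exp (s • Aᴴ) * D * (A * NormedSpace.exp (s • A)) =
        NormedSpace.exp (s • Aᴴ) * (Aᴴ * D + D * A) * NormedSpace.exp (s • A) := by
        noncomm_ring
      rw [this, h]; simp
    exact h1.congr_deriv h2
  have h3 := is_const_of_deriv_eq_zero (fun s => (hd s).differentiableAt) (fun s => (hd s).deriv) t 0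
  have h4 : (NormedSpace.exp (t • A))ᴴ = NormedSpace.exp (t • Aᴴ) := by
    rw [← Matrix.exp_conjTranspose, Matrix.conjTranspose_smul]; simp
  rw [h4]
  simpa using h3

/-- The block-diagonal embedding of a pair of matrices is a continuous ring homomorphism, and these
commute with the exponential. -/
theorem exp_fromBlocks_diagonal (A : Matrix ι ι ℂ) (B : Matrix κ κ ℂ) :
    NormedSpace.exp (Matrix.fromBlocks A 0 0 B) =
      Matrix.fromBlocks (NormedSpace.exp A) 0 0 (NormedSpace.exp B) := by
  let _ : NormedRing (Matrix ι ι ℂ) := Matrix.linftyOpNormedRing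
  let _ : NormedAlgebra ℝ (Matrix ι ι ℂ) := Matrix.linftyOpNormedAlgebra
  let _ : NormedAlgebra ℚ (Matrix ι ι ℂ) := NormedAlgebra.restrictScalars ℚ ℝ _
  let _ : NormedRing (Matrix κ κ ℂ) := Matrix.linftyOpNormedRing
  let _ : NormedAlgebra ℝ (Matrix κ κ ℂ) := Matrix.linftyOpNormedAlgebra
  let _ : NormedAlgebra ℚ (Matrix κ κ ℂ) := NormedAlgebra.restrictScalars ℚ ℝ _
  let _ : NormedRing (Matrix (ι ⊕ κ) (ι ⊕ κ) ℂ) := Matrix.linftyOpNormedRing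
  let _ : NormedAlgebra ℝ (Matrix (ι ⊕ κ) (ι ⊕ κ) ℂ) := Matrix.linftyOpNormedAlgebra
  let _ : NormedAlgebra ℚ (Matrix (ι ⊕ κ) (ι ⊕ κ) ℂ) := NormedAlgebra.restrictScalars ℚ ℝ _
  let f : (Matrix ι ι ℂ × Matrix κ κ ℂ) →+* Matrix (ι ⊕ κ) (ι ⊕ κ) ℂ :=
    { toFun := fun p => Matrix.fromBlocks p.1 0 0 p.2
      map_one' := Matrix.fromBlocks_one
      map_mul' := fun p q => by simp [Matrix.fromBlocks_multiply]
      map_zero' := Matrix.fromBlocks_zero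
      map_add' := fun p q => by simp [Matrix.fromBlocks_add] }
  have hf : Continuous f :=
    Continuous.matrix_fromBlocks continuous_fst continuous_const continuous_const continuous_snd
  have h := NormedSpace.map_exp f hf (A, B)
  have h1 : (NormedSpace.exp (A, B)).1 = NormedSpace.exp A :=
    NormedSpace.map_exp (RingHom.fst _ _) continuous_fst (A, B)
  have h2 : (NormedSpace.exp (A, B)).2 = NormedSpace.exp B :=
    NormedSpace.map_exp (RingHom.snd _ _) continuous_snd (A, B)
  change Matrix.fromBlocks (NormedSpace.exp (A, B)).1 0 0 (NormedSpace.exp (A, B)).2 = _ at h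
  rw [h1, h2] at h
  exact h.symm

theorem exp_map_conj (A : Matrix ι ι ℂ) :
    NormedSpace.exp (A.map (starRingEnd ℂ)) = (NormedSpace.exp A).map (starRingEnd ℂ) := by
  have h : ∀ B : Matrix ι ι ℂ, B.map (starRingEnd ℂ) = Bᴴᵀ := fun B => by ext; simp
  rw [h, h, Matrix.exp_transpose, Matrix.exp_conjTranspose]

end MatrixExp

/-! ### Symbols -/

/-- Labels of the coordinates `(u₁, u₂, ∂₀u₂)` of the Cauchy data. -/
abbrev DIdx (d₁ d₂ : ℕ) := Fin d₁ ⊕ (Fin d₂ ⊕ Fin d₂)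

theorem norm_coord_le (ξ : Sp n) (k : Fin n) : ‖Complex.I * (ξ k : ℂ)‖ ≤ ‖ξ‖ := by
  rw [norm_mul, Complex.norm_I, one_mul, Complex.norm_real]
  exact PiLp.norm_apply_le ξ k

/-- Every coordinate of `ξ` is at most `⟨ξ⟩`, so a monomial of degree `j ≤ k` is at most `⟨ξ⟩^j ≤
m^{j-k} ⟨ξ⟩^k`. -/
theorem norm_aeval_le {m : ℝ} (hm : 0 < m) (p : MvPolynomial (Fin n) ℝ) {k : ℕ}
    (hp : p.totalDegree ≤ k) : ∃ C, 0 ≤ C ∧ ∀ η : Sp n,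
      ‖MvPolynomial.aeval (fun l => Complex.I * ((((2 * Real.pi) • η) l : ℝ) : ℂ)) p‖ ≤
        C * wt m k η := by
  refine ⟨∑ a ∈ p.support, |p.coeff a| * m ^ ((∑ l, a l : ℕ) - k : ℝ),
    Finset.sum_nonneg fun a _ => by positivity, fun η => ?_⟩
  rw [MvPolynomial.aeval_def, MvPolynomial.eval₂_eq', Finset.sum_mul]
  refine (norm_sum_le _ _).trans (Finset.sum_le_sum fun a ha => ?_)
  rw [norm_mul, norm_prod, mul_assoc]
  refine mul_le_mul (by simp) ?_ (Finset.prod_nonneg fun _ _ => norm_nonneg _) (abs_nonneg _)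
  have hdeg : (∑ l, a l : ℕ) ≤ k := by
    refine le_trans ?_ hp
    have := MvPolynomial.le_totalDegree ha
    rwa [Finsupp.sum_fintype _ _ (fun _ => rfl)] at this
  have h1 : ∏ l, ‖(Complex.I * ((((2 * Real.pi) • η) l : ℝ) : ℂ)) ^ a l‖ ≤
      ∏ l, wt m 1 η ^ a l := by
    refine Finset.prod_le_prod (fun _ _ => norm_nonneg _) fun l _ => ?_
    rw [norm_pow]
    exact pow_le_pow_left₀ (norm_nonneg _) ((norm_coord_le _ _).trans (norm_le_wt_one m η)) _
  refine h1.trans ?_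
  rw [Finset.prod_pow_eq_pow_sum, ← wt_nat hm]
  exact wt_le hm (by exact_mod_cast hdeg) η

theorem continuous_symb_entry {d : ℕ} (P : Matrix (Fin d) (Fin d) (MvPolynomial (Fin n) ℝ))
    (i j : Fin d) : Continuous fun η : Sp n => symb P ((2 * Real.pi) • η) i j := by
  simp only [symb, Matrix.map_apply, MvPolynomial.aeval_def, MvPolynomial.eval₂_eq']
  fun_prop

theorem symb_neg {d : ℕ} (P : Matrix (Fin d) (Fin d) (MvPolynomial (Fin n) ℝ)) (ξ : Sp n) :
    symb P (-ξ) = (symb P ξ).map (starRingEnd ℂ) := by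
  ext i j
  simp [symb, Matrix.map_apply, MvPolynomial.aeval_def, MvPolynomial.eval₂_eq', map_sum, map_mul,
    map_prod]

/-- The generator of the evolution of the weighted Cauchy data, on the Fourier side. -/
def gen (L : EvolOp n d₁ d₂) (m r : ℝ) (η : Sp n) : Matrix (DIdx d₁ d₂) (DIdx d₁ d₂) ℂ :=
  Matrix.fromBlocks (-(L.γC⁻¹ * symb L.P₁ ((2 * Real.pi) • η))) 0 0
    (Matrix.fromBlocks 0 ((wt m r η : ℂ) • 1) (-((wt m (-r) η : ℂ) • symb L.P₂ ((2 * Real.pi) • η))) 0)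

/-- The evolution of the weighted Cauchy data, on the Fourier side. -/
def evo (L : EvolOp n d₁ d₂) (m r t : ℝ) (η : Sp n) : Matrix (DIdx d₁ d₂) (DIdx d₁ d₂) ℂ :=
  NormedSpace.exp (t • gen L m r η)

theorem continuous_gen (L : EvolOp n d₁ d₂) {m : ℝ} (hm : 0 < m) (r : ℝ) :
    Continuous (gen L m r) := by
  have h1 : Continuous fun η : Sp n => symb L.P₁ ((2 * Real.pi) • η) :=
    continuous_matrix fun i j => continuous_symb_entry _ i j
  have h2 : Continuous fun η : Sp n => symb L.P₂ ((2 * Real.pi) • η) :=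
    continuous_matrix fun i j => continuous_symb_entry _ i j
  have h3 : ∀ σ, Continuous fun η : Sp n => (wt m σ η : ℂ) :=
    fun σ => Complex.continuous_ofReal.comp (continuous_wt hm σ)
  refine Continuous.matrix_fromBlocks (continuous_const.matrix_mul h1).neg continuous_const
    continuous_const (Continuous.matrix_fromBlocks continuous_const ((h3 r).smul continuous_const)
    ((h3 (-r)).smul h2).neg continuous_const)

theorem continuous_evo (L : EvolOp n d₁ d₂) {m : ℝ} (hm : 0 < m) (r t : ℝ) :
    Continuous (evo L m r t) :=
  continuous_matrix_exp.comp ((continuous_gen L hm r).const_smul t)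

theorem continuous_evo_time (L : EvolOp n d₁ d₂) (m r : ℝ) (η : Sp n) :
    Continuous fun t : ℝ => evo L m r t η :=
  continuous_matrix_exp.comp (continuous_id.smul continuous_const)

theorem evo_zero (L : EvolOp n d₁ d₂) (m r : ℝ) (η : Sp n) : evo L m r 0 η = 1 := by
  simp [evo]

theorem evo_add (L : EvolOp n d₁ d₂) (m r t s : ℝ) (η : Sp n) :
    evo L m r (t + s) η = evo L m r t η * evo L m r s η := by
  rw [evo, add_smul, Matrix.exp_add_of_commute]
  · rfl
  · exact ((Commute.refl _).smul_left _).smul_right _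

theorem gen_mul_evo (L : EvolOp n d₁ d₂) (m r t : ℝ) (η : Sp n) :
    gen L m r η * evo L m r t η = evo L m r t η * gen L m r η :=
  ((Commute.refl (gen L m r η)).smul_right t).exp_right

theorem hasDerivAt_evo (L : EvolOp n d₁ d₂) (m r t : ℝ) (η : Sp n) (i j : DIdx d₁ d₂) :
    HasDerivAt (fun s => evo L m r s η i j) ((gen L m r η * evo L m r t η) i j) t :=
  hasDerivAt_exp_smul_entry _ _ _ _

theorem γC_map_conj (L : EvolOp n d₁ d₂) : L.γC⁻¹.map (starRingEnd ℂ) = L.γC⁻¹ := by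
  have h : L.γC = L.γ.map (algebraMap ℝ ℂ) := rfl
  have h1 : L.γC.map (starRingEnd ℂ) = L.γC := by
    ext i j; simp [EvolOp.γC]
  have h2 := Matrix.conjTranspose_nonsing_inv L.γC
  have h3 := Matrix.transpose_nonsing_inv L.γCᴴ
  have h4 : ∀ B : Matrix (Fin d₁) (Fin d₁) ℂ, B.map (starRingEnd ℂ) = Bᴴᵀ := fun B => by
    ext; simp
  rw [h4, h2, h3, ← h4, h1]

/-- The operator has real coefficients, so conjugating a symbol amounts to reflecting the frequency.
This is what makes the evolution preserve real distributions. -/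
theorem gen_neg (L : EvolOp n d₁ d₂) (m r : ℝ) (η : Sp n) :
    gen L m r (-η) = (gen L m r η).map (starRingEnd ℂ) := by
  have h1 : (L.γC⁻¹ * symb L.P₁ ((2 * Real.pi) • η)).map (starRingEnd ℂ) =
      L.γC⁻¹ * (symb L.P₁ ((2 * Real.pi) • η)).map (starRingEnd ℂ) := by
    rw [Matrix.map_mul, γC_map_conj]
  have h2 : (-(L.γC⁻¹ * symb L.P₁ ((2 * Real.pi) • η))).map (starRingEnd ℂ) =
      -(L.γC⁻¹ * (symb L.P₁ ((2 * Real.pi) • η)).map (starRingEnd ℂ)) := by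
    rw [← h1]; ext i j
    simp only [Matrix.map_apply, Matrix.neg_apply, map_neg]
  have h3 : ((wt m r η : ℂ) • (1 : Matrix (Fin d₂) (Fin d₂) ℂ)).map (starRingEnd ℂ) =
      (wt m r η : ℂ) • 1 := by
    ext i j
    simp only [Matrix.map_apply, Matrix.smul_apply, Matrix.one_apply, smul_eq_mul, map_mul,
      Complex.conj_ofReal]
    split_ifs <;> simp
  have h4 : (-((wt m (-r) η : ℂ) • symb L.P₂ ((2 * Real.pi) • η))).map (starRingEnd ℂ) =
      -((wt m (-r) η : ℂ) • (symb L.P₂ ((2 * Real.pi) • η)).map (starRingEnd ℂ)) := by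
    ext i j
    simp only [Matrix.map_apply, Matrix.smul_apply, Matrix.neg_apply, smul_eq_mul, map_mul,
      map_neg, Complex.conj_ofReal]
  have h5 : ∀ (ι κ : Type) , (0 : Matrix ι κ ℂ).map (starRingEnd ℂ) = 0 := fun _ _ => by
    ext; simp
  rw [gen, gen, smul_neg, symb_neg, symb_neg, wt_even, wt_even, Matrix.fromBlocks_map,
    Matrix.fromBlocks_map, h2, h3, h4, h5, h5, h5]

theorem evo_neg (L : EvolOp n d₁ d₂) (m r t : ℝ) (η : Sp n) :
    evo L m r t (-η) = (evo L m r t η).map (starRingEnd ℂ) := by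
  rw [evo, evo, ← exp_map_conj, gen_neg]
  congr 1
  ext i j
  simp

/-- The second block of the generator is the conjugate by `diag(⟨ξ⟩^r, 1)` of the first order system
of `prop₂`, and conjugation passes through the exponential. The formula serves both to bound `evo`
and to recognize the Green function inside it. -/
theorem evo_eq (L : EvolOp n d₁ d₂) {m : ℝ} (hm : 0 < m) (r t : ℝ) (η : Sp n) :
    evo L m r t η = Matrix.fromBlocks
      (NormedSpace.exp (t • (-(L.γC⁻¹ * symb L.P₁ ((2 * Real.pi) • η))))) 0 0
      (Matrix.fromBlocks ((wt m r η : ℂ) • 1) 0 0 1 * prop₂ L t ((2 * Real.pi) • η) *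
        Matrix.fromBlocks ((wt m (-r) η : ℂ) • 1) 0 0 1) := by
  have h0 : wt m r η * wt m (-r) η = 1 := wt_mul_neg hm r η
  let D : Matrix (Fin d₂ ⊕ Fin d₂) (Fin d₂ ⊕ Fin d₂) ℂ :=
    Matrix.fromBlocks ((wt m r η : ℂ) • 1) 0 0 1
  let D' : Matrix (Fin d₂ ⊕ Fin d₂) (Fin d₂ ⊕ Fin d₂) ℂ :=
    Matrix.fromBlocks ((wt m (-r) η : ℂ) • 1) 0 0 1
  have hDD : D * D' = 1 := by
    simp [D, D', Matrix.fromBlocks_multiply, smul_smul, h0, mul_comm]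
  have hDD' : D' * D = 1 := by
    simp [D, D', Matrix.fromBlocks_multiply, smul_smul, h0]
  let U : (Matrix (Fin d₂ ⊕ Fin d₂) (Fin d₂ ⊕ Fin d₂) ℂ)ˣ := ⟨D, D', hDD, hDD'⟩
  have h1 : gen L m r η = Matrix.fromBlocks (-(L.γC⁻¹ * symb L.P₁ ((2 * Real.pi) • η))) 0 0
      (D * Matrix.fromBlocks 0 1 (-symb L.P₂ ((2 * Real.pi) • η)) 0 * D') := by
    rw [gen]
    congr 1
    simp [D, D', Matrix.fromBlocks_multiply]
  rw [evo, h1, Matrix.fromBlocks_smul, smul_zero, smul_zero, exp_fromBlocks_diagonal]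
  congr 1
  have h2 := Matrix.exp_units_conj U (t • Matrix.fromBlocks 0 1 (-symb L.P₂ ((2 * Real.pi) • η)) 0)
  rw [mul_smul_comm, smul_mul_assoc] at h2
  exact h2

/-! ### Energy estimates for the propagators. -/

/-- If `iA` is Hermitian then `A` is skew-Hermitian, so its exponentials are unitary, and entries of
unitary matrices have modulus at most one. -/
theorem norm_exp_green₁_le {L : EvolOp n d₁ d₂} {r : ℕ} {α μ₀ : ℝ} (hL : L.Admissible r α μ₀)
    (t : ℝ) (ξ : Sp n) (i j : Fin d₁) :
    ‖NormedSpace.exp (t • (-(L.γC⁻¹ * symb L.P₁ ξ))) i j‖ ≤ 1 := by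
  apply entry_norm_bound_of_unitary
  rw [Matrix.mem_unitaryGroup_iff']
  have h := hL.herm₁ ξ
  set A := L.γC⁻¹ * symb L.P₁ ξ
  have h1 : Aᴴ = -A := by
    have h2 : (Complex.I • A)ᴴ = Complex.I • A := h
    rw [Matrix.conjTranspose_smul] at h2
    simp only [RCLike.star_def, Complex.conj_I, neg_smul] at h2
    have h3 : Complex.I • (Aᴴ + A) = 0 := by
      rw [smul_add, ← h2]; simp
    exact eq_neg_of_add_eq_zero_left ((smul_eq_zero.1 h3).resolve_left Complex.I_ne_zero)
  have := conjTranspose_exp_mul_exp (A := -A) (D := 1) (by simp [h1]) t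
  simpa using! this

/-- A column of `prop₂` is a pair (position `y`, velocity `z`) with conserved energy `⟨y, P₂ y⟩ +
|z|²`. The right-hand side is the energy of the column of index `j` at time `0`; on the left, `P₂`
is replaced by its lower bound `κ`. -/
theorem prop₂_energy {L : EvolOp n d₁ d₂} {ξ : Sp n} {κ : ℝ} (hP : (symb L.P₂ ξ).IsHermitian)
    (hκ : (symb L.P₂ ξ - (κ : ℂ) • (1 : Matrix (Fin d₂) (Fin d₂) ℂ)).PosSemidef) (t : ℝ)
    (j : Fin d₂ ⊕ Fin d₂) :
    κ * ∑ i, ‖prop₂ L t ξ (Sum.inl i) j‖ ^ 2 + ∑ i, ‖prop₂ L t ξ (Sum.inr i) j‖ ^ 2 ≤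
      ((Matrix.fromBlocks (symb L.P₂ ξ) 0 0 1 : Matrix (Fin d₂ ⊕ Fin d₂) (Fin d₂ ⊕ Fin d₂) ℂ) j j).re := by
  have h := conjTranspose_exp_mul_exp
    (A := Matrix.fromBlocks 0 1 (-symb L.P₂ ξ) 0) (D := Matrix.fromBlocks (symb L.P₂ ξ) 0 0 1)
    (by simp [Matrix.fromBlocks_multiply, Matrix.fromBlocks_conjTranspose, Matrix.fromBlocks_add,
      hP.eq]) t
  change (prop₂ L t ξ)ᴴ * _ * prop₂ L t ξ = _ at h
  set p := prop₂ L t ξ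
  let Y : Matrix (Fin d₂) (Fin d₂ ⊕ Fin d₂) ℂ := p.toRows₁
  let Z : Matrix (Fin d₂) (Fin d₂ ⊕ Fin d₂) ℂ := p.toRows₂
  have hYZ : Matrix.fromBlocks (symb L.P₂ ξ) 0 0 1 = Yᴴ * symb L.P₂ ξ * Y + Zᴴ * Z := by
    rw [← h]
    ext a b
    simp [Matrix.mul_apply, Fintype.sum_sum_type, Y, Z, Matrix.one_apply]
  have h1 := (hκ.conjTranspose_mul_mul_same Y).diag_nonneg (i := j)
  have h2 : ∀ W : Matrix (Fin d₂) (Fin d₂ ⊕ Fin d₂) ℂ, ((Wᴴ * W) j j).re = ∑ i, ‖W i j‖ ^ 2 := by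
    intro W
    rw [Matrix.mul_apply, Complex.re_sum]
    refine Finset.sum_congr rfl fun i _ => ?_
    rw [Matrix.conjTranspose_apply, Complex.star_def, ← Complex.normSq_eq_conj_mul_self,
      Complex.ofReal_re, Complex.normSq_eq_norm_sq]
  rw [hYZ, Matrix.add_apply, Complex.add_re, h2 Z]
  refine add_le_add ?_ le_rfl
  rw [Matrix.mul_sub, Matrix.sub_mul, Matrix.sub_apply, Matrix.mul_smul, Matrix.mul_one,
    Matrix.smul_mul, Matrix.smul_apply] at h1
  have h3 := (Complex.le_def.1 h1).1
  simp only [Complex.zero_re, Complex.sub_re, smul_eq_mul, Complex.re_ofReal_mul, h2 Y] at h3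
  have h4 : ∑ i, ‖p (Sum.inl i) j‖ ^ 2 = ∑ i, ‖Y i j‖ ^ 2 := rfl
  rw [h4]
  linarith

theorem norm_symb_le {m : ℝ} (hm : 0 < m) {d k : ℕ}
    (P : Matrix (Fin d) (Fin d) (MvPolynomial (Fin n) ℝ)) (hP : ∀ i j, (P i j).totalDegree ≤ k) :
    ∃ C, 0 ≤ C ∧ ∀ (η : Sp n) i j, ‖symb P ((2 * Real.pi) • η) i j‖ ≤ C * wt m k η := by
  choose C hC0 hC using fun i j => norm_aeval_le hm (P i j) (hP i j)
  refine ⟨∑ i, ∑ j, C i j, Finset.sum_nonneg fun i _ => Finset.sum_nonneg fun j _ => hC0 i j,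
    fun η i j => (hC i j η).trans (mul_le_mul_of_nonneg_right ?_ (wt_pos hm _ _).le)⟩
  exact (Finset.single_le_sum (f := C i) (fun j _ => hC0 i j) (Finset.mem_univ j)).trans
    (Finset.single_le_sum (f := fun i => ∑ j, C i j)
      (fun i _ => Finset.sum_nonneg fun j _ => hC0 i j) (Finset.mem_univ i))

/-- All blocks are of order `r`: `P₁` by its degree, the coupling `⟨ξ⟩^r` by definition, and
`⟨ξ⟩^{-r} P₂` because `2r - r = r`. So a smoothing of order `r` maps into the domain of the
generator. -/
theorem norm_gen_le {L : EvolOp n d₁ d₂} {r : ℕ} {α μ₀ : ℝ} (hL : L.Admissible r α μ₀)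
    {m : ℝ} (hm : 0 < m) : ∃ C, ∀ (η : Sp n) (i j : DIdx d₁ d₂),
      ‖(wt m (-r) η : ℂ) * gen L m r η i j‖ ≤ C := by
  obtain ⟨C₁, hC₁, h₁⟩ := norm_symb_le hm L.P₁ hL.deg₁
  obtain ⟨C₂, hC₂, h₂⟩ := norm_symb_le hm L.P₂ hL.deg₂
  let G := ∑ i, ∑ j, ‖L.γC⁻¹ i j‖
  have hG : 0 ≤ G := Finset.sum_nonneg fun i _ => Finset.sum_nonneg fun j _ => norm_nonneg _
  refine ⟨G * C₁ + 1 + C₂, fun η i j => ?_⟩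
  have hw : ∀ σ, ‖(wt m σ η : ℂ)‖ = wt m σ η := fun σ => by
    rw [Complex.norm_real, Real.norm_of_nonneg (wt_pos hm _ _).le]
  have hGC : 0 ≤ G * C₁ := mul_nonneg hG hC₁
  rcases i with i | i | i <;> rcases j with j | j | j <;>
    simp only [gen, Matrix.fromBlocks_apply₁₁, Matrix.fromBlocks_apply₁₂,
      Matrix.fromBlocks_apply₂₁, Matrix.fromBlocks_apply₂₂, Matrix.zero_apply, mul_zero, norm_zero] <;>
    try positivity
  · rw [norm_mul, hw, Matrix.neg_apply, norm_neg, Matrix.mul_apply]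
    have h3 : ‖∑ l, L.γC⁻¹ i l * symb L.P₁ ((2 * Real.pi) • η) l j‖ ≤ G * (C₁ * wt m r η) := by
      refine (norm_sum_le _ _).trans ?_
      have h4 : ∑ l, ‖L.γC⁻¹ i l‖ ≤ G := Finset.single_le_sum (f := fun i => ∑ l, ‖L.γC⁻¹ i l‖)
        (fun i _ => Finset.sum_nonneg fun j _ => norm_nonneg _) (Finset.mem_univ i)
      refine le_trans ?_ (mul_le_mul_of_nonneg_right h4 (mul_nonneg hC₁ (wt_pos hm _ _).le))
      rw [Finset.sum_mul]
      refine Finset.sum_le_sum fun l _ => ?_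
      rw [norm_mul]
      exact mul_le_mul_of_nonneg_left (h₁ η l j) (norm_nonneg _)
    have h5 := mul_le_mul_of_nonneg_left h3 (wt_pos hm (-r) η).le
    have h6 : wt m (-r) η * (G * (C₁ * wt m r η)) = G * C₁ := by
      have := wt_neg_mul hm (r : ℝ) η
      linear_combination (G * C₁) * this
    linarith
  · rw [Matrix.smul_apply, smul_eq_mul, ← mul_assoc, ← Complex.ofReal_mul, wt_neg_mul hm,
      Complex.ofReal_one, one_mul, Matrix.one_apply]
    split_ifs
    · rw [norm_one]; linarith
    · rw [norm_zero]; linarith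
  · rw [Matrix.neg_apply, Matrix.smul_apply, smul_eq_mul, mul_neg, norm_neg, norm_mul, norm_mul, hw]
    have h3 := h₂ η i j
    have h5 := mul_le_mul_of_nonneg_left h3 (mul_pos (wt_pos hm (-r) η) (wt_pos hm (-r) η)).le
    have h6 : wt m (-r) η * wt m (-r) η * (C₂ * wt m ((2 * r : ℕ) : ℝ) η) = C₂ := by
      have h7 : wt m ((2 * r : ℕ) : ℝ) η = wt m r η * wt m r η := by
        rw [← wt_add hm]; congr 1; push_cast; ring
      have := wt_neg_mul hm (r : ℝ) η
      rw [h7]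
      linear_combination (C₂ * (wt m (-r) η * wt m r η) + C₂) * this
    linarith

/-- Ellipticity of `P₂` relative to the weight can only fail at low frequencies, and only if `μ₀ =
0`; there the weight itself is bounded. -/
theorem exists_lower_bound {m : ℝ} (hm : 0 < m) (r : ℕ) {α μ₀ : ℝ} (hα : 0 < α) (hμ : 0 ≤ μ₀) :
    ∃ c W, 0 < c ∧ 0 < W ∧ ∀ η : Sp n,
      (c * wt m r η ^ 2 ≤ α * (μ₀ + ‖(2 * Real.pi) • η‖ ^ (2 * r)) ∨ (wt m r η ≤ W ∧ μ₀ = 0)) := by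
  have hX : ∀ η : Sp n, wt m r η ^ 2 = (m ^ 2 + ‖(2 * Real.pi) • η‖ ^ 2) ^ r := fun η => by
    rw [wt_nat hm, ← pow_mul, mul_comm, pow_mul, wt_one, Real.sq_sqrt (by positivity)]
  let c₁ : ℝ := α / 2 ^ r
  let c₂ : ℝ := α * μ₀ / (2 * m ^ 2) ^ r
  -- The constant `c₁` is for `|ξ| ≥ m`, where `⟨ξ⟩² ≤ 2|ξ|²`, and `c₂` for `|ξ| < m`, where `⟨ξ⟩² ≤
  -- 2m²`. The bound on the weight follows from `w ≤ 1 + w²`.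
  refine ⟨if μ₀ = 0 then c₁ else min c₁ c₂, 1 + (2 * m ^ 2) ^ r, ?_, by positivity, fun η => ?_⟩
  · split_ifs with h
    · positivity
    · have : 0 < μ₀ := lt_of_le_of_ne hμ (Ne.symm h)
      exact lt_min (by positivity) (by positivity)
  · set x := ‖(2 * Real.pi) • η‖ with hx
    have hx0 : 0 ≤ x := norm_nonneg _
    by_cases hxm : m ≤ x
    · left
      have h1 : wt m r η ^ 2 ≤ 2 ^ r * x ^ (2 * r) := by
        rw [hX, pow_mul, ← mul_pow]
        exact pow_le_pow_left₀ (by positivity) (by nlinarith) _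
      have h2 : c₁ * wt m r η ^ 2 ≤ α * x ^ (2 * r) := by
        calc c₁ * wt m r η ^ 2 ≤ c₁ * (2 ^ r * x ^ (2 * r)) :=
              mul_le_mul_of_nonneg_left h1 (by positivity)
          _ = _ := by simp only [c₁]; field_simp
      have h3 : (if μ₀ = 0 then c₁ else min c₁ c₂) ≤ c₁ := by
        split_ifs
        · exact le_rfl
        · exact min_le_left _ _
      have h4 := mul_le_mul_of_nonneg_right h3 (sq_nonneg (wt m r η))
      have h5 : 0 ≤ α * μ₀ := by positivity
      linarith
    · push Not at hxm
      have h1 : wt m r η ^ 2 ≤ (2 * m ^ 2) ^ r := by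
        rw [hX]
        exact pow_le_pow_left₀ (by positivity) (by nlinarith) _
      by_cases h : μ₀ = 0
      · right
        refine ⟨?_, h⟩
        nlinarith [sq_nonneg (wt m r η - 1)]
      · left
        rw [if_neg h]
        have h2 : c₂ * wt m r η ^ 2 ≤ α * μ₀ := by
          calc c₂ * wt m r η ^ 2 ≤ c₂ * (2 * m ^ 2) ^ r :=
                mul_le_mul_of_nonneg_left h1 (by positivity)
            _ = _ := by simp only [c₂]; field_simp
        have h4 := mul_le_mul_of_nonneg_right (min_le_right c₁ c₂) (sq_nonneg (wt m r η))
        have h5 : 0 ≤ α * x ^ (2 * r) := by positivity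
        linarith

theorem norm_sub_le_of_hasDerivAt {f f' : ℝ → ℂ} (hf : ∀ s, HasDerivAt f (f' s) s) {C : ℝ}
    (hC : ∀ s, ‖f' s‖ ≤ C) (s t : ℝ) : ‖f t - f s‖ ≤ C * |t - s| :=
  convex_univ.norm_image_sub_le_of_norm_hasDerivWithin_le
    (fun x _ => (hf x).hasDerivWithinAt) (fun x _ => hC x) (mem_univ s) (mem_univ t)

/-- The position is the initial position plus the integral of the velocity. This replaces the energy
bound at frequencies where the lower bound on `P₂` degenerates. -/
theorem norm_prop₂_inl {L : EvolOp n d₁ d₂} {ξ : Sp n} {C : ℝ} (j : Fin d₂ ⊕ Fin d₂)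
    (hC : ∀ t i, ‖prop₂ L t ξ (Sum.inr i) j‖ ≤ C) (t : ℝ) (i : Fin d₂) :
    ‖prop₂ L t ξ (Sum.inl i) j‖ ≤ ‖(1 : Matrix (Fin d₂ ⊕ Fin d₂) (Fin d₂ ⊕ Fin d₂) ℂ) (Sum.inl i) j‖
      + C * |t| := by
  have hd : ∀ s, HasDerivAt (fun s => prop₂ L s ξ (Sum.inl i) j) (prop₂ L s ξ (Sum.inr i) j) s := by
    intro s
    have h := hasDerivAt_exp_smul_entry (Matrix.fromBlocks 0 1 (-symb L.P₂ ξ) 0) s (Sum.inl i) j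
    refine h.congr_deriv ?_
    simp [Matrix.mul_apply, Fintype.sum_sum_type, Matrix.one_apply, prop₂]
  have h := norm_sub_le_of_hasDerivAt hd (fun s => hC s i) 0 t
  have h0 : prop₂ L 0 ξ = 1 := by simp [prop₂]
  rw [h0, sub_zero] at h
  have := norm_le_norm_add_norm_sub ((1 : Matrix (Fin d₂ ⊕ Fin d₂) (Fin d₂ ⊕ Fin d₂) ℂ) (Sum.inl i) j)
    (prop₂ L t ξ (Sum.inl i) j)
  rw [norm_sub_rev] at this
  linarith

/-- Velocities are bounded directly by the energy. Positions are bounded by the energy divided by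
the lower bound on `P₂` where that bound is elliptic, and by integrating the velocity on the
remaining low frequencies; only the latter, which requires `μ₀ = 0`, produces growth in time. -/
theorem norm_evo_le {L : EvolOp n d₁ d₂} {r : ℕ} {α μ₀ : ℝ} (hα : 0 < α) (hμ : 0 ≤ μ₀)
    (hL : L.Admissible r α μ₀) {m : ℝ} (hm : 0 < m) :
    ∃ C, 0 ≤ C ∧ ∀ (t : ℝ) (η : Sp n) (i j : DIdx d₁ d₂),
      ‖evo L m r t η i j‖ ≤ C * (1 + |t|) ∧ (0 < μ₀ → ‖evo L m r t η i j‖ ≤ C) := by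
  obtain ⟨C₂, hC₂, h₂⟩ := norm_symb_le hm L.P₂ hL.deg₂
  obtain ⟨c, W, hc, hW, hcW⟩ := exists_lower_bound (n := n) hm r hα hμ
  -- With `w = ⟨ξ⟩^r`: `A` comes from the upper bound `P₂ ≤ A² w²`, `B` from the lower bound `w² /
  -- B² ≤ κ`, and `W` bounds `w` at degenerate frequencies. `C` dominates every combination that
  -- occurs.
  let A := √C₂
  have hA0 : 0 ≤ A := Real.sqrt_nonneg _
  have hA2 : A ^ 2 = C₂ := Real.sq_sqrt hC₂
  let B := √(1 / c)
  have hB0 : 0 ≤ B := Real.sqrt_nonneg _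
  have hB2 : B ^ 2 = 1 / c := Real.sq_sqrt (by positivity)
  let C := 1 + A + B + A * B + A * W + W
  have hC0 : 0 ≤ C := by positivity
  refine ⟨C, hC0, fun t η i j => ?_⟩
  set w := wt m r η with hw
  have hw0 : 0 < w := wt_pos hm _ _
  set w' := wt m (-r) η with hw'
  have hw'0 : 0 < w' := wt_pos hm _ _
  have hww : w * w' = 1 := wt_mul_neg hm _ _
  set ξ := (2 * Real.pi) • η with hξ
  set κ := α * (μ₀ + ‖ξ‖ ^ (2 * r)) with hκ
  have hκ0 : 0 ≤ κ := by positivity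
  have hE := prop₂_energy (hL.herm₂ ξ) (hL.pos₂ ξ)
  have hPw : ∀ j, (symb L.P₂ ξ j j).re ≤ (A * w) ^ 2 := by
    intro j
    refine (Complex.re_le_norm _).trans ((h₂ η j j).trans (le_of_eq ?_))
    have h7 : wt m ((2 * r : ℕ) : ℝ) η = w ^ 2 := by
      rw [hw, pow_two, ← wt_add hm]; congr 1; push_cast; ring
    rw [h7, mul_pow, hA2]
  have hterm : ∀ (f : Fin d₂ → ℂ) i, ‖f i‖ ^ 2 ≤ ∑ i, ‖f i‖ ^ 2 := fun f i =>
    Finset.single_le_sum (f := fun i => ‖f i‖ ^ 2) (fun _ _ => sq_nonneg _) (Finset.mem_univ i)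
  -- the four blocks
  have b22 : ∀ t i j, ‖prop₂ L t ξ (Sum.inr i) (Sum.inr j)‖ ≤ 1 := by
    intro t i j
    have h := hE t (Sum.inr j)
    simp only [Matrix.fromBlocks_apply₂₂, Matrix.one_apply_eq, Complex.one_re] at h
    have h1 := hterm (fun i => prop₂ L t ξ (Sum.inr i) (Sum.inr j)) i
    have h2 : 0 ≤ κ * ∑ i, ‖prop₂ L t ξ (Sum.inl i) (Sum.inr j)‖ ^ 2 := by positivity
    refine abs_le_of_sq_le_sq' ?_ zero_le_one |>.2
    linarith
  have b21 : ∀ t i j, ‖prop₂ L t ξ (Sum.inr i) (Sum.inl j)‖ ≤ A * w := by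
    intro t i j
    have h := hE t (Sum.inl j)
    simp only [Matrix.fromBlocks_apply₁₁] at h
    have h1 := hterm (fun i => prop₂ L t ξ (Sum.inr i) (Sum.inl j)) i
    have h2 : 0 ≤ κ * ∑ i, ‖prop₂ L t ξ (Sum.inl i) (Sum.inl j)‖ ^ 2 := by positivity
    refine abs_le_of_sq_le_sq' ?_ (by positivity) |>.2
    have := hPw j
    linarith
  -- An energy bound `κ z² ≤ R²` controls the weighted position `w z` wherever `κ` dominates `c w²`.
  have hdiv : ∀ z R : ℝ, 0 ≤ R → c * w ^ 2 ≤ κ → κ * z ^ 2 ≤ R ^ 2 → w * z ≤ R * B := by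
    intro z R hR h1 h2
    refine abs_le_of_sq_le_sq' ?_ (by positivity) |>.2
    rw [mul_pow, mul_pow, hB2, mul_one_div, le_div_iff₀ hc]
    nlinarith [mul_le_mul_of_nonneg_right h1 (sq_nonneg z)]
  have b12 : ∀ t i j, w * ‖prop₂ L t ξ (Sum.inl i) (Sum.inr j)‖ ≤ B + W * |t| ∧
      (0 < μ₀ → w * ‖prop₂ L t ξ (Sum.inl i) (Sum.inr j)‖ ≤ B) := by
    intro t i j
    rcases hcW η with h | ⟨h, h0⟩
    · have h1 := hE t (Sum.inr j)
      simp only [Matrix.fromBlocks_apply₂₂, Matrix.one_apply_eq, Complex.one_re] at h1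
      have h2 := hterm (fun i => prop₂ L t ξ (Sum.inl i) (Sum.inr j)) i
      have h3 : 0 ≤ ∑ i, ‖prop₂ L t ξ (Sum.inr i) (Sum.inr j)‖ ^ 2 := by positivity
      have h4 := hdiv _ 1 zero_le_one h (by nlinarith [mul_le_mul_of_nonneg_left h2 hκ0])
      have h5 : 0 ≤ W * |t| := by positivity
      exact ⟨by linarith, fun _ => by linarith⟩
    · refine ⟨?_, fun h' => absurd h0 h'.ne'⟩
      have h1 := norm_prop₂_inl (Sum.inr j) (fun t i => b22 t i j) t i
      have h2 : ‖(1 : Matrix (Fin d₂ ⊕ Fin d₂) (Fin d₂ ⊕ Fin d₂) ℂ) (Sum.inl i) (Sum.inr j)‖ = 0 := by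
        simp
      rw [h2, zero_add, one_mul] at h1
      have h3 := mul_le_mul h h1 (norm_nonneg _) hW.le
      linarith
  have b11 : ∀ t i j, ‖prop₂ L t ξ (Sum.inl i) (Sum.inl j)‖ ≤ 1 + A * B + A * W * |t| ∧
      (0 < μ₀ → ‖prop₂ L t ξ (Sum.inl i) (Sum.inl j)‖ ≤ A * B) := by
    intro t i j
    rcases hcW η with h | ⟨h, h0⟩
    · have h1 := hE t (Sum.inl j)
      simp only [Matrix.fromBlocks_apply₁₁] at h1
      have h2 := hterm (fun i => prop₂ L t ξ (Sum.inl i) (Sum.inl j)) i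
      have h3 : 0 ≤ ∑ i, ‖prop₂ L t ξ (Sum.inr i) (Sum.inl j)‖ ^ 2 := by positivity
      have h4 := hdiv _ (A * w) (by positivity) h (by
        have := hPw j
        nlinarith [mul_le_mul_of_nonneg_left h2 hκ0])
      have h5 : 0 ≤ A * W * |t| := by positivity
      have h6 : ‖prop₂ L t ξ (Sum.inl i) (Sum.inl j)‖ ≤ A * B := by
        refine le_of_mul_le_mul_left ?_ hw0
        linarith
      exact ⟨by linarith, fun _ => h6⟩
    · refine ⟨?_, fun h' => absurd h0 h'.ne'⟩
      have h1 := norm_prop₂_inl (Sum.inl j) (fun t i => b21 t i j) t i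
      have h2 : ‖(1 : Matrix (Fin d₂ ⊕ Fin d₂) (Fin d₂ ⊕ Fin d₂) ℂ) (Sum.inl i) (Sum.inl j)‖ ≤ 1 := by
        rw [Matrix.one_apply]; split_ifs <;> simp
      have h3 : A * w * |t| ≤ A * W * |t| := by gcongr
      have h4 : 0 ≤ A * B := by positivity
      linarith
  have hnw : ‖(w : ℂ)‖ = w := by rw [Complex.norm_real, Real.norm_of_nonneg hw0.le]
  have hnw' : ‖(w' : ℂ)‖ = w' := by rw [Complex.norm_real, Real.norm_of_nonneg hw'0.le]
  have hp1 : 0 ≤ A * B := by positivity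
  have hp2 : 0 ≤ A * W := by positivity
  have hexp : C * (1 + |t|) = C + C * |t| := by ring
  have hCt : 0 ≤ C * |t| := by positivity
  have fin : ∀ x : ℝ, x ≤ C → x ≤ C * (1 + |t|) ∧ (0 < μ₀ → x ≤ C) := fun x hx =>
    ⟨by linarith, fun _ => hx⟩
  rw [evo_eq L hm]
  rcases i with i | i | i <;> rcases j with j | j | j <;>
    simp only [Matrix.fromBlocks_apply₁₁, Matrix.fromBlocks_apply₁₂,
      Matrix.fromBlocks_apply₂₁, Matrix.fromBlocks_apply₂₂, Matrix.zero_apply, norm_zero,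
      Matrix.mul_apply, Fintype.sum_sum_type, Matrix.smul_apply, Matrix.one_apply, smul_eq_mul,
      mul_ite, mul_one, mul_zero, ite_mul, zero_mul, Finset.sum_ite_eq, Finset.sum_ite_eq',
      Finset.mem_univ, if_true, Finset.sum_const_zero, add_zero, zero_add, one_mul]
  · exact fin _ ((norm_exp_green₁_le hL t ξ i j).trans (by simp only [C]; linarith))
  · exact fin _ hC0
  · exact fin _ hC0
  · exact fin _ hC0
  · have h1 := b11 t i j
    have h2 : (w : ℂ) * prop₂ L t ξ (Sum.inl i) (Sum.inl j) * (w' : ℂ) =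
        prop₂ L t ξ (Sum.inl i) (Sum.inl j) := by
      rw [mul_right_comm, ← Complex.ofReal_mul, hww, Complex.ofReal_one, one_mul]
    rw [h2]
    refine ⟨h1.1.trans ?_, fun h => (h1.2 h).trans (by simp only [C]; linarith)⟩
    have : A * W * |t| ≤ C * |t| := mul_le_mul_of_nonneg_right (by simp only [C]; linarith) (abs_nonneg _)
    have h3 : 1 + A * B ≤ C := by simp only [C]; linarith
    linarith
  · have h1 := b12 t i j
    rw [norm_mul, hnw]
    refine ⟨h1.1.trans ?_, fun h => (h1.2 h).trans (by simp only [C]; linarith)⟩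
    have : W * |t| ≤ C * |t| := mul_le_mul_of_nonneg_right (by simp only [C]; linarith) (abs_nonneg _)
    have h3 : B ≤ C := by simp only [C]; linarith
    linarith
  · exact fin _ hC0
  · refine fin _ ?_
    rw [norm_mul, hnw']
    have h1 := mul_le_mul_of_nonneg_right (b21 t i j) hw'0.le
    have h2 : A * w * w' = A := by rw [mul_assoc, hww, mul_one]
    simp only [C]; linarith
  · exact fin _ ((b22 t i j).trans (by simp only [C]; linarith))

/-! ### Multiplication operators on `L²` -/

/-- Bounded measurable multipliers. -/
structure IsMult (b : Sp n → ℂ) : Prop where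
  meas : Measurable b
  bdd : ∃ C, ∀ η, ‖b η‖ ≤ C

theorem IsMult.of_continuous {b : Sp n → ℂ} (hb : Continuous b) {C : ℝ} (hC : ∀ η, ‖b η‖ ≤ C) :
    IsMult b := ⟨hb.measurable, C, hC⟩

theorem memLp_mul_of_bdd {b f : Sp n → ℂ} (hb : AEStronglyMeasurable b volume) {C : ℝ}
    (hC : ∀ η, ‖b η‖ ≤ C) (hf : MemLp f 2 volume) : MemLp (fun η => b η * f η) 2 volume := by
  refine (hf.const_mul (C : ℂ)).mono (hb.mul hf.1) (Eventually.of_forall fun η => ?_)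
  have hC0 : 0 ≤ C := (norm_nonneg _).trans (hC η)
  rw [norm_mul, norm_mul, Complex.norm_real, Real.norm_of_nonneg hC0]
  exact mul_le_mul_of_nonneg_right (hC η) (norm_nonneg _)

theorem IsMult.memLp {b f : Sp n → ℂ} (hb : IsMult b) (hf : MemLp f 2 volume) :
    MemLp (fun η => b η * f η) 2 volume :=
  let ⟨_, hC⟩ := hb.bdd
  memLp_mul_of_bdd hb.meas.aestronglyMeasurable hC hf

theorem norm_toLp_mul_le {b : Sp n → ℂ} {C : ℝ} (hC : ∀ η, ‖b η‖ ≤ C) (f : L2 n)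
    (h : MemLp (fun η => b η * f η) 2 volume) : ‖h.toLp‖ ≤ C * ‖f‖ := by
  refine Lp.norm_le_mul_norm_of_ae_le_mul ?_
  filter_upwards [h.coeFn_toLp] with η hη
  rw [hη, norm_mul]
  exact mul_le_mul_of_nonneg_right (hC η) (norm_nonneg _)

open Classical in
/-- The operator of multiplication by a bounded measurable function. -/
def mulOp (b : Sp n → ℂ) : L2 n →L[ℂ] L2 n :=
  if h : IsMult b then
    LinearMap.mkContinuous
      { toFun := fun f => (h.memLp (Lp.memLp f)).toLp
        map_add' := fun f g => by
          rw [← MemLp.toLp_add]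
          apply MemLp.toLp_congr
          filter_upwards [Lp.coeFn_add f g] with η hη
          simp only [Pi.add_apply] at hη ⊢
          rw [hη, mul_add]
        map_smul' := fun c f => by
          rw [RingHom.id_apply, ← MemLp.toLp_const_smul]
          apply MemLp.toLp_congr
          filter_upwards [Lp.coeFn_smul c f] with η hη
          simp only [Pi.smul_apply, smul_eq_mul] at hη ⊢
          rw [hη, mul_left_comm] }
      h.bdd.choose fun f => norm_toLp_mul_le h.bdd.choose_spec f (h.memLp (Lp.memLp f))
  else 0

theorem coeFn_mulOp {b : Sp n → ℂ} (hb : IsMult b) (f : L2 n) :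
    mulOp b f =ᵐ[volume] fun η => b η * f η := by
  have : mulOp b f = (hb.memLp (Lp.memLp f)).toLp := by
    rw [mulOp, dif_pos hb]; rfl
  rw [this]
  exact MemLp.coeFn_toLp _

theorem norm_mulOp_le {b : Sp n → ℂ} (hb : IsMult b) {C : ℝ} (hC : ∀ η, ‖b η‖ ≤ C) (f : L2 n) :
    ‖mulOp b f‖ ≤ C * ‖f‖ := by
  refine Lp.norm_le_mul_norm_of_ae_le_mul ?_
  filter_upwards [coeFn_mulOp hb f] with η hη
  rw [hη, norm_mul]
  exact mul_le_mul_of_nonneg_right (hC η) (norm_nonneg _)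

theorem IsMult.mul {b c : Sp n → ℂ} (hb : IsMult b) (hc : IsMult c) :
    IsMult (fun η => b η * c η) := by
  obtain ⟨B, hB⟩ := hb.bdd
  obtain ⟨C, hC⟩ := hc.bdd
  refine ⟨hb.meas.mul hc.meas, B * C, fun η => ?_⟩
  rw [norm_mul]
  exact mul_le_mul (hB η) (hC η) (norm_nonneg _) ((norm_nonneg _).trans (hB η))

theorem IsMult.add {b c : Sp n → ℂ} (hb : IsMult b) (hc : IsMult c) :
    IsMult (fun η => b η + c η) := by
  obtain ⟨B, hB⟩ := hb.bdd
  obtain ⟨C, hC⟩ := hc.bdd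
  exact ⟨hb.meas.add hc.meas, B + C, fun η => (norm_add_le _ _).trans (add_le_add (hB η) (hC η))⟩

theorem IsMult.const (z : ℂ) : IsMult (fun _ : Sp n => z) :=
  ⟨measurable_const, ‖z‖, fun _ => le_rfl⟩

theorem IsMult.sum {ι : Type*} (s : Finset ι) {b : ι → Sp n → ℂ} (hb : ∀ i ∈ s, IsMult (b i)) :
    IsMult (fun η => ∑ i ∈ s, b i η) := by
  classical
  induction s using Finset.induction_on with
  | empty => simpa using IsMult.const 0
  | insert a s ha ih =>
    simp only [Finset.sum_insert ha]
    exact (hb a (by simp)).add (ih fun i hi => hb i (by simp [hi]))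

theorem isMult_wt_neg {m : ℝ} (hm : 0 < m) {σ : ℝ} (hσ : 0 ≤ σ) :
    IsMult (fun η : Sp n => (wt m (-σ) η : ℂ)) :=
  IsMult.of_continuous (Complex.continuous_ofReal.comp (continuous_wt hm _)) (C := m ^ (-σ))
    fun η => by
      rw [Complex.norm_real, Real.norm_of_nonneg (wt_pos hm _ _).le]
      exact wt_neg_le hm hσ η

theorem mulOp_mulOp {b c : Sp n → ℂ} (hb : IsMult b) (hc : IsMult c) (f : L2 n) :
    mulOp b (mulOp c f) = mulOp (fun η => b η * c η) f := by
  apply Lp.ext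
  filter_upwards [coeFn_mulOp hb (mulOp c f), coeFn_mulOp hc f, coeFn_mulOp (hb.mul hc) f]
    with η h1 h2 h3
  rw [h1, h2, h3, mul_assoc]

theorem mulOp_sum {ι : Type*} (s : Finset ι) {b : ι → Sp n → ℂ} (hb : ∀ i ∈ s, IsMult (b i))
    (f : L2 n) : mulOp (fun η => ∑ i ∈ s, b i η) f = ∑ i ∈ s, mulOp (b i) f := by
  classical
  induction s using Finset.induction_on with
  | empty =>
    apply Lp.ext
    filter_upwards [coeFn_mulOp (IsMult.const 0) f, Lp.coeFn_zero ℂ 2 (volume : Measure (Sp n))]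
      with η h1 h2
    simp only [Finset.sum_empty]
    rw [h1, h2]; simp
  | insert a s ha ih =>
    have h1 := ih fun i hi => hb i (by simp [hi])
    rw [Finset.sum_insert ha, ← h1]
    have h2 : IsMult (fun η => ∑ i ∈ s, b i η) := IsMult.sum s fun i hi => hb i (by simp [hi])
    have h3 := IsMult.sum (insert a s) hb
    apply Lp.ext
    filter_upwards [coeFn_mulOp h2 f, coeFn_mulOp h3 f, coeFn_mulOp (hb a (by simp)) f,
      Lp.coeFn_add (mulOp (b a) f) (mulOp (fun η => ∑ i ∈ s, b i η) f)] with η e1 e2 e3 e4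
    rw [e4, e2, Pi.add_apply, e1, e3, Finset.sum_insert ha, add_mul]

theorem mulOp_congr_smul_sub {b c : Sp n → ℂ} (hb : IsMult b) (hc : IsMult c) (z : ℂ) (f : L2 n) :
    z • (mulOp b f - mulOp c f) = mulOp (fun η => z * (b η + -1 * c η)) f := by
  apply Lp.ext
  have h := (IsMult.const z).mul (hb.add ((IsMult.const (-1)).mul hc))
  filter_upwards [coeFn_mulOp hb f, coeFn_mulOp hc f, coeFn_mulOp h f,
    Lp.coeFn_smul z (mulOp b f - mulOp c f), Lp.coeFn_sub (mulOp b f) (mulOp c f)]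
    with η h1 h2 h3 h4 h5
  rw [h4, h3, Pi.smul_apply, h5, Pi.sub_apply, h1, h2, smul_eq_mul]
  ring

/-- Dominated convergence, with majorant a multiple of `|f|²`: uniformly bounded and pointwise
convergent multipliers converge strongly, though not in norm in general. -/
theorem tendsto_mulOp {ι : Type*} {l : Filter ι} [l.IsCountablyGenerated] {b : ι → Sp n → ℂ}
    {b₀ : Sp n → ℂ} (hb : ∀ i, IsMult (b i)) (hb₀ : IsMult b₀) {C : ℝ}
    (hC : ∀ᶠ i in l, ∀ η, ‖b i η‖ ≤ C)
    (hlim : ∀ η, Tendsto (fun i => b i η) l (𝓝 (b₀ η))) (f : L2 n) :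
    Tendsto (fun i => mulOp (b i) f) l (𝓝 (mulOp b₀ f)) := by
  obtain ⟨C₀, hC₀⟩ := hb₀.bdd
  rw [Lp.tendsto_Lp_iff_tendsto_eLpNorm']
  have h1 : ∀ i, eLpNorm (⇑(mulOp (b i) f) - ⇑(mulOp b₀ f)) 2 volume =
      (∫⁻ η, ‖(b i η - b₀ η) * f η‖ₑ ^ (2 : ℝ)) ^ ((1 : ℝ) / 2) := by
    intro i
    rw [eLpNorm_eq_lintegral_rpow_enorm_toReal (by norm_num) (by norm_num)]
    simp only [ENNReal.toReal_ofNat]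
    congr 1
    apply lintegral_congr_ae
    filter_upwards [coeFn_mulOp (hb i) f, coeFn_mulOp hb₀ f] with η h1 h2
    rw [Pi.sub_apply, h1, h2, sub_mul]
  simp_rw [h1]
  have h2 : Tendsto (fun i => ∫⁻ η, ‖(b i η - b₀ η) * f η‖ₑ ^ (2 : ℝ)) l (𝓝 (∫⁻ _ : Sp n, 0)) := by
    refine tendsto_lintegral_filter_of_dominated_convergence
      (fun η => ‖((C + C₀ : ℝ) : ℂ) * f η‖ₑ ^ (2 : ℝ)) ?_ ?_ ?_ ?_
    · exact Eventually.of_forall fun i => (((hb i).meas.sub hb₀.meas).mul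
        (Lp.stronglyMeasurable f).measurable).enorm.pow_const _
    · filter_upwards [hC] with i hi
      refine Eventually.of_forall fun η => ?_
      gcongr
      rw [enorm_mul, enorm_mul]
      gcongr
      have h3 : ‖b i η - b₀ η‖ ≤ C + C₀ := (norm_sub_le _ _).trans (add_le_add (hi η) (hC₀ η))
      rw [← ofReal_norm, ← ofReal_norm, Complex.norm_real]
      exact ENNReal.ofReal_le_ofReal (h3.trans (le_abs_self _))
    · have h4 := ((Lp.memLp f).const_mul ((C + C₀ : ℝ) : ℂ)).eLpNorm_lt_top
      have := lintegral_rpow_enorm_lt_top_of_eLpNorm_lt_top (p := 2) (by norm_num) (by norm_num) h4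
      simpa using this.ne
    · refine Eventually.of_forall fun η => ?_
      have h5 : Tendsto (fun i => (b i η - b₀ η) * f η) l (𝓝 0) := by
        have := ((hlim η).sub_const (b₀ η)).mul_const (f η)
        simpa using this
      have h6 := (continuous_enorm.tendsto _).comp h5
      have h7 := (ENNReal.continuous_rpow_const (y := (2:ℝ))).tendsto _ |>.comp h6
      simpa [Function.comp_def] using h7
  have h3 := (ENNReal.continuous_rpow_const (y := ((1:ℝ)/2))).tendsto _ |>.comp h2
  simpa [Function.comp_def] using h3

/-! ### Matrices of multiplication operators -/

/-- Vectors of square integrable functions, with the sum of the norms. -/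
abbrev VL2 (n : ℕ) (ι : Type) [Fintype ι] := PiLp 1 (fun _ : ι => L2 n)

section MatOp

/-- Matrices of bounded measurable multipliers. -/
def IsMatMult {ι κ : Type} (β : Sp n → Matrix ι κ ℂ) : Prop := ∀ i j, IsMult fun η => β η i j

theorem IsMatMult.mul {ι κ κ' : Type} [Fintype κ] {β : Sp n → Matrix ι κ ℂ}
    {β' : Sp n → Matrix κ κ' ℂ} (h : IsMatMult β)
    (h' : IsMatMult β') : IsMatMult (fun η => β η * β' η) := fun i j => by
  simp only [Matrix.mul_apply]
  exact IsMult.sum _ fun l _ => (h i l).mul (h' l j)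

variable {ι κ κ' : Type} [Fintype ι] [Fintype κ] [Fintype κ']

/-- The operator of multiplication by a matrix-valued function. -/
def matOp (β : Sp n → Matrix ι κ ℂ) : VL2 n κ →L[ℂ] VL2 n ι :=
  (PiLp.continuousLinearEquiv 1 ℂ (fun _ : ι => L2 n)).symm.toContinuousLinearMap ∘L
    ContinuousLinearMap.pi fun i => ∑ j, mulOp (fun η => β η i j) ∘L
      PiLp.proj 1 (fun _ : κ => L2 n) j

theorem matOp_apply (β : Sp n → Matrix ι κ ℂ) (U : VL2 n κ) (i : ι) :
    matOp β U i = ∑ j, mulOp (fun η => β η i j) (U j) := by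
  simp [matOp]

theorem matOp_matOp {β : Sp n → Matrix ι κ ℂ} {β' : Sp n → Matrix κ κ' ℂ} (h : IsMatMult β)
    (h' : IsMatMult β') (U : VL2 n κ') : matOp β (matOp β' U) = matOp (fun η => β η * β' η) U := by
  ext1 i
  simp only [matOp_apply, map_sum, Matrix.mul_apply]
  have h1 : ∀ j, mulOp (fun η => ∑ l, β η i l * β' η l j) (U j) =
      ∑ l, mulOp (fun η => β η i l * β' η l j) (U j) := fun j =>
    mulOp_sum _ (fun l _ => (h i l).mul (h' l j)) (U j)
  simp_rw [h1]
  rw [Finset.sum_comm]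
  refine Finset.sum_congr rfl fun j _ => Finset.sum_congr rfl fun l _ => ?_
  exact mulOp_mulOp (h i l) (h' l j) (U j)

theorem mulOp_one (f : L2 n) : mulOp (fun _ => 1) f = f := by
  apply Lp.ext
  filter_upwards [coeFn_mulOp (IsMult.const 1) f] with η h1
  rw [h1, one_mul]

theorem mulOp_zero (f : L2 n) : mulOp (fun _ => 0) f = 0 := by
  simpa using mulOp_sum (∅ : Finset ℕ) (b := fun _ _ => 0) (by simp) f

theorem matOp_one [DecidableEq ι] (U : VL2 n ι) : matOp (fun _ => (1 : Matrix ι ι ℂ)) U = U := by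
  ext1 i
  rw [matOp_apply, Finset.sum_eq_single i]
  · simp [mulOp_one]
  · intro j _ hj
    simp [Matrix.one_apply_ne' hj, mulOp_zero]
  · simp

theorem norm_matOp_le {β : Sp n → Matrix ι κ ℂ} (h : IsMatMult β) {C : ℝ}
    (hC : ∀ η i j, ‖β η i j‖ ≤ C) (U : VL2 n κ) :
    ‖matOp β U‖ ≤ Fintype.card ι * C * ‖U‖ := by
  rw [PiLp.norm_eq_of_nat 1 (by norm_num), PiLp.norm_eq_of_nat 1 (by norm_num)]
  simp only [pow_one, Nat.cast_one, div_one, Real.rpow_one]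
  calc ∑ i, ‖matOp β U i‖ ≤ ∑ _i : ι, C * ∑ j, ‖U j‖ := by
        refine Finset.sum_le_sum fun i _ => ?_
        rw [matOp_apply, Finset.mul_sum]
        exact (norm_sum_le _ _).trans (Finset.sum_le_sum fun j _ =>
          norm_mulOp_le (h i j) (fun η => hC η i j) _)
    _ = _ := by rw [Finset.sum_const, Finset.card_univ, nsmul_eq_mul, mul_assoc]

theorem tendsto_matOp {T : Type*} {l : Filter T} [l.IsCountablyGenerated]
    {β : T → Sp n → Matrix ι κ ℂ} {β₀ : Sp n → Matrix ι κ ℂ} (hβ : ∀ t, IsMatMult (β t))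
    (hβ₀ : IsMatMult β₀) {C : ℝ} (hC : ∀ᶠ t in l, ∀ η i j, ‖β t η i j‖ ≤ C)
    (hlim : ∀ η i j, Tendsto (fun t => β t η i j) l (𝓝 (β₀ η i j))) (U : VL2 n κ) :
    Tendsto (fun t => matOp (β t) U) l (𝓝 (matOp β₀ U)) := by
  have h : Tendsto (fun t i => matOp (β t) U i) l (𝓝 (fun i => matOp β₀ U i)) := by
    rw [tendsto_pi_nhds]
    intro i
    simp only [matOp_apply]
    refine tendsto_finsetSum _ fun j _ => ?_
    exact tendsto_mulOp (fun t => hβ t i j) (hβ₀ i j)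
      (by filter_upwards [hC] with t ht η using ht η i j) (fun η => hlim η i j) (U j)
  exact ((PiLp.continuousLinearEquiv 1 ℂ (fun _ : ι => L2 n)).symm.continuous.tendsto _).comp h

/-- Difference quotients are themselves multiplication operators, bounded near `t` by the mean value
inequality, so strong convergence of multipliers applies to them. -/
theorem hasDerivAt_matOp {β β' : ℝ → Sp n → Matrix ι κ ℂ} (hβ : ∀ t, IsMatMult (β t))
    (hβ' : ∀ t, IsMatMult (β' t)) {C : ℝ → ℝ} (hC : Monotone C)
    (hCb : ∀ t η i j, ‖β' t η i j‖ ≤ C |t|)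
    (hd : ∀ t η i j, HasDerivAt (fun s => β s η i j) (β' t η i j) t) (U : VL2 n κ) (t : ℝ) :
    HasDerivAt (fun s => matOp (β s) U) (matOp (β' t) U) t := by
  rw [hasDerivAt_iff_tendsto_slope]
  let q : ℝ → Sp n → Matrix ι κ ℂ := fun s η => Matrix.of fun i j =>
    ((s - t : ℝ) : ℂ)⁻¹ * (β s η i j + -1 * β t η i j)
  have hq : ∀ s, IsMatMult (q s) := fun s i j =>
    (IsMult.const _).mul ((hβ s i j).add ((IsMult.const (-1)).mul (hβ t i j)))
  have hslope : slope (fun s => matOp (β s) U) t = fun s => matOp (q s) U := by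
    funext s
    ext1 i
    have h1 : slope (fun s => matOp (β s) U) t s =
        ((s - t : ℝ) : ℂ)⁻¹ • (matOp (β s) U - matOp (β t) U) := by
      rw [slope_def_module, ← Complex.ofReal_inv]
      exact (Complex.coe_smul _ _).symm
    rw [h1, PiLp.smul_apply, PiLp.sub_apply, matOp_apply, matOp_apply, matOp_apply,
      ← Finset.sum_sub_distrib, Finset.smul_sum]
    refine Finset.sum_congr rfl fun j _ => ?_
    rw [mulOp_congr_smul_sub (hβ s i j) (hβ t i j)]
    rfl
  rw [hslope]
  refine tendsto_matOp (C := C (|t| + 1)) hq (hβ' t) ?_ ?_ U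
  · have : Metric.ball t 1 ∈ 𝓝[≠] t := mem_nhdsWithin_of_mem_nhds (Metric.ball_mem_nhds t one_pos)
    filter_upwards [this] with s hs η i j
    have hb : ∀ x ∈ Metric.ball t 1, ‖β' x η i j‖ ≤ C (|t| + 1) := by
      intro x hx
      refine (hCb x η i j).trans (hC ?_)
      rw [Metric.mem_ball, Real.dist_eq] at hx
      have := abs_sub_abs_le_abs_sub x t
      linarith
    have h2 := (convex_ball t 1).norm_image_sub_le_of_norm_hasDerivWithin_le
      (fun x _ => (hd x η i j).hasDerivWithinAt) hb (Metric.mem_ball_self one_pos) hs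
    simp only [q, Matrix.of_apply]
    rw [norm_mul, norm_inv, Complex.norm_real, neg_one_mul, ← sub_eq_add_neg]
    rcases eq_or_ne s t with rfl | hst
    · simpa using (norm_nonneg _).trans (hb s (Metric.mem_ball_self one_pos))
    · rw [inv_mul_le_iff₀ (norm_pos_iff.2 (sub_ne_zero.2 hst)), mul_comm]
      exact h2
  · intro η i j
    have h := hasDerivAt_iff_tendsto_slope.1 (hd t η i j)
    refine h.congr fun s => ?_
    rw [slope_def_module]
    simp only [q, Matrix.of_apply]
    rw [← Complex.ofReal_inv, ← Complex.coe_smul, smul_eq_mul]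
    ring

end MatOp

/-! ### The Duhamel formula -/

/-- The fundamental theorem of calculus relative to an interval that may contain its endpoints;
outside of it nothing is known about `W`. -/
theorem hasDerivWithinAt_integral_of_continuousOn {X : Type*} [NormedAddCommGroup X]
    [NormedSpace ℝ X] [CompleteSpace X] {I : Set ℝ} (hI : I.OrdConnected) {W : ℝ → X}
    (hW : ContinuousOn W I) {t₀ t : ℝ} (ht₀ : t₀ ∈ I) (ht : t ∈ I) :
    HasDerivWithinAt (fun τ => ∫ σ in t₀..τ, W σ) (W t) I t := by
  have hint : ∀ a ∈ I, ∀ b ∈ I, IntervalIntegrable W volume a b := fun a ha b hb =>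
    (hW.mono (hI.uIcc_subset ha hb)).intervalIntegrable
  rw [hasDerivWithinAt_iff_isLittleO, Asymptotics.isLittleO_iff]
  intro ε hε
  have h1 : ∀ᶠ σ in 𝓝[I] t, ‖W σ - W t‖ < ε := by
    have := (hW t ht).sub_const (W t)
    have h2 := this.norm
    simp only [sub_self, norm_zero] at h2
    exact h2.eventually (gt_mem_nhds hε)
  obtain ⟨δ, hδ, hball⟩ := Metric.mem_nhdsWithin_iff.1 h1
  have h3 : Metric.ball t δ ∩ I ∈ 𝓝[I] t :=
    inter_mem (mem_nhdsWithin_of_mem_nhds (Metric.ball_mem_nhds t hδ)) self_mem_nhdsWithin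
  filter_upwards [h3] with τ hτ
  rw [intervalIntegral.integral_interval_sub_left (hint _ ht₀ _ hτ.2) (hint _ ht₀ _ ht)]
  have h4 : (∫ σ in t..τ, W σ) - (τ - t) • W t = ∫ σ in t..τ, (W σ - W t) := by
    rw [intervalIntegral.integral_sub (hint _ ht _ hτ.2) (by simp), intervalIntegral.integral_const]
  rw [h4, Real.norm_eq_abs]
  refine intervalIntegral.norm_integral_le_of_norm_le_const fun σ hσ => ?_
  have hσ' := uIoc_subset_uIcc hσ
  refine (hball ⟨?_, hI.uIcc_subset ht hτ.2 hσ'⟩).le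
  rw [Metric.mem_ball, Real.dist_eq]
  have := Set.abs_sub_left_of_mem_uIcc hσ'
  have h5 := hτ.1
  rw [Metric.mem_ball, Real.dist_eq] at h5
  linarith

theorem eq_of_hasDerivWithinAt_zero {X : Type*} [NormedAddCommGroup X]
    [NormedSpace ℝ X] {I : Set ℝ} (hI : I.OrdConnected) {f : ℝ → X}
    (hf : ∀ t ∈ I, HasDerivWithinAt f 0 I t) {s t : ℝ} (hs : s ∈ I) (ht : t ∈ I) : f s = f t := by
  have h := hI.convex.norm_image_sub_le_of_norm_hasDerivWithin_le (C := 0) hf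
    (fun x _ => by simp) ht hs
  rw [zero_mul] at h
  exact sub_eq_zero.1 (norm_le_zero_iff.1 h)

/-- A strongly continuous group of operators, with a bounded injective operator `K` that maps into
the domain of the generator; `B` is the composition of the generator with `K`. -/
structure IsEvolution {X : Type*} [NormedAddCommGroup X] [NormedSpace ℂ X]
    (S : ℝ → X →L[ℂ] X) (K B : X →L[ℂ] X) (C : ℝ) : Prop where
  zero : ∀ x, S 0 x = x
  add : ∀ t s x, S (t + s) x = S t (S s x)
  cont : ∀ x, Continuous fun t => S t x
  bound : ∀ t x, ‖S t x‖ ≤ C * (1 + |t|) * ‖x‖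
  inj : Function.Injective K
  comm : ∀ t x, K (S t x) = S t (K x)
  commB : ∀ t x, B (S t x) = S t (B x)
  deriv : ∀ t x, HasDerivAt (fun s => S s (K x)) (S t (B x)) t

namespace IsEvolution

variable {X : Type*} [NormedAddCommGroup X] [NormedSpace ℂ X]
  {S : ℝ → X →L[ℂ] X} {K B : X →L[ℂ] X} {C : ℝ}

theorem neg_apply (h : IsEvolution S K B C) (t : ℝ) (x : X) : S t (S (-t) x) = x := by
  rw [← h.add, add_neg_cancel, h.zero]

theorem apply_neg (h : IsEvolution S K B C) (t : ℝ) (x : X) : S (-t) (S t x) = x := by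
  rw [← h.add, neg_add_cancel, h.zero]

/-- Strong continuity and local boundedness of the norms give joint continuity: `S(a) x = S(a) x₀ +
S(a)(x - x₀)`. -/
theorem tendsto (h : IsEvolution S K B C) {T : Type*} {l : Filter T} {a : T → ℝ}
    {a₀ : ℝ} {x : T → X} {x₀ : X} (ha : Tendsto a l (𝓝 a₀)) (hx : Tendsto x l (𝓝 x₀)) :
    Tendsto (fun s => S (a s) (x s)) l (𝓝 (S a₀ x₀)) := by
  have h1 : Tendsto (fun s => S (a s) (x s - x₀)) l (𝓝 0) := by
    have h2 : Tendsto (fun s => C * (1 + |a s|) * ‖x s - x₀‖) l (𝓝 (C * (1 + |a₀|) * 0)) := by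
      have h3 : Tendsto (fun s => ‖x s - x₀‖) l (𝓝 0) := by
        simpa using (hx.sub_const x₀).norm
      exact ((ha.abs.const_add 1).const_mul C).mul h3
    rw [mul_zero] at h2
    exact squeeze_zero_norm (fun s => h.bound _ _) h2
  have h2 := (((h.cont x₀).tendsto a₀).comp ha).add h1
  rw [add_zero] at h2
  refine h2.congr fun s => ?_
  simp only [Function.comp_apply, map_sub]
  abel

/-- The product rule. The group need only be differentiated at the fixed vector `V t`, which lies in
the range of `K` and hence in the domain of the generator; the increment of `V` is handled by joint
continuity. -/
theorem hasDerivWithinAt_comp (h : IsEvolution S K B C) {I : Set ℝ} {V : ℝ → X}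
    {V' x : X} {t ε : ℝ} (hV : HasDerivWithinAt V V' I t) (hx : V t = K x) :
    HasDerivWithinAt (fun τ => S (ε * τ) (V τ)) (S (ε * t) V' + ε • S (ε * t) (B x)) I t := by
  rw [hasDerivWithinAt_iff_tendsto_slope] at hV ⊢
  have hε : Tendsto (fun τ : ℝ => ε * τ) (𝓝[I \ {t}] t) (𝓝 (ε * t)) :=
    (tendsto_id.mono_left nhdsWithin_le_nhds).const_mul ε
  have h1 := h.tendsto hε hV
  have h2 : HasDerivAt (fun τ => S (ε * τ) (V t)) (ε • S (ε * t) (B x)) t := by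
    rw [hx]
    have h3 : HasDerivAt (fun τ : ℝ => ε * τ) ε t := by
      simpa using (hasDerivAt_id t).const_mul ε
    exact (h.deriv (ε * t) x).scomp t h3
  have h3 := (hasDerivWithinAt_iff_tendsto_slope.1 (h2.hasDerivWithinAt (s := I)))
  refine (h1.add h3).congr fun τ => ?_
  simp only [slope_def_module]
  have h4 : S (ε * τ) ((τ - t)⁻¹ • (V τ - V t)) = (τ - t)⁻¹ • S (ε * τ) (V τ - V t) :=
    (S (ε * τ)).map_smul_of_tower _ _
  rw [h4, map_sub, ← smul_add]
  congr 1
  abel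

/-- The smoothing can be removed from a differential equation whose right-hand side is continuous
without it: the primitive of `W` has the same image under `K` as `Z`, and `K` is injective. -/
theorem hasDerivWithinAt_of_comp [CompleteSpace X] (h : IsEvolution S K B C) {I : Set ℝ}
    (hI : I.OrdConnected) {Z W : ℝ → X} (hW : ContinuousOn W I)
    (hZ : ∀ t ∈ I, HasDerivWithinAt (fun τ => K (Z τ)) (K (W t)) I t) :
    ∀ t ∈ I, HasDerivWithinAt Z (W t) I t := by
  intro t ht
  let Z₂ : ℝ → X := fun τ => Z t + ∫ σ in t..τ, W σ
  have h1 : ∀ τ ∈ I, HasDerivWithinAt Z₂ (W τ) I τ := fun τ hτ =>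
    (hasDerivWithinAt_integral_of_continuousOn hI hW ht hτ).const_add _
  have h2 : ∀ τ ∈ I, HasDerivWithinAt (fun σ => K (Z₂ σ) - K (Z σ)) 0 I τ := fun τ hτ => by
    have h3 : HasDerivWithinAt (fun σ => K (Z₂ σ)) (K (W τ)) I τ :=
      (K.restrictScalars ℝ).hasFDerivAt.comp_hasDerivWithinAt τ (h1 τ hτ)
    simpa [Pi.sub_def] using h3.sub (hZ τ hτ)
  have h3 : ∀ τ ∈ I, Z τ = Z₂ τ := fun τ hτ => by
    have h4 := eq_of_hasDerivWithinAt_zero hI h2 hτ ht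
    have h5 : Z₂ t = Z t := by simp [Z₂]
    rw [h5, sub_self] at h4
    exact (h.inj (sub_eq_zero.1 h4)).symm
  exact (h1 t ht).congr h3 (h3 t ht)

/-- Passing to `S(-τ) U(τ)` cancels the generator. What is left is the source term, which is
continuous before smoothing, so `K` can be dropped; conversely, applying `S(τ)` to `K S(-τ) U(τ)`
restores the generator. -/
theorem duhamel_iff [CompleteSpace X] (h : IsEvolution S K B C) {I : Set ℝ}
    (hI : I.OrdConnected) {U F : ℝ → X} (hF : ContinuousOn F I) :
    (∀ t ∈ I, HasDerivWithinAt (fun τ => K (U τ)) (B (U t) + K (F t)) I t) ↔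
      ∀ t ∈ I, HasDerivWithinAt (fun τ => S (-τ) (U τ)) (S (-t) (F t)) I t := by
  constructor
  · intro hU
    refine h.hasDerivWithinAt_of_comp hI ?_ fun t ht => ?_
    · intro t ht
      exact h.tendsto ((continuous_neg.tendsto t).mono_left nhdsWithin_le_nhds) (hF t ht)
    · have h1 := h.hasDerivWithinAt_comp (ε := -1) (hU t ht) rfl
      simp only [neg_one_mul, ← h.comm] at h1
      refine h1.congr_deriv ?_
      rw [map_add, neg_one_smul, ← h.comm]
      abel
  · intro hZ t ht
    have h1 : HasDerivWithinAt (fun τ => K (S (-τ) (U τ))) (K (S (-t) (F t))) I t :=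
      (K.restrictScalars ℝ).hasFDerivAt.comp_hasDerivWithinAt t (hZ t ht)
    have h2 := h.hasDerivWithinAt_comp (ε := 1) h1 rfl
    simp only [one_mul, one_smul, ← h.comm, ← h.commB, h.neg_apply] at h2
    exact h2.congr_deriv (add_comm _ _)

end IsEvolution

/-! ### The free evolution -/

/-- The space of Cauchy data. -/
abbrev Data (n d₁ d₂ : ℕ) := VL2 n (DIdx d₁ d₂)

/-- The free evolution of the weighted Cauchy data. -/
def evoOp (L : EvolOp n d₁ d₂) (m r t : ℝ) : Data n d₁ d₂ →L[ℂ] Data n d₁ d₂ := matOp (evo L m r t)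

/-- Multiplication by the weight of order `-r`. -/
def regOp (m r : ℝ) : Data n d₁ d₂ →L[ℂ] Data n d₁ d₂ :=
  matOp fun η => (wt m (-r) η : ℂ) • (1 : Matrix (DIdx d₁ d₂) (DIdx d₁ d₂) ℂ)

/-- The composition of the generator with `regOp`. -/
def genOp (L : EvolOp n d₁ d₂) (m r : ℝ) : Data n d₁ d₂ →L[ℂ] Data n d₁ d₂ :=
  matOp fun η => (wt m (-r) η : ℂ) • gen L m r η

theorem isMatMult_evo {L : EvolOp n d₁ d₂} {r : ℕ} {α μ₀ : ℝ} (hα : 0 < α) (hμ : 0 ≤ μ₀)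
    (hL : L.Admissible r α μ₀) {m : ℝ} (hm : 0 < m) (t : ℝ) : IsMatMult (evo L m r t) := by
  obtain ⟨C, -, hC⟩ := norm_evo_le hα hμ hL hm
  exact fun i j => IsMult.of_continuous ((continuous_evo L hm r t).matrix_elem i j)
    fun η => (hC t η i j).1

theorem isMatMult_reg {m : ℝ} (hm : 0 < m) {r : ℝ} (hr : 0 ≤ r) :
    IsMatMult fun η : Sp n => (wt m (-r) η : ℂ) • (1 : Matrix (DIdx d₁ d₂) (DIdx d₁ d₂) ℂ) :=
  fun i j => by
    simp only [Matrix.smul_apply, smul_eq_mul]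
    exact (isMult_wt_neg hm hr).mul (IsMult.const _)

theorem isMatMult_gen {L : EvolOp n d₁ d₂} {r : ℕ} {α μ₀ : ℝ}
    (hL : L.Admissible r α μ₀) {m : ℝ} (hm : 0 < m) :
    IsMatMult fun η : Sp n => (wt m (-r) η : ℂ) • gen L m r η := by
  obtain ⟨C, hC⟩ := norm_gen_le hL hm
  intro i j
  refine IsMult.of_continuous (C := C) ?_ fun η => ?_
  · exact (Continuous.smul (Complex.continuous_ofReal.comp (continuous_wt hm _))
      (continuous_gen L hm r)).matrix_elem i j
  · simpa using hC η i j

theorem regOp_apply {m : ℝ} {r : ℝ} (U : Data n d₁ d₂) (i : DIdx d₁ d₂) :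
    regOp m r U i = mulOp (fun η => (wt m (-r) η : ℂ)) (U i) := by
  rw [regOp, matOp_apply, Finset.sum_eq_single i]
  · simp
  · intro j _ hj
    simp [Matrix.one_apply_ne' hj, mulOp_zero]
  · simp

theorem mulOp_wt_injective {m : ℝ} (hm : 0 < m) {r : ℝ} (hr : 0 ≤ r) :
    Function.Injective (mulOp (fun η : Sp n => (wt m (-r) η : ℂ))) := by
  intro f g hfg
  apply Lp.ext
  filter_upwards [coeFn_mulOp (isMult_wt_neg hm hr) f, coeFn_mulOp (isMult_wt_neg hm hr) g]
    with η h1 h2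
  rw [hfg, h2] at h1
  have h4 : (wt m (-r) η : ℂ) ≠ 0 := by exact_mod_cast (wt_pos hm _ _).ne'
  exact (mul_left_cancel₀ h4 h1).symm

/-- The algebraic laws hold frequency by frequency. The analytic ones come from strong convergence
of multipliers and the bounds on `evo`; differentiability uses that the smoothed generator is
bounded. -/
theorem isEvolution_evoOp {L : EvolOp n d₁ d₂} {r : ℕ} {α μ₀ : ℝ} (hα : 0 < α) (hμ : 0 ≤ μ₀)
    (hL : L.Admissible r α μ₀) {m : ℝ} (hm : 0 < m) :
    ∃ C, 0 ≤ C ∧ IsEvolution (evoOp L m r) (regOp m r) (genOp L m r) C ∧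
      (0 < μ₀ → ∀ t x, ‖evoOp L m r t x‖ ≤ C * ‖x‖) := by
  obtain ⟨C, hC0, hC⟩ := norm_evo_le hα hμ hL hm
  obtain ⟨G, hG⟩ := norm_gen_le hL hm
  have hS := fun t => isMatMult_evo hα hμ hL hm t
  have hK : IsMatMult fun η : Sp n => (wt m (-r) η : ℂ) • (1 : Matrix (DIdx d₁ d₂) (DIdx d₁ d₂) ℂ) :=
    isMatMult_reg hm (Nat.cast_nonneg r)
  have hB := isMatMult_gen hL hm
  refine ⟨Fintype.card (DIdx d₁ d₂) * C, by positivity, ⟨?_, ?_, ?_, ?_, ?_, ?_, ?_, ?_⟩, ?_⟩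
  · intro x
    rw [evoOp, funext (evo_zero L m r)]
    exact matOp_one x
  · intro t s x
    rw [evoOp, evoOp, evoOp, matOp_matOp (hS t) (hS s), funext (evo_add L m r t s)]
  · intro x
    rw [continuous_iff_continuousAt]
    intro t
    refine tendsto_matOp (C := C * (1 + (|t| + 1))) hS (hS t) ?_ ?_ x
    · filter_upwards [Metric.ball_mem_nhds t one_pos] with s hs η i j
      refine (hC s η i j).1.trans ?_
      rw [Metric.mem_ball, Real.dist_eq] at hs
      have := abs_sub_abs_le_abs_sub s t
      gcongr
      linarith
    · intro η i j
      exact ((continuous_evo_time L m r η).matrix_elem i j).tendsto t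
  · intro t x
    refine (norm_matOp_le (hS t) (fun η i j => (hC t η i j).1) x).trans (le_of_eq ?_)
    ring
  · intro x y hxy
    ext1 i
    have := congrArg (fun z : Data n d₁ d₂ => z i) hxy
    simp only [regOp_apply] at this
    exact mulOp_wt_injective hm (Nat.cast_nonneg r) this
  · intro t x
    rw [evoOp, regOp, matOp_matOp hK (hS t), matOp_matOp (hS t) hK]
    congr 2; funext η
    simp
  · intro t x
    rw [evoOp, genOp, matOp_matOp hB (hS t), matOp_matOp (hS t) hB]
    congr 2; funext η
    rw [Matrix.smul_mul, Matrix.mul_smul, gen_mul_evo]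
  · intro t x
    have e1 : (fun s => evoOp L m r s (regOp m r x)) =
        fun s => matOp (fun η => evo L m r s η * ((wt m (-r) η : ℂ) • (1 : Matrix _ _ ℂ))) x := by
      funext s
      rw [evoOp, regOp, matOp_matOp (hS s) hK]
    rw [e1, evoOp, genOp, matOp_matOp (hS t) hB]
    refine hasDerivAt_matOp (β' := fun s η => evo L m r s η * ((wt m (-r) η : ℂ) • gen L m r η))
      -- This bounds the entries of the product of `evo`, which grows at most linearly in time, with
      -- the smoothed generator, bounded by `G`.
      (C := fun x => ∑ _l : DIdx d₁ d₂, C * (1 + x) * G)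
      (fun s => (hS s).mul hK) (fun s => (hS s).mul hB) ?_ ?_ ?_ x t
    · intro a b hab
      refine Finset.sum_le_sum fun l _ => ?_
      have hG0 : 0 ≤ G := (norm_nonneg _).trans (hG 0 l l)
      gcongr
    · intro t η i j
      rw [Matrix.mul_apply]
      refine (norm_sum_le _ _).trans (Finset.sum_le_sum fun l _ => ?_)
      rw [norm_mul]
      refine mul_le_mul (hC t η i l).1 ?_ (norm_nonneg _) (by positivity)
      simpa using hG η l j
    · intro t η i j
      have h1 := (hasDerivAt_evo L m r t η i j).const_mul (wt m (-r) η : ℂ)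
      rw [gen_mul_evo] at h1
      simpa using h1
  · intro h t x
    exact norm_matOp_le (hS t) (fun η i j => (hC t η i j).2 h) x

/-! ### Sobolev distributions as derivatives of square integrable functions -/

theorem hatT_congr {m : ℝ} (hm : 0 < m) {σ τ : ℝ} {g g' : L2 n}
    (h : ∀ᵐ η, (wt m (-σ) η : ℂ) * g η = (wt m (-τ) η : ℂ) * g' η) : hatT m σ g = hatT m τ g' := by
  apply dist_ext_fourier
  intro ψ
  rw [fourier_hatT_apply hm, fourier_hatT_apply hm]
  apply integral_congr_ae
  filter_upwards [h] with η hη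
  rw [hη]

theorem isMult_wt_sub {m : ℝ} (hm : 0 < m) {σ τ : ℝ} (h : τ ≤ σ) :
    IsMult (fun η : Sp n => (wt m (τ - σ) η : ℂ)) := by
  have := isMult_wt_neg (n := n) hm (sub_nonneg.2 h)
  rwa [neg_sub] at this

theorem hatT_scale {m : ℝ} (hm : 0 < m) {σ τ : ℝ} (h : τ ≤ σ) (g : L2 n) :
    hatT m τ (mulOp (fun η => (wt m (τ - σ) η : ℂ)) g) = hatT m σ g := by
  apply hatT_congr hm
  filter_upwards [coeFn_mulOp (isMult_wt_sub hm h) g] with η hη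
  rw [hη, coeFn_ofReal_wt_mul_wt hm]
  congr 3
  ring

/-- The operator `m² - Δ`. -/
def bessel (m : ℝ) : 𝓢(Sp n, ℂ) →ₗ[ℂ] 𝓢(Sp n, ℂ) where
  toFun g := ((m ^ 2 : ℝ) : ℂ) • g - ∑ k : Fin n, ∂_{basisVec k} (∂_{basisVec k} g)
  map_add' f g := by
    simp only [LineDeriv.lineDerivOp_add, Finset.sum_add_distrib, smul_add]
    abel
  map_smul' c f := by
    simp only [LineDeriv.lineDerivOp_smul, RingHom.id_apply, smul_sub, Finset.smul_sum]
    rw [smul_comm]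

theorem inner_basisVec (η : Sp n) (k : Fin n) : inner ℝ η (basisVec k) = η k := by
  simp [basisVec, EuclideanSpace.inner_single_right]

theorem hasTemperateGrowth_inner (v : Sp n) :
    Function.HasTemperateGrowth (fun η : Sp n => inner ℝ η v) := by
  fun_prop

theorem fourierInv_lineDeriv_apply (g : 𝓢(Sp n, ℂ)) (k : Fin n) (η : Sp n) :
    𝓕⁻ (∂_{basisVec k} g) η = -(2 * Real.pi * Complex.I) * (η k) * 𝓕⁻ g η := by
  rw [SchwartzMap.fourierInv_lineDerivOp_eq, smul_apply,
    SchwartzMap.smulLeftCLM_apply_apply (hasTemperateGrowth_inner _), inner_basisVec]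
  simp [mul_assoc]

theorem fourierInv_bessel {m : ℝ} (g : 𝓢(Sp n, ℂ)) (η : Sp n) :
    𝓕⁻ (bessel m g) η = wt m 2 η * 𝓕⁻ g η := by
  have h1 : 𝓕⁻ (bessel m g) = ((m ^ 2 : ℝ) : ℂ) • 𝓕⁻ g -
      ∑ k : Fin n, 𝓕⁻ (∂_{basisVec k} (∂_{basisVec k} g)) := by
    have := (FourierTransform.fourierInvCLM ℂ 𝓢(Sp n, ℂ)).map_sub (((m ^ 2 : ℝ) : ℂ) • g)
      (∑ k : Fin n, ∂_{basisVec k} (∂_{basisVec k} g))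
    rw [map_smul, map_sum] at this
    exact this
  rw [h1, sub_apply, smul_apply, sum_apply]
  simp only [fourierInv_lineDeriv_apply]
  rw [wt_two, norm_smul, mul_pow, EuclideanSpace.real_norm_sq_eq, smul_eq_mul]
  push_cast
  rw [add_mul, sub_eq_add_neg, Finset.mul_sum, Finset.sum_mul, ← Finset.sum_neg_distrib]
  congr 1
  refine Finset.sum_congr rfl fun k _ => ?_
  have : ‖(2 * Real.pi)‖ ^ 2 = (2 * Real.pi) ^ 2 := by
    rw [Real.norm_eq_abs, sq_abs]
  have h2 : ((‖(2 * Real.pi)‖ : ℝ) : ℂ) ^ 2 = (2 * Real.pi) ^ 2 := by exact_mod_cast this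
  rw [h2]
  linear_combination (-(4 : ℂ) * Real.pi ^ 2 * (η k) ^ 2 * 𝓕⁻ g η) * Complex.I_sq

theorem fourierInv_bessel_pow {m : ℝ} (hm : 0 < m) (k : ℕ) (g : 𝓢(Sp n, ℂ)) (η : Sp n) :
    𝓕⁻ ((bessel m ^ k) g) η = wt m (2 * k) η * 𝓕⁻ g η := by
  induction k with
  | zero => simp
  | succ k ih =>
    rw [pow_succ', Module.End.mul_apply, fourierInv_bessel, ih, ← mul_assoc, ← Complex.ofReal_mul,
      ← wt_add hm]
    congr 3
    push_cast
    ring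

/-- The pairing of square integrable functions. -/
def pair2 : L2 n →L[ℂ] L2 n →L[ℂ] ℂ :=
  ContinuousLinearMap.lpPairing volume 2 2 (ContinuousLinearMap.mul ℂ ℂ)

theorem pair2_eq (f g : L2 n) : pair2 f g = ∫ x, f x * g x :=
  ContinuousLinearMap.lpPairing_eq_integral _ _ _

/-- The order of the operator in `hatT_eq_pair2`. -/
def bOrd (σ : ℝ) : ℕ := ⌈|σ|⌉₊

theorem neg_bOrd_le (σ : ℝ) : -(2 * (bOrd σ : ℝ)) ≤ σ := by
  have h1 : |σ| ≤ bOrd σ := Nat.le_ceil _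
  have h2 := neg_abs_le σ
  have h3 := abs_nonneg σ
  linarith

/-- The square integrable function of which a distribution is a derivative. -/
def sobPrim (m σ : ℝ) : L2 n →L[ℂ] L2 n :=
  ((nc n : ℝ) : ℂ)⁻¹ •
    ((Lp.fourierTransformₗᵢ (Sp n) ℂ).symm.toContinuousLinearEquiv.toContinuousLinearMap ∘L
      mulOp (fun η => (wt m (-(2 * (bOrd σ : ℝ)) - σ) η : ℂ)))

theorem hatT_zero_apply {m : ℝ} (e : L2 n) (g : 𝓢(Sp n, ℂ)) :
    hatT m 0 e g = pair2 (g.toLp 2) (((nc n : ℝ) : ℂ)⁻¹ • (𝓕⁻ e : L2 n)) := by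
  have h1 : hatT m 0 e = ((nc n : ℝ) : ℂ)⁻¹ • (((𝓕⁻ e : L2 n)) : Dist n) := by
    rw [hatT_eq]
    have : (fun η : Sp n => ((wt m (-0) η : ℝ) : ℂ)) = fun _ => 1 := by
      funext η; simp
    rw [this, TemperedDistribution.smulLeftCLM_const, one_smul,
      ← Lp.fourierInv_toTemperedDistribution_eq]
  rw [h1, map_smul, pair2_eq]
  change ((nc n : ℝ) : ℂ)⁻¹ * (((𝓕⁻ e : L2 n)) : Dist n) g = _
  rw [toTD_apply, smul_eq_mul]
  congr 1
  apply integral_congr_ae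
  filter_upwards [g.coeFn_toLp 2 volume] with x hx
  rw [hx]

/-- An element of `H^σ` is `(m² - Δ)^k` of a square integrable function once `2k ≥ -σ`. Moving the
operator onto the test function turns the evaluation into a pairing in `L²`, which is jointly
continuous and differentiable when both arguments depend on time. -/
theorem hatT_eq_pair2 {m : ℝ} (hm : 0 < m) (σ : ℝ) (e : L2 n) (g : 𝓢(Sp n, ℂ)) :
    hatT m σ e g = pair2 (((bessel m ^ bOrd σ) g).toLp 2) (sobPrim m σ e) := by
  rw [← hatT_scale hm (neg_bOrd_le σ)]
  refine Eq.trans ?_ (hatT_zero_apply (m := m) _ _)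
  rw [hatT_apply hm, hatT_apply hm]
  congr 1; ext η
  rw [fourierInv_bessel_pow hm]
  simp only [neg_neg, neg_zero, wt_zero]
  push_cast
  ring

theorem continuous_hatT_apply {m : ℝ} (hm : 0 < m) (σ : ℝ) (g : 𝓢(Sp n, ℂ)) :
    Continuous fun e : L2 n => hatT m σ e g := by
  simp_rw [hatT_eq_pair2 hm]
  fun_prop

/-- The evaluation of the elements of `H^σ` at a test function. -/
def evalCLM (m σ : ℝ) (g : 𝓢(Sp n, ℂ)) : L2 n →L[ℂ] ℂ :=
  pair2 (((bessel m ^ bOrd σ) g).toLp 2) ∘L sobPrim m σ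

theorem evalCLM_apply {m : ℝ} (hm : 0 < m) (σ : ℝ) (g : 𝓢(Sp n, ℂ)) (e : L2 n) :
    evalCLM m σ g e = hatT m σ e g := (hatT_eq_pair2 hm σ e g).symm

/-! ### Differential operators -/

theorem fourierRep_lineDeriv {m : ℝ} (hm : 0 < m) {f : Dist n} {h : Sp n → ℂ}
    (hf : FourierRep m f h) (k : Fin n) :
    FourierRep m (∂_{basisVec k} f) (fun η => (Complex.I * (((2 * Real.pi) • η) k : ℝ)) * h η) := by
  obtain ⟨σ, hσ⟩ := hf.temp
  refine ⟨⟨σ - 1, ?_⟩, fun ψ => ?_⟩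
  · refine (memLp_mul_of_bdd (b := fun η : Sp n => (wt m (-1) η : ℂ) *
      (Complex.I * (((2 * Real.pi) • η) k : ℝ))) (C := 1) ?_ ?_ hσ).ae_eq ?_
    · refine Continuous.aestronglyMeasurable ?_
      have := continuous_wt (n := n) hm (-1)
      fun_prop
    · intro η
      rw [norm_mul, Complex.norm_real, Real.norm_of_nonneg (wt_pos hm _ _).le]
      have h1 := norm_coord_le ((2 * Real.pi) • η) k
      calc wt m (-1) η * _ ≤ wt m (-1) η * wt m 1 η :=
            mul_le_mul_of_nonneg_left (h1.trans (norm_le_wt_one m η)) (wt_pos hm _ _).le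
        _ = 1 := wt_neg_mul hm 1 η
    · refine Eventually.of_forall fun η => ?_
      beta_reduce
      rw [sub_eq_add_neg, wt_add hm]
      push_cast
      ring
  · rw [TemperedDistribution.fourier_lineDerivOp_eq]
    have hg : Function.HasTemperateGrowth (fun η : Sp n => ((inner ℝ η (basisVec k) : ℝ) : ℂ)) :=
      Function.Complex.hasTemperateGrowth_ofReal.comp (hasTemperateGrowth_inner _)
    change (2 * Real.pi * Complex.I) * (𝓕 f (SchwartzMap.smulLeftCLM ℂ
      (fun η : Sp n => ((inner ℝ η (basisVec k) : ℝ) : ℂ)) ψ)) = _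
    rw [hf.eq, ← integral_const_mul]
    congr 1; ext η
    rw [SchwartzMap.smulLeftCLM_apply_apply hg, inner_basisVec]
    simp only [PiLp.smul_apply, smul_eq_mul]
    push_cast
    ring

theorem fourierRep_partialD {m : ℝ} (hm : 0 < m) {f : Dist n} {h : Sp n → ℂ}
    (hf : FourierRep m f h) (a : Fin n →₀ ℕ) :
    FourierRep m (partialD a f)
      (fun η => (∏ k, (Complex.I * (((2 * Real.pi) • η) k : ℝ)) ^ a k) * h η) := by
  have h1 : ∀ (k : Fin n) (j : ℕ) {f : Dist n} {h : Sp n → ℂ}, FourierRep m f h →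
      FourierRep m ((∂_{basisVec k})^[j] f)
        (fun η => (Complex.I * (((2 * Real.pi) • η) k : ℝ)) ^ j * h η) := by
    intro k j
    induction j with
    | zero => intro f h hf; simpa using hf
    | succ j ih =>
      intro f h hf
      rw [Function.iterate_succ_apply']
      simpa only [pow_succ', mul_assoc] using fourierRep_lineDeriv hm (ih hf) k
  have h2 : ∀ l : List (Fin n), FourierRep m
      (l.foldr (fun k g => (∂_{basisVec k})^[a k] g) f)
      (fun η => (l.map fun k => (Complex.I * (((2 * Real.pi) • η) k : ℝ)) ^ a k).prod * h η) := by
    intro l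
    induction l with
    | nil => simpa using hf
    | cons k l ih => simpa [mul_assoc] using h1 k (a k) ih
  have h3 := h2 (List.finRange n)
  simpa only [← Fin.prod_univ_def] using! h3

theorem fourierRep_polyD {m : ℝ} (hm : 0 < m) {f : Dist n} {h : Sp n → ℂ}
    (hf : FourierRep m f h) (p : MvPolynomial (Fin n) ℝ) :
    FourierRep m (polyD p f) (fun η => MvPolynomial.aeval
      (fun k => Complex.I * ((((2 * Real.pi) • η) k : ℝ) : ℂ)) p * h η) := by
  have h1 := FourierRep.sum hm p.support fun a _ =>
    (fourierRep_partialD hm hf a).smul ((p.coeff a : ℝ) : ℂ)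
  have h2 : (fun η => MvPolynomial.aeval
      (fun k => Complex.I * ((((2 * Real.pi) • η) k : ℝ) : ℂ)) p * h η) =
      fun η => ∑ a ∈ p.support, ((p.coeff a : ℝ) : ℂ) *
        ((∏ k, (Complex.I * (((2 * Real.pi) • η) k : ℝ)) ^ a k) * h η) := by
    funext η
    rw [MvPolynomial.aeval_def, MvPolynomial.eval₂_eq', Finset.sum_mul]
    refine Finset.sum_congr rfl fun a _ => ?_
    simp [mul_assoc]
  rw [h2]
  exact h1

/-- A polynomial of order `k` in the derivatives, divided by the weight of order `k`. -/
def polyOp (m k : ℝ) (p : MvPolynomial (Fin n) ℝ) : L2 n →L[ℂ] L2 n :=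
  mulOp fun η => (wt m (-k) η : ℂ) * MvPolynomial.aeval
    (fun j => Complex.I * ((((2 * Real.pi) • η) j : ℝ) : ℂ)) p

theorem isMult_polyOp {m : ℝ} (hm : 0 < m) {k : ℕ} {p : MvPolynomial (Fin n) ℝ}
    (hp : p.totalDegree ≤ k) : IsMult fun η : Sp n => (wt m (-(k : ℝ)) η : ℂ) * MvPolynomial.aeval
    (fun j => Complex.I * ((((2 * Real.pi) • η) j : ℝ) : ℂ)) p := by
  obtain ⟨C, hC⟩ := norm_aeval_le hm p hp
  refine IsMult.of_continuous (C := C) ?_ fun η => ?_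
  · have h1 := continuous_wt (n := n) hm (-(k : ℝ))
    refine (Complex.continuous_ofReal.comp h1).mul ?_
    simp only [MvPolynomial.aeval_def, MvPolynomial.eval₂_eq']
    fun_prop
  · rw [norm_mul, Complex.norm_real, Real.norm_of_nonneg (wt_pos hm _ _).le]
    calc wt m (-(k:ℝ)) η * _ ≤ wt m (-(k:ℝ)) η * (C * wt m k η) :=
          mul_le_mul_of_nonneg_left (hC.2 η) (wt_pos hm _ _).le
      _ = C := by rw [mul_left_comm, wt_neg_mul hm, mul_one]

theorem polyD_hatT {m : ℝ} (hm : 0 < m) {k : ℕ} {p : MvPolynomial (Fin n) ℝ}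
    (hp : p.totalDegree ≤ k) (σ : ℝ) (g : L2 n) :
    polyD p (hatT m σ g) = hatT m (σ - k) (polyOp m k p g) := by
  have h1 := fourierRep_polyD hm (fourierRep_hatT hm σ g) p
  have h2 := fourierRep_hatT hm (σ - k) (polyOp m k p g)
  apply dist_ext_fourier
  intro ψ
  rw [h1.eq, h2.eq]
  apply integral_congr_ae
  filter_upwards [coeFn_mulOp (isMult_polyOp hm hp) g] with η hη
  rw [polyOp, hη]
  have : wt m (-σ) η = wt m (-(σ - k)) η * wt m (-(k : ℝ)) η := by
    rw [← wt_add hm]; congr 1; ring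
  rw [this]
  push_cast
  ring

theorem lineDeriv_hatT {m : ℝ} (hm : 0 < m) (σ : ℝ) (k : Fin n) (g : L2 n) :
    ∂_{basisVec k} (hatT m σ g) = hatT m (σ - 1) (polyOp m 1 (MvPolynomial.X k) g) := by
  have hp : (MvPolynomial.X k : MvPolynomial (Fin n) ℝ).totalDegree ≤ 1 :=
    (MvPolynomial.totalDegree_X k).le
  have h1 := polyD_hatT hm hp σ g
  rw [Nat.cast_one] at h1
  rw [← h1]
  have h2 := fourierRep_polyD hm (fourierRep_hatT hm σ g) (MvPolynomial.X k)
  have h3 := fourierRep_lineDeriv hm (fourierRep_hatT hm σ g) k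
  apply dist_ext_fourier
  intro ψ
  rw [h2.eq, h3.eq]
  simp

/-! ### Real distributions -/

/-- Complex conjugation of Schwartz functions. -/
def conjS (ψ : 𝓢(Sp n, ℂ)) : 𝓢(Sp n, ℂ) :=
  SchwartzMap.postcompCLM (𝕜 := ℝ) (Complex.conjCLE : ℂ →L[ℝ] ℂ) ψ

theorem conjS_apply (ψ : 𝓢(Sp n, ℂ)) (x : Sp n) : conjS ψ x = starRingEnd ℂ (ψ x) := rfl

/-- A test function splits as `a + ib` with `a` and `b` real-valued, and the distribution is real at
both. -/
theorem isRealDist_iff {f : Dist n} :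
    IsRealDist f ↔ ∀ ψ, f (conjS ψ) = starRingEnd ℂ (f ψ) := by
  constructor
  · intro h ψ
    let a : 𝓢(Sp n, ℂ) := (1 / 2 : ℂ) • (ψ + conjS ψ)
    let b : 𝓢(Sp n, ℂ) := (-(Complex.I / 2)) • (ψ - conjS ψ)
    have ha : (f a).im = 0 := h a fun x => by
      simp [a, conjS_apply, Complex.add_im, Complex.mul_im]
    have hb : (f b).im = 0 := h b fun x => by
      simp [b, conjS_apply, Complex.sub_im, Complex.mul_im]
    have h1 : ψ = a + Complex.I • b := by
      ext x
      simp only [a, b, add_apply, smul_apply, sub_apply, smul_eq_mul]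
      linear_combination (-(1 / 2 : ℂ) * (ψ x - conjS ψ x)) * (-Complex.I_sq)
    have h2 : conjS ψ = a - Complex.I • b := by
      ext x
      simp only [a, b, add_apply, smul_apply, sub_apply, smul_eq_mul]
      linear_combination ((1 / 2 : ℂ) * (ψ x - conjS ψ x)) * (-Complex.I_sq)
    have h3 : f ψ = f (a + Complex.I • b) := congrArg f h1
    clear_value a b
    rw [h2, h3, map_sub, map_add, map_smul, smul_eq_mul, map_add, map_mul, Complex.conj_I,
      Complex.conj_eq_iff_im.2 ha, Complex.conj_eq_iff_im.2 hb]
    ring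
  · intro h g hg
    have h1 : conjS g = g := by
      ext x
      rw [conjS_apply, Complex.conj_eq_iff_im.2 (hg x)]
    have h2 := h g
    rw [h1] at h2
    exact Complex.conj_eq_iff_im.1 h2.symm

/-- The Hermitian symmetry of the Fourier transforms of real distributions. -/
def Herm (g : L2 n) : Prop := ∀ᵐ η, g (-η) = starRingEnd ℂ (g η)

theorem ae_neg {P : Sp n → Prop} (h : ∀ᵐ η, P η) : ∀ᵐ η : Sp n, P (-η) :=
  (Measure.measurePreserving_neg (volume : Measure (Sp n))).quasiMeasurePreserving.ae h

theorem memLp_conj {g : Sp n → ℂ} (hg : MemLp g 2 volume) :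
    MemLp (fun η => starRingEnd ℂ (g η)) 2 volume :=
  hg.of_le (Complex.continuous_conj.comp_aestronglyMeasurable hg.1)
    (Eventually.of_forall fun η => by simp)

/-- The function `η ↦ conj (g (-η))`. -/
def sharp (g : L2 n) : L2 n :=
  (memLp_conj ((Lp.memLp g).comp_measurePreserving (Measure.measurePreserving_neg volume))).toLp

theorem coeFn_sharp (g : L2 n) : sharp g =ᵐ[volume] fun η => starRingEnd ℂ (g (-η)) :=
  MemLp.coeFn_toLp _

theorem sharp_eq_iff {g : L2 n} : sharp g = g ↔ Herm g := by
  constructor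
  · intro h
    filter_upwards [coeFn_sharp g] with η hη
    rw [h] at hη
    rw [hη, Complex.conj_conj]
  · intro h
    apply Lp.ext
    filter_upwards [coeFn_sharp g, h] with η h1 h2
    rw [h1, h2, Complex.conj_conj]

theorem fourierInv_conjS (ψ : 𝓢(Sp n, ℂ)) (η : Sp n) :
    𝓕⁻ (conjS ψ) η = starRingEnd ℂ (𝓕⁻ ψ (-η)) := by
  rw [SchwartzMap.fourierInv_coe, SchwartzMap.fourierInv_coe, Real.fourierInv_eq',
    Real.fourierInv_eq', ← integral_conj]
  congr 1; ext x
  rw [conjS_apply, smul_eq_mul, smul_eq_mul, map_mul, ← Complex.exp_conj, map_mul,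
    Complex.conj_ofReal, Complex.conj_I]
  congr 2
  rw [inner_neg_right]
  push_cast
  ring

theorem hatT_conjS {m : ℝ} (hm : 0 < m) (σ : ℝ) (g : L2 n) (ψ : 𝓢(Sp n, ℂ)) :
    hatT m σ g (conjS ψ) = starRingEnd ℂ (hatT m σ (sharp g) ψ) := by
  rw [hatT_apply hm, hatT_apply hm, ← integral_conj, ← integral_neg_eq_self]
  apply integral_congr_ae
  filter_upwards [coeFn_sharp g] with η hη
  rw [hη, fourierInv_conjS, neg_neg, wt_even]
  simp only [map_mul, map_inv₀, Complex.conj_ofReal, Complex.conj_conj]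

/-- The weight is even, so conjugating test functions corresponds to `g ↦ sharp g` on the Fourier
side; injectivity of `hatT` identifies the fixed points. -/
theorem isRealDist_hatT {m : ℝ} (hm : 0 < m) {σ : ℝ} {g : L2 n} :
    IsRealDist (hatT m σ g) ↔ Herm g := by
  rw [isRealDist_iff, ← sharp_eq_iff]
  constructor
  · intro h
    apply hatT_injective hm σ
    ext ψ
    have := h ψ
    rw [hatT_conjS hm] at this
    exact (starRingEnd ℂ).injective this
  · intro h ψ
    rw [hatT_conjS hm, h]

theorem Herm.add {g g' : L2 n} (h : Herm g) (h' : Herm g') : Herm (g + g') := by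
  have h1 := Lp.coeFn_add g g'
  filter_upwards [h, h', h1, ae_neg h1] with η e1 e2 e3 e4
  rw [e3, e4, Pi.add_apply, Pi.add_apply, e1, e2, map_add]

theorem Herm.zero : Herm (0 : L2 n) := by
  have h1 := Lp.coeFn_zero ℂ 2 (volume : Measure (Sp n))
  filter_upwards [h1, ae_neg h1] with η e1 e2
  rw [e1, e2]; simp

theorem Herm.sum {ι : Type*} (s : Finset ι) {g : ι → L2 n} (h : ∀ i ∈ s, Herm (g i)) :
    Herm (∑ i ∈ s, g i) := by
  classical
  induction s using Finset.induction_on with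
  | empty => simpa using Herm.zero
  | insert a s ha ih =>
    rw [Finset.sum_insert ha]
    exact (h a (by simp)).add (ih fun i hi => h i (by simp [hi]))

theorem Herm.mulOp {g : L2 n} (h : Herm g) {b : Sp n → ℂ} (hb : IsMult b)
    (hs : ∀ η, b (-η) = starRingEnd ℂ (b η)) : Herm (mulOp b g) := by
  have h1 := coeFn_mulOp hb g
  filter_upwards [h, h1, ae_neg h1] with η e1 e2 e3
  rw [e2, e3, e1, hs, map_mul]

theorem Herm.smul {g : L2 n} (h : Herm g) {z : ℂ} (hz : starRingEnd ℂ z = z) : Herm (z • g) := by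
  have h1 := Lp.coeFn_smul z g
  filter_upwards [h, h1, ae_neg h1] with η e1 e2 e3
  rw [e2, e3, Pi.smul_apply, Pi.smul_apply, e1, smul_eq_mul, smul_eq_mul, map_mul, hz]

theorem Herm.neg {g : L2 n} (h : Herm g) : Herm (-g) := by
  have := h.smul (z := -1) (by simp)
  simpa using this

theorem Herm.sub {g g' : L2 n} (h : Herm g) (h' : Herm g') : Herm (g - g') := by
  rw [sub_eq_add_neg]; exact h.add h'.neg

theorem Herm.matOp {ι κ : Type} [Fintype ι] [Fintype κ] {β : Sp n → Matrix ι κ ℂ}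
    (hβ : IsMatMult β) (hs : ∀ η, β (-η) = (β η).map (starRingEnd ℂ)) {U : VL2 n κ}
    (hU : ∀ j, Herm (U j)) (i : ι) : Herm (matOp β U i) := by
  rw [matOp_apply]
  refine Herm.sum _ fun j _ => (hU j).mulOp (hβ i j) fun η => ?_
  rw [hs]; rfl

/-! ### Square integrable representatives -/

theorem rep_coe (g : L2 n) : rep (g : Dist n) = g := by
  have h : ∃ g' : L2 n, (g : Dist n) = (g' : Dist n) := ⟨g, rfl⟩
  rw [rep, dif_pos h, ← toTD_injective h.choose_spec]

theorem ofFun_eq {g : Sp n → ℂ} (h : MemLp g 2 volume) : ofFun g = ((h.toLp g : L2 n) : Dist n) := by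
  rw [ofFun, dif_pos h]

theorem toTD_conjS (g : L2 n) (ψ : 𝓢(Sp n, ℂ)) : (g : Dist n) (conjS ψ) =
    starRingEnd ℂ ((((memLp_conj (Lp.memLp g)).toLp : L2 n) : Dist n) ψ) := by
  rw [toTD_apply, toTD_apply, ← integral_conj]
  apply integral_congr_ae
  filter_upwards [(memLp_conj (Lp.memLp g)).coeFn_toLp] with η hη
  rw [hη, conjS_apply, map_mul, Complex.conj_conj]

theorem isRealDist_coe {g : L2 n} : IsRealDist (g : Dist n) ↔ ∀ᵐ x, (g x).im = 0 := by
  rw [isRealDist_iff]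
  have hc := (memLp_conj (Lp.memLp g)).coeFn_toLp
  constructor
  · intro h
    have h1 : (memLp_conj (Lp.memLp g)).toLp = g := by
      apply toTD_injective
      ext ψ
      have := h ψ
      rw [toTD_conjS] at this
      exact (starRingEnd ℂ).injective this
    rw [h1] at hc
    filter_upwards [hc] with x hx
    exact Complex.conj_eq_iff_im.1 hx.symm
  · intro h ψ
    rw [toTD_conjS]
    have h1 : (memLp_conj (Lp.memLp g)).toLp = g := by
      apply Lp.ext
      filter_upwards [hc, h] with x h1 h2
      rw [h1, Complex.conj_eq_iff_im.2 h2]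
    rw [h1]

/-! ### Curves of Sobolev distributions -/

theorem uniqueDiff {I : Set ℝ} (hI : I.OrdConnected) (hne : (interior I).Nonempty) {t : ℝ}
    (ht : t ∈ I) : UniqueDiffWithinAt ℝ I t :=
  uniqueDiffWithinAt_convex hI.convex hne (subset_closure ht)

/-- The interval is non-degenerate, so derivatives within it are unique, at its endpoints too, and
the choice made by `timeDeriv` is forced. -/
theorem timeDeriv_eq {I : Set ℝ} (hI : I.OrdConnected) (hne : (interior I).Nonempty)
    {u : FieldPath n d₁ d₂} {t : ℝ} (ht : t ∈ I) {i : Idx d₁ d₂} {v : Dist n}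
    (h : ∀ g : 𝓢(Sp n, ℂ), HasDerivWithinAt (fun τ => u τ i g) (v g) I t) :
    timeDeriv I u t i = v := by
  have h' : ∃ v : Dist n, ∀ g : 𝓢(Sp n, ℂ), HasDerivWithinAt (fun τ => u τ i g) (v g) I t := ⟨v, h⟩
  rw [timeDeriv, dif_pos h']
  ext g
  exact UniqueDiffWithinAt.eq_deriv I (uniqueDiff hI hne ht) (h'.choose_spec g) (h g)

theorem hatT_reg {m : ℝ} (hm : 0 < m) (σ : ℝ) {r : ℝ} (hr : 0 ≤ r) (g : L2 n) :
    hatT m (σ - r) (mulOp (fun η => (wt m (-r) η : ℂ)) g) = hatT m σ g := by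
  have := hatT_scale hm (sub_le_self σ hr) g
  rwa [sub_sub_cancel_left] at this

/-- The curves `U` and `V` of `L²` functions represent the curve `u` in `H^s` and its derivative in
`H^{s-r}`. -/
structure PathRep (r : ℕ) (m s : ℝ) (I : Set ℝ) (u : FieldPath n d₁ d₂)
    (U V : ℝ → Idx d₁ d₂ → L2 n) : Prop where
  eq : ∀ t ∈ I, ∀ i, u t i = hatT m s (U t i)
  herm : ∀ t ∈ I, ∀ i, Herm (U t i)
  herm_deriv : ∀ t ∈ I, ∀ i, Herm (V t i)
  cont : ∀ i, ContinuousOn (fun t => U t i) I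
  cont_deriv : ∀ i, ContinuousOn (fun t => V t i) I
  deriv : ∀ t ∈ I, ∀ i, HasDerivWithinAt
    (fun τ => mulOp (fun η => (wt m (-(r : ℝ)) η : ℂ)) (U τ i)) (V t i) I t

theorem hasDerivWithinAt_hatT {m : ℝ} (hm : 0 < m) (σ : ℝ) {I : Set ℝ} {A : ℝ → L2 n} {B : L2 n}
    {t : ℝ} (h : HasDerivWithinAt A B I t) (g : 𝓢(Sp n, ℂ)) :
    HasDerivWithinAt (fun τ => hatT m σ (A τ) g) (hatT m σ B g) I t := by
  have := ((evalCLM m σ g).restrictScalars ℝ).hasFDerivAt.comp_hasDerivWithinAt t h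
  simpa [Function.comp_def, evalCLM_apply hm] using this

namespace PathRep

variable {r : ℕ} {m s : ℝ} {I : Set ℝ} {u : FieldPath n d₁ d₂} {U V : ℝ → Idx d₁ d₂ → L2 n}

theorem hasDeriv_apply (h : PathRep r m s I u U V) (hm : 0 < m) {t : ℝ} (ht : t ∈ I)
    (i : Idx d₁ d₂) (g : 𝓢(Sp n, ℂ)) :
    HasDerivWithinAt (fun τ => u τ i g) (hatT m (s - r) (V t i) g) I t := by
  have h1 := hasDerivWithinAt_hatT hm (s - r) (h.deriv t ht i) g
  refine h1.congr_of_mem (fun τ hτ => ?_) ht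
  rw [hatT_reg hm s (Nat.cast_nonneg r), h.eq τ hτ]

theorem timeDeriv_eq (h : PathRep r m s I u U V) (hm : 0 < m) (hI : I.OrdConnected)
    (hne : (interior I).Nonempty) {t : ℝ} (ht : t ∈ I) (i : Idx d₁ d₂) :
    timeDeriv I u t i = hatT m (s - r) (V t i) :=
  LagrangeDuhamel.timeDeriv_eq hI hne ht fun g => h.hasDeriv_apply hm ht i g

end PathRep

theorem tendsto_enorm_sub_iff {E T : Type*} [NormedAddCommGroup E] {f : T → E} {x : E}
    {l : Filter T} : Tendsto (fun τ => ‖f τ - x‖ₑ) l (𝓝 0) ↔ Tendsto f l (𝓝 x) := by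
  rw [tendsto_iff_edist_tendsto_0]
  simp only [edist_eq_enorm_sub]

theorem slope_coe {E : Type*} [NormedAddCommGroup E] [NormedSpace ℂ E] (f : ℝ → E) (t τ : ℝ) :
    slope f t τ = ((τ - t : ℝ) : ℂ)⁻¹ • (f τ - f t) := by
  rw [slope_def_module, ← Complex.ofReal_inv]
  exact (Complex.coe_smul _ _).symm

/-- Differentiability in `H^{s-r}` of a curve in `H^s` becomes differentiability in `L²` of the
curve of its representatives smoothed by `⟨ξ⟩^{-r}`. -/
theorem hatT_slope {m : ℝ} (hm : 0 < m) (σ : ℝ) {r : ℝ} (hr : 0 ≤ r) (A : ℝ → L2 n) (B : L2 n)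
    (t τ : ℝ) :
    ((τ - t : ℝ) : ℂ)⁻¹ • (hatT m σ (A τ) - hatT m σ (A t)) - hatT m (σ - r) B =
      hatT m (σ - r) (slope (fun τ => mulOp (fun η => (wt m (-r) η : ℂ)) (A τ)) t τ - B) := by
  have h : slope (fun τ => mulOp (fun η : Sp n => (wt m (-r) η : ℂ)) (A τ)) t τ =
      ((τ - t : ℝ) : ℂ)⁻¹ • (mulOp (fun η : Sp n => (wt m (-r) η : ℂ)) (A τ) -
        mulOp (fun η : Sp n => (wt m (-r) η : ℂ)) (A t)) := slope_coe _ t τ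
  rw [h, map_sub, map_smul, map_sub, hatT_reg hm σ hr, hatT_reg hm σ hr]

theorem PathRep.memF {r : ℕ} {m s : ℝ} {I : Set ℝ} {u : FieldPath n d₁ d₂}
    {U V : ℝ → Idx d₁ d₂ → L2 n} (h : PathRep r m s I u U V) (hm : 0 < m) (hI : I.OrdConnected)
    (hne : (interior I).Nonempty) : MemF r m s I u where
  mem t ht i := by
    rw [h.eq t ht]
    exact ⟨(isRealDist_hatT hm).2 (h.herm t ht i), (sobNorm_lt_top_iff hm).2 ⟨_, rfl⟩⟩
  cont t ht i := by
    have h1 := tendsto_enorm_sub_iff.2 (h.cont i t ht)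
    refine h1.congr' ?_
    filter_upwards [self_mem_nhdsWithin] with τ hτ
    rw [h.eq t ht, h.eq τ hτ, ← map_sub, sobNorm_hatT hm]
  mem_deriv t ht i := by
    rw [h.timeDeriv_eq hm hI hne ht]
    exact ⟨(isRealDist_hatT hm).2 (h.herm_deriv t ht i), (sobNorm_lt_top_iff hm).2 ⟨_, rfl⟩⟩
  hasDeriv t ht i := by
    have h1 := tendsto_enorm_sub_iff.2 (hasDerivWithinAt_iff_tendsto_slope.1 (h.deriv t ht i))
    refine h1.congr' ?_
    filter_upwards [self_mem_nhdsWithin] with τ hτ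
    rw [h.timeDeriv_eq hm hI hne ht, h.eq t ht, h.eq τ hτ.1,
      hatT_slope hm s (Nat.cast_nonneg r) (fun τ => U τ i), sobNorm_hatT hm]
  cont_deriv t ht i := by
    have h1 := tendsto_enorm_sub_iff.2 (h.cont_deriv i t ht)
    refine h1.congr' ?_
    filter_upwards [self_mem_nhdsWithin] with τ hτ
    rw [h.timeDeriv_eq hm hI hne ht, h.timeDeriv_eq hm hI hne hτ, ← map_sub, sobNorm_hatT hm]

/-- Together with `PathRep.memF`, this translates membership in `𝓕^s(I)` into properties of curves
in `L²`, where all of the later analysis takes place. -/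
theorem MemF.pathRep {r : ℕ} {m s : ℝ} {I : Set ℝ} {u : FieldPath n d₁ d₂} (h : MemF r m s I u)
    (hm : 0 < m) : PathRep r m s I u (fun t i => unhat m s (u t i))
      (fun t i => unhat m (s - r) (timeDeriv I u t i)) := by
  have e1 : ∀ t ∈ I, ∀ i, u t i = hatT m s (unhat m s (u t i)) := fun t ht i =>
    (hatT_unhat hm (h.mem t ht i).2).symm
  have e2 : ∀ t ∈ I, ∀ i, timeDeriv I u t i = hatT m (s - r) (unhat m (s - r) (timeDeriv I u t i)) :=
    fun t ht i => (hatT_unhat hm (h.mem_deriv t ht i).2).symm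
  refine ⟨e1, fun t ht i => ?_, fun t ht i => ?_, fun i t ht => ?_, fun i t ht => ?_,
    fun t ht i => ?_⟩
  · have := (h.mem t ht i).1
    rw [e1 t ht i] at this
    exact (isRealDist_hatT hm).1 this
  · have := (h.mem_deriv t ht i).1
    rw [e2 t ht i] at this
    exact (isRealDist_hatT hm).1 this
  · refine tendsto_enorm_sub_iff.1 ((h.cont t ht i).congr' ?_)
    filter_upwards [self_mem_nhdsWithin] with τ hτ
    rw [← sobNorm_hatT hm s, map_sub, ← e1 t ht, ← e1 τ hτ]
  · refine tendsto_enorm_sub_iff.1 ((h.cont_deriv t ht i).congr' ?_)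
    filter_upwards [self_mem_nhdsWithin] with τ hτ
    rw [← sobNorm_hatT hm (s - r), map_sub, ← e2 t ht, ← e2 τ hτ]
  · rw [hasDerivWithinAt_iff_tendsto_slope]
    refine tendsto_enorm_sub_iff.1 ((h.hasDeriv t ht i).congr' ?_)
    filter_upwards [self_mem_nhdsWithin] with τ hτ
    rw [← sobNorm_hatT hm (s - r), ← hatT_slope hm s (Nat.cast_nonneg r), ← e1 t ht, ← e1 τ hτ.1,
      ← e2 t ht]

/-- The Cauchy data `(u₁, u₂, ∂₀u₂)`. -/
def mkData (U V : Idx d₁ d₂ → L2 n) : Data n d₁ d₂ :=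
  WithLp.toLp 1 fun k => match k with
    | Sum.inl i => U (Sum.inl i)
    | Sum.inr (Sum.inl j) => U (Sum.inr j)
    | Sum.inr (Sum.inr j) => V (Sum.inr j)

theorem enorm_VL2 {ι : Type} [Fintype ι] (U : VL2 n ι) : ‖U‖ₑ = ∑ i, ‖U i‖ₑ := by
  have h : ‖U‖ = ∑ i, ‖U i‖ := by
    rw [PiLp.norm_eq_of_nat 1 (by norm_num)]
    simp
  rw [← ofReal_norm, h, ENNReal.ofReal_sum_of_nonneg fun i _ => norm_nonneg _]
  simp

theorem norm_VL2 {ι : Type} [Fintype ι] (U : VL2 n ι) : ‖U‖ = ∑ i, ‖U i‖ := by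
  rw [PiLp.norm_eq_of_nat 1 (by norm_num)]
  simp

theorem PathRep.fNorm_eq {r : ℕ} {m s : ℝ} {I : Set ℝ} {u : FieldPath n d₁ d₂}
    {U V : ℝ → Idx d₁ d₂ → L2 n} (h : PathRep r m s I u U V) (hm : 0 < m) (hI : I.OrdConnected)
    (hne : (interior I).Nonempty) : fNorm r m s I u = ⨆ τ ∈ I, ‖mkData (U τ) (V τ)‖ₑ := by
  unfold fNorm
  refine iSup_congr fun τ => iSup_congr fun hτ => ?_
  rw [enorm_VL2]
  simp only [h.eq τ hτ, h.timeDeriv_eq hm hI hne hτ, sobNorm_hatT hm, Fintype.sum_sum_type, mkData]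
  rw [add_assoc]

theorem PathRep.continuousOn_mkData {r : ℕ} {m s : ℝ} {I : Set ℝ} {u : FieldPath n d₁ d₂}
    {U V : ℝ → Idx d₁ d₂ → L2 n} (h : PathRep r m s I u U V) :
    ContinuousOn (fun t => mkData (U t) (V t)) I := by
  have h1 : ContinuousOn (fun t k => mkData (U t) (V t) k) I := by
    rw [continuousOn_pi]
    rintro (i | j | j)
    · exact h.cont _
    · exact h.cont _
    · exact h.cont_deriv _
  exact (PiLp.continuousLinearEquiv 1 ℂ
    (fun _ : DIdx d₁ d₂ => L2 n)).symm.continuous.comp_continuousOn h1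

/-! ### Space-time test functions -/

section Slices

variable {I : Set ℝ}

theorem slice_apply (ψ : 𝓓(slab n I, ℂ)) (t : ℝ) (x : Sp n) : slice ψ t x = ψ (t, x) := rfl

theorem lineDeriv_testFunction_apply (ψ : 𝓓(slab n I, ℂ)) (v p : ℝ × Sp n) :
    (∂_{v} ψ) p = fderiv ℝ ψ p v := by
  rw [TestFunction.lineDerivOp_eq_lineDerivCLM ℝ, TestFunction.lineDerivCLM_apply_of_le (by simp)]
  exact ((ψ.contDiff.differentiable (by simp)) p).lineDeriv_eq_fderiv

theorem hasFDerivAt_testFunction (ψ : 𝓓(slab n I, ℂ)) (p : ℝ × Sp n) :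
    HasFDerivAt ψ (fderiv ℝ ψ p) p :=
  (ψ.contDiff.differentiable (by simp) p).hasFDerivAt

theorem slice_lineDeriv (ψ : 𝓓(slab n I, ℂ)) (t : ℝ) (v : Sp n) :
    slice (∂_{((0 : ℝ), v)} ψ) t = ∂_{v} (slice ψ t) := by
  ext x
  rw [slice_apply, lineDeriv_testFunction_apply, SchwartzMap.lineDerivOp_apply_eq_fderiv]
  have h1 : HasFDerivAt (fun y : Sp n => (t, y)) (ContinuousLinearMap.inr ℝ ℝ (Sp n)) x :=
    hasFDerivAt_prodMk_right t x
  have h2 := (hasFDerivAt_testFunction ψ (t, x)).comp x h1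
  have h3 : HasFDerivAt (slice ψ t) _ x := h2
  rw [h3.fderiv]
  simp

theorem two_le_infty : (2 : WithTop ℕ∞) ≤ ((⊤ : ℕ∞) : WithTop ℕ∞) :=
  WithTop.coe_le_coe.2 (le_top : (2 : ℕ∞) ≤ ⊤)

theorem lineDeriv_testFunction_comm (ψ : 𝓓(slab n I, ℂ)) (v w : ℝ × Sp n) :
    ∂_{v} (∂_{w} ψ) = ∂_{w} (∂_{v} ψ) := by
  have h : ∀ (v w p : ℝ × Sp n), (∂_{v} (∂_{w} ψ)) p = fderiv ℝ (fderiv ℝ ψ) p v w := by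
    intro v w p
    rw [lineDeriv_testFunction_apply]
    have h1 : ⇑(∂_{w} ψ : 𝓓(slab n I, ℂ)) = fun q => fderiv ℝ ψ q w := by
      funext q; exact lineDeriv_testFunction_apply ψ w q
    have h2 : DifferentiableAt ℝ (fderiv ℝ ψ) p :=
      (ψ.contDiff.fderiv_right (m := 1) (by
        rw [one_add_one_eq_two]; exact two_le_infty)).differentiable (by simp) p
    rw [h1, fderiv_clm_apply h2 (differentiableAt_const w)]
    simp
  ext p
  rw [h, h]
  exact (ψ.contDiff.contDiffAt.isSymmSndFDerivAt (by simpa using two_le_infty)) v w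

/-- The operator `m² - Δ` on space-time test functions. -/
def besselT (m : ℝ) (ψ : 𝓓(slab n I, ℂ)) : 𝓓(slab n I, ℂ) :=
  (m ^ 2) • ψ - ∑ k : Fin n, ∂_{((0 : ℝ), basisVec k)} (∂_{((0 : ℝ), basisVec k)} ψ)

theorem slice_sub (ψ ψ' : 𝓓(slab n I, ℂ)) (t : ℝ) : slice (ψ - ψ') t = slice ψ t - slice ψ' t := by
  ext x; rfl

theorem slice_add (ψ ψ' : 𝓓(slab n I, ℂ)) (t : ℝ) : slice (ψ + ψ') t = slice ψ t + slice ψ' t := by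
  ext x; rfl

theorem slice_zero (t : ℝ) : slice (0 : 𝓓(slab n I, ℂ)) t = 0 := by
  ext x; rfl

theorem slice_sum {ι : Type*} (s : Finset ι) (ψ : ι → 𝓓(slab n I, ℂ)) (t : ℝ) :
    slice (∑ i ∈ s, ψ i) t = ∑ i ∈ s, slice (ψ i) t := by
  classical
  induction s using Finset.induction_on with
  | empty => simpa using slice_zero t
  | insert a s ha ih => rw [Finset.sum_insert ha, Finset.sum_insert ha, slice_add, ih]

theorem slice_besselT (m : ℝ) (ψ : 𝓓(slab n I, ℂ)) (t : ℝ) :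
    slice (besselT m ψ) t = bessel m (slice ψ t) := by
  rw [besselT, slice_sub, slice_sum]
  simp only [slice_lineDeriv]
  change _ = ((m ^ 2 : ℝ) : ℂ) • slice ψ t - _
  congr 1

theorem slice_besselT_iterate (m : ℝ) (k : ℕ) (ψ : 𝓓(slab n I, ℂ)) (t : ℝ) :
    slice ((besselT m)^[k] ψ) t = (bessel m ^ k) (slice ψ t) := by
  induction k with
  | zero => simp
  | succ k ih =>
    rw [Function.iterate_succ_apply', slice_besselT, ih, pow_succ', Module.End.mul_apply]

theorem lineDeriv_besselT (m : ℝ) (ψ : 𝓓(slab n I, ℂ)) (v : ℝ × Sp n) :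
    ∂_{v} (besselT m ψ) = besselT m (∂_{v} ψ) := by
  have h1 : ∀ φ : 𝓓(slab n I, ℂ), ∂_{v} φ = LineDeriv.lineDerivOpCLM ℝ 𝓓(slab n I, ℂ) v φ :=
    fun _ => rfl
  rw [besselT, h1, map_sub, map_smul, map_sum]
  simp only [← h1]
  rw [besselT]
  congr 1
  refine Finset.sum_congr rfl fun k _ => ?_
  rw [lineDeriv_testFunction_comm, lineDeriv_testFunction_comm ψ v]

theorem lineDeriv_besselT_iterate (m : ℝ) (k : ℕ) (ψ : 𝓓(slab n I, ℂ)) (v : ℝ × Sp n) :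
    ∂_{v} ((besselT m)^[k] ψ) = (besselT m)^[k] (∂_{v} ψ) := by
  induction k with
  | zero => rfl
  | succ k ih => rw [Function.iterate_succ_apply', Function.iterate_succ_apply', lineDeriv_besselT, ih]

theorem isMult_slice (ψ : 𝓓(slab n I, ℂ)) : ∃ C, ∀ t, ∀ η : Sp n, ‖ψ (t, η)‖ ≤ C := by
  obtain ⟨C, hC⟩ := ψ.hasCompactSupport.exists_bound_of_continuous ψ.continuous
  exact ⟨C, fun t η => hC _⟩

/-- All slices are supported in one compact set, the projection of the support of `ψ`. Each is
therefore a bounded multiplier applied to the indicator function of this set, and derivatives of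
multipliers are already under control. -/
theorem hasDerivAt_toLp_slice (ψ : 𝓓(slab n I, ℂ)) (t : ℝ) :
    HasDerivAt (fun τ => ((slice ψ τ).toLp 2 : L2 n)) ((slice (∂_{e₀ n} ψ) t).toLp 2) t := by
  have hK : IsCompact (Prod.snd '' tsupport ψ) := ψ.hasCompactSupport.isCompact.image continuous_snd
  let o : L2 n := indicatorConstLp 2 hK.measurableSet hK.measure_lt_top.ne (1 : ℂ)
  have hd : ∀ t (η : Sp n), HasDerivAt (fun s => ψ (s, η)) ((∂_{e₀ n} ψ) (t, η)) t := by
    intro t η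
    rw [lineDeriv_testFunction_apply]
    have h1 : HasDerivAt (fun s : ℝ => (s, η)) (e₀ n) t :=
      (hasDerivAt_id t).prodMk (hasDerivAt_const t η)
    exact (hasFDerivAt_testFunction ψ (t, η)).comp_hasDerivAt t h1
  have hz : ∀ t (η : Sp n), η ∉ Prod.snd '' tsupport ψ → ψ (t, η) = 0 := by
    intro t η h
    by_contra hne
    exact h ⟨(t, η), subset_tsupport _ hne, rfl⟩
  have hz' : ∀ t (η : Sp n), η ∉ Prod.snd '' tsupport ψ → (∂_{e₀ n} ψ) (t, η) = 0 := by
    intro t η h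
    have h1 := hd t η
    have h2 : (fun s => ψ (s, η)) = fun _ => 0 := by
      funext s; exact hz s η h
    rw [h2] at h1
    exact h1.unique (hasDerivAt_const _ _)
  have hm : ∀ (φ : 𝓓(slab n I, ℂ)) t, IsMult fun η => φ (t, η) := fun φ t =>
    IsMult.of_continuous (φ.continuous.comp (by fun_prop)) fun η => (isMult_slice φ).choose_spec t η
  have he : ∀ (φ : 𝓓(slab n I, ℂ)) t, (∀ η, η ∉ Prod.snd '' tsupport ψ → φ (t, η) = 0) →
      ((slice φ t).toLp 2 : L2 n) = mulOp (fun η => φ (t, η)) o := by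
    intro φ t h
    apply Lp.ext
    have e1 := indicatorConstLp_coeFn (p := 2) (hs := hK.measurableSet)
      (hμs := (hK.measure_lt_top (μ := (volume : Measure (Sp n)))).ne) (c := (1 : ℂ))
    filter_upwards [(slice φ t).coeFn_toLp 2 volume, coeFn_mulOp (hm φ t) o, e1] with η h1 h2 h3
    rw [h1, h2, h3, slice_apply]
    by_cases hη : η ∈ Prod.snd '' tsupport ψ
    · rw [Set.indicator_of_mem hη, mul_one]
    · rw [h η hη, zero_mul]
  have e1 : (fun τ => ((slice ψ τ).toLp 2 : L2 n)) = fun τ => mulOp (fun η => ψ (τ, η)) o := by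
    funext τ; exact he ψ τ (hz τ)
  rw [e1, he _ t (hz' t)]
  -- One-by-one matrices, so that `hasDerivAt_matOp` applies to a single multiplier.
  let O : VL2 n Unit := WithLp.toLp 1 fun _ => o
  have h := hasDerivAt_matOp (ι := Unit) (κ := Unit)
    (β := fun t η => Matrix.of fun _ _ => ψ (t, η))
    (β' := fun t η => Matrix.of fun _ _ => (∂_{e₀ n} ψ : 𝓓(slab n I, ℂ)) (t, η))
    (C := fun _ => (isMult_slice (∂_{e₀ n} ψ)).choose) (fun t _ _ => hm ψ t)
    (fun t _ _ => hm (∂_{e₀ n} ψ) t) monotone_const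
    (fun t η _ _ => (isMult_slice (∂_{e₀ n} ψ)).choose_spec t η) (fun t η _ _ => hd t η) O t
  have h2 := ((PiLp.proj 1 (fun _ : Unit => L2 n) () : _ →L[ℂ] L2 n).restrictScalars
    ℝ).hasFDerivAt.comp_hasDerivAt t h
  have e2 : ∀ b : Sp n → ℂ,
      matOp (fun η => (Matrix.of fun _ _ => b η : Matrix Unit Unit ℂ)) O () = mulOp b o := fun b => by
    rw [matOp_apply]; simp [O]
  refine (h2.congr_deriv (e2 _)).congr_of_eventuallyEq (Eventually.of_forall fun τ => ?_)
  exact (e2 _).symm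

/-- The set of the times at which a test function is not locally zero. -/
def timeSupport (ψ : 𝓓(slab n I, ℂ)) : Set ℝ := Prod.fst '' tsupport ψ

theorem isCompact_timeSupport (ψ : 𝓓(slab n I, ℂ)) : IsCompact (timeSupport ψ) :=
  ψ.hasCompactSupport.isCompact.image continuous_fst

theorem timeSupport_subset (ψ : 𝓓(slab n I, ℂ)) : timeSupport ψ ⊆ interior I := by
  rintro t ⟨p, hp, rfl⟩
  exact (ψ.tsupport_subset hp).1

theorem slice_eq_zero (ψ : 𝓓(slab n I, ℂ)) {t : ℝ} (ht : t ∉ timeSupport ψ) : slice ψ t = 0 := by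
  ext x
  rw [slice_apply]
  by_contra hne
  exact ht ⟨(t, x), subset_tsupport _ hne, rfl⟩

theorem slice_lineDeriv_eq_zero (ψ : 𝓓(slab n I, ℂ)) (v : ℝ × Sp n) {t : ℝ}
    (ht : t ∉ timeSupport ψ) : slice (∂_{v} ψ) t = 0 := by
  ext x
  rw [slice_apply, lineDeriv_testFunction_apply]
  have : (t, x) ∉ tsupport ψ := fun h => ht ⟨_, h, rfl⟩
  have h2 : (t, x) ∉ tsupport (fderiv ℝ ψ) := fun h => this (tsupport_fderiv_subset ℝ h)
  rw [image_eq_zero_of_notMem_tsupport h2]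
  rfl

theorem isBoundedBilinearMap_pair2 :
    IsBoundedBilinearMap ℝ fun p : L2 n × L2 n => pair2 p.1 p.2 :=
  (pair2.bilinearRestrictScalars ℝ).isBoundedBilinearMap

/-- The product rule for the `L²` pairing of `hatT_eq_pair2`; the powers of `m² - Δ` commute with
restriction to a time and with the time derivative. -/
theorem hasDerivAt_hatT_slice {m : ℝ} (hm : 0 < m) (σ : ℝ) {A : ℝ → L2 n} {B : L2 n} {t : ℝ}
    (hA : HasDerivAt A B t) (ψ : 𝓓(slab n I, ℂ)) :
    HasDerivAt (fun τ => hatT m σ (A τ) (slice ψ τ))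
      (hatT m σ B (slice ψ t) + hatT m σ (A t) (slice (∂_{e₀ n} ψ) t)) t := by
  have h1 := hasDerivAt_toLp_slice ((besselT m)^[bOrd σ] ψ) t
  have h2 : HasDerivAt (fun τ => sobPrim m σ (A τ)) (sobPrim m σ B) t :=
    ((sobPrim m σ).restrictScalars ℝ).hasFDerivAt.comp_hasDerivAt t hA
  have hb := isBoundedBilinearMap_pair2 (n := n)
  have h3 := (hb.hasFDerivAt _).comp_hasDerivAt t (h1.prodMk h2)
  rw [lineDeriv_besselT_iterate] at h3
  simp only [slice_besselT_iterate] at h3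
  simp only [hatT_eq_pair2 hm]
  exact h3

theorem continuousOn_pair2 {a b : ℝ → L2 n} {J : Set ℝ} (ha : ContinuousOn a J)
    (hb : ContinuousOn b J) : ContinuousOn (fun t => pair2 (a t) (b t)) J :=
  (pair2.continuous.comp_continuousOn ha).clm_apply hb

theorem continuousOn_hatT_slice {m : ℝ} (hm : 0 < m) (σ : ℝ) {A : ℝ → L2 n} {J : Set ℝ}
    (hA : ContinuousOn A J) (ψ : 𝓓(slab n I, ℂ)) :
    ContinuousOn (fun τ => hatT m σ (A τ) (slice ψ τ)) J := by
  have h2 : ContinuousOn (fun τ => sobPrim m σ (A τ)) J :=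
    (sobPrim m σ).continuous.comp_continuousOn hA
  simp only [hatT_eq_pair2 hm]
  generalize bOrd σ = k
  simp only [← slice_besselT_iterate]
  have h1 : Continuous fun τ => ((slice ((besselT m)^[k] ψ) τ).toLp 2 : L2 n) :=
    continuous_iff_continuousAt.2 fun t => (hasDerivAt_toLp_slice _ t).continuousAt
  exact continuousOn_pair2 h1.continuousOn h2

theorem integrable_of_continuousOn_timeSupport (ψ : 𝓓(slab n I, ℂ)) {f : ℝ → ℂ}
    (hf : ContinuousOn f (interior I)) (h0 : ∀ t ∉ timeSupport ψ, f t = 0) : Integrable f := by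
  have h1 : Function.support f ⊆ timeSupport ψ := fun t ht => by
    by_contra h
    exact ht (h0 t h)
  rw [← integrableOn_iff_integrable_of_support_subset h1]
  exact (hf.mono (timeSupport_subset ψ)).integrableOn_compact (isCompact_timeSupport ψ)

theorem integrable_hatT_slice {m : ℝ} (hm : 0 < m) (σ : ℝ) {A : ℝ → L2 n}
    (hA : ContinuousOn A I) (ψ : 𝓓(slab n I, ℂ)) :
    Integrable fun τ => hatT m σ (A τ) (slice ψ τ) :=
  integrable_of_continuousOn_timeSupport ψ
    (continuousOn_hatT_slice hm σ (hA.mono interior_subset) ψ) fun t ht => by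
      rw [slice_eq_zero ψ ht, map_zero]

/-- Integration by parts: the pairing of `A` with the slices of `ψ` is differentiable on the whole
line, compactly supported in time, and the integral of its derivative vanishes. -/
theorem integral_hatT_slice_deriv {m : ℝ} (hm : 0 < m) (σ : ℝ) {A B : ℝ → L2 n}
    (hA : ∀ t ∈ interior I, HasDerivAt A (B t) t) (hAc : ContinuousOn A I) (hB : ContinuousOn B I)
    (ψ : 𝓓(slab n I, ℂ)) :
    ∫ t, hatT m σ (A t) (slice (∂_{e₀ n} ψ) t) = -∫ t, hatT m σ (B t) (slice ψ t) := by
  have i1 := integrable_hatT_slice hm σ hB ψ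
  have i2 := integrable_hatT_slice hm σ hAc (∂_{e₀ n} ψ)
  have i3 := integrable_hatT_slice hm σ hAc ψ
  have h : ∀ t, HasDerivAt (fun τ => hatT m σ (A τ) (slice ψ τ))
      (hatT m σ (B t) (slice ψ t) + hatT m σ (A t) (slice (∂_{e₀ n} ψ) t)) t := by
    intro t
    by_cases ht : t ∈ interior I
    · exact hasDerivAt_hatT_slice hm σ (hA t ht) ψ
    · have ht' : t ∉ timeSupport ψ := fun h => ht (timeSupport_subset ψ h)
      rw [slice_eq_zero ψ ht', slice_lineDeriv_eq_zero ψ _ ht', map_zero, map_zero, add_zero]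
      refine (hasDerivAt_const t (0 : ℂ)).congr_of_eventuallyEq ?_
      filter_upwards [(isCompact_timeSupport ψ).isClosed.isOpen_compl.mem_nhds ht'] with τ hτ
      rw [slice_eq_zero ψ hτ, map_zero]
  have h0 := integral_eq_zero_of_hasDerivAt_of_integrable h (i1.add i2) i3
  rw [integral_add i1 i2] at h0
  linear_combination h0

/-- The test function `(t, x) ↦ χ(t) g(x)`. -/
def tensorTest {χ : ℝ → ℝ} (hχ : ContDiff ℝ ((⊤ : ℕ∞) : WithTop ℕ∞) χ) (hχc : HasCompactSupport χ)
    (hχs : tsupport χ ⊆ interior I) {g : Sp n → ℂ} (hg : ContDiff ℝ ((⊤ : ℕ∞) : WithTop ℕ∞) g)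
    (hgc : HasCompactSupport g) : 𝓓(slab n I, ℂ) :=
  have hsub : tsupport (fun p : ℝ × Sp n => (χ p.1 : ℂ) * g p.2) ⊆ tsupport χ ×ˢ tsupport g := by
    refine closure_minimal ?_ ((isClosed_tsupport χ).prod (isClosed_tsupport g))
    intro p hp
    rw [Function.mem_support] at hp
    refine ⟨subset_tsupport _ fun h => hp ?_, subset_tsupport _ fun h => hp ?_⟩
    · rw [h]; simp
    · rw [h]; simp
  { toFun := fun p => (χ p.1 : ℂ) * g p.2
    contDiff' := (Complex.ofRealCLM.contDiff.comp (hχ.comp contDiff_fst)).mul (hg.comp contDiff_snd)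
    hasCompactSupport' := HasCompactSupport.of_support_subset_isCompact (hχc.isCompact.prod hgc.isCompact)
      ((subset_tsupport _).trans hsub)
    tsupport_subset' := hsub.trans fun _ hp => ⟨hχs hp.1, mem_univ _⟩ }

theorem slice_tensorTest {χ : ℝ → ℝ} (hχ : ContDiff ℝ ((⊤ : ℕ∞) : WithTop ℕ∞) χ)
    (hχc : HasCompactSupport χ) (hχs : tsupport χ ⊆ interior I) {g : Sp n → ℂ}
    (hg : ContDiff ℝ ((⊤ : ℕ∞) : WithTop ℕ∞) g) (hgc : HasCompactSupport g) (t : ℝ) :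
    slice (tensorTest hχ hχc hχs hg hgc) t = (χ t : ℂ) • hgc.toSchwartzMap hg := by
  ext x; rfl

theorem slice_deriv_tensorTest {χ : ℝ → ℝ} (hχ : ContDiff ℝ ((⊤ : ℕ∞) : WithTop ℕ∞) χ)
    (hχc : HasCompactSupport χ) (hχs : tsupport χ ⊆ interior I) {g : Sp n → ℂ}
    (hg : ContDiff ℝ ((⊤ : ℕ∞) : WithTop ℕ∞) g) (hgc : HasCompactSupport g) (t : ℝ) :
    slice (∂_{e₀ n} (tensorTest hχ hχc hχs hg hgc)) t =
      ((deriv χ t : ℝ) : ℂ) • hgc.toSchwartzMap hg := by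
  ext x
  rw [slice_apply, lineDeriv_testFunction_apply]
  have h1 : HasDerivAt (fun s : ℝ => (s, x)) (e₀ n) t :=
    (hasDerivAt_id t).prodMk (hasDerivAt_const t x)
  have h2 := (hasFDerivAt_testFunction (tensorTest hχ hχc hχs hg hgc) (t, x)).comp_hasDerivAt t h1
  have h3 : HasDerivAt (fun s : ℝ => (χ s : ℂ) * g x) (((deriv χ t : ℝ) : ℂ) * g x) t :=
    ((hχ.differentiable (by simp) t).hasDerivAt.ofReal_comp).mul_const _
  exact h2.unique h3

end Slices

/-! ### Density of the test functions -/

/-- The product `φ(ε ·) g`. -/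
def cutoff (φ : 𝓢(Sp n, ℂ)) (ε : ℝ) (g : 𝓢(Sp n, ℂ)) : 𝓢(Sp n, ℂ) :=
  SchwartzMap.smulLeftCLM ℂ (fun x => φ (ε • x)) g

theorem cutoff_apply (φ : 𝓢(Sp n, ℂ)) (ε : ℝ) (g : 𝓢(Sp n, ℂ)) (x : Sp n) :
    cutoff φ ε g x = φ (ε • x) * g x := by
  have h2 : Function.HasTemperateGrowth (fun x : Sp n => ε • x) :=
    (ε • ContinuousLinearMap.id ℝ (Sp n)).hasTemperateGrowth
  have h : Function.HasTemperateGrowth (fun x : Sp n => φ (ε • x)) :=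
    φ.hasTemperateGrowth.comp h2
  rw [cutoff, SchwartzMap.smulLeftCLM_apply_apply h, smul_eq_mul]

theorem lineDeriv_cutoff (φ : 𝓢(Sp n, ℂ)) (ε : ℝ) (g : 𝓢(Sp n, ℂ)) (v : Sp n) :
    ∂_{v} (cutoff φ ε g) = cutoff φ ε (∂_{v} g) + (ε : ℂ) • cutoff (∂_{v} φ) ε g := by
  ext x
  rw [SchwartzMap.lineDerivOp_apply_eq_fderiv, add_apply, smul_apply, cutoff_apply, cutoff_apply,
    SchwartzMap.lineDerivOp_apply_eq_fderiv, SchwartzMap.lineDerivOp_apply_eq_fderiv]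
  have h1 : HasFDerivAt (fun y : Sp n => ε • y) (ε • ContinuousLinearMap.id ℝ (Sp n)) x :=
    (hasFDerivAt_id x).const_smul ε
  have h2 := (φ.hasFDerivAt (ε • x)).comp x h1
  have h3 := h2.mul (g.hasFDerivAt x)
  have h4 : (cutoff φ ε g : Sp n → ℂ) = (⇑φ ∘ fun y : Sp n => ε • y) * ⇑g := by
    funext y; exact cutoff_apply φ ε g y
  rw [h4, h3.fderiv]
  simp only [add_apply, smul_apply, Function.comp_apply,
    ContinuousLinearMap.comp_apply, ContinuousLinearMap.id_apply, map_smul, smul_eq_mul,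
    Complex.real_smul]
  ring

/-- The operators compatible with the approximation by cutoffs. -/
def CutoffGood (T : 𝓢(Sp n, ℂ) →ₗ[ℂ] 𝓢(Sp n, ℂ)) : Prop := ∀ φ g : 𝓢(Sp n, ℂ),
  Tendsto (fun ε : ℝ => ((T (cutoff φ ε g)).toLp 2 volume : L2 n)) (𝓝 0) (𝓝 (φ 0 • (T g).toLp 2 volume))

theorem toLp_add' (f g : 𝓢(Sp n, ℂ)) : ((f + g).toLp 2 volume : L2 n) = f.toLp 2 volume + g.toLp 2 volume :=
  map_add (SchwartzMap.toLpCLM ℂ ℂ 2 (volume : Measure (Sp n))) f g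

theorem toLp_sub' (f g : 𝓢(Sp n, ℂ)) : ((f - g).toLp 2 volume : L2 n) = f.toLp 2 volume - g.toLp 2 volume :=
  map_sub (SchwartzMap.toLpCLM ℂ ℂ 2 (volume : Measure (Sp n))) f g

theorem toLp_smul' (z : ℂ) (g : 𝓢(Sp n, ℂ)) : ((z • g).toLp 2 volume : L2 n) = z • g.toLp 2 volume :=
  map_smul (SchwartzMap.toLpCLM ℂ ℂ 2 (volume : Measure (Sp n))) z g

theorem toLp_sum' {ι : Type*} (s : Finset ι) (g : ι → 𝓢(Sp n, ℂ)) :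
    ((∑ i ∈ s, g i).toLp 2 volume : L2 n) = ∑ i ∈ s, (g i).toLp 2 volume :=
  map_sum (SchwartzMap.toLpCLM ℂ ℂ 2 (volume : Measure (Sp n))) g s

theorem cutoffGood_one : CutoffGood (1 : 𝓢(Sp n, ℂ) →ₗ[ℂ] 𝓢(Sp n, ℂ)) := by
  intro φ g
  obtain ⟨C, hC⟩ := φ.toBoundedContinuousFunction.isBounded_range.exists_norm_le
  have hb : ∀ x, ‖φ x‖ ≤ C := fun x => hC _ ⟨x, rfl⟩
  have hm : ∀ ε : ℝ, IsMult fun x : Sp n => φ (ε • x) := fun ε =>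
    IsMult.of_continuous (φ.continuous.comp (by fun_prop)) fun x => hb _
  have h1 : ∀ ε : ℝ, (((1 : 𝓢(Sp n, ℂ) →ₗ[ℂ] 𝓢(Sp n, ℂ)) (cutoff φ ε g)).toLp 2 volume : L2 n) =
      mulOp (fun x => φ (ε • x)) (g.toLp 2 volume) := by
    intro ε
    apply Lp.ext
    filter_upwards [(cutoff φ ε g).coeFn_toLp 2 volume, g.coeFn_toLp 2 volume,
      coeFn_mulOp (hm ε) (g.toLp 2 volume)] with x e1 e2 e3
    rw [e3, e2]
    exact e1.trans (cutoff_apply φ ε g x)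
  have h2 : φ 0 • ((1 : 𝓢(Sp n, ℂ) →ₗ[ℂ] 𝓢(Sp n, ℂ)) g).toLp 2 volume =
      mulOp (fun _ => φ 0) (g.toLp 2 volume : L2 n) := by
    apply Lp.ext
    filter_upwards [Lp.coeFn_smul (φ 0) (g.toLp 2 volume : L2 n),
      coeFn_mulOp (IsMult.const (φ 0)) (g.toLp 2 volume)] with x e1 e2
    rw [e2]
    exact e1
  rw [h2]
  refine Tendsto.congr (fun ε => (h1 ε).symm) ?_
  refine tendsto_mulOp (C := C) hm (IsMult.const _) (Eventually.of_forall fun ε x => hb _) ?_ _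
  intro x
  have : Continuous fun ε : ℝ => φ (ε • x) := φ.continuous.comp (by fun_prop)
  simpa using this.tendsto 0

/-- By the Leibniz rule, a derivative that falls on `φ(ε ·)` produces a factor `ε` and another
cutoff of the same kind. As `CutoffGood` quantifies over all `φ`, that term is `ε` times a
convergent one and disappears in the limit. -/
theorem cutoffGood_mul_bessel {T : 𝓢(Sp n, ℂ) →ₗ[ℂ] 𝓢(Sp n, ℂ)} (hT : CutoffGood T) (m : ℝ) :
    CutoffGood (T * bessel m) := by
  have hd : ∀ {T : 𝓢(Sp n, ℂ) →ₗ[ℂ] 𝓢(Sp n, ℂ)}, CutoffGood T → ∀ v : Sp n, CutoffGood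
      (T * (LineDeriv.lineDerivOpCLM ℂ 𝓢(Sp n, ℂ) v : 𝓢(Sp n, ℂ) →ₗ[ℂ] 𝓢(Sp n, ℂ))) := by
    intro T hT v φ g
    have h1 := hT φ (∂_{v} g)
    have h2 : Tendsto (fun ε : ℝ => (ε : ℂ) • ((T (cutoff (∂_{v} φ) ε g)).toLp 2 volume : L2 n)) (𝓝 0)
        (𝓝 (((0 : ℝ) : ℂ) • ((∂_{v} φ) 0 • ((T g).toLp 2 volume : L2 n)))) :=
      (Complex.continuous_ofReal.tendsto 0).smul (hT (∂_{v} φ) g)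
    have h3 := h1.add h2
    rw [Complex.ofReal_zero, zero_smul, add_zero] at h3
    refine h3.congr fun ε => ?_
    have e : T (∂_{v} (cutoff φ ε g)) =
        T (cutoff φ ε (∂_{v} g)) + (ε : ℂ) • T (cutoff (∂_{v} φ) ε g) := by
      rw [lineDeriv_cutoff, map_add, map_smul]
    rw [← toLp_smul', ← toLp_add', ← e]
    rfl
  intro φ g
  have h1 := (hT φ g).const_smul ((m ^ 2 : ℝ) : ℂ)
  have h2 := fun k : Fin n => hd (hd hT (basisVec k)) (basisVec k) φ g
  have h3 := h1.sub (tendsto_finsetSum Finset.univ fun k _ => h2 k)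
  have e : ∀ f : 𝓢(Sp n, ℂ), (((T * bessel m : 𝓢(Sp n, ℂ) →ₗ[ℂ] 𝓢(Sp n, ℂ)) f).toLp 2 volume : L2 n) =
      ((m ^ 2 : ℝ) : ℂ) • ((T f).toLp 2 volume : L2 n) -
        ∑ k : Fin n, ((T (∂_{basisVec k} (∂_{basisVec k} f))).toLp 2 volume : L2 n) := by
    intro f
    rw [← toLp_smul', ← toLp_sum', ← toLp_sub', ← map_smul, ← map_sum, ← map_sub]
    rfl
  rw [e, smul_sub, Finset.smul_sum, smul_comm]
  exact h3.congr fun ε => (e _).symm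

theorem cutoffGood_bessel_pow (m : ℝ) (k : ℕ) :
    CutoffGood (bessel m ^ k : 𝓢(Sp n, ℂ) →ₗ[ℂ] 𝓢(Sp n, ℂ)) := by
  induction k with
  | zero => exact cutoffGood_one
  | succ k ih =>
    rw [pow_succ]
    exact cutoffGood_mul_bessel ih m

/-- Vanishing on compactly supported test functions suffices: `φ(ε ·) g` tends to `g`, with `φ(0) =
1`, in the sense needed to pass to the limit in `hatT_eq_pair2`. -/
theorem eq_zero_of_hatT_apply {m : ℝ} (hm : 0 < m) {σ : ℝ} {e : L2 n}
    (h : ∀ (g : Sp n → ℂ) (hg : ContDiff ℝ ((⊤ : ℕ∞) : WithTop ℕ∞) g) (hc : HasCompactSupport g),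
      hatT m σ e (hc.toSchwartzMap hg) = 0) : e = 0 := by
  apply hatT_injective hm σ
  rw [map_zero]
  ext g
  let b : ContDiffBump (0 : Sp n) := ⟨1, 2, one_pos, one_lt_two⟩
  have hb : ContDiff ℝ ((⊤ : ℕ∞) : WithTop ℕ∞) fun x => ((b x : ℝ) : ℂ) :=
    Complex.ofRealCLM.contDiff.comp b.contDiff
  have hbc : HasCompactSupport fun x => ((b x : ℝ) : ℂ) :=
    b.hasCompactSupport.comp_left Complex.ofReal_zero
  let φ : 𝓢(Sp n, ℂ) := hbc.toSchwartzMap hb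
  have hφ : ∀ x, φ x = ((b x : ℝ) : ℂ) := fun x => rfl
  have hφ0 : φ 0 = 1 := by
    rw [hφ, b.one_of_mem_closedBall (Metric.mem_closedBall_self b.rIn_pos.le), Complex.ofReal_one]
  have h1 := cutoffGood_bessel_pow m (bOrd σ) φ g
  have h2 := ((pair2.flip (sobPrim m σ e)).continuous.tendsto _).comp h1
  rw [hφ0, one_smul] at h2
  have h3 : Tendsto (fun ε : ℝ => hatT m σ e (cutoff φ ε g)) (𝓝 0) (𝓝 (hatT m σ e g)) := by
    have h4 : hatT m σ e g = (pair2.flip (sobPrim m σ e)) (((bessel m ^ bOrd σ) g).toLp 2 volume) :=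
      hatT_eq_pair2 hm σ e g
    rw [h4]
    exact h2.congr fun ε => (hatT_eq_pair2 hm σ e _).symm
  have h5 : ∀ ε : ℝ, ε ≠ 0 → hatT m σ e (cutoff φ ε g) = 0 := by
    intro ε hε
    have hc : HasCompactSupport fun x => cutoff φ ε g x := by
      have h6 : HasCompactSupport fun x : Sp n => φ (ε • x) :=
        hbc.comp_homeomorph (Homeomorph.smulOfNeZero ε hε)
      have h7 : (fun x => cutoff φ ε g x) = fun x => φ (ε • x) * g x :=
        funext fun x => cutoff_apply φ ε g x
      rw [h7]
      exact h6.mul_right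
    have hg : ContDiff ℝ ((⊤ : ℕ∞) : WithTop ℕ∞) fun x => cutoff φ ε g x := (cutoff φ ε g).smooth ⊤
    have := h _ hg hc
    convert this using 2
    ext x; rfl
  -- The limit is taken through `ε ≠ 0`, since for `ε = 0` the cutoff is not compactly supported in
  -- general.
  have h6 : Tendsto (fun ε : ℝ => hatT m σ e (cutoff φ ε g)) (𝓝[≠] 0) (𝓝 0) :=
    tendsto_const_nhds.congr' (by
      filter_upwards [self_mem_nhdsWithin] with ε hε
      exact (h5 ε hε).symm)
  exact tendsto_nhds_unique (h3.mono_left nhdsWithin_le_nhds) h6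

/-! ### The lemma of du Bois-Reymond -/

theorem eq_zero_of_integral_smul_eq_zero {J : Set ℝ} (hJ : IsOpen J) {w : ℝ → ℂ}
    (hw : ContinuousOn w J) (h : ∀ χ : ℝ → ℝ, ContDiff ℝ ((⊤ : ℕ∞) : WithTop ℕ∞) χ →
      HasCompactSupport χ → tsupport χ ⊆ J → ∫ t, (χ t : ℂ) * w t = 0) : ∀ t ∈ J, w t = 0 := by
  have h1 := hJ.ae_eq_zero_of_integral_contDiff_smul_eq_zero (μ := volume)
    (hw.locallyIntegrableOn hJ.measurableSet) (fun χ hχ hc hs => by simpa using h χ hχ hc hs)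
  have h2 : w =ᵐ[volume.restrict J] fun _ => 0 := by
    rw [EventuallyEq, ae_restrict_iff' hJ.measurableSet]
    exact h1
  exact Measure.eqOn_open_of_ae_eq h2 hJ hw continuousOn_const

/-- The primitive that starts at the left end of the support vanishes to the left of it, and to the
right because the total integral is zero. -/
theorem exists_antideriv {J : Set ℝ} (hJ : J.OrdConnected) {χ : ℝ → ℝ}
    (hχ : ContDiff ℝ ((⊤ : ℕ∞) : WithTop ℕ∞) χ) (hc : HasCompactSupport χ) (hs : tsupport χ ⊆ J)
    (h0 : ∫ t, χ t = 0) : ∃ ω : ℝ → ℝ, ContDiff ℝ ((⊤ : ℕ∞) : WithTop ℕ∞) ω ∧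
      HasCompactSupport ω ∧ tsupport ω ⊆ J ∧ deriv ω = χ := by
  rcases (tsupport χ).eq_empty_or_nonempty with he | hne
  · rw [tsupport_eq_empty_iff] at he
    refine ⟨0, contDiff_const, HasCompactSupport.zero, by simp [tsupport], ?_⟩
    rw [he]
    funext t
    simp
  have hK := hc.isCompact
  set a := sInf (tsupport χ)
  set b := sSup (tsupport χ)
  have ha : a ∈ tsupport χ := hK.sInf_mem hne
  have hb : b ∈ tsupport χ := hK.sSup_mem hne
  have hsub : tsupport χ ⊆ Icc a b := fun t ht =>
    ⟨csInf_le hK.bddBelow ht, le_csSup hK.bddAbove ht⟩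
  have hz : ∀ t, t ∉ Icc a b → χ t = 0 := fun t ht =>
    image_eq_zero_of_notMem_tsupport fun h => ht (hsub h)
  let ω : ℝ → ℝ := fun t => ∫ x in a..t, χ x
  have hd : ∀ t, HasDerivAt ω (χ t) t := fun t => (hχ.continuous.integral_hasStrictDerivAt a t).hasDerivAt
  have hder : deriv ω = χ := funext fun t => (hd t).deriv
  have hω : ∀ t, t ∉ Icc a b → ω t = 0 := by
    intro t ht
    rcases not_and_or.1 ht with h | h
    · have : ∀ x ∈ uIcc a t, χ x = 0 ∨ x = a := by
        intro x hx
        rw [uIcc_of_ge (not_le.1 h).le] at hx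
        rcases hx.2.lt_or_eq with h' | h'
        · exact Or.inl (hz x fun h'' => absurd h''.1 (not_le.2 h'))
        · exact Or.inr h'
      refine intervalIntegral.integral_zero_ae ?_
      filter_upwards [compl_mem_ae_iff.2 (measure_singleton (μ := volume) a)] with x hx hx'
      exact (this x (uIoc_subset_uIcc hx')).resolve_right hx
    · have hlt := not_le.1 h
      rw [← h0]
      have hab : a ≤ b := (hsub ha).2
      have h2 : ∫ x in a..t, χ x = ∫ x in Ioc a t, χ x :=
        intervalIntegral.integral_of_le (hab.trans hlt.le)
      change ∫ x in a..t, χ x = _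
      rw [h2, ← integral_Icc_eq_integral_Ioc]
      refine setIntegral_eq_integral_of_forall_compl_eq_zero fun x hx => hz x fun h' => hx ?_
      exact ⟨h'.1, h'.2.trans hlt.le⟩
  have hts : tsupport ω ⊆ Icc a b := closure_minimal (fun t ht => by
    by_contra h
    exact ht (hω t h)) isClosed_Icc
  refine ⟨ω, ?_, HasCompactSupport.of_support_subset_isCompact isCompact_Icc
    ((subset_tsupport _).trans hts), hts.trans (hJ.out (hs ha) (hs hb)), hder⟩
  rw [contDiff_infty_iff_deriv, hder]
  exact ⟨fun t => (hd t).differentiableAt, hχ⟩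

/-- Subtracting from a test function the multiple of a fixed bump `χ₀` with the same integral leaves
the derivative of a test function. Hence `w` minus its `χ₀`-average is orthogonal to all test
functions. -/
theorem eq_of_integral_deriv_mul_eq_zero {J : Set ℝ} (hJ : IsOpen J) (hJc : J.OrdConnected)
    {w : ℝ → ℂ} (hw : ContinuousOn w J) (h : ∀ χ : ℝ → ℝ, ContDiff ℝ ((⊤ : ℕ∞) : WithTop ℕ∞) χ →
      HasCompactSupport χ → tsupport χ ⊆ J → ∫ t, ((deriv χ t : ℝ) : ℂ) * w t = 0) :
    ∀ s ∈ J, ∀ t ∈ J, w s = w t := by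
  intro s hs t ht
  obtain ⟨χ₀, h1, h2, h3, h4, h5⟩ := exists_contDiff_tsupport_subset (n := ⊤) (hJ.mem_nhds hs)
  have hi : ∀ χ : ℝ → ℝ, Continuous χ → HasCompactSupport χ → Integrable χ :=
    fun χ h h' => h.integrable_of_hasCompactSupport h'
  have hiw : ∀ χ : ℝ → ℝ, Continuous χ → HasCompactSupport χ → tsupport χ ⊆ J →
      Integrable fun t => (χ t : ℂ) * w t := by
    intro χ hχ hc hs
    have h1 : Function.support (fun t => (χ t : ℂ) * w t) ⊆ tsupport χ := fun t ht => by
      by_contra h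
      exact ht (by simp [image_eq_zero_of_notMem_tsupport h])
    rw [← integrableOn_iff_integrable_of_support_subset h1]
    refine ContinuousOn.integrableOn_compact hc.isCompact ?_
    exact (Complex.continuous_ofReal.comp hχ).continuousOn.mul (hw.mono hs)
  have hpos : 0 < ∫ x, χ₀ x := by
    refine integral_pos_of_integrable_nonneg_nonzero (x := s) h3.continuous (hi _ h3.continuous h2)
      (fun x => (h4 ⟨x, rfl⟩).1) ?_
    rw [h5]; exact one_ne_zero
  set I₀ := ∫ x, χ₀ x
  let c : ℂ := (I₀ : ℂ)⁻¹ * ∫ t, (χ₀ t : ℂ) * w t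
  have key : ∀ t ∈ J, w t - c = 0 := by
    refine eq_zero_of_integral_smul_eq_zero hJ (hw.sub continuousOn_const) ?_
    intro χ hχ hc hs
    let k : ℝ := (∫ x, χ x) / I₀
    have e0 : ContDiff ℝ ((⊤ : ℕ∞) : WithTop ℕ∞) fun t => χ t - k * χ₀ t :=
      hχ.sub (contDiff_const.mul h3)
    have ec : HasCompactSupport fun t => χ t - k * χ₀ t := hc.sub h2.mul_left
    have es : tsupport (fun t => χ t - k * χ₀ t) ⊆ J := by
      refine (tsupport_sub χ (fun t => k * χ₀ t)).trans (union_subset hs ?_)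
      refine (closure_mono fun t ht => ?_).trans h1
      exact fun h => ht (by simp [h])
    have ez : ∫ t, (χ t - k * χ₀ t) = 0 := by
      rw [integral_sub (hi _ hχ.continuous hc) ((hi _ h3.continuous h2).const_mul k),
        integral_const_mul]
      simp only [k]
      rw [div_mul_cancel₀ _ hpos.ne', sub_self]
    obtain ⟨ω, o1, o2, o3, o4⟩ := exists_antideriv hJc e0 ec es ez
    have e1 := h ω o1 o2 o3
    rw [o4] at e1
    have i1 := hiw χ hχ.continuous hc hs
    have i2 := hiw χ₀ h3.continuous h2 h1
    have e2 : (∫ t, (χ t : ℂ) * w t) - k * ∫ t, (χ₀ t : ℂ) * w t = 0 := by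
      rw [← integral_const_mul, ← integral_sub i1 (i2.const_mul _), ← e1]
      congr 1; ext t
      push_cast
      ring
    have i3 : Integrable fun t => (χ t : ℂ) * c := (hi _ hχ.continuous hc).ofReal.mul_const c
    have e3 : ∫ t, (χ t : ℂ) * (w t - c) = (∫ t, (χ t : ℂ) * w t) - (∫ t, (χ t : ℂ)) * c := by
      rw [← integral_mul_const, ← integral_sub i1 i3]
      congr 1; ext t
      ring
    rw [e3, integral_complex_ofReal, ← e2]
    simp only [c, k]
    push_cast
    ring
  have := key s hs
  have h' := key t ht
  rw [sub_eq_zero] at this h'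
  rw [this, h']

/-! ### Curves that vanish weakly -/

section WeakCurves

variable {I : Set ℝ}

theorem eqOn_of_interior {X : Type*} [TopologicalSpace X] [T2Space X] (hI : I.OrdConnected)
    (hne : (interior I).Nonempty) {f g : ℝ → X} (hf : ContinuousOn f I) (hg : ContinuousOn g I)
    (h : ∀ t ∈ interior I, f t = g t) : ∀ t ∈ I, f t = g t := by
  have hsub : I ⊆ closure (interior I) := by
    rw [(hI.convex : Convex ℝ I).closure_interior_eq_closure_of_nonempty_interior hne]
    exact subset_closure
  exact Set.EqOn.of_subset_closure (fun t ht => h t ht) hf hg interior_subset hsub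

theorem ordConnected_interior (hI : I.OrdConnected) : (interior I).OrdConnected :=
  hI.convex.interior.ordConnected

/-- Products `χ(t) g(x)` are enough: localizing in time gives vanishing against `g` at every
interior time, then varying `g` gives `A t = 0`. Continuity extends this to the endpoints. -/
theorem eq_zero_of_integral_slice {m : ℝ} (hm : 0 < m) (σ : ℝ) (hI : I.OrdConnected)
    (hne : (interior I).Nonempty) {A : ℝ → L2 n} (hA : ContinuousOn A I)
    (h : ∀ ψ : 𝓓(slab n I, ℂ), ∫ t, hatT m σ (A t) (slice ψ t) = 0) : ∀ t ∈ I, A t = 0 := by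
  refine eqOn_of_interior hI hne hA continuousOn_const fun t ht => ?_
  refine eq_zero_of_hatT_apply hm (σ := σ) fun g hg hc => ?_
  refine eq_zero_of_integral_smul_eq_zero isOpen_interior
    (w := fun t => hatT m σ (A t) (hc.toSchwartzMap hg))
    ((continuous_hatT_apply hm σ _).comp_continuousOn (hA.mono interior_subset)) ?_ t ht
  intro χ hχ hχc hχs
  have := h (tensorTest hχ hχc hχs hg hc)
  simpa only [slice_tensorTest, map_smul, smul_eq_mul] using this

theorem eq_of_integral_slice_deriv {m : ℝ} (hm : 0 < m) (σ : ℝ) (hI : I.OrdConnected)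
    (hne : (interior I).Nonempty) {A : ℝ → L2 n} (hA : ContinuousOn A I)
    (h : ∀ ψ : 𝓓(slab n I, ℂ), ∫ t, hatT m σ (A t) (slice (∂_{e₀ n} ψ) t) = 0) :
    ∀ s ∈ I, ∀ t ∈ I, A s = A t := by
  have h1 : ∀ s ∈ interior I, ∀ t ∈ interior I, A s = A t := by
    intro s hs t ht
    rw [← sub_eq_zero]
    refine eq_zero_of_hatT_apply hm (σ := σ) fun g hg hc => ?_
    rw [map_sub]
    refine sub_eq_zero.2 (eq_of_integral_deriv_mul_eq_zero isOpen_interior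
      (ordConnected_interior hI) (w := fun t => hatT m σ (A t) (hc.toSchwartzMap hg))
      ((continuous_hatT_apply hm σ _).comp_continuousOn (hA.mono interior_subset)) ?_ s hs t ht)
    intro χ hχ hχc hχs
    have := h (tensorTest hχ hχc hχs hg hc)
    simpa only [slice_deriv_tensorTest, map_smul, smul_eq_mul] using this
  obtain ⟨t₀, ht₀⟩ := hne
  have h2 := eqOn_of_interior hI ⟨t₀, ht₀⟩ hA (continuousOn_const (c := A t₀))
    fun t ht => h1 t ht t₀ ht₀
  intro s hs t ht
  rw [h2 s hs, h2 t ht]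

end WeakCurves

/-! ### Weak solutions as solutions of an evolution equation -/

theorem mulOp_smul {b : Sp n → ℂ} (hb : IsMult b) (z : ℂ) (f : L2 n) :
    mulOp (fun η => z * b η) f = z • mulOp b f := by
  apply Lp.ext
  filter_upwards [coeFn_mulOp hb f, coeFn_mulOp ((IsMult.const z).mul hb) f,
    Lp.coeFn_smul z (mulOp b f)] with η h1 h2 h3
  rw [h2, h3, Pi.smul_apply, h1, smul_eq_mul, mul_assoc]

/-- The weights of the source terms. -/
def srcWt (r : ℕ) (s : ℝ) : Idx d₁ d₂ → ℝ
  | Sum.inl _ => s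
  | Sum.inr _ => s - r

/-- The change of the Cauchy data that is due to a source term. -/
def srcData (L : EvolOp n d₁ d₂) (F : Idx d₁ d₂ → L2 n) : Data n d₁ d₂ :=
  WithLp.toLp 1 fun k => match k with
    | Sum.inl i => -∑ k, L.γC⁻¹ i k • F (Sum.inl k)
    | Sum.inr (Sum.inl _) => 0
    | Sum.inr (Sum.inr j) => -F (Sum.inr j)

theorem genOp_inl {L : EvolOp n d₁ d₂} {r : ℕ} {α μ₀ : ℝ} (hL : L.Admissible r α μ₀) {m : ℝ}
    (hm : 0 < m) (X : Data n d₁ d₂) (i : Fin d₁) : genOp L m r X (Sum.inl i) =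
      -∑ k, L.γC⁻¹ i k • ∑ j, polyOp m r (L.P₁ k j) (X (Sum.inl j)) := by
  have hb := fun k j => isMult_polyOp hm (hL.deg₁ k j)
  have h1 : ∀ j, mulOp (fun η => ((wt m (-r) η : ℂ) • gen L m r η) (Sum.inl i) (Sum.inl j))
      (X (Sum.inl j)) = ∑ k, (-L.γC⁻¹ i k) • polyOp m r (L.P₁ k j) (X (Sum.inl j)) := by
    intro j
    have e : (fun η => ((wt m (-r) η : ℂ) • gen L m r η) (Sum.inl i) (Sum.inl j)) =
        fun η => ∑ k, (-L.γC⁻¹ i k) * ((wt m (-(r : ℝ)) η : ℂ) * MvPolynomial.aeval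
          (fun l => Complex.I * ((((2 * Real.pi) • η) l : ℝ) : ℂ)) (L.P₁ k j)) := by
      funext η
      simp only [gen, Matrix.smul_apply, Matrix.fromBlocks_apply₁₁, Matrix.neg_apply,
        Matrix.mul_apply, symb, Matrix.map_apply, smul_eq_mul]
      rw [mul_neg, Finset.mul_sum, ← Finset.sum_neg_distrib]
      refine Finset.sum_congr rfl fun k _ => ?_
      ring
    rw [e, mulOp_sum _ fun k _ => (IsMult.const _).mul (hb k j)]
    exact Finset.sum_congr rfl fun k _ => mulOp_smul (hb k j) _ _
  have h2 : ∀ j, mulOp (fun η => ((wt m (-r) η : ℂ) • gen L m r η) (Sum.inl i) (Sum.inr j))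
      (X (Sum.inr j)) = 0 := by
    intro j
    have e : (fun η => ((wt m (-r) η : ℂ) • gen L m r η) (Sum.inl i) (Sum.inr j)) = fun _ => 0 := by
      funext η
      simp [gen]
    rw [e, mulOp_zero]
  rw [genOp, matOp_apply, Fintype.sum_sum_type]
  simp only [h1, h2, Finset.sum_const_zero, add_zero]
  rw [Finset.sum_comm, ← Finset.sum_neg_distrib]
  refine Finset.sum_congr rfl fun k _ => ?_
  rw [Finset.smul_sum, ← Finset.sum_neg_distrib]
  exact Finset.sum_congr rfl fun j _ => neg_smul _ _

theorem genOp_inr_inl {L : EvolOp n d₁ d₂} {r : ℝ} {m : ℝ}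
    (hm : 0 < m) (X : Data n d₁ d₂) (i : Fin d₂) :
    genOp L m r X (Sum.inr (Sum.inl i)) = X (Sum.inr (Sum.inr i)) := by
  rw [genOp, matOp_apply, Fintype.sum_sum_type, Fintype.sum_sum_type]
  have h1 : ∀ j, (fun η => ((wt m (-r) η : ℂ) • gen L m r η) (Sum.inr (Sum.inl i)) (Sum.inl j)) =
      fun _ => 0 := fun j => by
    funext η; simp [gen]
  have h2 : ∀ j, (fun η => ((wt m (-r) η : ℂ) • gen L m r η) (Sum.inr (Sum.inl i))
      (Sum.inr (Sum.inl j))) = fun _ => 0 := fun j => by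
    funext η; simp [gen]
  have h3 : ∀ j, (fun η => ((wt m (-r) η : ℂ) • gen L m r η) (Sum.inr (Sum.inl i))
      (Sum.inr (Sum.inr j))) = fun _ => (1 : Matrix (Fin d₂) (Fin d₂) ℂ) i j := fun j => by
    funext η
    simp only [gen, Matrix.smul_apply, Matrix.fromBlocks_apply₂₂, Matrix.fromBlocks_apply₁₂,
      smul_eq_mul]
    rw [← mul_assoc, ← Complex.ofReal_mul, wt_neg_mul hm, Complex.ofReal_one, one_mul]
  simp only [h1, h2, h3, mulOp_zero, Finset.sum_const_zero, zero_add]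
  rw [Finset.sum_eq_single i]
  · simp [mulOp_one]
  · intro j _ hj
    simp [Matrix.one_apply_ne' hj, mulOp_zero]
  · simp

theorem genOp_inr_inr {L : EvolOp n d₁ d₂} {r : ℕ} {α μ₀ : ℝ} (hL : L.Admissible r α μ₀) {m : ℝ}
    (hm : 0 < m) (X : Data n d₁ d₂) (i : Fin d₂) : genOp L m r X (Sum.inr (Sum.inr i)) =
      -∑ j, polyOp m (2 * r : ℕ) (L.P₂ i j) (X (Sum.inr (Sum.inl j))) := by
  rw [genOp, matOp_apply, Fintype.sum_sum_type, Fintype.sum_sum_type]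
  have h1 : ∀ j, (fun η => ((wt m (-r) η : ℂ) • gen L m r η) (Sum.inr (Sum.inr i)) (Sum.inl j)) =
      fun _ => 0 := fun j => by
    funext η; simp [gen]
  have h2 : ∀ j, (fun η => ((wt m (-r) η : ℂ) • gen L m r η) (Sum.inr (Sum.inr i))
      (Sum.inr (Sum.inr j))) = fun _ => 0 := fun j => by
    funext η; simp [gen]
  have h3 : ∀ j, (fun η => ((wt m (-r) η : ℂ) • gen L m r η) (Sum.inr (Sum.inr i))
      (Sum.inr (Sum.inl j))) = fun η => (-1) * ((wt m (-((2 * r : ℕ) : ℝ)) η : ℂ) *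
        MvPolynomial.aeval (fun l => Complex.I * ((((2 * Real.pi) • η) l : ℝ) : ℂ)) (L.P₂ i j)) :=
    fun j => by
      funext η
      have e : wt m (-((2 * r : ℕ) : ℝ)) η = wt m (-r) η * wt m (-r) η := by
        rw [← wt_add hm]; congr 1; push_cast; ring
      simp only [gen, Matrix.smul_apply, Matrix.fromBlocks_apply₂₂, Matrix.fromBlocks_apply₂₁,
        Matrix.neg_apply, symb, Matrix.map_apply, smul_eq_mul]
      rw [e]
      push_cast
      ring
  simp only [h1, h2, h3, mulOp_zero, Finset.sum_const_zero, zero_add, add_zero]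
  rw [← Finset.sum_neg_distrib]
  refine Finset.sum_congr rfl fun j _ => ?_
  rw [mulOp_smul (isMult_polyOp hm (hL.deg₂ i j)), neg_one_smul]
  rfl

theorem sum_smul_sum_smul {E : Type*} [AddCommGroup E] [Module ℂ E] {d : ℕ}
    {M N : Matrix (Fin d) (Fin d) ℂ} (h : M * N = 1) (v : Fin d → E) (i : Fin d) :
    ∑ k, M i k • ∑ j, N k j • v j = v i := by
  simp only [Finset.smul_sum, smul_smul]
  rw [Finset.sum_comm]
  simp only [← Finset.sum_smul]
  have : ∀ j, ∑ k, M i k * N k j = (1 : Matrix (Fin d) (Fin d) ℂ) i j := fun j => by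
    rw [← h, Matrix.mul_apply]
  simp only [this]
  rw [Finset.sum_eq_single i]
  · simp
  · intro j _ hj
    simp [Matrix.one_apply_ne' hj]
  · simp

theorem γC_mul_inv {L : EvolOp n d₁ d₂} {r : ℕ} {α μ₀ : ℝ} (hL : L.Admissible r α μ₀) :
    L.γC * L.γC⁻¹ = 1 ∧ L.γC⁻¹ * L.γC = 1 := by
  have h : IsUnit L.γC.det := by
    have h1 : L.γC = (Complex.ofRealHom).mapMatrix L.γ := rfl
    rw [h1, ← RingHom.map_det]
    exact hL.isUnit.map _
  exact ⟨Matrix.mul_nonsing_inv _ h, Matrix.nonsing_inv_mul _ h⟩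

theorem gamma_solve_iff {L : EvolOp n d₁ d₂} {r : ℕ} {α μ₀ : ℝ} (hL : L.Admissible r α μ₀)
    (V X : Fin d₁ → L2 n) : (∀ i, ∑ j, L.γC i j • V j + X i = 0) ↔
      ∀ i, V i = -∑ k, L.γC⁻¹ i k • X k := by
  obtain ⟨h1, h2⟩ := γC_mul_inv hL
  constructor
  · intro h i
    have h3 : ∀ k, X k = -∑ j, L.γC k j • V j := fun k => (neg_eq_of_add_eq_zero_right (h k)).symm
    simp only [h3, smul_neg, Finset.sum_neg_distrib, neg_neg]
    exact (sum_smul_sum_smul h2 V i).symm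
  · intro h i
    have h3 : ∑ j, L.γC i j • V j = -∑ j, L.γC i j • ∑ k, L.γC⁻¹ j k • X k := by
      rw [← Finset.sum_neg_distrib]
      refine Finset.sum_congr rfl fun j _ => ?_
      rw [h j, smul_neg]
    rw [h3, sum_smul_sum_smul h1, neg_add_cancel]

theorem hasDerivWithinAt_VL2 {ι : Type} [Fintype ι] {f : ℝ → VL2 n ι} {f' : VL2 n ι} {I : Set ℝ}
    {t : ℝ} : HasDerivWithinAt f f' I t ↔ ∀ i, HasDerivWithinAt (fun τ => f τ i) (f' i) I t := by
  constructor
  · intro h i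
    exact ((PiLp.proj 1 (fun _ : ι => L2 n) i : _ →L[ℂ] L2 n).restrictScalars
      ℝ).hasFDerivAt.comp_hasDerivWithinAt t h
  · intro h
    have h1 := hasDerivWithinAt_pi.2 h
    exact ((PiLp.continuousLinearEquiv 1 ℂ (fun _ : ι => L2 n)).symm.toContinuousLinearMap.restrictScalars
      ℝ).hasFDerivAt.comp_hasDerivWithinAt t h1

section WeakIff

variable {L : EvolOp n d₁ d₂} {r : ℕ} {α μ₀ m s : ℝ} {I : Set ℝ} {u f : FieldPath n d₁ d₂}
  {U V F : ℝ → Idx d₁ d₂ → L2 n}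

theorem PathRep.hasDerivAt_interior (h : PathRep r m s I u U V) {t : ℝ} (ht : t ∈ interior I)
    (i : Idx d₁ d₂) : HasDerivAt
      (fun τ => mulOp (fun η => (wt m (-(r : ℝ)) η : ℂ)) (U τ i)) (V t i) t :=
  (h.deriv t (interior_subset ht) i).hasDerivAt (mem_interior_iff_mem_nhds.1 ht)

/-- One integration by parts turns the weak equation into the pairing of `ψ` with a single
continuous curve in `H^{s-r}`, which annihilates all test functions iff it is zero. -/
theorem weak_fst_iff (hL : L.Admissible r α μ₀) (hm : 0 < m) (hI : I.OrdConnected)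
    (hne : (interior I).Nonempty) (h : PathRep r m s I u U V)
    (hf : ∀ t ∈ I, ∀ i, f t i = hatT m (srcWt r s i) (F t i))
    (hF : ∀ i, ContinuousOn (fun t => F t i) I) (i : Fin d₁) :
    (∀ ψ : 𝓓(slab n I, ℂ), ∫ t : ℝ, (-(∑ j, ((L.γ i j : ℝ) : ℂ) *
        u t (Sum.inl j) (slice (∂_{e₀ n} ψ) t))
      + (∑ j, polyD (L.P₁ i j) (u t (Sum.inl j)) (slice ψ t))
      + f t (Sum.inl i) (slice ψ t)) = 0) ↔
    ∀ t ∈ I, ∑ j, L.γC i j • V t (Sum.inl j) + (∑ j, polyOp m r (L.P₁ i j) (U t (Sum.inl j)) +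
      mulOp (fun η => (wt m (-(r : ℝ)) η : ℂ)) (F t (Sum.inl i))) = 0 := by
  set K := mulOp (fun η : Sp n => (wt m (-(r : ℝ)) η : ℂ))
  let X : ℝ → L2 n := fun t => ∑ j, polyOp m r (L.P₁ i j) (U t (Sum.inl j)) + K (F t (Sum.inl i))
  have hXc : ContinuousOn X I :=
    (continuousOn_finsetSum _ fun j _ => (polyOp m r (L.P₁ i j)).continuous.comp_continuousOn
      (h.cont _)).add (K.continuous.comp_continuousOn (hF _))
  have hVc : ContinuousOn (fun t => ∑ j, L.γC i j • V t (Sum.inl j)) I :=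
    continuousOn_finsetSum _ fun j _ =>
      (continuous_const_smul (L.γC i j)).comp_continuousOn (h.cont_deriv (Sum.inl j))
  have key : ∀ ψ : 𝓓(slab n I, ℂ), ∫ t : ℝ, (-(∑ j, ((L.γ i j : ℝ) : ℂ) *
        u t (Sum.inl j) (slice (∂_{e₀ n} ψ) t))
      + (∑ j, polyD (L.P₁ i j) (u t (Sum.inl j)) (slice ψ t))
      + f t (Sum.inl i) (slice ψ t)) =
      ∫ t, hatT m (s - r) (∑ j, L.γC i j • V t (Sum.inl j) + X t) (slice ψ t) := by
    intro ψ
    -- The representation of `u` and `f` is only valid on `I`; outside of the time support of `ψ`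
    -- both sides are zero.
    have e1 : ∀ t, (-(∑ j, ((L.γ i j : ℝ) : ℂ) * u t (Sum.inl j) (slice (∂_{e₀ n} ψ) t))
      + (∑ j, polyD (L.P₁ i j) (u t (Sum.inl j)) (slice ψ t))
      + f t (Sum.inl i) (slice ψ t)) =
      (-∑ j, L.γC i j * hatT m (s - r) (K (U t (Sum.inl j))) (slice (∂_{e₀ n} ψ) t)) +
        hatT m (s - r) (X t) (slice ψ t) := by
      intro t
      by_cases ht : t ∈ timeSupport ψ
      · have htI := interior_subset (timeSupport_subset ψ ht)
        rw [add_assoc]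
        congr 1
        · congr 1
          refine Finset.sum_congr rfl fun j _ => ?_
          rw [h.eq t htI, hatT_reg hm s (Nat.cast_nonneg r)]
          rfl
        · rw [hf t htI]
          simp only [X, srcWt, map_add, map_sum]
          rw [hatT_reg hm s (Nat.cast_nonneg r)]
          simp only [add_apply, sum_apply]
          congr 1
          refine Finset.sum_congr rfl fun j _ => ?_
          rw [h.eq t htI, polyD_hatT hm (hL.deg₁ i j)]
      · simp [slice_eq_zero ψ ht, slice_lineDeriv_eq_zero ψ _ ht]
    have hK : ∀ j, ContinuousOn (fun t => K (U t j)) I := fun j =>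
      K.continuous.comp_continuousOn (h.cont j)
    have i1 : ∀ j, Integrable fun t => hatT m (s - r) (K (U t (Sum.inl j)))
        (slice (∂_{e₀ n} ψ) t) := fun j => integrable_hatT_slice hm _ (hK _) _
    have i2 := integrable_hatT_slice hm (s - r) hXc ψ
    have i3 := integrable_hatT_slice hm (s - r) hVc ψ
    simp only [e1]
    have i1' : Integrable fun t => -∑ j, L.γC i j * hatT m (s - r) (K (U t (Sum.inl j)))
        (slice (∂_{e₀ n} ψ) t) := (integrable_finsetSum _ fun j _ => (i1 j).const_mul _).neg
    rw [integral_add i1' i2, integral_neg, integral_finsetSum _ fun j _ => (i1 j).const_mul _]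
    simp only [map_add, add_apply]
    rw [integral_add i3 i2]
    congr 1
    have e2 : ∀ j, ∫ t, L.γC i j * hatT m (s - r) (K (U t (Sum.inl j))) (slice (∂_{e₀ n} ψ) t) =
        -∫ t, L.γC i j * hatT m (s - r) (V t (Sum.inl j)) (slice ψ t) := by
      intro j
      rw [integral_const_mul, integral_const_mul, integral_hatT_slice_deriv hm (s - r)
        (fun t ht => h.hasDerivAt_interior ht (Sum.inl j)) (hK _) (h.cont_deriv _), mul_neg]
    simp only [e2, Finset.sum_neg_distrib, neg_neg]
    rw [← integral_finsetSum _ fun j _ =>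
      (integrable_hatT_slice hm (s - r) (h.cont_deriv (Sum.inl j)) ψ).const_mul _]
    congr 1; ext t
    simp only [map_sum, map_smul, sum_apply, smul_apply, smul_eq_mul]
  constructor
  · intro hw
    exact eq_zero_of_integral_slice hm (s - r) hI hne (hVc.add hXc) fun ψ => (key ψ).symm.trans (hw ψ)
  · intro hz ψ
    rw [key ψ]
    have : ∀ t, hatT m (s - r) (∑ j, L.γC i j • V t (Sum.inl j) + X t) (slice ψ t) = 0 := by
      intro t
      by_cases ht : t ∈ timeSupport ψ
      · have := hz t (interior_subset (timeSupport_subset ψ ht))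
        change ∑ j, L.γC i j • V t (Sum.inl j) + X t = 0 at this
        rw [this, map_zero]; rfl
      · rw [slice_eq_zero ψ ht, map_zero]
    exact (integral_congr_ae (Eventually.of_forall this)).trans (integral_zero _ _)

/-- Since `u₂` is only assumed to be `C¹`, a single time derivative can be moved off `ψ`. The second
one is recovered from du Bois-Reymond: the smoothed velocity plus a primitive of the remaining terms
is constant in time. -/
theorem weak_snd_iff (hL : L.Admissible r α μ₀) (hm : 0 < m) (hI : I.OrdConnected)
    (hne : (interior I).Nonempty) (h : PathRep r m s I u U V)
    (hf : ∀ t ∈ I, ∀ i, f t i = hatT m (srcWt r s i) (F t i))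
    (hF : ∀ i, ContinuousOn (fun t => F t i) I) (i : Fin d₂) :
    (∀ ψ : 𝓓(slab n I, ℂ), ∫ t : ℝ, (u t (Sum.inr i) (slice (∂_{e₀ n} (∂_{e₀ n} ψ)) t)
      + (∑ j, polyD (L.P₂ i j) (u t (Sum.inr j)) (slice ψ t))
      + f t (Sum.inr i) (slice ψ t)) = 0) ↔
    ∀ t ∈ I, HasDerivWithinAt
      (fun τ => mulOp (fun η => (wt m (-(r : ℝ)) η : ℂ)) (V τ (Sum.inr i)))
      (-(∑ j, polyOp m (2 * r : ℕ) (L.P₂ i j) (U t (Sum.inr j)) +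
        mulOp (fun η => (wt m (-(r : ℝ)) η : ℂ)) (F t (Sum.inr i)))) I t := by
  set K := mulOp (fun η : Sp n => (wt m (-(r : ℝ)) η : ℂ))
  let X : ℝ → L2 n := fun t =>
    ∑ j, polyOp m (2 * r : ℕ) (L.P₂ i j) (U t (Sum.inr j)) + K (F t (Sum.inr i))
  have hXc : ContinuousOn X I :=
    (continuousOn_finsetSum _ fun j _ => (polyOp m (2 * r : ℕ) (L.P₂ i j)).continuous.comp_continuousOn
      (h.cont _)).add (K.continuous.comp_continuousOn (hF _))
  have hKV : ContinuousOn (fun t => K (V t (Sum.inr i))) I :=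
    K.continuous.comp_continuousOn (h.cont_deriv _)
  have hKU : ContinuousOn (fun t => K (U t (Sum.inr i))) I :=
    K.continuous.comp_continuousOn (h.cont _)
  have hw2 : s - ((2 * r : ℕ) : ℝ) = s - r - r := by push_cast; ring
  have key : ∀ ψ : 𝓓(slab n I, ℂ), ∫ t : ℝ, (u t (Sum.inr i) (slice (∂_{e₀ n} (∂_{e₀ n} ψ)) t)
      + (∑ j, polyD (L.P₂ i j) (u t (Sum.inr j)) (slice ψ t))
      + f t (Sum.inr i) (slice ψ t)) =
      -(∫ t, hatT m (s - r - r) (K (V t (Sum.inr i))) (slice (∂_{e₀ n} ψ) t)) +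
        ∫ t, hatT m (s - r - r) (X t) (slice ψ t) := by
    intro ψ
    have e1 : ∀ t, (u t (Sum.inr i) (slice (∂_{e₀ n} (∂_{e₀ n} ψ)) t)
      + (∑ j, polyD (L.P₂ i j) (u t (Sum.inr j)) (slice ψ t))
      + f t (Sum.inr i) (slice ψ t)) =
      hatT m (s - r) (K (U t (Sum.inr i))) (slice (∂_{e₀ n} (∂_{e₀ n} ψ)) t) +
        hatT m (s - r - r) (X t) (slice ψ t) := by
      intro t
      by_cases ht : t ∈ timeSupport ψ
      · have htI := interior_subset (timeSupport_subset ψ ht)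
        rw [add_assoc]
        congr 1
        · rw [h.eq t htI, hatT_reg hm s (Nat.cast_nonneg r)]
        · rw [hf t htI]
          simp only [X, srcWt, map_add, map_sum]
          rw [hatT_reg hm (s - r) (Nat.cast_nonneg r)]
          simp only [add_apply, sum_apply]
          congr 1
          refine Finset.sum_congr rfl fun j _ => ?_
          rw [h.eq t htI, polyD_hatT hm (hL.deg₂ i j), hw2]
      · have h1 : t ∉ timeSupport (∂_{e₀ n} ψ) := by
          rintro ⟨p, hp, rfl⟩
          refine ht ⟨p, ?_, rfl⟩
          have h2 : (⇑(∂_{e₀ n} ψ : 𝓓(slab n I, ℂ))) = fun q => fderiv ℝ ψ q (e₀ n) :=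
            funext fun q => lineDeriv_testFunction_apply ψ _ q
          have h3 : tsupport (fun q => fderiv ℝ ψ q (e₀ n)) ⊆ tsupport (fderiv ℝ ψ) :=
            closure_mono fun q hq h0 => hq (by simp [h0])
          rw [h2] at hp
          exact tsupport_fderiv_subset ℝ (h3 hp)
        simp [slice_eq_zero ψ ht, slice_lineDeriv_eq_zero _ _ h1]
    simp only [e1]
    rw [integral_add (integrable_hatT_slice hm _ hKU _) (integrable_hatT_slice hm _ hXc ψ),
      integral_hatT_slice_deriv hm (s - r) (fun t ht => h.hasDerivAt_interior ht (Sum.inr i)) hKU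
        (h.cont_deriv _) (∂_{e₀ n} ψ)]
    congr 2
    congr 1; ext t
    rw [hatT_reg hm (s - r) (Nat.cast_nonneg r)]
  constructor
  · intro hw
    obtain ⟨t₀, ht₀⟩ := hne
    have ht₀I := interior_subset ht₀
    let A : ℝ → L2 n := fun t => ∫ τ in t₀..t, X τ
    have hA : ∀ t ∈ I, HasDerivWithinAt A (X t) I t := fun t ht =>
      hasDerivWithinAt_integral_of_continuousOn hI hXc ht₀I ht
    have hAc : ContinuousOn A I := fun t ht => (hA t ht).continuousWithinAt
    have hc := eq_of_integral_slice_deriv hm (s - r - r) hI ⟨t₀, ht₀⟩ (hKV.add hAc) fun ψ => by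
      have h1 := (key ψ).symm.trans (hw ψ)
      have h2 := integral_hatT_slice_deriv hm (s - r - r) (A := A) (B := X) (fun t ht =>
        (hA t (interior_subset ht)).hasDerivAt (mem_interior_iff_mem_nhds.1 ht)) hAc hXc ψ
      simp only [Pi.add_apply, map_add, add_apply]
      rw [integral_add (integrable_hatT_slice hm _ hKV _) (integrable_hatT_slice hm _ hAc _), h2]
      linear_combination -h1
    intro t ht
    have h3 : ∀ τ ∈ I, K (V τ (Sum.inr i)) = K (V t₀ (Sum.inr i)) + A t₀ - A τ := fun τ hτ => by
      have := hc τ hτ t₀ ht₀I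
      simp only [Pi.add_apply] at this
      rw [← this]
      abel
    refine HasDerivWithinAt.congr ?_ h3 (h3 t ht)
    have := (hA t ht).const_sub (K (V t₀ (Sum.inr i)) + A t₀)
    exact this
  · intro hd ψ
    rw [key ψ, integral_hatT_slice_deriv hm (s - r - r) (B := fun t => -X t) (fun t ht =>
      (hd t (interior_subset ht)).hasDerivAt (mem_interior_iff_mem_nhds.1 ht)) hKV hXc.neg ψ]
    simp only [map_neg, neg_apply, integral_neg, neg_neg]
    simp

/-- The three slots of the data are treated separately. The first order equation is solved for the
derivative of `u₁` by inverting `γ⁰`, the slot of `u₂` says only that its derivative is the third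
slot, and the third slot is the second order equation. -/
theorem isWeakSol_iff (hL : L.Admissible r α μ₀) (hm : 0 < m) (hI : I.OrdConnected)
    (hne : (interior I).Nonempty) (h : PathRep r m s I u U V)
    (hf : ∀ t ∈ I, ∀ i, f t i = hatT m (srcWt r s i) (F t i))
    (hF : ∀ i, ContinuousOn (fun t => F t i) I) :
    IsWeakSol L I u f ↔ ∀ t ∈ I, HasDerivWithinAt (fun τ => regOp m r (mkData (U τ) (V τ)))
      (genOp L m r (mkData (U t) (V t)) + regOp m r (srcData L (F t))) I t := by
  have h1 : IsWeakSol L I u f ↔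
      (∀ t ∈ I, ∀ i, ∑ j, L.γC i j • V t (Sum.inl j) +
        (∑ j, polyOp m r (L.P₁ i j) (U t (Sum.inl j)) +
          mulOp (fun η => (wt m (-(r : ℝ)) η : ℂ)) (F t (Sum.inl i))) = 0) ∧
      ∀ t ∈ I, ∀ i, HasDerivWithinAt
        (fun τ => mulOp (fun η => (wt m (-(r : ℝ)) η : ℂ)) (V τ (Sum.inr i)))
        (-(∑ j, polyOp m (2 * r : ℕ) (L.P₂ i j) (U t (Sum.inr j)) +
          mulOp (fun η => (wt m (-(r : ℝ)) η : ℂ)) (F t (Sum.inr i)))) I t := by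
    constructor
    · intro hw
      exact ⟨fun t ht i => (weak_fst_iff hL hm hI hne h hf hF i).1 (fun ψ => hw.fst ψ i) t ht,
        fun t ht i => (weak_snd_iff hL hm hI hne h hf hF i).1 (fun ψ => hw.snd ψ i) t ht⟩
    · rintro ⟨ha, hb⟩
      exact ⟨fun ψ i => (weak_fst_iff hL hm hI hne h hf hF i).2 (fun t ht => ha t ht i) ψ,
        fun ψ i => (weak_snd_iff hL hm hI hne h hf hF i).2 (fun t ht => hb t ht i) ψ⟩
  rw [h1, ← forall₂_and]
  refine forall₂_congr fun t ht => ?_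
  rw [hasDerivWithinAt_VL2, gamma_solve_iff hL, Sum.forall, Sum.forall]
  have e1 : ∀ i, HasDerivWithinAt (fun τ => regOp m r (mkData (U τ) (V τ)) (Sum.inl i))
      (V t (Sum.inl i)) I t := fun i => by
    simp only [regOp_apply]
    exact h.deriv t ht (Sum.inl i)
  have e2 : ∀ i, HasDerivWithinAt (fun τ => regOp m r (mkData (U τ) (V τ)) (Sum.inr (Sum.inl i)))
      (V t (Sum.inr i)) I t := fun i => by
    simp only [regOp_apply]
    exact h.deriv t ht (Sum.inr i)
  have hu := uniqueDiff hI hne ht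
  refine and_congr (forall_congr' fun i => ?_) ?_
  · have e3 : (genOp L m r (mkData (U t) (V t)) + regOp m r (srcData L (F t))) (Sum.inl i) =
        -∑ k, L.γC⁻¹ i k • (∑ j, polyOp m r (L.P₁ k j) (U t (Sum.inl j)) +
          mulOp (fun η => (wt m (-(r : ℝ)) η : ℂ)) (F t (Sum.inl k))) := by
      rw [PiLp.add_apply, genOp_inl hL hm, regOp_apply]
      simp only [srcData, mkData, map_neg, map_sum, map_smul, smul_add, Finset.sum_add_distrib,
        neg_add]
    rw [← e3]
    constructor
    · intro hV
      rw [← hV]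
      exact e1 i
    · intro hd
      exact hu.eq_deriv _ (e1 i) hd
  -- The middle slot holds for every curve in `𝓕^s(I)`, so it drops out of the equivalence.
  · have e4 : ∀ i, HasDerivWithinAt (fun τ => regOp m r (mkData (U τ) (V τ)) (Sum.inr (Sum.inl i)))
        ((genOp L m r (mkData (U t) (V t)) + regOp m r (srcData L (F t))) (Sum.inr (Sum.inl i))) I t :=
      fun i => by
        rw [PiLp.add_apply, genOp_inr_inl hm, regOp_apply]
        simp only [srcData, mkData, map_zero, add_zero]
        exact e2 i
    rw [and_iff_right e4]
    refine forall_congr' fun i => ?_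
    rw [PiLp.add_apply, genOp_inr_inr hL hm]
    simp only [regOp_apply, srcData, mkData, map_neg, neg_add]

end WeakIff

/-! ### Solutions of the linear equation -/

/-- The position of the coordinates of the field among the Cauchy data. -/
def fieldIdx : Idx d₁ d₂ → DIdx d₁ d₂
  | Sum.inl i => Sum.inl i
  | Sum.inr j => Sum.inr (Sum.inl j)

/-- The solution of the linear equation with Cauchy data `x` at time `0`. -/
def sol (L : EvolOp n d₁ d₂) (m : ℝ) (r : ℕ) (s : ℝ) (x : Data n d₁ d₂) : FieldPath n d₁ d₂ :=
  fun τ i => hatT m s (evoOp L m r τ x (fieldIdx i))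

/-- The Cauchy data of a curve of distributions. -/
def dataOf (m : ℝ) (r : ℕ) (s : ℝ) (I : Set ℝ) (u : FieldPath n d₁ d₂) (t : ℝ) : Data n d₁ d₂ :=
  mkData (fun i => unhat m s (u t i)) (fun i => unhat m (s - r) (timeDeriv I u t i))

theorem evo_herm (L : EvolOp n d₁ d₂) (m : ℝ) (r : ℕ) (t : ℝ) (η : Sp n) :
    evo L m r t (-η) = (evo L m r t η).map (starRingEnd ℂ) := evo_neg L m r t η

/-- Cauchy data of real distributions. -/
def HermV {ι : Type} [Fintype ι] (x : VL2 n ι) : Prop := ∀ k, Herm (x k)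

theorem PathRep.hermV {r : ℕ} {m s : ℝ} {I : Set ℝ} {u : FieldPath n d₁ d₂}
    {U V : ℝ → Idx d₁ d₂ → L2 n} (h : PathRep r m s I u U V) {t : ℝ} (ht : t ∈ I) :
    HermV (mkData (U t) (V t)) := by
  rintro (i | j | j)
  · exact h.herm t ht _
  · exact h.herm t ht _
  · exact h.herm_deriv t ht _

section Sol

variable {L : EvolOp n d₁ d₂} {r : ℕ} {α μ₀ m s : ℝ} {I : Set ℝ}

theorem HermV.evoOp (hα : 0 < α) (hμ : 0 ≤ μ₀) (hL : L.Admissible r α μ₀) (hm : 0 < m)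
    {x : Data n d₁ d₂} (hx : HermV x) (t : ℝ) : HermV (evoOp L m r t x) := fun k =>
  Herm.matOp (isMatMult_evo hα hμ hL hm t) (evo_herm L m r t) hx k

theorem HermV.genOp (hL : L.Admissible r α μ₀) (hm : 0 < m)
    {x : Data n d₁ d₂} (hx : HermV x) : HermV (genOp L m r x) := fun k =>
  Herm.matOp (isMatMult_gen hL hm) (fun η => by
    rw [gen_neg, wt_even]
    ext i j
    simp) hx k

theorem mkData_sol (hm : 0 < m) (x : Data n d₁ d₂) (τ : ℝ) :
    mkData (fun i => evoOp L m r τ x (fieldIdx i))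
      (fun i => genOp L m r (evoOp L m r τ x) (fieldIdx i)) = evoOp L m r τ x := by
  ext1 k
  rcases k with i | j | j
  · rfl
  · rfl
  · exact genOp_inr_inl hm _ j

theorem pathRep_sol (hα : 0 < α) (hμ : 0 ≤ μ₀) (hL : L.Admissible r α μ₀) (hm : 0 < m)
    (s : ℝ) (I : Set ℝ) {x : Data n d₁ d₂} (hx : HermV x) :
    PathRep r m s I (sol L m r s x) (fun τ i => evoOp L m r τ x (fieldIdx i))
      (fun τ i => genOp L m r (evoOp L m r τ x) (fieldIdx i)) := by
  obtain ⟨C, -, hS, -⟩ := isEvolution_evoOp hα hμ hL hm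
  have hp : ∀ k, Continuous fun X : Data n d₁ d₂ => X k := fun k =>
    (PiLp.proj 1 (fun _ : DIdx d₁ d₂ => L2 n) k : _ →L[ℂ] L2 n).continuous
  refine ⟨fun t _ i => rfl, fun t _ i => hx.evoOp hα hμ hL hm t _,
    fun t _ i => (hx.evoOp hα hμ hL hm t).genOp hL hm _,
    fun i => ((hp _).comp (hS.cont x)).continuousOn,
    fun i => ((hp _).comp ((genOp L m r).continuous.comp (hS.cont x))).continuousOn, fun t _ i => ?_⟩
  have h1 := hS.deriv t x
  simp only [← hS.comm, ← hS.commB] at h1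
  have h2 := hasDerivWithinAt_VL2.1 (h1.hasDerivWithinAt (s := I)) (fieldIdx i)
  simpa only [regOp_apply] using h2

theorem memE₀_sol (hα : 0 < α) (hμ : 0 ≤ μ₀) (hL : L.Admissible r α μ₀) (hm : 0 < m)
    (s : ℝ) (hI : I.OrdConnected) (hne : (interior I).Nonempty) {x : Data n d₁ d₂} (hx : HermV x) :
    MemE₀ L r m s I (sol L m r s x) := by
  obtain ⟨C, -, hS, -⟩ := isEvolution_evoOp hα hμ hL hm
  have h := pathRep_sol hα hμ hL hm s I hx
  refine ⟨h.memF hm hI hne, ?_⟩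
  rw [isWeakSol_iff hL hm hI hne h (f := 0) (F := fun _ _ => 0) (fun t _ i => (map_zero (hatT m _)).symm)
    fun i => continuousOn_const]
  intro t _
  have h1 := (hS.deriv t x).hasDerivWithinAt (s := I)
  simp only [← hS.comm, ← hS.commB] at h1
  simp only [mkData_sol hm]
  have h2 : srcData L (fun _ => (0 : L2 n)) = 0 := by
    ext1 k
    rcases k with i | j | j <;> simp [srcData]
  rw [h2, map_zero, add_zero]
  exact h1

theorem fNorm_sol (hα : 0 < α) (hμ : 0 ≤ μ₀) (hL : L.Admissible r α μ₀) (hm : 0 < m)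
    (s : ℝ) (hI : I.OrdConnected) (hne : (interior I).Nonempty) {x : Data n d₁ d₂} (hx : HermV x) :
    fNorm r m s I (sol L m r s x) = ⨆ τ ∈ I, ‖evoOp L m r τ x‖ₑ := by
  rw [(pathRep_sol hα hμ hL hm s I hx).fNorm_eq hm hI hne]
  simp only [mkData_sol hm]

/-- With zero source, the Duhamel equivalence says that `S(-τ) x(τ)` has derivative zero, hence is
constant. -/
theorem sol_eq_of_memE₀ (hα : 0 < α) (hμ : 0 ≤ μ₀) (hL : L.Admissible r α μ₀) (hm : 0 < m)
    (hI : I.OrdConnected) (hne : (interior I).Nonempty) {φ : FieldPath n d₁ d₂}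
    {U V : ℝ → Idx d₁ d₂ → L2 n} (h : PathRep r m s I φ U V) (hw : IsWeakSol L I φ 0) {t τ : ℝ}
    (ht : t ∈ I) (hτ : τ ∈ I) : mkData (U τ) (V τ) = evoOp L m r (τ - t) (mkData (U t) (V t)) := by
  obtain ⟨C, -, hS, -⟩ := isEvolution_evoOp hα hμ hL hm
  rw [isWeakSol_iff hL hm hI hne h (f := 0) (F := fun _ _ => 0) (fun t _ i => (map_zero (hatT m _)).symm)
    fun i => continuousOn_const] at hw
  have h2 : srcData L (fun _ => (0 : L2 n)) = 0 := by
    ext1 k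
    rcases k with i | j | j <;> simp [srcData]
  simp only [h2] at hw
  have h3 := (hS.duhamel_iff hI (F := fun _ => 0) continuousOn_const).1 hw
  simp only [map_zero] at h3
  have h4 := eq_of_hasDerivWithinAt_zero hI h3 hτ ht
  have h5 := congrArg (evoOp L m r τ) h4
  rw [hS.neg_apply] at h5
  rw [h5, ← hS.add, sub_eq_add_neg]

theorem sol_eq_on (hα : 0 < α) (hμ : 0 ≤ μ₀) (hL : L.Admissible r α μ₀) (hm : 0 < m)
    (hI : I.OrdConnected) (hne : (interior I).Nonempty) {φ : FieldPath n d₁ d₂}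
    {U V : ℝ → Idx d₁ d₂ → L2 n} (h : PathRep r m s I φ U V) (hw : IsWeakSol L I φ 0) {t τ : ℝ}
    (ht : t ∈ I) (hτ : τ ∈ I) : φ τ = sol L m r s (evoOp L m r (-t) (mkData (U t) (V t))) τ := by
  obtain ⟨C, -, hS, -⟩ := isEvolution_evoOp hα hμ hL hm
  funext i
  rw [h.eq τ hτ, sol, ← hS.add, ← sub_eq_add_neg, ← sol_eq_of_memE₀ hα hμ hL hm hI hne h hw ht hτ]
  rcases i with i | j <;> rfl

/-- The free solution with these data is a candidate, and any other candidate agrees with it because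
solutions are determined by their data at one time. So the choice in `Theta` has an explicit value.
-/
theorem theta_eq (hα : 0 < α) (hμ : 0 ≤ μ₀) (hL : L.Admissible r α μ₀) (hm : 0 < m)
    {u : FieldPath n d₁ d₂}
    (hu : MemF r m s I u) {t : ℝ} (ht : t ∈ I) :
    Theta L r m s I u t = sol L m r s (evoOp L m r (-t) (dataOf m r s I u t)) := by
  obtain ⟨C, -, hS, -⟩ := isEvolution_evoOp hα hμ hL hm
  have hp := hu.pathRep hm
  have hx : HermV (evoOp L m r (-t) (dataOf m r s I u t)) :=
    (hp.hermV ht).evoOp hα hμ hL hm (-t)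
  have hne' : (interior (univ : Set ℝ)).Nonempty := by simp
  have e1 : evoOp L m r t (evoOp L m r (-t) (dataOf m r s I u t)) = dataOf m r s I u t :=
    hS.neg_apply t _
  have hex : ∃ φ, IsTheta L r m s I u t φ := by
    refine ⟨_, memE₀_sol hα hμ hL hm s ordConnected_univ hne' hx, ?_, fun j => ?_⟩
    · funext i
      rw [sol, e1, hp.eq t ht]
      rcases i with i | j <;> rfl
    · rw [(pathRep_sol hα hμ hL hm s univ hx).timeDeriv_eq hm ordConnected_univ hne' (mem_univ t),
        e1]
      have : genOp L m r (dataOf m r s I u t) (fieldIdx (Sum.inr j)) =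
          unhat m (s - r) (timeDeriv I u t (Sum.inr j)) := genOp_inr_inl hm _ j
      rw [this, hatT_unhat hm (hu.mem_deriv t ht _).2]
  rw [Theta, dif_pos hex]
  obtain ⟨h1, h2, h3⟩ := hex.choose_spec
  have hq := h1.1.pathRep hm
  funext τ
  rw [sol_eq_on hα hμ hL hm ordConnected_univ hne' hq h1.2 (mem_univ t) (mem_univ τ)]
  congr 2
  ext1 k
  rcases k with i | j | j
  · simp only [mkData, dataOf, h2]
  · simp only [mkData, dataOf, h2]
  · simp only [mkData, dataOf, h3]

/-! ### The Green function -/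

theorem neg_srcData_inl (F : Idx d₁ d₂ → L2 n) (i : Fin d₁) :
    (-srcData L F) (Sum.inl i) = ∑ k, L.γC⁻¹ i k • F (Sum.inl k) := by
  rw [PiLp.neg_apply]
  simp [srcData]

theorem coeFn_sum_mulOp {ι : Type*} (t : Finset ι) {b : ι → Sp n → ℂ} (hb : ∀ i ∈ t, IsMult (b i))
    (f : ι → L2 n) : (∑ i ∈ t, mulOp (b i) (f i) : L2 n) =ᵐ[volume]
      fun η => ∑ i ∈ t, b i η * f i η := by
  classical
  induction t using Finset.induction_on with
  | empty =>
    filter_upwards [Lp.coeFn_zero ℂ 2 (volume : Measure (Sp n))] with η h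
    rw [Finset.sum_empty, Finset.sum_empty, h]; rfl
  | insert a t ha ih =>
    rw [Finset.sum_insert ha]
    filter_upwards [Lp.coeFn_add (mulOp (b a) (f a)) (∑ i ∈ t, mulOp (b i) (f i)),
      ih fun i hi => hb i (by simp [hi]), coeFn_mulOp (hb a (by simp)) (f a)] with η h1 h2 h3
    rw [h1, Pi.add_apply, h2, h3, Finset.sum_insert ha]

theorem rep_fourier_coe (g : L2 n) : rep (𝓕 (g : Dist n)) = (𝓕 g : L2 n) := by
  rw [Lp.fourier_toTemperedDistribution_eq, rep_coe]

theorem rep_fourier_ae (hm : 0 < m) {σ : ℝ} {g F : L2 n} (h : (g : Dist n) = hatT m σ F) :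
    rep (𝓕 (g : Dist n)) =ᵐ[volume] fun η => ((nc n : ℝ) : ℂ)⁻¹ * (wt m (-σ) η * F η) := by
  rw [rep_fourier_coe]
  have h1 : FourierRep m (g : Dist n) (𝓕 g : L2 n) := by
    refine ⟨⟨0, by simpa using Lp.memLp _⟩, fun ψ => ?_⟩
    rw [Lp.fourier_toTemperedDistribution_eq, toTD_apply]
  have h2 := fourierRep_hatT hm σ F
  rw [← h] at h2
  exact h1.unique hm h2

/-- The Green function is the response of the position to a source placed in the velocity slot. The
relevant entry of `evo` carries a factor `⟨ξ⟩^r`, which compensates the difference between the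
weight of the source in `H^{s-r}` and of the solution in `H^s`. For `u₁` the source passes through
`(γ⁰)⁻¹`. The condition `0 ≤ s` ensures that the transform of the convolution is in `L²`, as `ofFun`
requires. -/
theorem greenConv_eq (hα : 0 < α) (hμ : 0 ≤ μ₀) (hL : L.Admissible r α μ₀) (hm : 0 < m)
    (hs : 0 ≤ s) {f : Idx d₁ d₂ → Dist n} {F g : Idx d₁ d₂ → L2 n}
    (hf : ∀ i, f i = hatT m (srcWt r s i) (F i)) (hg : ∀ i, f i = (g i : Dist n)) (τ : ℝ) :
    greenConv L τ f = fun i => hatT m s (evoOp L m r τ (-srcData L F) (fieldIdx i)) := by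
  have hS := isMatMult_evo hα hμ hL hm τ
  have hrep : ∀ᵐ η, ∀ j, rep (𝓕 (f j)) η =
      ((nc n : ℝ) : ℂ)⁻¹ * (wt m (-(srcWt r s j)) η * F j η) := by
    rw [ae_all_iff]
    intro j
    have := rep_fourier_ae hm ((hg j).symm.trans (hf j))
    rw [← hg j] at this
    exact this
  have key : ∀ i, (fun η : Sp n => ∑ j, green L τ ((2 * Real.pi) • η) i j * rep (𝓕 (f j)) η)
      =ᵐ[volume] fun η => ((nc n : ℝ) : ℂ)⁻¹ *
        (wt m (-s) η * evoOp L m r τ (-srcData L F) (fieldIdx i) η) := by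
    rintro (i | i)
    · have h1 := coeFn_sum_mulOp Finset.univ (fun k _ => hS (Sum.inl i) k) (fun k => (-srcData L F) k)
      have h2 : ∀ᵐ η, ∀ j, (∑ k, L.γC⁻¹ j k • F (Sum.inl k) : L2 n) η =
          ∑ k, L.γC⁻¹ j k * F (Sum.inl k) η := by
        rw [ae_all_iff]
        intro j
        have := coeFn_sum_mulOp Finset.univ (fun k _ => IsMult.const (n := n) (L.γC⁻¹ j k))
          (fun k => F (Sum.inl k))
        have e : ∀ k, mulOp (fun _ => L.γC⁻¹ j k) (F (Sum.inl k)) = L.γC⁻¹ j k • F (Sum.inl k) := by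
          intro k
          have := mulOp_smul (IsMult.const (n := n) 1) (L.γC⁻¹ j k) (F (Sum.inl k))
          simpa [mulOp_one] using this
        simp only [e] at this
        exact this
      rw [evoOp]
      filter_upwards [hrep, h1, h2] with η e1 e2 e3
      simp only [fieldIdx]
      rw [matOp_apply, e2, Fintype.sum_sum_type, Fintype.sum_sum_type]
      simp only [neg_srcData_inl, e3, e1]
      have z1 : ∀ j, evo L m r τ η (Sum.inl i) (Sum.inr j) = 0 := fun j => by
        rw [evo_eq L hm]; rfl
      have z2 : ∀ j, evo L m r τ η (Sum.inl i) (Sum.inl j) =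
          NormedSpace.exp (τ • (-(L.γC⁻¹ * symb L.P₁ ((2 * Real.pi) • η)))) i j := fun j => by
        rw [evo_eq L hm]; rfl
      simp only [z1, z2, zero_mul, Finset.sum_const_zero, add_zero]
      have z3 : ∀ j, green L τ ((2 * Real.pi) • η) (Sum.inl i) (Sum.inr j) = 0 := fun j => rfl
      have z4 : ∀ k, green L τ ((2 * Real.pi) • η) (Sum.inl i) (Sum.inl k) =
          ∑ j, NormedSpace.exp (τ • (-(L.γC⁻¹ * symb L.P₁ ((2 * Real.pi) • η)))) i j *
            L.γC⁻¹ j k := fun k => by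
        change green₁ L τ ((2 * Real.pi) • η) i k = _
        rw [green₁, Matrix.mul_apply]
      simp only [z3, z4, zero_mul, Finset.sum_const_zero, add_zero, srcWt]
      simp only [Finset.mul_sum, Finset.sum_mul]
      rw [Finset.sum_comm]
      refine Finset.sum_congr rfl fun j _ => Finset.sum_congr rfl fun k _ => ?_
      ring
    · have h1 := coeFn_sum_mulOp Finset.univ (fun k _ => hS (Sum.inr (Sum.inl i)) k)
        (fun k => (-srcData L F) k)
      have h3 : ∀ᵐ η, ((0 : L2 n)) η = 0 := Lp.coeFn_zero ℂ 2 (volume : Measure (Sp n))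
      rw [evoOp]
      filter_upwards [hrep, h1, h3] with η e1 e2 e3
      simp only [fieldIdx]
      rw [matOp_apply, e2]
      simp only [Fintype.sum_sum_type]
      have z1 : ∀ j, evo L m r τ η (Sum.inr (Sum.inl i)) (Sum.inl j) = 0 := fun j => by
        rw [evo_eq L hm]; rfl
      have z2 : ∀ j, evo L m r τ η (Sum.inr (Sum.inl i)) (Sum.inr (Sum.inr j)) =
          wt m r η * green₂ L τ ((2 * Real.pi) • η) i j := fun j => by
        rw [evo_eq L hm, ← Matrix.fromBlocks_toBlocks (prop₂ L τ _), Matrix.fromBlocks_multiply,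
          Matrix.fromBlocks_multiply]
        simp [green₂]
      have z3 : ∀ j, green L τ ((2 * Real.pi) • η) (Sum.inr i) (Sum.inl j) = 0 := fun j => rfl
      have z4 : ∀ j, green L τ ((2 * Real.pi) • η) (Sum.inr i) (Sum.inr j) =
        green₂ L τ ((2 * Real.pi) • η) i j := fun j => rfl
      have z5 : ∀ j, (-srcData L F) (Sum.inr (Sum.inl j)) = 0 := fun j => by
        rw [PiLp.neg_apply]; simp [srcData]
      have z6 : ∀ j, (-srcData L F) (Sum.inr (Sum.inr j)) = F (Sum.inr j) := fun j => by
        rw [PiLp.neg_apply]; simp [srcData]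
      have z7 : wt m (-(s - r)) η = wt m (-s) η * wt m r η := by
        rw [← wt_add hm]; congr 1; ring
      simp only [z1, z2, z3, z4, z5, z6, e1, e3, srcWt, z7, zero_mul, mul_zero,
        Finset.sum_const_zero, zero_add]
      simp only [Finset.mul_sum]
      refine Finset.sum_congr rfl fun j _ => ?_
      push_cast
      ring
  funext i
  have hmem : MemLp (fun η : Sp n => ∑ j, green L τ ((2 * Real.pi) • η) i j * rep (𝓕 (f j)) η) 2
      volume :=
    (memLp_congr_ae (key i)).2 (((isMult_wt_neg hm hs).memLp (Lp.memLp _)).const_mul _)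
  rw [greenConv, ofFun_eq hmem]
  apply dist_ext_fourier
  intro ψ
  rw [FourierTransform.fourier_fourierInv_eq, toTD_apply, fourier_hatT_apply hm]
  apply integral_congr_ae
  filter_upwards [hmem.coeFn_toLp, key i] with η e1 e2
  rw [e1, e2]

end Sol

/-! ### Sobolev spaces as spaces of functions, products -/

/-- The isometry `L² → H^σ` for `σ ≥ 0`, with values in `L²`. -/
def phys (m σ : ℝ) : L2 n →L[ℂ] L2 n :=
  ((nc n : ℝ) : ℂ)⁻¹ • ((FourierTransform.fourierInvCLM ℂ (L2 n)) ∘L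
    mulOp (fun η => ((wt m (-σ) η : ℝ) : ℂ)))

theorem phys_eq (m σ : ℝ) (g : L2 n) : phys m σ g =
    ((nc n : ℝ) : ℂ)⁻¹ • 𝓕⁻ (mulOp (fun η => ((wt m (-σ) η : ℝ) : ℂ)) g) := rfl

theorem hatT_eq_phys {m : ℝ} (hm : 0 < m) {σ : ℝ} (hσ : 0 ≤ σ) (g : L2 n) :
    hatT m σ g = (phys m σ g : Dist n) := by
  have h1 : TemperedDistribution.smulLeftCLM ℂ (fun η : Sp n => ((wt m (-σ) η : ℝ) : ℂ)) (g : Dist n)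
      = ((mulOp (fun η => ((wt m (-σ) η : ℝ) : ℂ)) g : L2 n) : Dist n) := by
    ext ψ
    change (g : Dist n) _ = _
    rw [toTD_apply, toTD_apply]
    apply integral_congr_ae
    filter_upwards [coeFn_mulOp (isMult_wt_neg hm hσ) g] with η hη
    rw [hη]
    refine (congrArg (fun z => z * g η) (smul_schwartz hm (-σ) ψ η)).trans ?_
    ring
  rw [hatT_eq, h1, Lp.fourierInv_toTemperedDistribution_eq]
  exact ((Lp.toTemperedDistributionCLM (E := Sp n) ℂ volume 2).map_smul _ _).symm

theorem phys_injective {m : ℝ} (hm : 0 < m) {σ : ℝ} (hσ : 0 ≤ σ) :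
    Function.Injective (phys m σ : L2 n → L2 n) := by
  intro a b hab
  apply hatT_injective hm σ
  rw [hatT_eq_phys hm hσ, hatT_eq_phys hm hσ, hab]

theorem phys_scale {m : ℝ} (hm : 0 < m) {σ τ : ℝ} (hτ : 0 ≤ τ) (h : τ ≤ σ) (g : L2 n) :
    phys m τ (mulOp (fun η => ((wt m (τ - σ) η : ℝ) : ℂ)) g) = phys m σ g := by
  apply toTD_injective
  simp only
  rw [← hatT_eq_phys hm hτ, ← hatT_eq_phys hm (hτ.trans h), hatT_scale hm h]

theorem phys_toLp {m : ℝ} (hm : 0 < m) {σ : ℝ} (hσ : 0 ≤ σ) (f : 𝓢(Sp n, ℂ)) :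
    phys m σ (f.toLp 2 volume) = (((nc n : ℝ) : ℂ)⁻¹ • 𝓕⁻ (SchwartzMap.smulLeftCLM ℂ
      (fun η : Sp n => ((wt m (-σ) η : ℝ) : ℂ)) f) : 𝓢(Sp n, ℂ)).toLp 2 volume := by
  have h1 : mulOp (fun η => ((wt m (-σ) η : ℝ) : ℂ)) (f.toLp 2 volume) =
      (SchwartzMap.smulLeftCLM ℂ (fun η : Sp n => ((wt m (-σ) η : ℝ) : ℂ)) f).toLp 2 volume := by
    apply Lp.ext
    filter_upwards [coeFn_mulOp (isMult_wt_neg hm hσ) (f.toLp 2 volume), f.coeFn_toLp 2 volume,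
      (SchwartzMap.smulLeftCLM ℂ (fun η : Sp n => ((wt m (-σ) η : ℝ) : ℂ)) f).coeFn_toLp 2 volume]
      with η h1 h2 h3
    rw [h1, h2, h3, smul_schwartz hm]
  rw [phys_eq, h1, SchwartzMap.toLp_fourierInv_eq]
  exact ((SchwartzMap.toLpCLM ℂ ℂ (E := Sp n) 2 volume).map_smul _ _).symm

/-! ### The Sobolev product estimate. -/

theorem wt_one_le {m : ℝ} (a b : Sp n) : wt m 1 (a + b) ≤ 2 * max (wt m 1 a) (wt m 1 b) := by
  have key : ∀ a b : Sp n, ‖(2 * Real.pi) • b‖ ≤ ‖(2 * Real.pi) • a‖ →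
      wt m 1 (a + b) ≤ 2 * wt m 1 a := by
    intro a b h
    rw [wt_one, wt_one, show (2 : ℝ) = √4 by norm_num, ← Real.sqrt_mul (by norm_num),
      show √4 = (2 : ℝ) by norm_num]
    apply Real.sqrt_le_sqrt
    have h1 := norm_add_le ((2 * Real.pi) • a) ((2 * Real.pi) • b)
    rw [← smul_add] at h1
    nlinarith [sq_nonneg m, norm_nonneg ((2 * Real.pi) • (a + b)), norm_nonneg ((2 * Real.pi) • a)]
  rcases le_total ‖(2 * Real.pi) • b‖ ‖(2 * Real.pi) • a‖ with h | h
  · exact (key a b h).trans (by gcongr; exact le_max_left _ _)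
  · rw [add_comm a b]
    exact (key b a h).trans (by gcongr; exact le_max_right _ _)

/-- Since `⟨ξ⟩ ≤ 2 max(⟨ξ-η⟩, ⟨η⟩)`, the larger of these weights absorbs `⟨ξ⟩^σ`. If it is `⟨η⟩`,
then `⟨ξ-η⟩^{-σ₀}` remains; if it is `⟨ξ-η⟩`, then `⟨ξ-η⟩^{σ-σ₀} ⟨η⟩^{-σ} ≤ ⟨η⟩^{-σ₀}` because `σ ≤
σ₀`. -/
theorem wt_kernel_le {m : ℝ} (hm : 0 < m) {σ₀ σ : ℝ} (hσ : 0 ≤ σ) (h : σ ≤ σ₀) (ξ η : Sp n) :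
    (wt m σ ξ * (wt m (-σ₀) (ξ - η) * wt m (-σ) η)) ^ 2 ≤
      2 ^ (2 * σ) * (wt m (-(2 * σ₀)) (ξ - η) + wt m (-(2 * σ₀)) η) := by
  have h1 := wt_one_le (m := m) (ξ - η) η
  rw [sub_add_cancel] at h1
  have hx0 := wt_pos hm 1 (ξ - η)
  have hy0 := wt_pos hm 1 η
  have hz0 := wt_pos hm 1 ξ
  simp only [wt_eq_rpow hm σ, wt_eq_rpow hm (-σ₀), wt_eq_rpow hm (-σ), wt_eq_rpow hm (-(2 * σ₀))]
  generalize wt m 1 (ξ - η) = x at *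
  generalize wt m 1 η = y at *
  generalize wt m 1 ξ = z at *
  have e : ∀ {a : ℝ} (c : ℝ), 0 < a → (a ^ c) ^ 2 = a ^ (2 * c) := fun c ha => by
    rw [← Real.rpow_natCast, ← Real.rpow_mul ha.le]; congr 1; push_cast; ring
  rw [mul_pow, mul_pow, e _ hx0, e _ hy0, e _ hz0]
  have hz : z ^ (2 * σ) ≤ 2 ^ (2 * σ) * (max x y) ^ (2 * σ) := by
    rw [← Real.mul_rpow (by norm_num) (hx0.le.trans (le_max_left _ _))]
    exact Real.rpow_le_rpow hz0.le h1 (by linarith)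
  have hxp := Real.rpow_pos_of_pos hx0 (2 * -σ₀)
  have hyp := Real.rpow_pos_of_pos hy0 (2 * -σ)
  refine (mul_le_mul_of_nonneg_right hz (by positivity)).trans ?_
  rw [mul_assoc]
  refine mul_le_mul_of_nonneg_left ?_ (by positivity)
  rcases le_total x y with hxy | hxy
  · rw [max_eq_right hxy, mul_left_comm, ← Real.rpow_add hy0]
    have : 2 * σ + 2 * -σ = 0 := by ring
    rw [this, Real.rpow_zero, mul_one, mul_neg]
    linarith [Real.rpow_pos_of_pos hy0 (-(2 * σ₀))]
  · rw [max_eq_left hxy, ← mul_assoc, ← Real.rpow_add hx0]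
    have h2 : x ^ (2 * σ + 2 * -σ₀) ≤ y ^ (2 * σ + 2 * -σ₀) :=
      Real.rpow_le_rpow_of_nonpos hy0 hxy (by linarith)
    have h3 := mul_le_mul_of_nonneg_right h2 hyp.le
    rw [← Real.rpow_add hy0] at h3
    have : 2 * σ + 2 * -σ₀ + 2 * -σ = -(2 * σ₀) := by ring
    rw [this] at h3
    linarith [Real.rpow_pos_of_pos hx0 (-(2 * σ₀))]

theorem lintegral_wt_lt_top {m : ℝ} (hm : 0 < m) {σ₀ : ℝ} (h : (n : ℝ) / 2 < σ₀) :
    ∫⁻ η : Sp n, ENNReal.ofReal (wt m (-(2 * σ₀)) η) < ⊤ := by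
  have h1 : Integrable (fun η : Sp n => (1 + ‖η‖ ^ 2) ^ (-(2 * σ₀) / 2)) :=
    integrable_rpow_neg_one_add_norm_sq (by simp; linarith)
  have h2 := h1.comp_smul (R := (2 * Real.pi / m)) (by positivity)
  have h3 := h2.const_mul ((m ^ 2) ^ (-(2 * σ₀) / 2))
  refine Integrable.lintegral_lt_top (h3.congr (Eventually.of_forall fun η => ?_))
  simp only [wt]
  rw [← Real.mul_rpow (by positivity) (by positivity)]
  congr 1
  rw [norm_smul, norm_smul]
  simp only [Real.norm_eq_abs, abs_of_pos Real.pi_pos, abs_of_pos hm, abs_mul, abs_div]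
  field_simp

/-- Cauchy–Schwarz in `η` for fixed `ξ` splits off the kernel; the rest is integrated in `ξ` first,
by Tonelli and translation invariance. -/
theorem lintegral_conv_sq_le {κ : Sp n → Sp n → ℝ≥0∞} (hκ : ∀ ξ, Measurable (κ ξ)) {A : ℝ≥0∞}
    (hA : ∀ ξ, ∫⁻ η, κ ξ η ^ 2 ≤ A) {G H : Sp n → ℝ≥0∞} (hG : Measurable G) (hH : Measurable H) :
    ∫⁻ ξ, (∫⁻ η, κ ξ η * (G (ξ - η) * H η)) ^ 2 ≤ A * ((∫⁻ η, G η ^ 2) * ∫⁻ η, H η ^ 2) := by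
  have h1 : ∀ ξ, (∫⁻ η, κ ξ η * (G (ξ - η) * H η)) ^ 2 ≤
      A * ∫⁻ η, G (ξ - η) ^ 2 * H η ^ 2 := by
    intro ξ
    have hm2 : Measurable fun η => G (ξ - η) * H η := by fun_prop
    have := ENNReal.lintegral_mul_le_Lp_mul_Lq volume Real.HolderConjugate.two_two
      (hκ ξ).aemeasurable hm2.aemeasurable
    simp only [Pi.mul_apply, ENNReal.rpow_two] at this
    refine (pow_le_pow_left' this 2).trans ?_
    rw [mul_pow, ← ENNReal.rpow_two, ← ENNReal.rpow_two, ← ENNReal.rpow_mul, ← ENNReal.rpow_mul]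
    norm_num
    simp only [mul_pow]
    gcongr
    exact hA ξ
  refine (lintegral_mono h1).trans ?_
  rw [lintegral_const_mul A]
  swap
  · exact Measurable.lintegral_prod_right' (f := fun p : Sp n × Sp n => G (p.1 - p.2) ^ 2 * H p.2 ^ 2)
      (by fun_prop)
  gcongr
  rw [lintegral_lintegral_swap]
  swap
  · exact Measurable.aemeasurable (by fun_prop)
  have h2 : ∀ η, ∫⁻ ξ, G (ξ - η) ^ 2 * H η ^ 2 = (∫⁻ ξ, G ξ ^ 2) * H η ^ 2 := by
    intro η
    rw [lintegral_mul_const _ (by fun_prop), lintegral_sub_right_eq_self (fun ξ => G ξ ^ 2)]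
  simp only [h2]
  rw [lintegral_const_mul _ (by fun_prop)]

theorem enorm_toLp_sq (f : 𝓢(Sp n, ℂ)) : ‖f.toLp 2 volume‖ₑ ^ 2 = ∫⁻ x, ‖f x‖ₑ ^ 2 := by
  rw [Lp.enorm_def]
  rw [eLpNorm_congr_ae (f.coeFn_toLp 2 volume)]
  have := eLpNorm_nnreal_pow_eq_lintegral (f := f) (μ := volume) (p := 2) (by norm_num)
  simpa using this

/-- The constant of the product estimate. -/
def prodConst (n : ℕ) (m σ₀ σ : ℝ) : ℝ≥0 :=
  (NNReal.sqrt (ENNReal.toNNReal (ENNReal.ofReal (2 ^ (2 * σ)) *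
    (2 * ∫⁻ η : Sp n, ENNReal.ofReal (wt m (-(2 * σ₀)) η)))) * (‖((nc n : ℝ) : ℂ)⁻¹‖₊))

theorem lintegral_kernel_le {m : ℝ} (hm : 0 < m) {σ₀ σ : ℝ} (hσ : 0 ≤ σ) (h : σ ≤ σ₀) (ξ : Sp n) :
    ∫⁻ η, ENNReal.ofReal (wt m σ ξ * (wt m (-σ₀) (ξ - η) * wt m (-σ) η)) ^ 2 ≤
      ENNReal.ofReal (2 ^ (2 * σ)) * (2 * ∫⁻ η : Sp n, ENNReal.ofReal (wt m (-(2 * σ₀)) η)) := by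
  have hc := continuous_wt (n := n) hm (-(2 * σ₀))
  calc _ ≤ ∫⁻ η, ENNReal.ofReal (2 ^ (2 * σ)) * (ENNReal.ofReal (wt m (-(2 * σ₀)) (ξ - η)) +
        ENNReal.ofReal (wt m (-(2 * σ₀)) η)) := by
        refine lintegral_mono fun η => ?_
        rw [← ENNReal.ofReal_pow
          (mul_pos (wt_pos hm _ _) (mul_pos (wt_pos hm _ _) (wt_pos hm _ _))).le,
          ← ENNReal.ofReal_add (wt_pos hm _ _).le (wt_pos hm _ _).le,
          ← ENNReal.ofReal_mul (by positivity)]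
        exact ENNReal.ofReal_le_ofReal (wt_kernel_le hm hσ h ξ η)
    _ = _ := by
        have hm1 : Measurable fun η : Sp n => ENNReal.ofReal (wt m (-(2 * σ₀)) η) :=
          hc.measurable.ennreal_ofReal
        have hm2 : Measurable fun η : Sp n => ENNReal.ofReal (wt m (-(2 * σ₀)) (ξ - η)) :=
          hm1.comp (measurable_const.sub measurable_id)
        rw [lintegral_const_mul _ (by exact hm2.add hm1), lintegral_add_left hm2,
          lintegral_sub_left_eq_self (fun η => ENNReal.ofReal (wt m (-(2 * σ₀)) η))]
        rw [two_mul (∫⁻ η : Sp n, ENNReal.ofReal (wt m (-(2 * σ₀)) η))]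

/-- The transform of a product is a convolution. Weighted by `⟨ξ⟩^σ` and expressed by `G` and `H`,
it has the kernel of `wt_kernel_le`, whose square is integrable in `η` uniformly in `ξ` because `2σ₀
> n`. -/
theorem exists_prod_schwartz {m : ℝ} (hm : 0 < m) {σ₀ σ : ℝ} (h0 : (n : ℝ) / 2 < σ₀) (hσ : 0 ≤ σ)
    (h : σ ≤ σ₀) (G H : 𝓢(Sp n, ℂ)) : ∃ k : L2 n,
      ‖k‖ ≤ prodConst n m σ₀ σ * ‖G.toLp 2 volume‖ * ‖H.toLp 2 volume‖ ∧
      phys m σ k =ᵐ[volume] fun x =>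
        phys m σ₀ (G.toLp 2 volume) x * phys m σ (H.toLp 2 volume) x := by
  set z : ℂ := ((nc n : ℝ) : ℂ)⁻¹ with hz
  set a := SchwartzMap.smulLeftCLM ℂ (fun η : Sp n => ((wt m (-σ₀) η : ℝ) : ℂ)) G with ha
  set b := SchwartzMap.smulLeftCLM ℂ (fun η : Sp n => ((wt m (-σ) η : ℝ) : ℂ)) H with hb
  set c := SchwartzMap.convolution (ContinuousLinearMap.mul ℂ ℂ) a b with hc
  set k := z • SchwartzMap.smulLeftCLM ℂ (fun η : Sp n => ((wt m σ η : ℝ) : ℂ)) c with hk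
  refine ⟨k.toLp 2 volume, ?_, ?_⟩
  · set A := ENNReal.ofReal (2 ^ (2 * σ)) * (2 * ∫⁻ η : Sp n, ENNReal.ofReal (wt m (-(2 * σ₀)) η))
      with hA
    have hAtop : A ≠ ⊤ := ENNReal.mul_ne_top ENNReal.ofReal_ne_top
      (ENNReal.mul_ne_top (by simp) (lintegral_wt_lt_top hm h0).ne)
    have hpt : ∀ ξ, ‖k ξ‖ₑ ≤ ‖z‖ₑ * ∫⁻ η, ENNReal.ofReal (wt m σ ξ * (wt m (-σ₀) (ξ - η) *
        wt m (-σ) η)) * (‖G (ξ - η)‖ₑ * ‖H η‖ₑ) := by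
      intro ξ
      have h1 : k ξ = z * (wt m σ ξ * c ξ) := by
        rw [hk, smul_apply, smul_schwartz hm, smul_eq_mul]
      rw [h1, enorm_mul]
      gcongr
      rw [hc, SchwartzMap.convolution_apply, ← convolution_flip]
      unfold convolution
      rw [← integral_const_mul]
      refine (enorm_integral_le_lintegral_enorm _).trans (le_of_eq ?_)
      congr 1; ext η
      simp only [ContinuousLinearMap.flip_apply, ContinuousLinearMap.mul_apply']
      rw [ha, hb, smul_schwartz hm, smul_schwartz hm, enorm_mul, enorm_mul, enorm_mul, enorm_mul,
        ENNReal.ofReal_mul (wt_pos hm _ _).le, ENNReal.ofReal_mul (wt_pos hm _ _).le]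
      have e : ∀ (τ : ℝ) (ζ : Sp n), ‖((wt m τ ζ : ℝ) : ℂ)‖ₑ = ENNReal.ofReal (wt m τ ζ) := by
        intro τ ζ
        rw [← ofReal_norm, Complex.norm_real, Real.norm_of_nonneg (wt_pos hm _ _).le]
      rw [e, e, e]
      ring
    have hsq : ‖k.toLp 2 volume‖ₑ ^ 2 ≤ ‖z‖ₑ ^ 2 * (A * (‖G.toLp 2 volume‖ₑ ^ 2 *
        ‖H.toLp 2 volume‖ₑ ^ 2)) := by
      rw [enorm_toLp_sq, enorm_toLp_sq, enorm_toLp_sq]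
      refine (lintegral_mono fun ξ => pow_le_pow_left' (hpt ξ) 2).trans ?_
      simp only [mul_pow ‖z‖ₑ]
      rw [lintegral_const_mul' _ _ (by simp)]
      gcongr
      refine lintegral_conv_sq_le (fun ξ => ?_) (fun ξ => lintegral_kernel_le hm hσ h ξ)
        (by fun_prop) (by fun_prop)
      have := continuous_wt (n := n) hm (-σ₀)
      have := continuous_wt (n := n) hm (-σ)
      fun_prop
    have hsq' : ‖k.toLp 2 volume‖ ^ 2 ≤ (prodConst n m σ₀ σ * ‖G.toLp 2 volume‖ *
        ‖H.toLp 2 volume‖) ^ 2 := by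
      have := ENNReal.toReal_mono (by finiteness) hsq
      simp only [ENNReal.toReal_pow, ENNReal.toReal_mul, toReal_enorm] at this
      refine this.trans (le_of_eq ?_)
      rw [prodConst, ← hA]
      push_cast
      rw [mul_pow, mul_pow, mul_pow, Real.sq_sqrt (by positivity), ← hz]
      change _ = A.toReal * _ * _ * _
      ring
    exact (abs_le_of_sq_le_sq' hsq' (by positivity)).2
  · have e1 : SchwartzMap.smulLeftCLM ℂ (fun η : Sp n => ((wt m (-σ) η : ℝ) : ℂ)) k = z • c := by
      rw [hk, map_smul]
      congr 1
      ext η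
      rw [smul_schwartz hm, smul_schwartz hm, ← mul_assoc, ← Complex.ofReal_mul, wt_neg_mul hm]
      simp
    rw [phys_toLp hm hσ, phys_toLp hm (hσ.trans h), phys_toLp hm hσ, e1]
    filter_upwards [SchwartzMap.coeFn_toLp (z • 𝓕⁻ (z • c) : 𝓢(Sp n, ℂ)) 2 volume,
      SchwartzMap.coeFn_toLp (z • 𝓕⁻ a : 𝓢(Sp n, ℂ)) 2 volume,
      SchwartzMap.coeFn_toLp (z • 𝓕⁻ b : 𝓢(Sp n, ℂ)) 2 volume] with x h1 h2 h3
    rw [h1, h2, h3]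
    have e2 : ∀ f : 𝓢(Sp n, ℂ), (𝓕⁻ f) x = 𝓕 f (-x) := fun f => by
      rw [SchwartzMap.fourierInv_coe, SchwartzMap.fourier_coe,
        Real.fourierInv_eq_fourier_neg]
    have e3 : (𝓕⁻ c) x = (𝓕⁻ a) x * (𝓕⁻ b) x := by
      rw [e2, e2, e2, hc, SchwartzMap.fourier_convolution]
      rfl
    rw [FourierTransform.fourierInv_smul]
    simp only [smul_apply, smul_eq_mul, e3]
    ring

/-- Extension by density: the product of approximating Schwartz functions is bilinear and bounded,
hence Cauchy, and the pointwise identity survives almost everywhere along a subsequence. -/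
theorem exists_prod {m : ℝ} (hm : 0 < m) {σ₀ σ : ℝ} (h0 : (n : ℝ) / 2 < σ₀) (hσ : 0 ≤ σ)
    (h : σ ≤ σ₀) (G H : L2 n) : ∃ k : L2 n, ‖k‖ ≤ prodConst n m σ₀ σ * ‖G‖ * ‖H‖ ∧
      phys m σ k =ᵐ[volume] fun x => phys m σ₀ G x * phys m σ H x := by
  set C : ℝ := (prodConst n m σ₀ σ : ℝ) with hC
  have hC0 : 0 ≤ C := NNReal.coe_nonneg _
  have hd : ∀ g : L2 n, ∃ f : ℕ → 𝓢(Sp n, ℂ),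
      Tendsto (fun j => (f j).toLp 2 volume) atTop (𝓝 g) := by
    intro g
    have h1 : g ∈ closure (range (SchwartzMap.toLpCLM ℂ ℂ (E := Sp n) 2 volume)) :=
      (SchwartzMap.denseRange_toLpCLM (p := 2) ENNReal.ofNat_ne_top) g
    obtain ⟨y, hy, hlim⟩ := mem_closure_iff_seq_limit.1 h1
    choose f hf using hy
    refine ⟨f, ?_⟩
    have : (fun j => (f j).toLp 2 volume) = y := funext hf
    rw [this]; exact hlim
  obtain ⟨f, hf⟩ := hd G
  obtain ⟨g, hg⟩ := hd H
  choose B hB1 hB2 using fun f g => exists_prod_schwartz hm h0 hσ h f g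
  have hBadd : ∀ f f' g g', B f g - B f' g' = B (f - f') g + B f' (g - g') := by
    intro f f' g g'
    apply phys_injective hm hσ
    apply Lp.ext
    rw [map_sub, map_add]
    have t : ∀ f f' : 𝓢(Sp n, ℂ), (f - f').toLp 2 volume = f.toLp 2 volume - f'.toLp 2 volume :=
      fun f f' => (SchwartzMap.toLpCLM ℂ ℂ (E := Sp n) 2 volume).map_sub f f'
    have hx := hB2 (f - f') g
    have hy := hB2 f' (g - g')
    rw [t, map_sub] at hx hy
    filter_upwards [Lp.coeFn_sub (phys m σ (B f g)) (phys m σ (B f' g')),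
      Lp.coeFn_add (phys m σ (B (f - f') g)) (phys m σ (B f' (g - g'))), hx, hy, hB2 f g, hB2 f' g',
      Lp.coeFn_sub (phys m σ₀ (f.toLp 2 volume)) (phys m σ₀ (f'.toLp 2 volume)),
      Lp.coeFn_sub (phys m σ (g.toLp 2 volume)) (phys m σ (g'.toLp 2 volume))]
      with x h1 h2 h3 h4 h5 h6 h7 h8
    rw [h1, h2, Pi.sub_apply, Pi.add_apply, h3, h4, h5, h6, h7, h8, Pi.sub_apply, Pi.sub_apply]
    ring
  have t : ∀ f f' : 𝓢(Sp n, ℂ), (f - f').toLp 2 volume = f.toLp 2 volume - f'.toLp 2 volume :=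
    fun f f' => (SchwartzMap.toLpCLM ℂ ℂ (E := Sp n) 2 volume).map_sub f f'
  obtain ⟨M, hM⟩ := hf.norm.bddAbove_range
  obtain ⟨M', hM'⟩ := hg.norm.bddAbove_range
  have hM1 : ∀ j, ‖(f j).toLp 2 volume‖ ≤ M := fun j => hM ⟨j, rfl⟩
  have hM2 : ∀ j, ‖(g j).toLp 2 volume‖ ≤ M' := fun j => hM' ⟨j, rfl⟩
  have hcau : CauchySeq fun j => B (f j) (g j) := by
    have hF := hf.cauchySeq
    have hG := hg.cauchySeq
    rw [cauchySeq_iff_tendsto_dist_atTop_0] at hF hG ⊢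
    have hlim : Tendsto (fun p : ℕ × ℕ => C * dist ((f p.1).toLp 2 volume) ((f p.2).toLp 2 volume) *
        M' + C * M * dist ((g p.1).toLp 2 volume) ((g p.2).toLp 2 volume)) atTop (𝓝 0) := by
      have := ((hF.const_mul C).mul_const M').add (hG.const_mul (C * M))
      simpa using this
    refine squeeze_zero (fun _ => dist_nonneg) (fun p => ?_) hlim
    rw [dist_eq_norm, hBadd]
    refine (norm_add_le _ _).trans (add_le_add ?_ ?_)
    · refine (hB1 _ _).trans ?_
      rw [t, dist_eq_norm]
      exact mul_le_mul_of_nonneg_left (hM2 _) (by positivity)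
    · refine (hB1 _ _).trans ?_
      rw [t, dist_eq_norm]
      gcongr
      exact hM1 _
  obtain ⟨k, hk⟩ := cauchySeq_tendsto_of_complete hcau
  refine ⟨k, le_of_tendsto_of_tendsto hk.norm (((hf.norm).const_mul C).mul hg.norm)
    (Eventually.of_forall fun j => hB1 _ _), ?_⟩
  have hsub : ∀ {y : ℕ → L2 n} {y' : L2 n}, Tendsto y atTop (𝓝 y') → ∃ ns : ℕ → ℕ, StrictMono ns ∧
      ∀ᵐ x, Tendsto (fun i => y (ns i) x) atTop (𝓝 (y' x)) := fun hy =>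
    (tendstoInMeasure_of_tendsto_Lp hy).exists_seq_tendsto_ae
  have l1 := ((phys m σ₀).continuous.tendsto G).comp hf
  have l2 := ((phys m σ).continuous.tendsto H).comp hg
  have l3 := ((phys m σ).continuous.tendsto k).comp hk
  -- Successive extractions give one subsequence along which both factors and the product converge
  -- almost everywhere.
  obtain ⟨n1, hn1, a1⟩ := hsub l1
  obtain ⟨n2, hn2, a2⟩ := hsub (l2.comp hn1.tendsto_atTop)
  obtain ⟨n3, hn3, a3⟩ := hsub ((l3.comp hn1.tendsto_atTop).comp hn2.tendsto_atTop)
  have hall : ∀ᵐ x, ∀ j, phys m σ (B (f j) (g j)) x =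
      phys m σ₀ ((f j).toLp 2 volume) x * phys m σ ((g j).toLp 2 volume) x :=
    ae_all_iff.2 fun j => hB2 _ _
  filter_upwards [a1, a2, a3, hall] with x h1 h2 h3 h4
  have h5 := ((h1.comp hn2.tendsto_atTop).comp hn3.tendsto_atTop).mul (h2.comp hn3.tendsto_atTop)
  refine tendsto_nhds_unique h3 (h5.congr fun j => ?_)
  simp only [Function.comp_apply]
  rw [h4]

/-! ### Coefficients of the nonlinearity -/

/-- Polarization: the derivative of order `p` at zero of `z ↦ g(z, …, z)` is the sum of `g` over all
permutations of its arguments, and it depends only on the values on the diagonal. -/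
theorem factorial_smul_eq_sum_perm {E F : Type*} [NormedAddCommGroup E] [NormedSpace ℝ E]
    [NormedAddCommGroup F] [NormedSpace ℝ F] {p : ℕ} (f g : E [×p]→L[ℝ] F)
    (hf : ∀ (σ : Equiv.Perm (Fin p)) v, f (v ∘ σ) = f v)
    (h : ∀ z, f (fun _ => z) = g (fun _ => z)) (v : Fin p → E) :
    (p.factorial : ℝ) • f v = ∑ σ : Equiv.Perm (Fin p), g (v ∘ σ) := by
  have h1 : (fun z => f (fun _ => z)) = fun z => g (fun _ => z) := funext h
  have h2 := f.iteratedFDeriv_comp_diagonal 0 v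
  rw [h1, g.iteratedFDeriv_comp_diagonal 0 v] at h2
  have h3 : ∀ σ : Equiv.Perm (Fin p), f (fun i => v (σ i)) = f v := fun σ => hf σ v
  simp only [h3, Finset.sum_const, Finset.card_univ, Fintype.card_perm, Fintype.card_fin] at h2
  rw [Nat.cast_smul_eq_nsmul, ← h2]
  rfl

/-- The vectors of the canonical basis of the space of jets. -/
def jetVec (k : JetIdx n d₁ d₂) : Jet n d₁ d₂ := WithLp.toLp 1 (Pi.single k 1)

theorem jetVec_apply (k l : JetIdx n d₁ d₂) : jetVec k l = if l = k then 1 else 0 := by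
  simp [jetVec]

theorem norm_jetVec (k : JetIdx n d₁ d₂) : ‖jetVec k‖ = 1 := by
  rw [PiLp.norm_eq_of_L1, Finset.sum_eq_single k]
  · simp [jetVec_apply]
  · intro l _ h
    simp [jetVec_apply, h]
  · simp

theorem sum_jetVec (z : Jet n d₁ d₂) : z = ∑ k, z k • jetVec k := by
  ext l
  simp [jetVec_apply, -Fintype.sum_sum_type]

/-- The coefficients of `N`. -/
def coeffN (N : Series n d₁ d₂) (p : ℕ) (i : Idx d₁ d₂) (κ : Fin p → JetIdx n d₁ d₂) : ℝ :=
  N p (fun a => jetVec (κ a)) i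

theorem abs_coeffN_le (N : Series n d₁ d₂) (p : ℕ) (i : Idx d₁ d₂) (κ : Fin p → JetIdx n d₁ d₂) :
    |coeffN N p i κ| ≤ ‖N p‖ := by
  have h1 := (N p).le_opNorm (fun a => jetVec (κ a))
  simp only [norm_jetVec, Finset.prod_const_one, mul_one] at h1
  exact (norm_le_pi_norm (N p fun a => jetVec (κ a)) i).trans h1

theorem apply_eq_sum_coeffN (N : Series n d₁ d₂) (p : ℕ) (i : Idx d₁ d₂)
    (z : Fin p → Jet n d₁ d₂) :
    N p z i = ∑ κ : Fin p → JetIdx n d₁ d₂, coeffN N p i κ * ∏ a, z a (κ a) := by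
  classical
  have h1 : z = fun a => ∑ k, z a k • jetVec k := funext fun a => sum_jetVec (z a)
  conv_lhs => rw [h1]
  rw [(N p).map_sum]
  simp only [(N p).map_smul_univ, Finset.sum_apply, Pi.smul_apply, smul_eq_mul]
  exact Finset.sum_congr rfl fun κ _ => mul_comm _ _

open Classical in
/-- The projection to the jets with coordinates in `S`. -/
def jetProj (S : Set (JetIdx n d₁ d₂)) : Jet n d₁ d₂ →L[ℝ] Jet n d₁ d₂ :=
  LinearMap.toContinuousLinearMap
    { toFun := fun z => WithLp.toLp 1 fun k => if k ∈ S then z k else 0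
      map_add' := fun z w => by ext k; by_cases h : k ∈ S <;> simp [h]
      map_smul' := fun c z => by ext k; by_cases h : k ∈ S <;> simp [h] }

theorem jetProj_apply (S : Set (JetIdx n d₁ d₂)) [DecidablePred (· ∈ S)] (z : Jet n d₁ d₂)
    (k : JetIdx n d₁ d₂) : jetProj S z k = if k ∈ S then z k else 0 := by
  simp only [jetProj, LinearMap.coe_toContinuousLinearMap', LinearMap.coe_mk, AddHom.coe_mk]

theorem jetProj_jetVec {S : Set (JetIdx n d₁ d₂)} {k : JetIdx n d₁ d₂} (h : k ∉ S) :
    jetProj S (jetVec k) = 0 := by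
  classical
  ext l
  rw [jetProj_apply, jetVec_apply]
  by_cases hl : l = k
  · subst hl; simp [h]
  · simp [hl]

/-- The component of index `i` of the polarized homogeneous term of degree `p` of `N`. -/
def compN (N : Series n d₁ d₂) (p : ℕ) (i : Idx d₁ d₂) : Jet n d₁ d₂ [×p]→L[ℝ] ℝ :=
  (ContinuousLinearMap.proj (R := ℝ) (φ := fun _ : Idx d₁ d₂ => ℝ) i).compContinuousMultilinearMap
    (N p)

/-- On the diagonal, the component agrees with its composition with the projection onto the
coordinates in `S`. After polarization, a basis vector outside `S` in any slot is sent to zero. -/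
theorem coeffN_eq_zero_of_dependsOnlyOn {N : Series n d₁ d₂} (hN : IsSymm N) {i : Idx d₁ d₂}
    {S : Set (JetIdx n d₁ d₂)} (h : DependsOnlyOn N i S) {p : ℕ} {κ : Fin p → JetIdx n d₁ d₂}
    {a : Fin p} (ha : κ a ∉ S) : coeffN N p i κ = 0 := by
  classical
  have h1 := factorial_smul_eq_sum_perm (compN N p i)
    ((compN N p i).compContinuousLinearMap fun _ => jetProj S)
    (fun σ v => congrFun (hN p σ v) i)
    (fun z => h p z (jetProj S z) fun k hk => by rw [jetProj_apply, if_pos hk])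
    (fun a => jetVec (κ a))
  rw [Finset.sum_eq_zero] at h1
  · exact (smul_eq_zero.1 h1).resolve_left (by exact_mod_cast p.factorial_ne_zero)
  · intro σ _
    rw [ContinuousMultilinearMap.compContinuousLinearMap_apply]
    apply ContinuousMultilinearMap.map_coord_zero _ (σ.symm a)
    simp [jetProj_jetVec ha]

/-- The field part of a jet. -/
def fieldPart : Jet n d₁ d₂ →L[ℝ] Fld d₁ d₂ :=
  LinearMap.toContinuousLinearMap
    { toFun := fun z i => z (Sum.inl i)
      map_add' := fun _ _ => rfl
      map_smul' := fun _ _ => rfl }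

theorem fieldPart_jetVec (k : Fin d₂ ⊕ (Fin n × Idx d₁ d₂)) :
    fieldPart (jetVec (d₁ := d₁) (Sum.inr k)) = 0 := by
  funext i
  change jetVec (Sum.inr k) (Sum.inl i) = 0
  simp [jetVec_apply]

/-- A monomial of an affine nonlinearity contains at most one derivative coordinate. Polarizing the
affine form, the part from `J` sees only fields, and each part from `K` sees a derivative in its
first slot only. -/
theorem coeffN_eq_zero_of_isAffine {N : Series n d₁ d₂} (hN : IsSymm N) (h : IsAffine N)
    {j : Fin d₂} {p : ℕ} {κ : Fin p → JetIdx n d₁ d₂} {a b : Fin p} (hab : a ≠ b)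
    (ha : κ a ∉ fieldCoords n d₁ d₂) (hb : κ b ∉ fieldCoords n d₁ d₂) :
    coeffN N p (Sum.inr j) κ = 0 := by
  obtain ⟨J, K, hJK⟩ := h
  cases p with
  | zero => exact a.elim0
  | succ p =>
  have hne : ∀ c, κ c ∉ fieldCoords n d₁ d₂ → fieldPart (jetVec (κ c)) = 0 := by
    intro c hc
    rcases hκ : κ c with i | k
    · exact absurd ⟨i, hκ.symm⟩ hc
    · exact fieldPart_jetVec k
  let pj := ContinuousLinearMap.proj (R := ℝ) (φ := fun _ : Fin d₂ => ℝ) j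
  let J' : Jet n d₁ d₂ [×(p + 1)]→L[ℝ] ℝ :=
    pj.compContinuousMultilinearMap ((J (p + 1)).compContinuousLinearMap fun _ => fieldPart)
  let K' : (Fin d₂ ⊕ (Fin n × Idx d₁ d₂)) → Jet n d₁ d₂ [×(p + 1)]→L[ℝ] ℝ := fun k =>
    ContinuousLinearMap.uncurryLeft ((PiLp.proj 1 (fun _ : JetIdx n d₁ d₂ => ℝ) (Sum.inr k) :
      Jet n d₁ d₂ →L[ℝ] ℝ).smulRight
        (pj.compContinuousMultilinearMap ((K k p).compContinuousLinearMap fun _ => fieldPart)))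
  have hK' : ∀ k v, K' k v = v 0 (Sum.inr k) * K k p (fun c => fieldPart (v c.succ)) j :=
    fun k v => rfl
  have h1 := factorial_smul_eq_sum_perm (compN N (p + 1) (Sum.inr j)) (J' + ∑ k, K' k)
    (fun σ v => congrFun (hN (p + 1) σ v) (Sum.inr j))
    (fun z => by
      refine ((hJK z j).2 p).trans ?_
      rw [add_apply, sum_apply]
      simp only [hK']
      congr 1
      exact Finset.sum_congr rfl fun k _ => mul_comm _ _)
    (fun a => jetVec (κ a))
  rw [Finset.sum_eq_zero] at h1
  · exact (smul_eq_zero.1 h1).resolve_left (by exact_mod_cast (p + 1).factorial_ne_zero)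
  · intro σ _
    rw [add_apply, sum_apply]
    have e1 : J' ((fun a => jetVec (κ a)) ∘ σ) = 0 := by
      change J (p + 1) (fun c => fieldPart (jetVec (κ (σ c)))) j = 0
      rw [(J (p + 1)).map_coord_zero (σ.symm a) (by simp [hne a ha])]
      rfl
    rw [e1, zero_add]
    refine Finset.sum_eq_zero fun k _ => ?_
    rw [hK']
    -- Of two distinct derivative slots, at least one is not the first, and there a field is
    -- expected.
    obtain ⟨c, hc, hc0⟩ : ∃ c, κ (σ c) ∉ fieldCoords n d₁ d₂ ∧ c ≠ 0 := by
      by_cases h0 : σ.symm a = 0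
      · refine ⟨σ.symm b, by simpa using hb, fun h => hab ?_⟩
        rw [← h0] at h
        exact (σ.symm.injective h).symm
      · exact ⟨σ.symm a, by simpa using ha, h0⟩
    obtain ⟨c', rfl⟩ := Fin.exists_succ_eq.2 hc0
    rw [(K k p).map_coord_zero c' (hne _ hc)]
    simp

/-! ### Coordinates of jets -/

/-- The Sobolev order of the coordinates of a jet. -/
def jetExp (r : ℕ) (s : ℝ) : JetIdx n d₁ d₂ → ℝ
  | Sum.inl _ => s
  | Sum.inr (Sum.inl _) => s - r
  | Sum.inr (Sum.inr _) => s - 1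

/-- The coordinates of a jet in terms of the Cauchy data. -/
def jetOp (m : ℝ) : JetIdx n d₁ d₂ → (Data n d₁ d₂ →L[ℂ] L2 n)
  | Sum.inl i => PiLp.proj 1 (fun _ : DIdx d₁ d₂ => L2 n) (fieldIdx i)
  | Sum.inr (Sum.inl j) => PiLp.proj 1 (fun _ : DIdx d₁ d₂ => L2 n) (Sum.inr (Sum.inr j))
  | Sum.inr (Sum.inr (l, i)) => (polyOp m 1 (MvPolynomial.X l)) ∘L
      (PiLp.proj 1 (fun _ : DIdx d₁ d₂ => L2 n) (fieldIdx i) : Data n d₁ d₂ →L[ℂ] L2 n)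

/-- The order of quantifiers matters: as both norms are sums over the coordinates, the constant does
not see `d₁` and `d₂`. The final `Q` inherits this. -/
theorem exists_norm_jetOp_le (n : ℕ) (m : ℝ) : ∃ c : ℝ, 0 ≤ c ∧
    ∀ (d₁ d₂ : ℕ) (x : Data n d₁ d₂), ∑ k, ‖jetOp m k x‖ ≤ c * ‖x‖ := by
  have h1 : ∀ l : Fin n, ∃ C : ℝ, 0 ≤ C ∧
      ∀ f : L2 n, ‖polyOp m 1 (MvPolynomial.X l : MvPolynomial (Fin n) ℝ) f‖ ≤ C * ‖f‖ := fun l =>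
    ⟨_, norm_nonneg _, fun f => ContinuousLinearMap.le_opNorm _ f⟩
  choose C hC0 hC using h1
  refine ⟨1 + ∑ l, C l, add_nonneg zero_le_one (Finset.sum_nonneg fun l _ => hC0 l), fun d₁ d₂ x => ?_⟩
  have h2 : ∑ i : Idx d₁ d₂, ‖x (fieldIdx i)‖ + ∑ j : Fin d₂, ‖x (Sum.inr (Sum.inr j))‖ = ‖x‖ := by
    rw [norm_VL2, Fintype.sum_sum_type, Fintype.sum_sum_type, Fintype.sum_sum_type, add_assoc]
    rfl
  have h3 : ∑ i : Idx d₁ d₂, ‖x (fieldIdx i)‖ ≤ ‖x‖ := by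
    rw [← h2]
    exact le_add_of_nonneg_right (Finset.sum_nonneg fun _ _ => norm_nonneg _)
  have h4 : ∑ k, ‖jetOp m k x‖ = ∑ i : Idx d₁ d₂, ‖x (fieldIdx i)‖ +
      (∑ j : Fin d₂, ‖x (Sum.inr (Sum.inr j))‖ +
        ∑ l, ∑ i, ‖polyOp m 1 (MvPolynomial.X l) (x (fieldIdx i))‖) :=
    (Fintype.sum_sum_type _).trans (congrArg₂ _ rfl ((Fintype.sum_sum_type _).trans
      (congrArg₂ _ rfl (Fintype.sum_prod_type _))))
  rw [h4, ← add_assoc]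
  rw [h2, add_mul, one_mul, Finset.sum_mul]
  gcongr with l
  calc _ ≤ ∑ i, C l * ‖x (fieldIdx i)‖ := Finset.sum_le_sum fun i _ => hC l _
    _ ≤ _ := by
      rw [← Finset.mul_sum]
      exact mul_le_mul_of_nonneg_left h3 (hC0 l)

theorem IsRealDist.lineDeriv {f : Dist n} (hf : IsRealDist f) (v : Sp n) : IsRealDist (∂_{v} f) := by
  intro g hg
  rw [TemperedDistribution.lineDerivOp_apply_apply, map_neg, Complex.neg_im, neg_eq_zero]
  apply hf
  intro x
  rw [SchwartzMap.lineDerivOp_apply_eq_fderiv]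
  have h2 : HasFDerivAt g (fderiv ℝ g x) x := g.differentiableAt.hasFDerivAt
  have h3 := Complex.imCLM.hasFDerivAt.comp x h2
  have h4 : (Complex.imCLM ∘ g) = fun _ => (0 : ℝ) := funext hg
  rw [h4] at h3
  exact congrArg (fun T => T v) (h3.unique (hasFDerivAt_const 0 x))

theorem ofReal_rep_phys {m : ℝ} (hm : 0 < m) {σ : ℝ} (hσ : 0 ≤ σ) {g : L2 n} {f : Dist n}
    (hf : IsRealDist f) (h : f = hatT m σ g) :
    ∀ᵐ y, (((rep f y).re : ℝ) : ℂ) = phys m σ g y := by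
  rw [hatT_eq_phys hm hσ] at h
  subst h
  rw [rep_coe]
  filter_upwards [isRealDist_coe.1 hf] with y hy
  exact Complex.ext rfl hy.symm

theorem PathRep.ofReal_jet {r : ℕ} {m s : ℝ} {I : Set ℝ} {u : FieldPath n d₁ d₂}
    {U V : ℝ → Idx d₁ d₂ → L2 n} (h : PathRep r m s I u U V) (hm : 0 < m) (hI : I.OrdConnected)
    (hne : (interior I).Nonempty) {t : ℝ} (ht : t ∈ I) {k : JetIdx n d₁ d₂}
    (hk : 0 ≤ jetExp r s k) : ∀ᵐ y, ((jet I u t y k : ℝ) : ℂ) =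
      phys m (jetExp r s k) (jetOp m k (mkData (U t) (V t))) y := by
  have hreal : ∀ i, IsRealDist (u t i) := fun i => by
    rw [h.eq t ht]; exact (isRealDist_hatT hm).2 (h.herm t ht i)
  have e1 : ∀ i, mkData (U t) (V t) (fieldIdx i) = U t i := by rintro (i | i) <;> rfl
  rcases k with i | j | ⟨l, i⟩
  · exact ofReal_rep_phys hm hk (hreal i) (by rw [h.eq t ht, ← e1]; rfl)
  · have e2 := h.timeDeriv_eq hm hI hne ht (Sum.inr j)
    refine ofReal_rep_phys hm hk ?_ e2
    rw [e2]
    exact (isRealDist_hatT hm).2 (h.herm_deriv t ht _)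
  · refine ofReal_rep_phys hm hk ((hreal i).lineDeriv _) ?_
    rw [h.eq t ht, lineDeriv_hatT hm, ← e1]
    rfl

/-! ### Multilinear maps defined by products -/

/-- One factor `g₀` of order `σ` is multiplied successively by factors of order `σ₀`, each at the
cost of one constant. -/
theorem exists_prod_finset {m : ℝ} (hm : 0 < m) {σ₀ σ : ℝ} (h0 : (n : ℝ) / 2 < σ₀) (hσ : 0 ≤ σ)
    (h : σ ≤ σ₀) {ι : Type*} (s : Finset ι) (g : ι → L2 n) (g₀ : L2 n) : ∃ k : L2 n,
      ‖k‖ ≤ ‖g₀‖ * ∏ a ∈ s, (prodConst n m σ₀ σ * ‖g a‖) ∧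
      phys m σ k =ᵐ[volume] fun y => phys m σ g₀ y * ∏ a ∈ s, phys m σ₀ (g a) y := by
  classical
  induction s using Finset.induction_on with
  | empty => exact ⟨g₀, by simp, by simp⟩
  | insert a s ha ih =>
    obtain ⟨k, hk, hk'⟩ := ih
    obtain ⟨l, hl, hl'⟩ := exists_prod hm h0 hσ h (g a) k
    refine ⟨l, hl.trans ?_, ?_⟩
    · rw [Finset.prod_insert ha, mul_left_comm]
      exact mul_le_mul_of_nonneg_left hk (by positivity)
    · filter_upwards [hk', hl'] with y h1 h2
      rw [h2, h1, Finset.prod_insert ha, mul_left_comm]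

/-- The multilinear form with coefficients `c`. -/
def formOf {ι : Type*} [Fintype ι] {p : ℕ} (c : (Fin p → ι) → ℂ) :
    MultilinearMap ℂ (fun _ : Fin p => ι → ℂ) ℂ :=
  ∑ κ : Fin p → ι, c κ • (MultilinearMap.mkPiAlgebra ℂ (Fin p) ℂ).compLinearMap
    fun a => LinearMap.proj (κ a)

theorem formOf_apply {ι : Type*} [Fintype ι] {p : ℕ} (c : (Fin p → ι) → ℂ) (z : Fin p → ι → ℂ) :
    formOf c z = ∑ κ : Fin p → ι, c κ * ∏ a, z a (κ a) := by
  simp [formOf]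

theorem formOf_update_add {ι : Type*} [Fintype ι] {p : ℕ} [DecidableEq (Fin p)]
    (c : (Fin p → ι) → ℂ) (z : Fin p → ι → ℂ) (a : Fin p) {u v w : ι → ℂ} (h : ∀ i, w i = u i + v i) :
    formOf c (Function.update z a w) =
      formOf c (Function.update z a u) + formOf c (Function.update z a v) := by
  rw [← MultilinearMap.map_update_add, show w = u + v from funext h]

theorem formOf_update_smul {ι : Type*} [Fintype ι] {p : ℕ} [DecidableEq (Fin p)]
    (c : (Fin p → ι) → ℂ) (z : Fin p → ι → ℂ) (a : Fin p) {u w : ι → ℂ} {ζ : ℂ}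
    (h : ∀ i, w i = ζ • u i) :
    formOf c (Function.update z a w) = ζ • formOf c (Function.update z a u) := by
  rw [← MultilinearMap.map_update_smul, show w = ζ • u from funext h]

/-- It is enough to produce each value with its bound. Multilinearity is automatic, since the
pointwise formula is multilinear and `phys` is injective. -/
theorem exists_multilinear {m : ℝ} (hm : 0 < m) {σ : ℝ} (hσ : 0 ≤ σ) {X : Type*}
    [NormedAddCommGroup X] [NormedSpace ℂ X] {ι : Type*} [Fintype ι] {p : ℕ} (w : ι → X →L[ℂ] L2 n)
    (c : (Fin p → ι) → ℂ) {B : ℝ} (hB0 : 0 ≤ B) (hB : ∀ x : Fin p → X, ∃ k : L2 n,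
      ‖k‖ ≤ B * ∏ a, ‖x a‖ ∧
      phys m σ k =ᵐ[volume] fun y => formOf c fun a i => phys m σ (w i (x a)) y) :
    ∃ M : X [×p]→L[ℂ] L2 n, ‖M‖ ≤ B ∧ ∀ x,
      phys m σ (M x) =ᵐ[volume] fun y => formOf c fun a i => phys m σ (w i (x a)) y := by
  choose k hk hk' using hB
  have hupd : ∀ (y : Sp n) (inst : DecidableEq (Fin p)) (x : Fin p → X) (a : Fin p) (u : X),
      (fun b i => phys m σ (w i (Function.update x a u b)) y) =
        Function.update (fun b i => phys m σ (w i (x b)) y) a fun i => phys m σ (w i u) y := by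
    intro y inst x a u
    funext b
    rcases eq_or_ne b a with rfl | hb
    · simp
    · simp [hb]
  have hk'' : ∀ (inst : DecidableEq (Fin p)) (x : Fin p → X) (a : Fin p) (u : X), ∀ᵐ y,
      phys m σ (k (Function.update x a u)) y = formOf c (Function.update
        (fun b i => phys m σ (w i (x b)) y) a fun i => phys m σ (w i u) y) := by
    intro inst x a u
    filter_upwards [hk' (Function.update x a u)] with y hy
    exact hy.trans (congrArg (formOf c) (hupd y inst x a u))
  clear hupd
  have hadd : ∀ (inst : DecidableEq (Fin p)) (x : Fin p → X) (a : Fin p) (u v : X),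
      k (Function.update x a (u + v)) = k (Function.update x a u) + k (Function.update x a v) := by
    intro inst x a u v
    apply phys_injective hm hσ
    apply Lp.ext
    have h0 : ∀ᵐ y, ∀ i, phys m σ (w i (u + v)) y =
        phys m σ (w i u) y + phys m σ (w i v) y := by
      rw [ae_all_iff]
      intro i
      rw [map_add, map_add]
      exact Lp.coeFn_add _ _
    rw [map_add]
    filter_upwards [h0, hk'' inst x a (u + v), hk'' inst x a u, hk'' inst x a v,
      Lp.coeFn_add (phys m σ (k (Function.update x a u)))
        (phys m σ (k (Function.update x a v)))] with y h1 h2 h3 h4 h5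
    exact h2.trans ((formOf_update_add c _ a h1).trans
      ((congrArg₂ (· + ·) h3.symm h4.symm).trans h5.symm))
  have hsmul : ∀ (inst : DecidableEq (Fin p)) (x : Fin p → X) (a : Fin p) (z : ℂ) (u : X),
      k (Function.update x a (z • u)) = z • k (Function.update x a u) := by
    intro inst x a z u
    apply phys_injective hm hσ
    apply Lp.ext
    have h0 : ∀ᵐ y, ∀ i, phys m σ (w i (z • u)) y = z • phys m σ (w i u) y := by
      rw [ae_all_iff]
      intro i
      rw [map_smul, map_smul]
      exact Lp.coeFn_smul _ _
    rw [map_smul]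
    filter_upwards [h0, hk'' inst x a (z • u), hk'' inst x a u,
      Lp.coeFn_smul z (phys m σ (k (Function.update x a u)))] with y h1 h2 h3 h4
    exact h2.trans ((formOf_update_smul c _ a h1).trans
      ((congrArg (z • ·) h3.symm).trans h4.symm))
  let M : MultilinearMap ℂ (fun _ : Fin p => X) (L2 n) :=
    { toFun := k
      map_update_add' := @hadd
      map_update_smul' := @hsmul }
  have hM : ∀ x, ‖M x‖ ≤ B * ∏ a, ‖x a‖ := hk
  refine ⟨M.mkContinuous B hM, M.mkContinuous_norm_le hB0 hM, fun x => ?_⟩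
  rw [M.coe_mkContinuous]
  exact hk' x

/-! ### The nonlinearity as a power series on the space of Cauchy data -/

/-- A bound for the weights that lower the order of the coordinates of jets to `τ`. -/
def scaleConst (m : ℝ) (r : ℕ) (s τ : ℝ) : ℝ := m ^ (τ - s) + m ^ (τ - (s - r)) + m ^ (τ - (s - 1))

theorem scaleConst_nonneg {m : ℝ} (hm : 0 < m) (r : ℕ) (s τ : ℝ) : 0 ≤ scaleConst m r s τ := by
  unfold scaleConst
  positivity

theorem norm_mulOp_wt_le {m : ℝ} (hm : 0 < m) {r : ℕ} {s τ : ℝ} {k : JetIdx n d₁ d₂}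
    (h : τ ≤ jetExp r s k) (f : L2 n) :
    ‖mulOp (fun η => ((wt m (τ - jetExp r s k) η : ℝ) : ℂ)) f‖ ≤ scaleConst m r s τ * ‖f‖ := by
  have h1 : m ^ (τ - jetExp r s k) ≤ scaleConst m r s τ := by
    have p1 := Real.rpow_pos_of_pos hm (τ - s)
    have p2 := Real.rpow_pos_of_pos hm (τ - (s - r))
    have p3 := Real.rpow_pos_of_pos hm (τ - (s - 1))
    unfold scaleConst
    rcases k with i | j | k <;> simp only [jetExp] <;> linarith
  refine (norm_mulOp_le (isMult_wt_sub hm h) (C := m ^ (τ - jetExp r s k)) (fun η => ?_) f).trans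
    (mul_le_mul_of_nonneg_right h1 (norm_nonneg _))
  rw [Complex.norm_real, Real.norm_of_nonneg (wt_pos hm _ _).le]
  have := wt_neg_le hm (sub_nonneg.2 h) η
  rwa [neg_sub] at this

/-- The coordinates of a jet, with the order lowered to `σ`. -/
def jetOpAt (m : ℝ) (r : ℕ) (s σ : ℝ) (k : JetIdx n d₁ d₂) : Data n d₁ d₂ →L[ℂ] L2 n :=
  mulOp (fun η => ((wt m (σ - jetExp r s k) η : ℝ) : ℂ)) ∘L jetOp m k

theorem phys_jetOpAt {m : ℝ} (hm : 0 < m) {r : ℕ} {s σ : ℝ} (hσ : 0 ≤ σ) {k : JetIdx n d₁ d₂}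
    (h : σ ≤ jetExp r s k) (x : Data n d₁ d₂) :
    phys m σ (jetOpAt m r s σ k x) = phys m (jetExp r s k) (jetOp m k x) :=
  phys_scale hm hσ h _

theorem norm_jetOpAt_le {m : ℝ} (hm : 0 < m) {r : ℕ} {s σ : ℝ} {k : JetIdx n d₁ d₂}
    (h : σ ≤ jetExp r s k) (x : Data n d₁ d₂) :
    ‖jetOpAt m r s σ k x‖ ≤ scaleConst m r s σ * ‖jetOp m k x‖ := norm_mulOp_wt_le hm h _

/-- The component of index `i` of `N` only involves monomials in the coordinates of order at least
`σ` of jets, in which at most one coordinate is of order less than `σ₀`. -/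
def IsTame (r : ℕ) (s σ₀ σ : ℝ) (N : Series n d₁ d₂) (i : Idx d₁ d₂) : Prop :=
  ∀ (p : ℕ) (κ : Fin p → JetIdx n d₁ d₂), coeffN N p i κ ≠ 0 →
    (∀ a, σ ≤ jetExp r s (κ a)) ∧
      ∀ a b, a ≠ b → σ₀ ≤ jetExp r s (κ a) ∨ σ₀ ≤ jetExp r s (κ b)

/-- The factor of low order, if there is one, is kept in `H^σ`; all the others are in `H^{σ₀}` and
act on it by multiplication. -/
theorem exists_monomial {m : ℝ} (hm : 0 < m) {r : ℕ} {s σ₀ σ : ℝ} (h0 : (n : ℝ) / 2 < σ₀)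
    (hσ : 0 ≤ σ) (h : σ ≤ σ₀) {p : ℕ} (hp : p ≠ 0) {κ : Fin p → JetIdx n d₁ d₂}
    (h1 : ∀ a, σ ≤ jetExp r s (κ a))
    (h2 : ∀ a b, a ≠ b → σ₀ ≤ jetExp r s (κ a) ∨ σ₀ ≤ jetExp r s (κ b)) (x : Fin p → Data n d₁ d₂) :
    ∃ k : L2 n, ‖k‖ ≤ ∏ a, ((scaleConst m r s σ + prodConst n m σ₀ σ * scaleConst m r s σ₀) *
        ‖jetOp m (κ a) (x a)‖) ∧
      phys m σ k =ᵐ[volume] fun y => ∏ a, phys m σ (jetOpAt m r s σ (κ a) (x a)) y := by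
  classical
  have hσ₀ := hσ.trans h
  -- If no factor has order below `σ₀`, any one can play this role; `p ≠ 0` provides it.
  obtain ⟨a₀, ha₀⟩ : ∃ a₀, ∀ a, a ≠ a₀ → σ₀ ≤ jetExp r s (κ a) := by
    by_cases hb : ∃ a₀, ¬ σ₀ ≤ jetExp r s (κ a₀)
    · obtain ⟨a₀, hb⟩ := hb
      exact ⟨a₀, fun a ha => (h2 a a₀ ha).resolve_right hb⟩
    · push Not at hb
      exact ⟨⟨0, Nat.pos_of_ne_zero hp⟩, fun a _ => hb a⟩
  obtain ⟨k, hk, hk'⟩ := exists_prod_finset hm h0 hσ h (Finset.univ.erase a₀)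
    (fun a => jetOpAt m r s σ₀ (κ a) (x a)) (jetOpAt m r s σ (κ a₀) (x a₀))
  have s1 := scaleConst_nonneg hm r s σ
  have s2 := scaleConst_nonneg hm r s σ₀
  refine ⟨k, hk.trans ?_, ?_⟩
  · rw [← Finset.mul_prod_erase _ _ (Finset.mem_univ a₀)]
    refine mul_le_mul ?_ (Finset.prod_le_prod (fun _ _ => by positivity) fun a ha => ?_)
      (Finset.prod_nonneg fun _ _ => by positivity) (by positivity)
    · refine (norm_jetOpAt_le hm (h1 a₀) _).trans (mul_le_mul_of_nonneg_right ?_ (norm_nonneg _))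
      exact le_add_of_nonneg_right (by positivity)
    · refine (mul_le_mul_of_nonneg_left
        (norm_jetOpAt_le hm (ha₀ a (Finset.ne_of_mem_erase ha)) _) (by positivity)).trans ?_
      rw [← mul_assoc]
      refine mul_le_mul_of_nonneg_right ?_ (norm_nonneg _)
      exact le_add_of_nonneg_left s1
  · filter_upwards [hk'] with y hy
    rw [hy, ← Finset.mul_prod_erase _ _ (Finset.mem_univ a₀)]
    congr 1
    refine Finset.prod_congr rfl fun a ha => ?_
    rw [phys_jetOpAt hm hσ₀ (ha₀ a (Finset.ne_of_mem_erase ha)), phys_jetOpAt hm hσ (h1 a)]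

/-- Each coefficient is at most `‖N p‖`. Summing the monomial bounds over all choices of coordinates
gives a product over the arguments of sums over the coordinates of a jet, so no combinatorial or
dimensional factor appears beyond `A^p`. -/
theorem exists_component {m : ℝ} (hm : 0 < m) (r : ℕ) (s : ℝ) {σ₀ σ : ℝ} (h0 : (n : ℝ) / 2 < σ₀)
    (hσ : 0 ≤ σ) (h : σ ≤ σ₀) : ∃ A : ℝ, 0 ≤ A ∧ ∀ (d₁ d₂ : ℕ) (N : Series n d₁ d₂) (i : Idx d₁ d₂),
      IsTame r s σ₀ σ N i → ∀ p, p ≠ 0 → ∃ M : Data n d₁ d₂ [×p]→L[ℂ] L2 n, ‖M‖ ≤ ‖N p‖ * A ^ p ∧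
        ∀ x, phys m σ (M x) =ᵐ[volume] fun y => formOf (fun κ => (coeffN N p i κ : ℂ))
          fun a k => phys m σ (jetOpAt m r s σ k (x a)) y := by
  obtain ⟨c, hc0, hc⟩ := exists_norm_jetOp_le n m
  set A' := scaleConst m r s σ + prodConst n m σ₀ σ * scaleConst m r s σ₀ with hA'
  have s1 := scaleConst_nonneg hm r s σ
  have s2 := scaleConst_nonneg hm r s σ₀
  have hA0 : 0 ≤ A' := by positivity
  refine ⟨A' * c, by positivity, fun d₁ d₂ N i hN p hp => ?_⟩
  refine exists_multilinear hm hσ _ _ (by positivity) fun x => ?_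
  have h1 : ∀ κ : Fin p → JetIdx n d₁ d₂, ∃ k : L2 n,
      ‖k‖ ≤ ‖N p‖ * ∏ a, (A' * ‖jetOp m (κ a) (x a)‖) ∧ phys m σ k =ᵐ[volume]
        fun y => (coeffN N p i κ : ℂ) * ∏ a, phys m σ (jetOpAt m r s σ (κ a) (x a)) y := by
    intro κ
    by_cases hκ : coeffN N p i κ = 0
    · refine ⟨0, by rw [norm_zero]; positivity, ?_⟩
      rw [map_zero, hκ]
      filter_upwards [Lp.coeFn_zero ℂ 2 (volume : Measure (Sp n))] with y hy
      rw [hy]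
      simp
    · obtain ⟨k, hk, hk'⟩ := exists_monomial hm h0 hσ h hp (hN p κ hκ).1 (hN p κ hκ).2 x
      refine ⟨(coeffN N p i κ : ℂ) • k, ?_, ?_⟩
      · rw [norm_smul, Complex.norm_real]
        exact mul_le_mul (abs_coeffN_le N p i κ) hk (norm_nonneg _) (norm_nonneg _)
      · rw [map_smul]
        filter_upwards [hk', Lp.coeFn_smul (coeffN N p i κ : ℂ) (phys m σ k)] with y h1 h2
        rw [h2, Pi.smul_apply, h1, smul_eq_mul]
  choose k hk hk' using h1
  refine ⟨∑ κ, k κ, ?_, ?_⟩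
  · calc ‖∑ κ, k κ‖ ≤ ∑ κ : Fin p → JetIdx n d₁ d₂, ‖N p‖ * ∏ a, (A' * ‖jetOp m (κ a) (x a)‖) :=
          norm_sum_le_of_le _ fun κ _ => hk κ
      _ = ‖N p‖ * ∏ a, ∑ l, (A' * ‖jetOp m l (x a)‖) := by
          rw [← Finset.mul_sum, Finset.prod_univ_sum, Fintype.piFinset_univ]
      _ ≤ ‖N p‖ * ∏ a, (A' * c * ‖x a‖) := by
          refine mul_le_mul_of_nonneg_left (Finset.prod_le_prod
            (fun a _ => Finset.sum_nonneg fun l _ => by positivity) fun a _ => ?_) (norm_nonneg _)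
          rw [← Finset.mul_sum, mul_assoc]
          exact mul_le_mul_of_nonneg_left (hc _ _ _) hA0
      _ = _ := by
          rw [Finset.prod_mul_distrib, Finset.prod_const, Finset.card_univ, Fintype.card_fin,
            mul_assoc]
  · rw [map_sum]
    have h2 : ∀ᵐ y, ∀ κ, phys m σ (k κ) y =
        (coeffN N p i κ : ℂ) * ∏ a, phys m σ (jetOpAt m r s σ (κ a) (x a)) y := ae_all_iff.2 hk'
    filter_upwards [h2, Lp.coeFn_fun_finsetSum Finset.univ fun κ => phys m σ (k κ)] with y h3 h4
    rw [h4, formOf_apply]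
    exact Finset.sum_congr rfl fun κ _ => h3 κ

/-- Coordinates of order less than `σ` may not be functions, in which case `rep` takes its default
value; this is harmless because their monomials have zero coefficients. -/
theorem ofReal_apply_jet {m : ℝ} (hm : 0 < m) {r : ℕ} {s σ₀ σ : ℝ} (hσ : 0 ≤ σ)
    {N : Series n d₁ d₂} {i : Idx d₁ d₂} (hN : IsTame r s σ₀ σ N i) {I : Set ℝ}
    (hI : I.OrdConnected) (hne : (interior I).Nonempty) {p : ℕ} {φ : Fin p → FieldPath n d₁ d₂}
    {U V : Fin p → ℝ → Idx d₁ d₂ → L2 n} (hφ : ∀ a, PathRep r m s I (φ a) (U a) (V a)) {t : ℝ}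
    (ht : t ∈ I) : ∀ᵐ y, ((N p (fun a => jet I (φ a) t y) i : ℝ) : ℂ) =
      formOf (fun κ => (coeffN N p i κ : ℂ))
        fun a k => phys m σ (jetOpAt m r s σ k (mkData (U a t) (V a t))) y := by
  have h1 : ∀ᵐ y, ∀ (a : Fin p) (k : JetIdx n d₁ d₂), σ ≤ jetExp r s k →
      ((jet I (φ a) t y k : ℝ) : ℂ) =
        phys m σ (jetOpAt m r s σ k (mkData (U a t) (V a t))) y := by
    rw [ae_all_iff]
    intro a
    rw [ae_all_iff]
    intro k
    by_cases hk : σ ≤ jetExp r s k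
    · filter_upwards [(hφ a).ofReal_jet hm hI hne ht (hσ.trans hk)] with y hy _
      rw [hy, phys_jetOpAt hm hσ hk]
    · exact Eventually.of_forall fun y hk' => absurd hk' hk
  filter_upwards [h1] with y hy
  rw [apply_eq_sum_coeffN, formOf_apply]
  push_cast
  refine Finset.sum_congr rfl fun κ _ => ?_
  by_cases hκ : coeffN N p i κ = 0
  · rw [hκ]; simp
  · congr 1
    exact Finset.prod_congr rfl fun a _ => hy a _ ((hN p κ hκ).1 a)

/-! ### The nonlinearity as a function of the Cauchy data -/

/-- The series `M` represents the component of index `i` of `N` in `H^σ`. -/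
structure Lifts (m : ℝ) (r : ℕ) (s : ℝ) (N : Series n d₁ d₂) (A : ℝ) (i : Idx d₁ d₂) (σ : ℝ)
    (M : FormalMultilinearSeries ℂ (Data n d₁ d₂) (L2 n)) : Prop where
  nonneg : 0 ≤ σ
  srcWt_le : srcWt r s i ≤ σ
  bound : ∀ p, ‖M p‖ ≤ ‖N p‖ * A ^ p
  eq : ∀ {I : Set ℝ}, I.OrdConnected → (interior I).Nonempty → ∀ {p : ℕ}
    {φ : Fin p → FieldPath n d₁ d₂} {U V : Fin p → ℝ → Idx d₁ d₂ → L2 n},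
    (∀ a, PathRep r m s I (φ a) (U a) (V a)) → ∀ {t : ℝ}, t ∈ I →
      ∀ᵐ y, ((N p (fun a => jet I (φ a) t y) i : ℝ) : ℂ) =
        phys m σ (M p fun a => mkData (U a t) (V a t)) y

theorem exists_lifts {m : ℝ} (hm : 0 < m) (r : ℕ) (s : ℝ) {σ₀ σ : ℝ} (h0 : (n : ℝ) / 2 < σ₀)
    (hσ : 0 ≤ σ) (h : σ ≤ σ₀) : ∃ A : ℝ, 0 ≤ A ∧ ∀ (d₁ d₂ : ℕ) (N : Series n d₁ d₂) (i : Idx d₁ d₂),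
      N 0 = 0 → srcWt r s i ≤ σ → IsTame r s σ₀ σ N i → ∃ M, Lifts m r s N A i σ M := by
  obtain ⟨A, hA0, hA⟩ := exists_component hm r s h0 hσ h
  refine ⟨A, hA0, fun d₁ d₂ N i hN0 hwt hN => ?_⟩
  have h1 : ∀ p, ∃ M : Data n d₁ d₂ [×p]→L[ℂ] L2 n, ‖M‖ ≤ ‖N p‖ * A ^ p ∧
      ∀ {I : Set ℝ}, I.OrdConnected → (interior I).Nonempty →
      ∀ {φ : Fin p → FieldPath n d₁ d₂} {U V : Fin p → ℝ → Idx d₁ d₂ → L2 n},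
      (∀ a, PathRep r m s I (φ a) (U a) (V a)) → ∀ {t : ℝ}, t ∈ I →
        ∀ᵐ y, ((N p (fun a => jet I (φ a) t y) i : ℝ) : ℂ) =
          phys m σ (M fun a => mkData (U a t) (V a t)) y := by
    intro p
    -- The constant term must vanish, since a nonzero constant is not square integrable on `ℝⁿ` for
    -- `n ≥ 1`.
    by_cases hp : p = 0
    · subst hp
      refine ⟨0, by rw [norm_zero]; positivity, fun _ _ => ?_⟩
      intros
      rw [hN0, zero_apply, map_zero]
      filter_upwards [Lp.coeFn_zero ℂ 2 (volume : Measure (Sp n))] with y hy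
      rw [hy]
      simp
    · obtain ⟨M, hM, hM'⟩ := hA d₁ d₂ N i hN p hp
      refine ⟨M, hM, fun hI hne => ?_⟩
      intro φ U V hφ t ht
      filter_upwards [ofReal_apply_jet hm hσ hN hI hne hφ ht,
        hM' fun a => mkData (U a t) (V a t)] with y h1 h2
      rw [h1, h2]
  choose M hM hM' using h1
  refine ⟨M, hσ, hwt, hM, ?_⟩
  intro I hI hne p φ U V hφ t ht
  exact hM' p hI hne hφ ht

/-- A tame component of `N`, with one of the admissible pairs of orders. -/
theorem exists_order {r : ℕ} (hr : 1 ≤ r) {s : ℝ} {N : Series n d₁ d₂} (hN : IsSymm N)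
    (h₁ : ∀ i : Fin d₁, DependsOnlyOn N (Sum.inl i) (fieldCoords n d₁ d₂))
    (h₂ : ((n : ℝ) / 2 < s ∧
            ∀ j : Fin d₂, DependsOnlyOn N (Sum.inr j) (fieldCoords n d₁ d₂)) ∨
          (IsAffine N ∧ (n : ℝ) / 2 < s ∧ s - r < (n : ℝ) / 2 ∧ 0 ≤ s - r) ∨
          ((n : ℝ) / 2 + 1 < s ∧
            ((n : ℝ) / 2 < s - r ∨
              ∀ j : Fin d₂, DependsOnlyOn N (Sum.inr j) (noTimeDerivCoords n d₁ d₂))))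
    (i : Idx d₁ d₂) : ∃ o ∈ [(s, s), (s, s - r), (s - r, s - r), (s - 1, s - 1)],
      (n : ℝ) / 2 < o.1 ∧ 0 ≤ o.2 ∧ o.2 ≤ o.1 ∧ srcWt r s i ≤ o.2 ∧ IsTame r s o.1 o.2 N i := by
  have hr' : (1 : ℝ) ≤ r := by exact_mod_cast hr
  have hn : (0 : ℝ) ≤ (n : ℝ) / 2 := by positivity
  have hall : ∀ {o : ℝ} {i : Idx d₁ d₂}, (∀ (p : ℕ) (κ : Fin p → JetIdx n d₁ d₂),
      coeffN N p i κ ≠ 0 → ∀ a, o ≤ jetExp r s (κ a)) → IsTame r s o o N i :=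
    fun h p κ hκ => ⟨h p κ hκ, fun a _ _ => Or.inl (h p κ hκ a)⟩
  have hfield : ∀ {i : Idx d₁ d₂}, DependsOnlyOn N i (fieldCoords n d₁ d₂) →
      IsTame r s s s N i := fun h => hall fun p κ hκ a => by
    by_cases ha : κ a ∈ fieldCoords n d₁ d₂
    · obtain ⟨i, hi⟩ := ha
      rw [← hi]; exact le_rfl
    · exact absurd (coeffN_eq_zero_of_dependsOnlyOn hN h ha) hκ
  have hmin : ∀ k : JetIdx n d₁ d₂, s - r ≤ jetExp r s k := by
    rintro (i | j | k) <;> simp only [jetExp] <;> linarith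
  have hs : (n : ℝ) / 2 < s := by rcases h₂ with ⟨h, -⟩ | ⟨-, h, -⟩ | ⟨h, -⟩ <;> linarith
  rcases i with i | j
  · exact ⟨(s, s), by simp, hs, hn.trans hs.le, le_rfl, le_rfl, hfield (h₁ i)⟩
  · rcases h₂ with ⟨-, h⟩ | ⟨h, -, h3, h4⟩ | ⟨h3, h | h⟩
    · exact ⟨(s, s), by simp, hs, hn.trans hs.le, le_rfl, by simp only [srcWt]; linarith,
        hfield (h j)⟩
    -- The affine case: the fields lie in `H^s` with `s > n/2` and multiply the only derivative
    -- coordinate, which is of order at least `s - r` because `r ≥ 1`.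
    · refine ⟨(s, s - r), by simp, hs, h4, by simp, le_rfl, fun p κ hκ =>
        ⟨fun a => hmin _, fun a b hab => ?_⟩⟩
      by_contra hc
      push Not at hc
      have hnf : ∀ c, jetExp r s (κ c) < s → κ c ∉ fieldCoords n d₁ d₂ := by
        rintro c hc ⟨i, hi⟩
        rw [← hi] at hc
        exact lt_irrefl _ hc
      exact hκ (coeffN_eq_zero_of_isAffine hN h hab (hnf a hc.1) (hnf b hc.2))
    · exact ⟨(s - r, s - r), by simp, h, hn.trans h.le, le_rfl, le_rfl,
        hall fun p κ _ a => hmin _⟩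
    -- Without `∂₀u₂` the worst coordinates are space derivatives, of order `s - 1 > n/2`, and
    -- `H^{s-1}` is an algebra.
    · refine ⟨(s - 1, s - 1), by simp, by simp only; linarith, by simp only; linarith, le_rfl,
        by simp only [srcWt]; linarith, hall fun p κ hκ a => ?_⟩
      by_cases ha : κ a ∈ noTimeDerivCoords n d₁ d₂
      · rcases hk : κ a with i | j | k
        · simp only [jetExp]; linarith
        · exact absurd hk (ha j)
        · exact le_rfl
      · exact absurd (coeffN_eq_zero_of_dependsOnlyOn hN (h j) ha) hκ

theorem summable_lifts {m : ℝ} {r : ℕ} {s : ℝ} {N : Series n d₁ d₂} {A : ℝ≥0}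
    {i : Idx d₁ d₂} {σ : ℝ} {M : FormalMultilinearSeries ℂ (Data n d₁ d₂) (L2 n)}
    (h : Lifts m r s N A i σ M) {x : Data n d₁ d₂} (hx : A * ‖x‖ₑ < N.radius) :
    Summable fun p => ‖M p fun _ => x‖ := by
  have h1 := N.summable_norm_mul_pow (r := A * ‖x‖₊) (by simpa using! hx)
  refine Summable.of_nonneg_of_le (fun _ => norm_nonneg _) (fun p => ?_) h1
  refine ((M p).le_opNorm _).trans ?_
  rw [Finset.prod_const, Finset.card_univ, Fintype.card_fin]
  push_cast
  rw [mul_pow, ← mul_assoc]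
  exact mul_le_mul_of_nonneg_right (h.bound p) (by positivity)

theorem ofFun_congr_ae {f : Sp n → ℂ} {g : L2 n} (h : f =ᵐ[volume] g) : ofFun f = (g : Dist n) := by
  have h1 : MemLp f 2 volume := (memLp_congr_ae h).2 (Lp.memLp g)
  rw [ofFun_eq h1]
  congr 1
  apply Lp.ext
  exact h1.coeFn_toLp.trans h

theorem herm_of_ofReal {m : ℝ} (hm : 0 < m) {σ : ℝ} (hσ : 0 ≤ σ) {g : L2 n} {f : Sp n → ℝ}
    (h : ∀ᵐ y, (f y : ℂ) = phys m σ g y) : Herm g := by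
  rw [← isRealDist_hatT hm (σ := σ), hatT_eq_phys hm hσ, isRealDist_coe]
  filter_upwards [h] with y hy
  rw [← hy, Complex.ofReal_im]

theorem Lifts.nonlinTerm_eq {m : ℝ} (hm : 0 < m) {r : ℕ} {s : ℝ} {N : Series n d₁ d₂} {A : ℝ}
    {i : Idx d₁ d₂} {σ : ℝ} {M : FormalMultilinearSeries ℂ (Data n d₁ d₂) (L2 n)}
    (h : Lifts m r s N A i σ M) {I : Set ℝ} (hI : I.OrdConnected) (hne : (interior I).Nonempty)
    {p : ℕ} {φ : Fin p → FieldPath n d₁ d₂} {U V : Fin p → ℝ → Idx d₁ d₂ → L2 n}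
    (hφ : ∀ a, PathRep r m s I (φ a) (U a) (V a)) {t : ℝ} (ht : t ∈ I) :
    nonlinTerm N I p φ t i = (phys m σ (M p fun a => mkData (U a t) (V a t)) : Dist n) ∧
      Herm (M p fun a => mkData (U a t) (V a t)) :=
  ⟨ofFun_congr_ae (h.eq hI hne hφ ht), herm_of_ofReal hm h.nonneg (h.eq hI hne hφ ht)⟩

/-- A series whose norms are summable in `L²` converges almost everywhere to its `L²` sum, so the
pointwise value of `N` agrees with the sum of the lifted series. -/
theorem nonlin_eq {m : ℝ} (hm : 0 < m) {r : ℕ} {s : ℝ} {N : Series n d₁ d₂} {A : ℝ≥0}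
    {σ : Idx d₁ d₂ → ℝ} {M : Idx d₁ d₂ → FormalMultilinearSeries ℂ (Data n d₁ d₂) (L2 n)}
    (h : ∀ i, Lifts m r s N A i (σ i) (M i)) {I : Set ℝ} (hI : I.OrdConnected)
    (hne : (interior I).Nonempty) {φ : FieldPath n d₁ d₂} {U V : ℝ → Idx d₁ d₂ → L2 n}
    (hφ : PathRep r m s I φ U V) {t : ℝ} (ht : t ∈ I)
    (hx : A * ‖mkData (U t) (V t)‖ₑ < N.radius) (i : Idx d₁ d₂) :
    nonlin N I φ t i = (phys m (σ i) ((M i).sum (mkData (U t) (V t))) : Dist n) ∧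
      Herm ((M i).sum (mkData (U t) (V t))) := by
  set x := mkData (U t) (V t) with hxdef
  have h1 : ∀ i, ∀ᵐ y, HasSum (fun p => ((N p (fun _ => jet I φ t y) i : ℝ) : ℂ))
      (phys m (σ i) ((M i).sum x) y) := by
    intro i
    have hs := summable_lifts (h i) hx
    have hs' : Summable fun p => M i p fun _ => x := hs.of_norm
    have e1 : phys m (σ i) ((M i).sum x) = ∑' p, phys m (σ i) (M i p fun _ => x) :=
      (phys m (σ i)).map_tsum hs'
    have hs2 : Summable fun p => ‖phys m (σ i) (M i p fun _ => x)‖ :=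
      Summable.of_nonneg_of_le (fun _ => norm_nonneg _)
        (fun p => (phys m (σ i)).le_opNorm _) (hs.mul_left _)
    have h2 := Lp.hasSum_coeFn_tsum (f := fun p => phys m (σ i) (M i p fun _ => x))
      (tsum_enorm_ne_top_iff_summable_norm.2 hs2)
    have h3 : ∀ᵐ y, ∀ p, ((N p (fun _ => jet I φ t y) i : ℝ) : ℂ) =
        phys m (σ i) (M i p fun _ => x) y :=
      ae_all_iff.2 fun p => (h i).eq hI hne (fun _ => hφ) ht
    filter_upwards [h2, h3] with y h4 h5
    simp only [h5]
    rw [e1]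
    exact h4
  -- The sum defining `N` is taken in `E`, so all components must converge at the same point before
  -- one of them can be read off.
  have h2 : ∀ᵐ y, ∀ i, ((N.sum (jet I φ t y) i : ℝ) : ℂ) = phys m (σ i) ((M i).sum x) y := by
    filter_upwards [ae_all_iff.2 h1] with y hy i
    have h3 : ∀ i, HasSum (fun p => N p (fun _ => jet I φ t y) i)
        (phys m (σ i) ((M i).sum x) y).re := fun i => by
      simpa using Complex.hasSum_re (hy i)
    have h4 : N.sum (jet I φ t y) = fun i => (phys m (σ i) ((M i).sum x) y).re :=
      (Pi.hasSum.2 h3).tsum_eq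
    rw [h4]
    refine Complex.ext rfl ?_
    have h5 := Complex.hasSum_im (hy i)
    simp only [Complex.ofReal_im] at h5 ⊢
    exact hasSum_zero.unique h5
  have h3 : ∀ᵐ y, ((N.sum (jet I φ t y) i : ℝ) : ℂ) = phys m (σ i) ((M i).sum x) y := by
    filter_upwards [h2] with y hy using hy i
  exact ⟨ofFun_congr_ae h3, herm_of_ofReal hm (h i).nonneg h3⟩

/-- The series `F` represent the components of `N` in `H^s` and `H^{s-r}`. -/
structure IsSourceSeries (m : ℝ) (r : ℕ) (s : ℝ) (N : Series n d₁ d₂) (A : ℝ≥0)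
    (F : Idx d₁ d₂ → FormalMultilinearSeries ℂ (Data n d₁ d₂) (L2 n)) : Prop where
  bound : ∃ C : ℝ≥0, ∀ i p, ‖F i p‖ ≤ C * (‖N p‖ * A ^ p)
  term : ∀ {I : Set ℝ}, I.OrdConnected → (interior I).Nonempty → ∀ {p : ℕ}
    {φ : Fin p → FieldPath n d₁ d₂} {U V : Fin p → ℝ → Idx d₁ d₂ → L2 n},
    (∀ a, PathRep r m s I (φ a) (U a) (V a)) → ∀ {t : ℝ}, t ∈ I → ∀ i,
      (∃ g : L2 n, nonlinTerm N I p φ t i = (g : Dist n)) ∧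
      nonlinTerm N I p φ t i = hatT m (srcWt r s i) (F i p fun a => mkData (U a t) (V a t)) ∧
      Herm (F i p fun a => mkData (U a t) (V a t))
  sum : ∀ {I : Set ℝ}, I.OrdConnected → (interior I).Nonempty →
    ∀ {φ : FieldPath n d₁ d₂} {U V : ℝ → Idx d₁ d₂ → L2 n},
    PathRep r m s I φ U V → ∀ {t : ℝ}, t ∈ I → A * ‖mkData (U t) (V t)‖ₑ < N.radius → ∀ i,
      (∃ g : L2 n, nonlin N I φ t i = (g : Dist n)) ∧
      nonlin N I φ t i = hatT m (srcWt r s i) ((F i).sum (mkData (U t) (V t))) ∧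
      Herm ((F i).sum (mkData (U t) (V t)))

theorem herm_mulOp_wt {m : ℝ} (hm : 0 < m) {σ τ : ℝ} (h : τ ≤ σ) {g : L2 n} (hg : Herm g) :
    Herm (mulOp (fun η : Sp n => ((wt m (τ - σ) η : ℝ) : ℂ)) g) :=
  hg.mulOp (isMult_wt_sub hm h) fun η => by rw [wt_even, Complex.conj_ofReal]

theorem isSourceSeries_of_lifts {m : ℝ} (hm : 0 < m) {r : ℕ} {s : ℝ} {N : Series n d₁ d₂}
    {A : ℝ≥0} {σ : Idx d₁ d₂ → ℝ}
    {M : Idx d₁ d₂ → FormalMultilinearSeries ℂ (Data n d₁ d₂) (L2 n)}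
    (h : ∀ i, Lifts m r s N A i (σ i) (M i)) : IsSourceSeries m r s N A fun i p =>
      (mulOp fun η => ((wt m (srcWt r s i - σ i) η : ℝ) : ℂ)).compContinuousMultilinearMap (M i p) := by
  refine ⟨⟨∑ i, ‖mulOp (n := n) fun η => ((wt m (srcWt r s i - σ i) η : ℝ) : ℂ)‖₊, fun i p => ?_⟩,
    ?_, ?_⟩
  · refine (ContinuousLinearMap.norm_compContinuousMultilinearMap_le _ _).trans ?_
    refine mul_le_mul ?_ ((h i).bound p) (norm_nonneg _) (by positivity)
    push_cast
    exact Finset.single_le_sum (f := fun i => ‖mulOp (n := n) fun η =>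
      ((wt m (srcWt r s i - σ i) η : ℝ) : ℂ)‖) (fun _ _ => norm_nonneg _) (Finset.mem_univ i)
  · intro I hI hne p φ U V hφ t ht i
    obtain ⟨h1, h2⟩ := (h i).nonlinTerm_eq hm hI hne hφ ht
    refine ⟨⟨_, h1⟩, ?_, herm_mulOp_wt hm (h i).srcWt_le h2⟩
    rw [h1, ← hatT_eq_phys hm (h i).nonneg, ← hatT_scale hm (h i).srcWt_le]
    rfl
  · intro I hI hne φ U V hφ t ht hx i
    obtain ⟨h1, h2⟩ := nonlin_eq hm h hI hne hφ ht hx i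
    have hs : Summable fun p => M i p fun _ => mkData (U t) (V t) :=
      (summable_lifts (h i) hx).of_norm
    have e1 : FormalMultilinearSeries.sum (fun p => (mulOp fun η =>
        ((wt m (srcWt r s i - σ i) η : ℝ) : ℂ)).compContinuousMultilinearMap (M i p))
        (mkData (U t) (V t)) = mulOp (fun η => ((wt m (srcWt r s i - σ i) η : ℝ) : ℂ))
          ((M i).sum (mkData (U t) (V t))) := ((mulOp _).map_tsum hs).symm
    rw [e1]
    refine ⟨⟨_, h1⟩, ?_, herm_mulOp_wt hm (h i).srcWt_le h2⟩
    rw [h1, ← hatT_eq_phys hm (h i).nonneg, ← hatT_scale hm (h i).srcWt_le]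

theorem Lifts.mono {m : ℝ} {r : ℕ} {s : ℝ} {N : Series n d₁ d₂} {A B : ℝ} {i : Idx d₁ d₂} {σ : ℝ}
    {M : FormalMultilinearSeries ℂ (Data n d₁ d₂) (L2 n)} (h : Lifts m r s N A i σ M) (hA : 0 ≤ A)
    (hAB : A ≤ B) : Lifts m r s N B i σ M :=
  ⟨h.nonneg, h.srcWt_le, fun p => (h.bound p).trans (mul_le_mul_of_nonneg_left
    (pow_le_pow_left₀ hA hAB p) (norm_nonneg _)), h.eq⟩

/-- Only four pairs of orders occur, and their constants are fixed before the dimensions and `N` are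
introduced. One more than their sum is a common, positive constant. -/
theorem exists_isSourceSeries (n r : ℕ) (hr : 1 ≤ r) (m s : ℝ) (hm : 0 < m) :
    ∃ A : ℝ≥0, 0 < A ∧ ∀ (d₁ d₂ : ℕ) (N : Series n d₁ d₂), IsSymm N → N 0 = 0 →
      (∀ i : Fin d₁, DependsOnlyOn N (Sum.inl i) (fieldCoords n d₁ d₂)) →
      (((n : ℝ) / 2 < s ∧
            ∀ j : Fin d₂, DependsOnlyOn N (Sum.inr j) (fieldCoords n d₁ d₂)) ∨
          (IsAffine N ∧ (n : ℝ) / 2 < s ∧ s - r < (n : ℝ) / 2 ∧ 0 ≤ s - r) ∨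
          ((n : ℝ) / 2 + 1 < s ∧
            ((n : ℝ) / 2 < s - r ∨
              ∀ j : Fin d₂, DependsOnlyOn N (Sum.inr j) (noTimeDerivCoords n d₁ d₂)))) →
      ∃ F, IsSourceSeries m r s N A F := by
  classical
  have h1 : ∀ o : ℝ × ℝ, ∃ A : ℝ, 0 ≤ A ∧ ((n : ℝ) / 2 < o.1 → 0 ≤ o.2 → o.2 ≤ o.1 →
      ∀ (d₁ d₂ : ℕ) (N : Series n d₁ d₂) (i : Idx d₁ d₂), N 0 = 0 → srcWt r s i ≤ o.2 →
        IsTame r s o.1 o.2 N i → ∃ M, Lifts m r s N A i o.2 M) := by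
    intro o
    by_cases ho : (n : ℝ) / 2 < o.1 ∧ 0 ≤ o.2 ∧ o.2 ≤ o.1
    · obtain ⟨A, hA0, hA⟩ := exists_lifts hm r s ho.1 ho.2.1 ho.2.2
      exact ⟨A, hA0, fun _ _ _ => hA⟩
    · exact ⟨0, le_rfl, fun h1 h2 h3 => absurd ⟨h1, h2, h3⟩ ho⟩
  choose A hA0 hA using h1
  set l : List (ℝ × ℝ) := [(s, s), (s, s - r), (s - r, s - r), (s - 1, s - 1)] with hl
  have hnn : ∀ a ∈ l.map A, 0 ≤ a := fun a ha => by
    obtain ⟨o, -, rfl⟩ := List.mem_map.1 ha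
    exact hA0 o
  have hle : ∀ o ∈ l, A o ≤ 1 + (l.map A).sum := by
    intro o ho
    have := List.single_le_sum (l := l.map A) hnn (A o)
      (List.mem_map_of_mem ho)
    linarith
  have hpos : 0 < 1 + (l.map A).sum := by
    have : 0 ≤ (l.map A).sum := List.sum_nonneg hnn
    linarith
  refine ⟨⟨1 + (l.map A).sum, hpos.le⟩, hpos, fun d₁ d₂ N hN hN0 h₁ h₂ => ?_⟩
  have h3 : ∀ i : Idx d₁ d₂, ∃ σ M, Lifts m r s N (1 + (l.map A).sum) i σ M := by
    intro i
    obtain ⟨o, ho, h4, h5, h6, h7, h8⟩ := exists_order hr hN h₁ h₂ i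
    obtain ⟨M, hM⟩ := hA o h4 h5 h6 d₁ d₂ N i hN0 h7 h8
    exact ⟨o.2, M, hM.mono (hA0 o) (hle o ho)⟩
  choose σ M hM using h3
  exact ⟨_, isSourceSeries_of_lifts hm hM⟩

/-! ### The Lagrange--Duhamel vector field on the space of Cauchy data -/

/-- Comparison of coefficients. The two series may be over different fields, because `N` is real
whereas the lifted series are complex. -/
theorem radius_le_mul_radius {𝕜 𝕜' E E' F F' : Type*} [NontriviallyNormedField 𝕜]
    [NontriviallyNormedField 𝕜'] [NormedAddCommGroup E] [NormedSpace 𝕜 E] [NormedAddCommGroup E']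
    [NormedSpace 𝕜' E'] [NormedAddCommGroup F] [NormedSpace 𝕜 F] [NormedAddCommGroup F']
    [NormedSpace 𝕜' F'] {N : FormalMultilinearSeries 𝕜 E F} {M : FormalMultilinearSeries 𝕜' E' F'}
    {A : ℝ≥0} (hA : 0 < A) {C : ℝ} (hC : 0 ≤ C) (h : ∀ p, ‖M p‖ ≤ C * (‖N p‖ * A ^ p)) :
    N.radius ≤ A * M.radius := by
  refine ENNReal.le_of_forall_nnreal_lt fun ρ hρ => ?_
  obtain ⟨K, hK0, hK⟩ := N.norm_mul_pow_le_of_lt_radius hρ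
  have h1 : ((ρ / A : ℝ≥0) : ℝ≥0∞) ≤ M.radius := by
    refine M.le_radius_of_bound (C * K) fun p => ?_
    calc ‖M p‖ * ((ρ / A : ℝ≥0) : ℝ) ^ p ≤ C * (‖N p‖ * A ^ p) * ((ρ / A : ℝ≥0) : ℝ) ^ p :=
          mul_le_mul_of_nonneg_right (h p) (by positivity)
      _ = C * (‖N p‖ * (ρ : ℝ) ^ p) := by
          have : (A : ℝ) ^ p ≠ 0 := pow_ne_zero _ (by exact_mod_cast hA.ne')
          push_cast
          rw [div_pow]
          field_simp
      _ ≤ C * K := mul_le_mul_of_nonneg_left (hK p) hC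
  calc (ρ : ℝ≥0∞) = A * ((ρ / A : ℝ≥0) : ℝ≥0∞) := by
        rw [← ENNReal.coe_mul, mul_div_cancel₀ _ hA.ne']
    _ ≤ _ := by gcongr

theorem lt_radius_of_mul_lt {A : ℝ≥0} {a b c : ℝ≥0∞} (h : b ≤ A * c) (ha : A * a < b) : a < c := by
  by_contra hc
  push Not at hc
  exact absurd (ha.trans_le h) (not_lt.2 (by gcongr))

/-- The change of the Cauchy data that is due to a source term, as a linear operator, with the sign
of the Lagrange--Duhamel vector field. -/
def srcOp (L : EvolOp n d₁ d₂) : (Idx d₁ d₂ → L2 n) →L[ℂ] Data n d₁ d₂ :=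
  (PiLp.continuousLinearEquiv 1 ℂ (fun _ : DIdx d₁ d₂ => L2 n)).symm.toContinuousLinearMap ∘L
    ContinuousLinearMap.pi fun k => match k with
      | Sum.inl i => ∑ k, L.γC⁻¹ i k • ContinuousLinearMap.proj (Sum.inl k)
      | Sum.inr (Sum.inl _) => 0
      | Sum.inr (Sum.inr j) => ContinuousLinearMap.proj (Sum.inr j)

theorem neg_srcData (L : EvolOp n d₁ d₂) (F : Idx d₁ d₂ → L2 n) : -srcData L F = srcOp L F := by
  ext1 k
  rcases k with i | j | j
  · rw [neg_srcData_inl]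
    change _ = (∑ k, L.γC⁻¹ i k • ContinuousLinearMap.proj (R := ℂ)
      (φ := fun _ : Idx d₁ d₂ => L2 n) (Sum.inl k)) F
    rw [sum_apply]
    rfl
  · exact neg_zero
  · exact neg_neg _

theorem HermV.srcOp {L : EvolOp n d₁ d₂} {r : ℕ} {α μ₀ : ℝ} (hL : L.Admissible r α μ₀)
    {F : Idx d₁ d₂ → L2 n} (hF : ∀ i, Herm (F i)) : HermV (srcOp L F) := by
  have h1 : L.γC⁻¹ = L.γ⁻¹.map (fun x : ℝ => (x : ℂ)) := by
    apply Matrix.inv_eq_right_inv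
    have h2 := congrArg (fun M => Complex.ofRealHom.mapMatrix M) (L.γ.mul_nonsing_inv hL.isUnit)
    simp only [map_mul, map_one] at h2
    exact h2
  rintro (i | j | j)
  · rw [← neg_srcData, neg_srcData_inl]
    refine Herm.sum _ fun k _ => (hF _).smul ?_
    rw [h1, Matrix.map_apply, Complex.conj_ofReal]
  · rw [← neg_srcData]
    change Herm (-(0 : L2 n))
    exact Herm.zero.neg
  · rw [← neg_srcData]
    change Herm (-(-F (Sum.inr j)))
    rw [neg_neg]
    exact hF _

section VectorField

variable {L : EvolOp n d₁ d₂} {r : ℕ} {α μ₀ m s : ℝ} {I : Set ℝ}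

theorem HermV.sub {ι : Type} [Fintype ι] {x y : VL2 n ι} (hx : HermV x) (hy : HermV y) :
    HermV (x - y) := fun k => (hx k).sub (hy k)

theorem HermV.add {ι : Type} [Fintype ι] {x y : VL2 n ι} (hx : HermV x) (hy : HermV y) :
    HermV (x + y) := fun k => (hx k).add (hy k)

theorem HermV.ofReal_smul {ι : Type} [Fintype ι] {x : VL2 n ι} (hx : HermV x) (a : ℝ) :
    HermV ((a : ℂ) • x) := fun k => (hx k).smul (Complex.conj_ofReal a)

theorem HermV.sum {ι κ : Type} [Fintype ι] (t : Finset κ) {x : κ → VL2 n ι}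
    (hx : ∀ a ∈ t, HermV (x a)) : HermV (∑ a ∈ t, x a) := fun k => by
  have h : (∑ a ∈ t, x a) k = ∑ a ∈ t, x a k := by simp
  rw [h]
  exact Herm.sum _ fun a ha => hx a ha k

theorem sol_sub (x y : Data n d₁ d₂) :
    sol L m r s (x - y) = sol L m r s x - sol L m r s y := by
  funext τ i
  simp only [sol, map_sub, Pi.sub_apply, PiLp.sub_apply]

theorem sol_neg (x : Data n d₁ d₂) : sol L m r s (-x) = -sol L m r s x := by
  funext τ i
  simp only [sol, map_neg, Pi.neg_apply, PiLp.neg_apply]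

theorem sol_smul (z : ℂ) (x : Data n d₁ d₂) : sol L m r s (z • x) = z • sol L m r s x := by
  funext τ i
  simp only [sol, map_smul, Pi.smul_apply, PiLp.smul_apply]

theorem sol_sum {κ : Type*} (t : Finset κ) (x : κ → Data n d₁ d₂) :
    sol L m r s (∑ a ∈ t, x a) = ∑ a ∈ t, sol L m r s (x a) := by
  classical
  induction t using Finset.induction_on with
  | empty =>
    funext τ i
    simp [sol]
  | insert a t ha ih =>
    rw [Finset.sum_insert ha, Finset.sum_insert ha, ← ih]
    funext τ i
    simp only [sol, map_add, Pi.add_apply, PiLp.add_apply]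

/-- The norm on `𝓔₀^s(I)` is equivalent to the norm of Cauchy data. -/
theorem exists_fNorm_sol_le (hα : 0 < α) (hμ : 0 ≤ μ₀) (hL : L.Admissible r α μ₀) (hm : 0 < m)
    (s : ℝ) (hI : I.OrdConnected) (hne : (interior I).Nonempty)
    (hb : 0 < μ₀ ∨ Bornology.IsBounded I) : ∃ B : ℝ≥0,
      (∀ x : Data n d₁ d₂, HermV x → ∀ t ∈ I,
        fNorm r m s I (sol L m r s (evoOp L m r (-t) x)) ≤ B * ‖x‖ₑ) ∧
      (∀ x : Data n d₁ d₂, HermV x → fNorm r m s I (sol L m r s x) ≤ B * ‖x‖ₑ) ∧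
      ∀ x : Data n d₁ d₂, HermV x → ‖x‖ₑ ≤ B * fNorm r m s I (sol L m r s x) := by
  obtain ⟨C, hC0, hS, hU⟩ := isEvolution_evoOp hα hμ hL hm
  obtain ⟨B₁, hB₁⟩ : ∃ B₁ : ℝ≥0, ∀ t ∈ I, ∀ τ ∈ I, ∀ x, ‖evoOp L m r (τ - t) x‖ₑ ≤ B₁ * ‖x‖ₑ := by
    have key : ∀ {c : ℝ≥0} {τ : ℝ} {x : Data n d₁ d₂}, ‖evoOp L m r τ x‖ ≤ c * ‖x‖ →
        ‖evoOp L m r τ x‖ₑ ≤ c * ‖x‖ₑ := by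
      intro c τ x h
      rw [← ofReal_norm, ← ofReal_norm, ← ENNReal.ofReal_coe_nnreal,
        ← ENNReal.ofReal_mul (NNReal.coe_nonneg c)]
      exact ENNReal.ofReal_le_ofReal h
    -- The alternative between `μ₀ > 0` and bounded `I` enters here: either the group is uniformly
    -- bounded, or only time differences up to the diameter of `I` occur.
    rcases hb with hb | hb
    · exact ⟨⟨C, hC0⟩, fun t _ τ _ x => key (hU hb _ _)⟩
    · obtain ⟨D, hD⟩ := Metric.isBounded_iff.1 hb
      have hD0 : 0 ≤ D := by
        obtain ⟨t, ht⟩ := hne.mono interior_subset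
        simpa using hD ht ht
      refine ⟨⟨C * (1 + D), by positivity⟩, fun t ht τ hτ x => key ((hS.bound _ _).trans ?_)⟩
      refine mul_le_mul_of_nonneg_right ?_ (norm_nonneg _)
      exact mul_le_mul_of_nonneg_left (by linarith [hD hτ ht, Real.dist_eq τ t]) hC0
  obtain ⟨t₀, ht₀⟩ := hne.mono interior_subset
  have h1 : ∀ x : Data n d₁ d₂, HermV x → ∀ t ∈ I,
      fNorm r m s I (sol L m r s (evoOp L m r (-t) x)) ≤ B₁ * ‖x‖ₑ := by
    intro x hx t ht
    rw [fNorm_sol hα hμ hL hm s hI hne (hx.evoOp hα hμ hL hm (-t))]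
    refine iSup₂_le fun τ hτ => ?_
    rw [← hS.add, ← sub_eq_add_neg]
    exact hB₁ t ht τ hτ x
  have hop : ∀ (t : ℝ) (x : Data n d₁ d₂), ‖evoOp L m r t x‖ₑ ≤ ‖evoOp L m r t‖₊ * ‖x‖ₑ :=
    fun t x => (evoOp L m r t).le_opENorm x
  refine ⟨B₁ + B₁ * ‖evoOp L m r t₀‖₊ + ‖evoOp L m r (-t₀)‖₊, fun x hx t ht => ?_,
    fun x hx => ?_, fun x hx => ?_⟩
  · refine (h1 x hx t ht).trans ?_
    gcongr
    rw [add_assoc]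
    exact le_self_add
  · have h2 := h1 _ (hx.evoOp hα hμ hL hm t₀) t₀ ht₀
    rw [hS.apply_neg] at h2
    refine h2.trans ((mul_le_mul_right (hop t₀ x) _).trans ?_)
    rw [← mul_assoc]
    gcongr
    push_cast
    exact le_add_right le_add_self
  · rw [fNorm_sol hα hμ hL hm s hI hne hx]
    have h2 := hop (-t₀) (evoOp L m r t₀ x)
    rw [hS.apply_neg] at h2
    refine h2.trans ?_
    gcongr
    · exact le_add_self
    · exact le_iSup₂ (f := fun τ (_ : τ ∈ I) => ‖evoOp L m r τ x‖ₑ) t₀ ht₀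

-- The derivative is obtained by choice, so it is the defining predicates that have to be shown
-- equal.
open Classical in
theorem timeDeriv_congr {u v : FieldPath n d₁ d₂} (h : EqOn u v I) {t : ℝ} (ht : t ∈ I) :
    timeDeriv I u t = timeDeriv I v t := by
  funext i
  have h1 : (fun w : Dist n => ∀ g : 𝓢(Sp n, ℂ), HasDerivWithinAt (fun τ => u τ i g) (w g) I t) =
      fun w => ∀ g : 𝓢(Sp n, ℂ), HasDerivWithinAt (fun τ => v τ i g) (w g) I t := by
    funext w
    refine propext (forall_congr' fun g => ⟨fun H => ?_, fun H => ?_⟩)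
    · exact H.congr (fun τ hτ => by rw [h hτ]) (by rw [h ht])
    · exact H.congr (fun τ hτ => by rw [h hτ]) (by rw [h ht])
  exact congrArg (fun P : Dist n → Prop => if h : ∃ w, P w then h.choose else 0) h1

theorem fNorm_congr {u v : FieldPath n d₁ d₂} (h : EqOn u v I) : fNorm r m s I u = fNorm r m s I v := by
  unfold fNorm
  refine iSup_congr fun τ => iSup_congr fun hτ => ?_
  rw [timeDeriv_congr h hτ, h hτ]

variable {N : Series n d₁ d₂} {A : ℝ≥0}
  {F : Idx d₁ d₂ → FormalMultilinearSeries ℂ (Data n d₁ d₂) (L2 n)}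

/-- Convolving the source at time `t` with the Green function yields the free solution whose data at
time `t` are `srcOp` of the source; `S(τ - t) = S(τ) S(-t)` refers them to time `0`. -/
theorem LDTerm_eq (hα : 0 < α) (hμ : 0 ≤ μ₀) (hL : L.Admissible r α μ₀) (hm : 0 < m) (hs : 0 ≤ s)
    (hI : I.OrdConnected) (hne : (interior I).Nonempty) (hF : IsSourceSeries m r s N A F) {t : ℝ}
    (ht : t ∈ I) {p : ℕ} {φ : Fin p → FieldPath n d₁ d₂} (hφ : ∀ a, MemF r m s I (φ a)) :
    LDTerm L N I t p φ = sol L m r s (evoOp L m r (-t)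
      (srcOp L fun i => F i p fun a => dataOf m r s I (φ a) t)) ∧
    HermV (srcOp L fun i => F i p fun a => dataOf m r s I (φ a) t) := by
  obtain ⟨C, -, hS, -⟩ := isEvolution_evoOp hα hμ hL hm
  have h1 := hF.term hI hne (fun a => (hφ a).pathRep hm) ht
  choose g hg using fun i => (h1 i).1
  have h2 := fun i => (h1 i).2
  refine ⟨?_, HermV.srcOp hL fun i => (h2 i).2⟩
  funext τ
  rw [LDTerm, greenConv_eq hα hμ hL hm hs (fun i => (h2 i).1) hg, neg_srcData]
  simp only [sub_eq_add_neg τ t, hS.add]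
  rfl

theorem LDField_eq (hα : 0 < α) (hμ : 0 ≤ μ₀) (hL : L.Admissible r α μ₀) (hm : 0 < m) (hs : 0 ≤ s)
    (hI : I.OrdConnected) (hne : (interior I).Nonempty) (hF : IsSourceSeries m r s N A F) {t : ℝ}
    (ht : t ∈ I) {φ : FieldPath n d₁ d₂} {U V : ℝ → Idx d₁ d₂ → L2 n}
    (hφ : PathRep r m s I φ U V) (hx : A * ‖mkData (U t) (V t)‖ₑ < N.radius) :
    LDField L N I t φ = sol L m r s (evoOp L m r (-t)
      (srcOp L fun i => (F i).sum (mkData (U t) (V t)))) ∧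
    HermV (srcOp L fun i => (F i).sum (mkData (U t) (V t))) := by
  obtain ⟨C, -, hS, -⟩ := isEvolution_evoOp hα hμ hL hm
  have h1 := hF.sum hI hne hφ ht hx
  choose g hg using fun i => (h1 i).1
  have h2 := fun i => (h1 i).2
  refine ⟨?_, HermV.srcOp hL fun i => (h2 i).2⟩
  funext τ
  rw [LDField, greenConv_eq hα hμ hL hm hs (fun i => (h2 i).1) hg, neg_srcData]
  simp only [sub_eq_add_neg τ t, hS.add]
  rfl

theorem IsSourceSeries.radius_le (hF : IsSourceSeries m r s N A F) (hA : 0 < A) (i : Idx d₁ d₂) :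
    N.radius ≤ A * (F i).radius := by
  obtain ⟨C, hC⟩ := hF.bound
  exact radius_le_mul_radius hA C.coe_nonneg (hC i)

theorem IsSourceSeries.mem_ball (hF : IsSourceSeries m r s N A F) (hA : 0 < A) (i : Idx d₁ d₂)
    {x : Data n d₁ d₂} (hx : A * ‖x‖ₑ < N.radius) : x ∈ Metric.eball 0 (F i).radius := by
  rw [Metric.mem_eball, edist_zero_right]
  exact lt_radius_of_mul_lt (hF.radius_le hA i) hx

theorem IsSourceSeries.tendsto_sum (hF : IsSourceSeries m r s N A F) (hA : 0 < A)
    {x : Data n d₁ d₂} (hx : A * ‖x‖ₑ < N.radius) :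
    Tendsto (fun k => ∑ p ∈ Finset.range k, srcOp L fun i => F i p fun _ => x) atTop
      (𝓝 (srcOp L fun i => (F i).sum x)) := by
  have h1 : Tendsto (fun k i => ∑ p ∈ Finset.range k, F i p fun _ => x) atTop
      (𝓝 fun i => (F i).sum x) := by
    rw [tendsto_pi_nhds]
    exact fun i => ((F i).hasSum (hF.mem_ball hA i hx)).tendsto_sum_nat
  refine (((srcOp L).continuous.tendsto _).comp h1).congr fun k => ?_
  rw [Function.comp_apply, ← map_sum]
  congr 1
  funext i
  rw [Finset.sum_apply]

theorem IsSourceSeries.continuousOn (hF : IsSourceSeries m r s N A F) (hA : 0 < A)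
    {x : ℝ → Data n d₁ d₂} (hx : ContinuousOn x I) (hx' : ∀ t ∈ I, A * ‖x t‖ₑ < N.radius)
    (i : Idx d₁ d₂) : ContinuousOn (fun t => (F i).sum (x t)) I :=
  (F i).continuousOn.comp hx fun t ht => hF.mem_ball hA i (hx' t ht)

/-- The equation in the interaction picture: `isWeakSol_iff` followed by Duhamel, applicable since
the source is a continuous curve as long as the data remain in the domain of convergence. -/
theorem isWeakSol_nonlin_iff (hα : 0 < α) (hμ : 0 ≤ μ₀) (hL : L.Admissible r α μ₀) (hm : 0 < m)
    (hI : I.OrdConnected) (hne : (interior I).Nonempty) (hF : IsSourceSeries m r s N A F)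
    (hA : 0 < A) {u : FieldPath n d₁ d₂} (hu : MemF r m s I u)
    (hx : ∀ t ∈ I, A * ‖dataOf m r s I u t‖ₑ < N.radius) :
    IsWeakSol L I u (nonlin N I u) ↔ ∀ t ∈ I, HasDerivWithinAt
      (fun τ => evoOp L m r (-τ) (dataOf m r s I u τ))
      (-evoOp L m r (-t) (srcOp L fun i => (F i).sum (dataOf m r s I u t))) I t := by
  obtain ⟨C, -, hS, -⟩ := isEvolution_evoOp hα hμ hL hm
  have hp := hu.pathRep hm
  have hc : ∀ i, ContinuousOn (fun t => (F i).sum (dataOf m r s I u t)) I :=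
    hF.continuousOn hA hp.continuousOn_mkData hx
  rw [isWeakSol_iff hL hm hI hne hp (F := fun t i => (F i).sum (dataOf m r s I u t))
    (fun t ht i => (hF.sum hI hne hp ht (hx t ht) i).2.1) hc]
  have h1 : ∀ G : Idx d₁ d₂ → L2 n, srcData L G = -srcOp L G := fun G => by
    rw [← neg_srcData, neg_neg]
  simp only [h1, ← map_neg (evoOp L m r _)]
  refine hS.duhamel_iff hI (U := dataOf m r s I u)
    (F := fun t => -srcOp L fun i => (F i).sum (dataOf m r s I u t)) ?_
  exact ((srcOp L).continuous.comp_continuousOn (continuousOn_pi.2 hc)).neg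

/-- The radius of the majorant is that of `N` divided by `2A`. The factor `2` leaves room: even for
`‖u‖` equal to `ρ` the lifted series are summed in the interior of their ball. Finiteness of `a`
matters only if the radius of `N` is infinite. -/
theorem exists_radius (hA : 0 < A) {K : ℝ≥0} (hK : 0 < K) (hN : 0 < N.radius) : ∃ ρ : ℝ≥0∞,
    (FormalMultilinearSeries.ofScalars ℝ
      (fun p => ((K * (‖N p‖₊ * (2 * A) ^ p) : ℝ≥0) : ℝ))).radius = ρ ∧
    N.radius ≤ (2 * A : ℝ≥0) * ρ ∧ ∀ a ≤ ρ, a ≠ ⊤ → A * a < N.radius := by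
  set X := FormalMultilinearSeries.ofScalars ℝ
      (fun p => ((K * (‖N p‖₊ * (2 * A) ^ p) : ℝ≥0) : ℝ)) with hX
  have hnorm : ∀ p, ‖X p‖ = K * (‖N p‖ * ((2 * A : ℝ≥0) : ℝ) ^ p) := fun p => by
    rw [hX, FormalMultilinearSeries.ofScalars_norm, Real.norm_of_nonneg (NNReal.coe_nonneg _)]
    push_cast
    rfl
  have hA2 : 0 < 2 * A := by positivity
  have h1 : N.radius ≤ (2 * A : ℝ≥0) * X.radius :=
    radius_le_mul_radius hA2 K.coe_nonneg fun p => (hnorm p).le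
  have h2 : X.radius ≤ ((2 * A)⁻¹ : ℝ≥0) * N.radius := by
    refine radius_le_mul_radius (C := (K : ℝ)⁻¹) (by positivity) (by positivity) fun p => ?_
    rw [hnorm]
    have : (K : ℝ) ≠ 0 := by exact_mod_cast hK.ne'
    have : (A : ℝ) ≠ 0 := by exact_mod_cast hA.ne'
    push_cast
    rw [inv_pow]
    field_simp
    exact le_rfl
  refine ⟨_, rfl, h1, fun a ha hatop => ?_⟩
  rcases eq_or_ne N.radius ⊤ with ht | ht
  · rw [ht]
    exact ENNReal.mul_lt_top ENNReal.coe_lt_top hatop.lt_top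
  · calc A * a ≤ A * (((2 * A)⁻¹ : ℝ≥0) * N.radius) := by gcongr; exact ha.trans h2
      _ = (2⁻¹ : ℝ≥0) * N.radius := by
          rw [← mul_assoc, ← ENNReal.coe_mul]
          congr 2
          rw [mul_inv, mul_left_comm, mul_inv_cancel₀ hA.ne', mul_one]
      _ < 1 * N.radius := by
          refine ENNReal.mul_lt_mul_left hN.ne' ht ?_
          exact_mod_cast (by norm_num : (2⁻¹ : ℝ≥0) < 1)
      _ = _ := one_mul _

end VectorField

/-! ### Normal families and the nonlinear equation -/

section Main

variable {L : EvolOp n d₁ d₂} {r : ℕ} {α μ₀ m s : ℝ} {I : Set ℝ} {N : Series n d₁ d₂} {A : ℝ≥0}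
  {F : Idx d₁ d₂ → FormalMultilinearSeries ℂ (Data n d₁ d₂) (L2 n)}

theorem enorm_dataOf_le (hm : 0 < m) (hI : I.OrdConnected) (hne : (interior I).Nonempty)
    {u : FieldPath n d₁ d₂} (hu : MemF r m s I u) {t : ℝ} (ht : t ∈ I) :
    ‖dataOf m r s I u t‖ₑ ≤ fNorm r m s I u := by
  rw [(hu.pathRep hm).fNorm_eq hm hI hne]
  exact le_iSup₂ (f := fun τ (_ : τ ∈ I) => ‖dataOf m r s I u τ‖ₑ) t ht

theorem enorm_srcTerm_le {C : ℝ≥0} (hC : ∀ i p, ‖F i p‖ ≤ C * (‖N p‖ * A ^ p)) (L : EvolOp n d₁ d₂)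
    {p : ℕ} (x : Fin p → Data n d₁ d₂) : ‖srcOp L fun i => F i p x‖ₑ ≤
      (‖srcOp (n := n) L‖₊ * C * (‖N p‖₊ * A ^ p) : ℝ≥0) * ∏ a, ‖x a‖ₑ := by
  have h1 : ‖fun i => F i p x‖ ≤ C * (‖N p‖ * A ^ p) * ∏ a, ‖x a‖ := by
    rw [pi_norm_le_iff_of_nonneg (by positivity)]
    exact fun i => ((F i p).le_opNorm x).trans
      (mul_le_mul_of_nonneg_right (hC i p) (by positivity))
  have h2 : ‖srcOp L fun i => F i p x‖₊ ≤
      ‖srcOp (n := n) L‖₊ * C * (‖N p‖₊ * A ^ p) * ∏ a, ‖x a‖₊ := by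
    rw [← NNReal.coe_le_coe]
    push_cast
    refine ((srcOp L).le_opNorm _).trans ?_
    rw [mul_assoc, mul_assoc]
    refine mul_le_mul_of_nonneg_left (h1.trans (le_of_eq ?_)) (norm_nonneg _)
    ring
  have h3 := ENNReal.coe_le_coe.2 h2
  rw [ENNReal.coe_mul, ENNReal.ofNNReal_finsetProd] at h3
  exact h3

theorem isNormalFamily (hα : 0 < α) (hμ : 0 ≤ μ₀) (hL : L.Admissible r α μ₀) (hm : 0 < m)
    (hs : 0 ≤ s) (hI : I.OrdConnected) (hne : (interior I).Nonempty)
    (hF : IsSourceSeries m r s N A F) (hA : 0 < A) {B C K : ℝ≥0}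
    (hB : ∀ x : Data n d₁ d₂, HermV x → ∀ t ∈ I,
      fNorm r m s I (sol L m r s (evoOp L m r (-t) x)) ≤ B * ‖x‖ₑ)
    (hC : ∀ i p, ‖F i p‖ ≤ C * (‖N p‖ * A ^ p)) (hK : B * (‖srcOp (n := n) L‖₊ * C) ≤ K)
    {ρ : ℝ≥0∞} (hρ : (FormalMultilinearSeries.ofScalars ℝ
      (fun p => ((K * (‖N p‖₊ * (2 * A) ^ p) : ℝ≥0) : ℝ))).radius = ρ)
    (hρN : ∀ a ≤ ρ, a ≠ ⊤ → A * a < N.radius) : IsNormalFamily L r m s I N ρ := by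
  refine ⟨⟨_, hρ, fun t ht p φ hφ => ?_⟩, fun t ht φ hφ hlt => ?_⟩
  · obtain ⟨h1, h2⟩ := LDTerm_eq hα hμ hL hm hs hI hne hF ht fun a => (hφ a).1
    rw [h1]
    refine ⟨memE₀_sol hα hμ hL hm s hI hne (h2.evoOp hα hμ hL hm _), ?_⟩
    refine (hB _ h2 t ht).trans ((mul_le_mul_right (enorm_srcTerm_le hC L _) _).trans ?_)
    rw [← mul_assoc, ← ENNReal.coe_mul]
    refine mul_le_mul' ?_ (Finset.prod_le_prod' fun a _ => enorm_dataOf_le hm hI hne (hφ a).1 ht)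
    rw [ENNReal.coe_le_coe, ← mul_assoc]
    refine mul_le_mul' hK (mul_le_mul_right (pow_le_pow_left' ?_ p) _)
    rw [two_mul]
    exact le_self_add
  · have hx : A * ‖dataOf m r s I φ t‖ₑ < N.radius :=
      hρN _ ((enorm_dataOf_le hm hI hne hφ.1 ht).trans hlt.le) enorm_ne_top
    obtain ⟨h1, h2⟩ := LDField_eq hα hμ hL hm hs hI hne hF ht (hφ.1.pathRep hm) hx
    have h3 := fun p => LDTerm_eq hα hμ hL hm hs hI hne hF ht (p := p) fun _ => hφ.1
    refine ⟨?_, ?_⟩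
    · rw [h1]
      exact memE₀_sol hα hμ hL hm s hI hne (h2.evoOp hα hμ hL hm _)
    · have h4 := tendsto_enorm_sub_iff.2 (hF.tendsto_sum (L := L) hA hx)
      have h5 := ENNReal.Tendsto.const_mul (a := (B : ℝ≥0∞)) h4 (Or.inr ENNReal.coe_ne_top)
      rw [mul_zero] at h5
      refine tendsto_of_tendsto_of_tendsto_of_le_of_le tendsto_const_nhds h5 (fun _ => zero_le)
        fun k => ?_
      simp only [h1, (h3 _).1]
      rw [← sol_sum, ← map_sum, ← sol_sub, ← map_sub]
      refine (hB _ (h2.sub (HermV.sum _ fun p _ => (h3 p).2)) t ht).trans (le_of_eq ?_)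
      rw [← enorm_neg, neg_sub]
      rfl

/-- At time `t`, `Θₜu` has the data of `u`. Hence the vector field `Vₜ` at `Θₜu` involves the
nonlinearity of `u` itself. -/
theorem dataOf_theta (hα : 0 < α) (hμ : 0 ≤ μ₀) (hL : L.Admissible r α μ₀) (hm : 0 < m)
    {u : FieldPath n d₁ d₂} (hu : MemF r m s I u) {t : ℝ} (ht : t ∈ I) :
    ∃ U V, PathRep r m s I (Theta L r m s I u t) U V ∧ mkData (U t) (V t) = dataOf m r s I u t := by
  obtain ⟨C, -, hS, -⟩ := isEvolution_evoOp hα hμ hL hm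
  rw [theta_eq hα hμ hL hm hu ht]
  refine ⟨_, _, pathRep_sol hα hμ hL hm s I
    (((hu.pathRep hm).hermV ht).evoOp hα hμ hL hm (-t)), ?_⟩
  rw [mkData_sol hm]
  exact hS.neg_apply t _

/-- Both sides say that `Z(t) = S(-t) x(t)` has derivative `-W(t)`: the weak equation by Duhamel,
the equation for `Θₜu` by linearity of `sol` and equivalence of norms. Continuity of the derivative
comes for free from that of `W`. -/
theorem isWeakSol_iff_isC1Curve (hα : 0 < α) (hμ : 0 ≤ μ₀) (hL : L.Admissible r α μ₀) (hm : 0 < m)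
    (hs : 0 ≤ s) (hI : I.OrdConnected) (hne : (interior I).Nonempty)
    (hF : IsSourceSeries m r s N A F) (hA : 0 < A) {B : ℝ≥0}
    (hB₁ : ∀ x : Data n d₁ d₂, HermV x → fNorm r m s I (sol L m r s x) ≤ B * ‖x‖ₑ)
    (hB₂ : ∀ x : Data n d₁ d₂, HermV x → ‖x‖ₑ ≤ B * fNorm r m s I (sol L m r s x))
    {u : FieldPath n d₁ d₂} (hu : MemF r m s I u)
    (hx : ∀ t ∈ I, A * ‖dataOf m r s I u t‖ₑ < N.radius) :
    IsWeakSol L I u (nonlin N I u) ↔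
      ∃ w : ℝ → FieldPath n d₁ d₂, IsC1Curve L r m s I (Theta L r m s I u) w ∧
        ∀ t ∈ I, ∀ τ ∈ I, w t τ + LDField L N I t (Theta L r m s I u t) τ = 0 := by
  obtain ⟨C, -, hS, -⟩ := isEvolution_evoOp hα hμ hL hm
  have hp := hu.pathRep hm
  set Z : ℝ → Data n d₁ d₂ := fun τ => evoOp L m r (-τ) (dataOf m r s I u τ) with hZ
  set W : ℝ → Data n d₁ d₂ := fun t =>
    evoOp L m r (-t) (srcOp L fun i => (F i).sum (dataOf m r s I u t)) with hW
  have hZherm : ∀ t ∈ I, HermV (Z t) := fun t ht => (hp.hermV ht).evoOp hα hμ hL hm (-t)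
  have hTheta : ∀ t ∈ I, Theta L r m s I u t = sol L m r s (Z t) := fun t ht =>
    theta_eq hα hμ hL hm hu ht
  have hfield : ∀ t ∈ I, LDField L N I t (Theta L r m s I u t) = sol L m r s (W t) ∧
      HermV (W t) := by
    intro t ht
    obtain ⟨U, V, h1, h2⟩ := dataOf_theta hα hμ hL hm hu ht
    obtain ⟨h3, h4⟩ := LDField_eq hα hμ hL hm hs hI hne hF ht h1 (by rw [h2]; exact hx t ht)
    rw [h2] at h3 h4
    exact ⟨h3, h4.evoOp hα hμ hL hm _⟩
  have hWcont : ∀ t ∈ I, Tendsto W (𝓝[I] t) (𝓝 (W t)) := by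
    intro t ht
    have hc := fun i => hF.continuousOn hA hp.continuousOn_mkData hx i t ht
    exact hS.tendsto ((continuous_neg.tendsto t).mono_left nhdsWithin_le_nhds)
      (((srcOp L).continuous.tendsto _).comp (tendsto_pi_nhds.2 hc))
  have hslope : ∀ t ∈ I, ∀ t' ∈ I,
      ((t' - t : ℝ) : ℂ)⁻¹ • (Theta L r m s I u t' - Theta L r m s I u t) + sol L m r s (W t) =
        sol L m r s (slope Z t t' - -W t) ∧ HermV (slope Z t t' - -W t) := by
    intro t ht t' ht'
    have hsl : slope Z t t' = ((t' - t : ℝ) : ℂ)⁻¹ • (Z t' - Z t) := slope_coe _ t t'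
    rw [hsl]
    refine ⟨?_, ?_⟩
    · rw [hTheta t ht, hTheta t' ht', ← sol_sub, ← sol_smul, sol_sub (_ • _), sol_neg, sub_neg_eq_add]
    · rw [← Complex.ofReal_inv, sub_neg_eq_add]
      exact (((hZherm t' ht').sub (hZherm t ht)).ofReal_smul _).add (hfield t ht).2
  rw [isWeakSol_nonlin_iff hα hμ hL hm hI hne hF hA hu hx]
  change (∀ t ∈ I, HasDerivWithinAt Z (-W t) I t) ↔ _
  have hderiv : (∀ t ∈ I, HasDerivWithinAt Z (-W t) I t) ↔ ∀ t ∈ I, Tendsto (fun t' => fNorm r m s I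
      (((t' - t : ℝ) : ℂ)⁻¹ • (Theta L r m s I u t' - Theta L r m s I u t) + sol L m r s (W t)))
      (𝓝[I \ {t}] t) (𝓝 0) := by
    refine forall₂_congr fun t ht => ?_
    rw [hasDerivWithinAt_iff_tendsto_slope, ← tendsto_enorm_sub_iff]
    have hev : ∀ᶠ t' in 𝓝[I \ {t}] t, t' ∈ I :=
      eventually_mem_nhdsWithin.mono fun _ h => h.1
    constructor
    · intro h
      have h1 := ENNReal.Tendsto.const_mul (a := (B : ℝ≥0∞)) h (Or.inr ENNReal.coe_ne_top)
      rw [mul_zero] at h1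
      refine tendsto_of_tendsto_of_tendsto_of_le_of_le' tendsto_const_nhds h1
        (Eventually.of_forall fun _ => zero_le) (hev.mono fun t' ht' => ?_)
      rw [(hslope t ht t' ht').1]
      exact hB₁ _ (hslope t ht t' ht').2
    · intro h
      have h1 := ENNReal.Tendsto.const_mul (a := (B : ℝ≥0∞)) h (Or.inr ENNReal.coe_ne_top)
      rw [mul_zero] at h1
      refine tendsto_of_tendsto_of_tendsto_of_le_of_le' tendsto_const_nhds h1
        (Eventually.of_forall fun _ => zero_le) (hev.mono fun t' ht' => ?_)
      rw [(hslope t ht t' ht').1]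
      exact hB₂ _ (hslope t ht t' ht').2
  rw [hderiv]
  have hneg : ∀ t ∈ I, HermV (-W t) := fun t ht k => ((hfield t ht).2 k).neg
  constructor
  · intro h
    refine ⟨fun t => sol L m r s (-W t), ⟨fun t ht => ?_, fun t ht => ?_, fun t ht => ?_,
      fun t ht => ?_⟩, fun t ht τ _ => ?_⟩
    · rw [hTheta t ht]
      exact memE₀_sol hα hμ hL hm s hI hne (hZherm t ht)
    · exact memE₀_sol hα hμ hL hm s hI hne (hneg t ht)
    · simpa only [sol_neg, sub_neg_eq_add] using h t ht
    · have h1 := ENNReal.Tendsto.const_mul (a := (B : ℝ≥0∞))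
        (tendsto_enorm_sub_iff.2 (hWcont t ht)) (Or.inr ENNReal.coe_ne_top)
      rw [mul_zero] at h1
      refine tendsto_of_tendsto_of_tendsto_of_le_of_le' tendsto_const_nhds h1
        (Eventually.of_forall fun _ => zero_le)
        (eventually_mem_nhdsWithin.mono fun t' ht' => ?_)
      rw [← sol_sub]
      refine (hB₁ _ ((hneg t' ht').sub (hneg t ht))).trans (le_of_eq ?_)
      rw [neg_sub_neg, ← enorm_neg, neg_sub]
    · rw [(hfield t ht).1]
      simp only [sol_neg, Pi.neg_apply, neg_add_cancel]
  · rintro ⟨w, hw, hw'⟩ t ht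
    -- The derivative `w` is prescribed at times in `I` only, which is all that the norm depends on.
    refine (hw.hasDeriv t ht).congr fun t' => fNorm_congr fun τ hτ => ?_
    have h1 := hw' t ht τ hτ
    rw [(hfield t ht).1] at h1
    rw [Pi.sub_apply, Pi.add_apply, eq_neg_of_add_eq_zero_left h1, sub_neg_eq_add]

end Main

end LagrangeDuhamel

end

theorem theorem2p1 (n r : ℕ) (hr : 1 ≤ r) (m s : ℝ) (hm : 0 < m) :
    ∃ Q : ℝ≥0, 0 < Q ∧
      ∀ (d₁ d₂ : ℕ) (L : EvolOp n d₁ d₂) (α μ₀ : ℝ), 0 < α → 0 ≤ μ₀ → L.Admissible r α μ₀ →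
      ∀ I : Set ℝ, I.OrdConnected → (interior I).Nonempty → (0 < μ₀ ∨ Bornology.IsBounded I) →
      ∀ N : Series n d₁ d₂, IsSymm N → N 0 = 0 → 0 < N.radius →
        (∀ i : Fin d₁, DependsOnlyOn N (Sum.inl i) (fieldCoords n d₁ d₂)) →
        (((n : ℝ) / 2 < s ∧
            ∀ j : Fin d₂, DependsOnlyOn N (Sum.inr j) (fieldCoords n d₁ d₂)) ∨
          (IsAffine N ∧ (n : ℝ) / 2 < s ∧ s - r < (n : ℝ) / 2 ∧ 0 ≤ s - r) ∨
          ((n : ℝ) / 2 + 1 < s ∧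
            ((n : ℝ) / 2 < s - r ∨
              ∀ j : Fin d₂, DependsOnlyOn N (Sum.inr j) (noTimeDerivCoords n d₁ d₂)))) →
        ∃ ρV : ℝ≥0∞, N.radius ≤ Q * ρV ∧ IsNormalFamily L r m s I N ρV ∧
          ∀ u : FieldPath n d₁ d₂, MemF r m s I u → fNorm r m s I u ≤ ρV →
            (IsWeakSol L I u (nonlin N I u) ↔
              ∃ w : ℝ → FieldPath n d₁ d₂, IsC1Curve L r m s I (Theta L r m s I u) w ∧
                ∀ t ∈ I, ∀ τ ∈ I, w t τ + LDField L N I t (Theta L r m s I u t) τ = 0) := by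
  obtain ⟨A, hA, hSrc⟩ := exists_isSourceSeries n r hr m s hm
  refine ⟨2 * A, by positivity, fun d₁ d₂ L α μ₀ hα hμ hL I hI hne hb N hN hN0 hNr h₁ h₂ => ?_⟩
  obtain ⟨F, hF⟩ := hSrc d₁ d₂ N hN hN0 h₁ h₂
  have hs : 0 ≤ s := by
    have hn : (0 : ℝ) ≤ (n : ℝ) / 2 := by positivity
    rcases h₂ with ⟨h, -⟩ | ⟨-, h, -⟩ | ⟨h, -⟩ <;> linarith
  obtain ⟨B, hB, hB₁, hB₂⟩ := exists_fNorm_sol_le hα hμ hL hm s hI hne hb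
  obtain ⟨C, hC⟩ := hF.bound
  -- Adding one keeps the constant of the majorant positive, so that its radius is exactly
  -- comparable with that of `N` even if the operator bounds vanish.
  obtain ⟨ρ, hρ, hρN, hlt⟩ := exists_radius hA
    (add_pos_of_nonneg_of_pos (zero_le (a := B * (‖srcOp (n := n) L‖₊ * C))) one_pos) hNr
  refine ⟨ρ, hρN, isNormalFamily hα hμ hL hm hs hI hne hF hA hB hC le_self_add hρ hlt,
    fun u hu huρ => ?_⟩
  exact isWeakSol_iff_isC1Curve hα hμ hL hm hs hI hne hF hA hB₁ hB₂ hu fun t ht =>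
    hlt _ ((enorm_dataOf_le hm hI hne hu ht).trans huρ) enorm_ne_top
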